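/- **Conventions.** A prederivator is a 2-functor $\mathscr D\colon \mathrm{Cat}^{op}\to \mathrm{CAT}$ (2-functors are allowed to be pseudofunctors); morphisms of prederivators are pseudonatural transformations and 2-cells are modifications. For a functor $f\colon A\to B$ of small categories write $f^*\colon\mathscr D(B)\to\mathscr D(A)$ for $\mathscr D(f)$, for $X\in\mathscr D(A)$ and $a\in A$ write $X_a\in\mathscr D(\mathbb 1)$ for the value of $X$ at $a$, and let $\mathscr D^B$ be the prederivator $A\mapsto \mathscr D(B\times A)$. A prederivator is a *derivator* if (Der1) it sends coproducts of categories to products, (Der2) isomorphisms in $\mathscr D(A)$ are detected by the values at the objects of $A$, (Der3) every $f^*$ has a left and a right adjoint, and (Der4) these Kan extensions are computed pointwise, i.e. the canonical mates associated with the comma squares of $(f/b)$ and $(b/f)$ are isomorphisms. A square $X\in\mathscr D(\square)$, $\square=[1]\times[1]$, is *cocartesian* (*cartesian*) if it lies in the essential image of the left (right) Kan extension along the inclusion of the square without its final (initial) object, and *bicartesian* if it is both. A derivator is *stable* if $\mathscr D(\mathbb 1)$ has a zero object and if a square is cocartesian exactly when it is cartesian. A morphism is *exact* if it preserves zero objects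 and bicartesian squares. Let $C_0\subseteq\mathbb Z^3$ be the full subposet of all $(n+\varepsilon_1,n+\varepsilon_2,n+\varepsilon_3)$ with $n\in\mathbb Z$, $\varepsilon_i\in\{0,1\}$, and let $C\subseteq\mathbb Z^3$ be the full subposet on the objects of $C_0$ and the objects $(n,n+2,n+1)$, $(n+2,n+1,n)$, $(n+1,n,n+2)$, $n\in\mathbb Z$. A *small square* in $C$ is a two-dimensional face of one of the cubes $[(n,n,n),(n+1,n+1,n+1)]$, or one of the reinforcing squares $[n,n+1]\times[n+1,n+2]\times\{n+1\}$, $\{n+1\}\times[n,n+1]\times[n+1,n+2]$, $[n+1,n+2]\times\{n+1\}\times[n,n+1]$. For a stable derivator $\mathscr D$ let $\mathscr D^{C,\mathrm{ex}}\subseteq\mathscr D^C$ be the full subprederivator of those $Y\in\mathscr D(C\times A)$ such that for every $a\in A$ all small squares of $Y_{(-,a)}$ are bicartesian and $Y_{(p,a)}=0$ for all $p\in C\setminus C_0$. Let $\mathrm{sh}(n_1,n_2,n_3)=(n_1+1,n_2+1,n_3+1)$ and $r(n_1,n_2,n_3)=(n_3,n_1,n_2)$ on $C$, and let $\mathbb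 S=r^*\,\mathrm{sh}^*\colon\mathscr D^{C,\mathrm{ex}}\to\mathscr D^{C,\mathrm{ex}}$ be the Serre endomorphism. A *functorial choice of suspension squares* on a prederivator $\mathscr E$ is a morphism $Q\colon\mathscr E\to\mathscr E^\square$ whose values are (pointwise) cocartesian squares with zero objects at the corners $(1,0)$ and $(0,1)$, together with an isomorphism $Q_{(0,0)}\cong \mathrm{id}_{\mathscr E}$; the suspension is $\Sigma=Q_{(1,1)}\colon\mathscr E\to\mathscr E$. Given a morphism $G\colon\mathscr E\to\mathscr E'$ and such choices $Q,Q'$, a *comparison* is an isomorphism $G^\square Q\cong Q'G$ which at the corner $(0,0)$ is compatible with the identifications with the identity; at the corner $(1,1)$ it induces an isomorphism $G\Sigma\cong\Sigma' G$. **Theorem.** For every stable derivator $\mathscr D$: 1. $\mathscr D^{C,\mathrm{ex}}$ is a stable derivator; restriction along the inclusion $i\colon[1]^3_{\le1}\to C$ of the trivalent source (the subposet of $\{0,1\}^3$ of the triples with at most one coordinate equal to $1$) is an equivalence of prederivators $i^*\colon\mathscr D^{C,\mathrm{ex}}\to\mathscr D^{[1]^3_{\le1}}$; and $\mathscr D^{C,\mathrm{ex}}$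 admits a functorial choice of suspension squares. 2. There are isomorphisms of endomorphisms of $\mathscr D^{C,\mathrm{ex}}$ $$\psi\colon(\mathrm{sh}^*)^3\cong\Sigma^2\qquad\text{and}\qquad\theta\colon\mathbb S^3\cong\Sigma^2,$$ one for each stable derivator $\mathscr D$ and each functorial choice of suspension squares on $\mathscr D^{C,\mathrm{ex}}$, which are canonical in the following sense. For every exact morphism $F\colon\mathscr D\to\mathscr E$ of stable derivators, with induced morphism $F^{C,\mathrm{ex}}\colon\mathscr D^{C,\mathrm{ex}}\to\mathscr E^{C,\mathrm{ex}}$, and all choices of suspension squares on both sides, a comparison along $F^{C,\mathrm{ex}}$ exists, and for each comparison $\psi$ and $\theta$ are compatible with $F^{C,\mathrm{ex}}$: modulo the canonical isomorphisms $F^{C,\mathrm{ex}}\mathrm{sh}^*\cong\mathrm{sh}^*F^{C,\mathrm{ex}}$ and $F^{C,\mathrm{ex}}\mathbb S\cong\mathbb SF^{C,\mathrm{ex}}$ and the isomorphism $F^{C,\mathrm{ex}}\Sigma\cong\Sigma F^{C,\mathrm{ex}}$ of the comparison, one has $F^{C,\mathrm{ex}}\psi_{\mathscr D}=\psi_{\mathscr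 E}F^{C,\mathrm{ex}}$ and $F^{C,\mathrm{ex}}\theta_{\mathscr D}=\theta_{\mathscr E}F^{C,\mathrm{ex}}$. (For $F=\mathrm{id}$ this includes independence of the choice of suspension squares.) -/

import Mathlib

open CategoryTheory CategoryTheory.Limits CategoryTheory.Bicategory Opposite
open scoped CategoryTheory.Pseudofunctor.StrongTrans
open Bicategory.Opposite (op2)

/-! ### Composing pseudonatural transformations with pseudofunctors -/

section
universe w₁ w₂ w₃ v₁ v₂ v₃ u₁ u₂ u₃
variable {B : Type u₁} [Bicategory.{w₁, v₁} B] {C : Type u₂} [Bicategory.{w₂, v₂} C]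
  {E : Type u₃} [Bicategory.{w₃, v₃} E]

/-- The pseudonatural transformation with components `η_{P a}`. -/
def precompTrans (P : B ⥤ᵖ C) {F G : C ⥤ᵖ E} (η : F ⟶ G) : P.comp F ⟶ P.comp G where
  app a := η.app (P.obj a)
  naturality f := η.naturality (P.map f)
  naturality_naturality α := η.naturality_naturality (P.map₂ α)
  naturality_id a := by
    have : (η.naturality (P.map (𝟙 a))).hom ≫
        η.app (P.obj a) ◁ (G.map₂ (P.mapId a).hom ≫ (G.mapId (P.obj a)).hom) =
        (F.map₂ (P.mapId a).hom ≫ (F.mapId (P.obj a)).hom) ▷ η.app (P.obj a) ≫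
        (λ_ (η.app (P.obj a))).hom ≫ (ρ_ (η.app (P.obj a))).inv := by
      rw [Bicategory.whiskerLeft_comp, ← η.naturality_naturality_assoc, η.naturality_id,
        comp_whiskerRight, Category.assoc]
    exact this
  naturality_comp {a b c} f g := by
    have : (η.naturality (P.map (f ≫ g))).hom ≫
        η.app (P.obj a) ◁ (G.map₂ (P.mapComp f g).hom ≫ (G.mapComp (P.map f) (P.map g)).hom) =
        (F.map₂ (P.mapComp f g).hom ≫ (F.mapComp (P.map f) (P.map g)).hom) ▷ η.app (P.obj c) ≫
          (α_ _ _ _).hom ≫ F.map (P.map f) ◁ (η.naturality (P.map g)).hom ≫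
        (α_ _ _ _).inv ≫ (η.naturality (P.map f)).hom ▷ G.map (P.map g) ≫ (α_ _ _ _).hom := by
      rw [Bicategory.whiskerLeft_comp, ← η.naturality_naturality_assoc, η.naturality_comp,
        comp_whiskerRight, Category.assoc]
    exact this

/-- The pseudonatural transformation with components `D (τ_a)`. -/
def postcompTrans {P Q : B ⥤ᵖ C} (τ : P ⟶ Q) (D : C ⥤ᵖ E) : P.comp D ⟶ Q.comp D where
  app a := D.map (τ.app a)
  naturality f := (D.mapComp _ _).symm ≪≫ D.map₂Iso (τ.naturality f) ≪≫ D.mapComp _ _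
  naturality_naturality {a b f g} α := by
    have h := congrArg D.map₂ (τ.naturality_naturality α)
    have : D.map₂ (P.map₂ α) ▷ D.map (τ.app b) ≫ (D.mapComp _ _).inv ≫
        D.map₂ (τ.naturality g).hom ≫ (D.mapComp _ _).hom =
      ((D.mapComp _ _).inv ≫ D.map₂ (τ.naturality f).hom ≫ (D.mapComp _ _).hom) ≫
        D.map (τ.app a) ◁ D.map₂ (Q.map₂ α) := by
      rw [D.map₂_comp, D.map₂_comp, D.map₂_whisker_left, D.map₂_whisker_right] at h
      simp only [Category.assoc] at h ⊢
      rw [← cancel_epi (D.mapComp _ _).hom, ← cancel_mono (D.mapComp _ _).inv]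
      simpa using h
    exact this
  naturality_id a := by
    have h := congrArg D.map₂ (τ.naturality_id a)
    have : ((D.mapComp _ _).inv ≫ D.map₂ (τ.naturality (𝟙 a)).hom ≫ (D.mapComp _ _).hom) ≫
        D.map (τ.app a) ◁ (D.map₂ (Q.mapId a).hom ≫ (D.mapId (Q.obj a)).hom) =
        (D.map₂ (P.mapId a).hom ≫ (D.mapId (P.obj a)).hom) ▷ D.map (τ.app a) ≫
      (λ_ (D.map (τ.app a))).hom ≫ (ρ_ (D.map (τ.app a))).inv := by
      simp only [D.map₂_comp, D.map₂_whisker_left, D.map₂_whisker_right, D.map₂_left_unitor,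
        Category.assoc, Iso.inv_hom_id_assoc] at h
      rw [Bicategory.whiskerLeft_comp, D.whiskerLeft_mapId_hom, comp_whiskerRight]
      simp only [Category.assoc]
      rw [reassoc_of% h, ← D.map₂_comp_assoc, Iso.inv_hom_id]
      simp
    exact this
  naturality_comp {a b c} f g := by
    have h := congrArg D.map₂ (τ.naturality_comp f g)
    have : ((D.mapComp _ _).inv ≫ D.map₂ (τ.naturality (f ≫ g)).hom ≫ (D.mapComp _ _).hom) ≫
        D.map (τ.app a) ◁ (D.map₂ (Q.mapComp f g).hom ≫ (D.mapComp (Q.map f) (Q.map g)).hom) =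
        (D.map₂ (P.mapComp f g).hom ≫ (D.mapComp (P.map f) (P.map g)).hom) ▷ D.map (τ.app c) ≫
         (α_ _ _ _).hom ≫ D.map (P.map f) ◁ ((D.mapComp _ _).inv ≫ D.map₂ (τ.naturality g).hom ≫ (D.mapComp _ _).hom) ≫
        (α_ _ _ _).inv ≫ ((D.mapComp _ _).inv ≫ D.map₂ (τ.naturality f).hom ≫ (D.mapComp _ _).hom) ▷ D.map (Q.map g) ≫ (α_ _ _ _).hom := by
      simp only [D.map₂_comp, D.map₂_whisker_left, D.map₂_whisker_right, D.map₂_associator,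
        Category.assoc, Iso.inv_hom_id_assoc] at h
      have key : D.map (P.map f) ◁ (D.mapComp (τ.app b) (Q.map g)).hom ≫
          (α_ (D.map (P.map f)) (D.map (τ.app b)) (D.map (Q.map g))).inv ≫
          (D.mapComp (P.map f) (τ.app b)).inv ▷ D.map (Q.map g) =
          (D.mapComp (P.map f) (τ.app b ≫ Q.map g)).inv ≫
          D.map₂ (α_ (P.map f) (τ.app b) (Q.map g)).inv ≫
          (D.mapComp (P.map f ≫ τ.app b) (Q.map g)).hom := by
        rw [← cancel_epi (D.mapComp (P.map f) (τ.app b ≫ Q.map g)).hom,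
          D.mapComp_assoc_right_hom_assoc]
        simp
      simp only [Bicategory.whiskerLeft_comp, comp_whiskerRight, Category.assoc]
      rw [reassoc_of% key, ← cancel_epi (D.mapComp (P.map (f ≫ g)) (τ.app c)).hom,
        Iso.hom_inv_id_assoc]
      simpa using h =≫ ((D.mapComp (τ.app a) (Q.map f ≫ Q.map g)).hom ≫
        D.map (τ.app a) ◁ (D.mapComp (Q.map f) (Q.map g)).hom)
    exact this

/-- The transformation with components `D (τ_a)`, for a transformation `τ` to the identity. -/
def postcompTransId {P : B ⥤ᵖ B} (τ : P ⟶ Pseudofunctor.id B) (D : B ⥤ᵖ E) : P.comp D ⟶ D where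
  app a := D.map (τ.app a)
  naturality f := (D.mapComp _ _).symm ≪≫ D.map₂Iso (τ.naturality f) ≪≫ D.mapComp _ _
  naturality_naturality α := (postcompTrans τ D).naturality_naturality α
  naturality_id a := by
    refine Eq.trans ?_ ((postcompTrans τ D).naturality_id a)
    refine congrArg (fun x => _ ≫ D.map (τ.app a) ◁ x) ?_
    change (D.mapId a).hom = D.map₂ (𝟙 (𝟙 a)) ≫ (D.mapId a).hom
    rw [D.map₂_id, Category.id_comp]
  naturality_comp {a b c} f g := by
    refine Eq.trans ?_ ((postcompTrans τ D).naturality_comp f g)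
    refine congrArg (fun x => _ ≫ D.map (τ.app a) ◁ x) ?_
    change (D.mapComp f g).hom = D.map₂ (𝟙 (f ≫ g)) ≫ (D.mapComp f g).hom
    rw [D.map₂_id, Category.id_comp]

/-- The modification whose components are the structure isomorphisms of `F` at `τ_a`. -/
def commSq {P Q : B ⥤ᵖ C} (τ : P ⟶ Q) {D D' : C ⥤ᵖ E} (F : D ⟶ D') :
    postcompTrans τ D ≫ precompTrans Q F ≅ precompTrans P F ≫ postcompTrans τ D' :=
  Pseudofunctor.StrongTrans.isoMk (fun a => F.naturality (τ.app a)) fun {a b} f => by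
    have : D.map (P.map f) ◁ (F.naturality (τ.app b)).hom ≫
        (α_ _ _ _).inv ≫ (F.naturality (P.map f)).hom ▷ D'.map (τ.app b) ≫ (α_ _ _ _).hom ≫
        F.app (P.obj a) ◁ ((D'.mapComp _ _).inv ≫ D'.map₂ (τ.naturality f).hom ≫
          (D'.mapComp _ _).hom) ≫ (α_ _ _ _).inv =
      ((α_ _ _ _).inv ≫ ((D.mapComp _ _).inv ≫ D.map₂ (τ.naturality f).hom ≫
          (D.mapComp _ _).hom) ▷ F.app (Q.obj b) ≫ (α_ _ _ _).hom ≫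
        D.map (τ.app a) ◁ (F.naturality (Q.map f)).hom ≫ (α_ _ _ _).inv) ≫
        (F.naturality (τ.app a)).hom ▷ D'.map (Q.map f) := by
      have h := F.naturality_naturality (τ.naturality f).hom
      rw [F.naturality_comp_hom, F.naturality_comp_hom] at h
      simp only [Category.assoc] at h
      simp only [comp_whiskerRight, Bicategory.whiskerLeft_comp, Category.assoc]
      have h' := ((α_ _ _ _).inv ≫ (D.mapComp (P.map f) (τ.app b)).inv ▷ F.app (Q.obj b)) ≫= h =≫
        (F.app (P.obj a) ◁ (D'.mapComp (τ.app a) (Q.map f)).hom ≫ (α_ _ _ _).inv)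
      simp only [Category.assoc, inv_hom_whiskerRight_assoc, whiskerLeft_inv_hom_assoc,
        Iso.hom_inv_id, Iso.inv_hom_id_assoc, Category.comp_id] at h'
      exact h'.symm
    exact this

/-- The modification whose components are the structure isomorphisms of `F` at `τ_a`. -/
def commSqId {P : B ⥤ᵖ B} (τ : P ⟶ Pseudofunctor.id B) {D D' : B ⥤ᵖ E} (F : D ⟶ D') :
    postcompTransId τ D ≫ F ≅ precompTrans P F ≫ postcompTransId τ D' :=
  Pseudofunctor.StrongTrans.isoMk (fun a => F.naturality (τ.app a)) fun f =>
    (commSq τ F).hom.as.naturality f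

/-- The restriction of `F` to full subfunctors which `F` respects. -/
def fullsubMap {D D' : B ⥤ᵖ Cat.{v₂, u₂}} (F : D ⟶ D') (P : D.ObjectProperty)
    (P' : D'.ObjectProperty) [P.IsClosedUnderMapObj] [P'.IsClosedUnderMapObj]
    (h : ∀ a M, P.prop a M → P'.prop a ((F.app a).toFunctor.obj M)) :
    P.fullsubcategory ⟶ P'.fullsubcategory where
  app a := ((P'.prop a).lift ((P.prop a).ι ⋙ (F.app a).toFunctor)
    (fun M => h a M.obj M.property)).toCatHom
  naturality {a b} f := Cat.Hom.isoMk (((P'.prop b).fullyFaithfulι.whiskeringRight _).preimageIso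
    (Functor.isoWhiskerLeft (P.prop a).ι (Cat.Hom.toNatIso (F.naturality f))))
  naturality_naturality α := Cat.Hom₂.ext (NatTrans.ext (funext fun M =>
    ObjectProperty.hom_ext _
      (congrArg (fun t => t.toNatTrans.app M.obj) (F.naturality_naturality α))))
  naturality_id a := Cat.Hom₂.ext (NatTrans.ext (funext fun M =>
    ObjectProperty.hom_ext _
      (congrArg (fun t => t.toNatTrans.app M.obj) (F.naturality_id a))))
  naturality_comp f g := Cat.Hom₂.ext (NatTrans.ext (funext fun M =>
    ObjectProperty.hom_ext _
      (congrArg (fun t => t.toNatTrans.app M.obj) (F.naturality_comp f g))))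

/-- The restriction of an invertible modification to full subfunctors. -/
def fullsubIso {D D₁ D₂ D' : B ⥤ᵖ Cat.{v₂, u₂}} {F₁ : D ⟶ D₁} {G₁ : D₁ ⟶ D'} {F₂ : D ⟶ D₂}
    {G₂ : D₂ ⟶ D'} (e : F₁ ≫ G₁ ≅ F₂ ≫ G₂) (P : D.ObjectProperty) (P₁ : D₁.ObjectProperty)
    (P₂ : D₂.ObjectProperty) (P' : D'.ObjectProperty) [P.IsClosedUnderMapObj]
    [P₁.IsClosedUnderMapObj] [P₂.IsClosedUnderMapObj] [P'.IsClosedUnderMapObj] (hF₁) (hG₁) (hF₂)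
    (hG₂) :
    fullsubMap F₁ P P₁ hF₁ ≫ fullsubMap G₁ P₁ P' hG₁ ≅
      fullsubMap F₂ P P₂ hF₂ ≫ fullsubMap G₂ P₂ P' hG₂ :=
  Pseudofunctor.StrongTrans.isoMk
    (fun a => Cat.Hom.isoMk (((P'.prop a).fullyFaithfulι.whiskeringRight _).preimageIso
      (Functor.isoWhiskerLeft (P.prop a).ι (Cat.Hom.toNatIso
        { hom := e.hom.as.app a
          inv := e.inv.as.app a
          hom_inv_id := congrArg (fun t => t.as.app a) e.hom_inv_id
          inv_hom_id := congrArg (fun t => t.as.app a) e.inv_hom_id }))))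
    (fun f => Cat.Hom₂.ext (NatTrans.ext (funext fun M => ObjectProperty.hom_ext _
      (congrArg (fun t => t.toNatTrans.app M.obj) (e.hom.as.naturality f)))))

end

universe w v u

/-! ### Prederivators

A prederivator is a 2-functor from the bicategory `Cat^op` (1-cells reversed) of small categories to
the bicategory of categories. Morphisms of prederivators are pseudonatural transformations, and
2-cells are modifications. -/

/-- Prederivators. -/
abbrev Prederivator := Pseudofunctor Cat.{w, w}ᵒᵖ Cat.{v, u}

namespace Prederivator

/-- The category `D(A)`. -/
abbrev Val (D : Prederivator.{w, v, u}) (A : Type w) [Category.{w} A] : Type u :=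
  D.obj (op (Cat.of A))

variable (D : Prederivator.{w, v, u})

/-- The restriction functor `f^* : D(B) ⥤ D(A)`. -/
abbrev res {A B : Type w} [Category.{w} A] [Category.{w} B] (f : A ⥤ B) : D.Val B ⥤ D.Val A :=
  (D.map f.toCatHom.op).toFunctor

/-- The natural transformation `α^* : f^* ⟶ g^*`. -/
abbrev resMap {A B : Type w} [Category.{w} A] [Category.{w} B] {f g : A ⥤ B} (α : f ⟶ g) :
    D.res f ⟶ D.res g :=
  (D.map₂ (op2 α.toCatHom₂)).toNatTrans

/-- The isomorphism `(g ∘ f)^* ≅ f^* ∘ g^*`. -/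
def resComp {A B C : Type w} [Category.{w} A] [Category.{w} B] [Category.{w} C]
    (f : A ⥤ B) (g : B ⥤ C) : D.res (f ⋙ g) ≅ D.res g ⋙ D.res f :=
  Cat.Hom.toNatIso (D.mapComp g.toCatHom.op f.toCatHom.op)

end Prederivator

/-- The 2-functor `A ↦ B × A`. -/
def prodOp (B : Type w) [Category.{w} B] : Pseudofunctor Cat.{w, w}ᵒᵖ Cat.{w, w}ᵒᵖ where
  obj A := op (Cat.of (B × A.unop))
  map f := ((𝟭 B).prod f.unop.toFunctor).toCatHom.op
  map₂ α := op2 (NatTrans.prod (𝟙 (𝟭 B)) α.unop2.toNatTrans).toCatHom₂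
  map₂_id f := rfl
  map₂_comp α β := by
    refine congrArg op2 (Cat.Hom₂.ext (NatTrans.ext (funext fun X => Prod.ext ?_ rfl)))
    exact (Category.id_comp _).symm
  mapId A := (Cat.Hom.isoMk (Iso.refl _)).op2
  mapComp f g := (Cat.Hom.isoMk (Iso.refl _)).op2
  map₂_whisker_left f g h η := by
    refine congrArg op2 (Cat.Hom₂.ext (NatTrans.ext (funext fun X => Prod.ext ?_ ?_)))
    · change 𝟙 X.1 = 𝟙 X.1 ≫ 𝟙 X.1 ≫ 𝟙 X.1
      simp only [Category.comp_id]
    · change f.unop.toFunctor.map (η.unop2.toNatTrans.app X.2) =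
        𝟙 _ ≫ f.unop.toFunctor.map (η.unop2.toNatTrans.app X.2) ≫ 𝟙 _
      simp only [Category.comp_id, Category.id_comp]
  map₂_whisker_right {_ _ _} f g η h := by
    refine congrArg op2 (Cat.Hom₂.ext (NatTrans.ext (funext fun X => Prod.ext ?_ ?_)))
    · change 𝟙 X.1 = 𝟙 X.1 ≫ 𝟙 X.1 ≫ 𝟙 X.1
      simp only [Category.comp_id]
    · change (η.unop2.toNatTrans.app (h.unop.toFunctor.obj X.2)) =
        𝟙 _ ≫ (η.unop2.toNatTrans.app (h.unop.toFunctor.obj X.2)) ≫ 𝟙 _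
      simp only [Category.comp_id, Category.id_comp]
  map₂_associator f g h := by
    refine congrArg op2 (Cat.Hom₂.ext (NatTrans.ext (funext fun X => Prod.ext ?_ ?_)))
    · change 𝟙 X.1 = 𝟙 X.1 ≫ 𝟙 X.1 ≫ 𝟙 X.1 ≫ 𝟙 X.1 ≫ 𝟙 X.1
      simp only [Category.comp_id]
    · change 𝟙 _ = 𝟙 _ ≫ 𝟙 _ ≫ 𝟙 _ ≫ f.unop.toFunctor.map (𝟙 _) ≫ 𝟙 _
      simp only [Category.comp_id, Category.id_comp]
      exact (f.unop.toFunctor.map_id _).symm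
  map₂_left_unitor f := by
    refine congrArg op2 (Cat.Hom₂.ext (NatTrans.ext (funext fun X => Prod.ext ?_ ?_)))
    · change 𝟙 X.1 = 𝟙 X.1 ≫ 𝟙 X.1 ≫ 𝟙 X.1
      simp only [Category.comp_id]
    · change 𝟙 _ = 𝟙 _ ≫ 𝟙 _ ≫ 𝟙 _
      simp only [Category.comp_id]
  map₂_right_unitor f := by
    refine congrArg op2 (Cat.Hom₂.ext (NatTrans.ext (funext fun X => Prod.ext ?_ ?_)))
    · change 𝟙 X.1 = 𝟙 X.1 ≫ 𝟙 X.1 ≫ 𝟙 X.1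
      simp only [Category.comp_id]
    · change 𝟙 _ = 𝟙 _ ≫ f.unop.toFunctor.map (𝟙 _) ≫ 𝟙 _
      simp only [Category.comp_id]
      exact ((Category.id_comp _).trans (f.unop.toFunctor.map_id _)).symm

/-- The transformation given by `f × A : B' × A ⥤ B × A`. -/
def prodOpMap {B B' : Type w} [Category.{w} B] [Category.{w} B'] (f : B' ⥤ B) :
    prodOp B ⟶ prodOp B' where
  app A := (f.prod (𝟭 A.unop)).toCatHom.op
  naturality g := (Cat.Hom.isoMk (Iso.refl (f.prod g.unop.toFunctor))).op2
  naturality_naturality η := by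
    refine congrArg op2 (Cat.Hom₂.ext (NatTrans.ext (funext fun X => Prod.ext ?_ ?_)))
    · change 𝟙 (f.obj X.1) ≫ 𝟙 _ = 𝟙 _ ≫ f.map (𝟙 X.1)
      exact (congrArg (fun t => 𝟙 (f.obj X.1) ≫ t) (f.map_id X.1)).symm
    · change η.unop2.toNatTrans.app X.2 ≫ 𝟙 _ = 𝟙 _ ≫ η.unop2.toNatTrans.app X.2
      simp only [Category.comp_id, Category.id_comp]
  naturality_id A := by
    refine congrArg op2 (Cat.Hom₂.ext (NatTrans.ext (funext fun X => Prod.ext ?_ ?_)))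
    · change 𝟙 (f.obj X.1) ≫ f.map (𝟙 X.1) = 𝟙 (f.obj X.1) ≫ 𝟙 (f.obj X.1) ≫ 𝟙 (f.obj X.1)
      simp only [Category.comp_id]
      exact (Category.id_comp _).trans (f.map_id _)
    · change 𝟙 X.2 ≫ 𝟙 X.2 = 𝟙 X.2 ≫ 𝟙 X.2 ≫ 𝟙 X.2
      simp only [Category.comp_id]
  naturality_comp g h := by
    refine congrArg op2 (Cat.Hom₂.ext (NatTrans.ext (funext fun X => Prod.ext ?_ ?_)))
    · change 𝟙 (f.obj X.1) ≫ f.map (𝟙 X.1) = 𝟙 (f.obj X.1) ≫ 𝟙 (f.obj X.1) ≫ 𝟙 (f.obj X.1) ≫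
        𝟙 (f.obj X.1) ≫ 𝟙 (f.obj X.1) ≫ 𝟙 (f.obj X.1)
      simp only [Category.comp_id]
      exact (Category.id_comp _).trans (f.map_id _)
    · change 𝟙 _ ≫ 𝟙 _ = 𝟙 _ ≫ 𝟙 _ ≫ g.unop.toFunctor.map (𝟙 _) ≫ 𝟙 _ ≫ 𝟙 _ ≫ 𝟙 _
      simp only [Category.comp_id, Category.id_comp]
      exact (g.unop.toFunctor.map_id _).symm

/-- The transformation given by the inclusions `A ⥤ B × A` at the object `b` of `B`. -/
def prodOpSect {B : Type w} [Category.{w} B] (b : B) : prodOp B ⟶ Pseudofunctor.id Cat.{w, w}ᵒᵖ where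
  app A := (Prod.sectR b A.unop).toCatHom.op
  naturality g := (Cat.Hom.isoMk (Iso.refl (g.unop.toFunctor ⋙ Prod.sectR b _))).op2
  naturality_naturality η := by
    refine congrArg op2 (Cat.Hom₂.ext (NatTrans.ext (funext fun X => Prod.ext ?_ ?_)))
    · change 𝟙 b ≫ 𝟙 b = 𝟙 b ≫ 𝟙 b
      rfl
    · change η.unop2.toNatTrans.app X ≫ 𝟙 _ = 𝟙 _ ≫ η.unop2.toNatTrans.app X
      simp only [Category.comp_id, Category.id_comp]
  naturality_id A := by
    refine congrArg op2 (Cat.Hom₂.ext (NatTrans.ext (funext fun X => Prod.ext ?_ ?_)))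
    · change 𝟙 b ≫ 𝟙 b = 𝟙 b ≫ 𝟙 b ≫ 𝟙 b
      simp only [Category.comp_id]
    · change 𝟙 X ≫ 𝟙 X = 𝟙 X ≫ 𝟙 X ≫ 𝟙 X
      simp only [Category.comp_id]
  naturality_comp g h := by
    refine congrArg op2 (Cat.Hom₂.ext (NatTrans.ext (funext fun X => Prod.ext ?_ ?_)))
    · change 𝟙 b ≫ 𝟙 b = 𝟙 b ≫ 𝟙 b ≫ 𝟙 b ≫ 𝟙 b ≫ 𝟙 b ≫ 𝟙 b
      simp only [Category.comp_id]
    · change 𝟙 _ ≫ 𝟙 _ = 𝟙 _ ≫ 𝟙 _ ≫ g.unop.toFunctor.map (𝟙 _) ≫ 𝟙 _ ≫ 𝟙 _ ≫ 𝟙 _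
      simp only [Category.comp_id, Category.id_comp]
      exact (g.unop.toFunctor.map_id _).symm

namespace Prederivator

variable (D : Prederivator.{w, v, u})

/-- The shifted prederivator `D^B`, with `D^B(A) = D(B × A)`. -/
abbrev shift (D : Prederivator.{w, v, u}) (B : Type w) [Category.{w} B] : Prederivator.{w, v, u} :=
  (prodOp B).comp D

/-- The evaluation `b^* : D^B ⟶ D` at an object `b` of `B`. -/
abbrev eval {B : Type w} [Category.{w} B] (b : B) : D.shift B ⟶ D :=
  postcompTransId (prodOpSect b) D

/-- The restriction `f^* : D^B ⟶ D^B'` along `f : B' ⥤ B`. -/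
abbrev restr {B B' : Type w} [Category.{w} B] [Category.{w} B'] (f : B' ⥤ B) :
    D.shift B ⟶ D.shift B' :=
  postcompTrans (prodOpMap f) D

/-- The morphism `F^B : D^B ⟶ E^B` induced by `F : D ⟶ E`. -/
abbrev shiftMap {D E : Prederivator.{w, v, u}} (F : D ⟶ E) (B : Type w) [Category.{w} B] :
    D.shift B ⟶ E.shift B :=
  precompTrans (prodOp B) F

end Prederivator

/-! ### Derivators -/

/-- The terminal category. -/
abbrev Pt : Type w := Discrete PUnit.{w + 1}

/-- A poset, viewed as a category in the universe `w`. -/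
abbrev Pos (P : Type) [Preorder P] : Type w := AsSmall.{w} P

/-- The object of `Pos P` given by `p`. -/
abbrev Pos.of {P : Type} [Preorder P] (p : P) : Pos.{w} P := AsSmall.up.obj p

/-- The functor given by a monotone map. -/
abbrev Pos.map {P Q : Type} [Preorder P] [Preorder Q] (f : P →o Q) : Pos.{w} P ⥤ Pos.{w} Q :=
  AsSmall.down ⋙ f.monotone.functor ⋙ AsSmall.up

/-- The square `[1] × [1]`. -/
abbrev Sq : Type := Fin 2 × Fin 2

/-- The inclusion into the square of the full subposet without the final object. -/
abbrev Sq.inclUL : {x : Sq // x ≠ (1, 1)} →o Sq := OrderHom.Subtype.val _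

/-- The inclusion into the square of the full subposet without the initial object. -/
abbrev Sq.inclLR : {x : Sq // x ≠ (0, 0)} →o Sq := OrderHom.Subtype.val _

namespace Prederivator

variable (D : Prederivator.{w, v, u})

/-- The transformation `u^* ⋙ p^* ⟶ b^* ⋙ q^*` induced by `α : p ⋙ u ⟶ q ⋙ b`. -/
def resSquare {P A B Q : Type w} [Category.{w} P] [Category.{w} A] [Category.{w} B]
    [Category.{w} Q] {p : P ⥤ A} {u : A ⥤ B} {q : P ⥤ Q} {b : Q ⥤ B} (α : p ⋙ u ⟶ q ⋙ b) :
    TwoSquare (D.res u) (D.res b) (D.res p) (D.res q) :=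
  .mk _ _ _ _ ((D.resComp p u).inv ≫ D.resMap α ≫ (D.resComp q b).hom)

/-- The value `X_a` of `X` at `a`. -/
abbrev ev {A : Type w} [Category.{w} A] (X : D.Val A) (a : A) : D.Val Pt.{w} :=
  (D.res (Functor.fromPUnit.{w} a)).obj X

/-- The axioms of a derivator: (Der1) `D` sends coproducts to products; (Der2) isomorphisms are
detected pointwise; (Der3) restriction functors have adjoints on both sides, the Kan extensions;
(Der4) Kan extensions are computed pointwise, i.e., the mates associated with comma squares are
invertible. -/
structure IsDerivator : Prop where
  der1 {I : Type w} (A : I → Type w) [∀ i, Category.{w} (A i)] :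
    (Functor.pi' fun i => D.res (Sigma.incl (C := A) i)).IsEquivalence
  der2 {A : Type w} [Category.{w} A] {X Y : D.Val A} (f : X ⟶ Y) :
    (∀ a : A, IsIso ((D.res (Functor.fromPUnit.{w} a)).map f)) → IsIso f
  der3_left {A B : Type w} [Category.{w} A] [Category.{w} B] (f : A ⥤ B) :
    (D.res f).IsRightAdjoint
  der3_right {A B : Type w} [Category.{w} A] [Category.{w} B] (f : A ⥤ B) :
    (D.res f).IsLeftAdjoint
  der4_left {A B : Type w} [Category.{w} A] [Category.{w} B] (f : A ⥤ B) (b : B)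
    {fL : D.Val A ⥤ D.Val B} (adj : fL ⊣ D.res f)
    {colim : D.Val (Comma f (Functor.fromPUnit.{w} b)) ⥤ D.Val Pt.{w}}
    (adj' : colim ⊣ D.res (Comma.snd f (Functor.fromPUnit.{w} b))) :
    IsIso ((mateEquiv adj adj').symm
      (D.resSquare (Comma.natTrans f (Functor.fromPUnit.{w} b)))).natTrans
  der4_right {A B : Type w} [Category.{w} A] [Category.{w} B] (f : A ⥤ B) (b : B)
    {fR : D.Val A ⥤ D.Val B} (adj : D.res f ⊣ fR)
    {lim : D.Val (Comma (Functor.fromPUnit.{w} b) f) ⥤ D.Val Pt.{w}}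
    (adj' : D.res (Comma.fst (Functor.fromPUnit.{w} b) f) ⊣ lim) :
    IsIso (mateEquiv adj adj'
      (D.resSquare (Comma.natTrans (Functor.fromPUnit.{w} b) f))).natTrans

/-- A square is cocartesian if it lies in the essential image of the left Kan extension functor from
the square without its final object. -/
def IsCocartesian (X : D.Val (Pos.{w} Sq)) : Prop :=
  ∃ (L : D.Val (Pos.{w} {x : Sq // x ≠ (1, 1)}) ⥤ D.Val (Pos.{w} Sq))
    (_ : L ⊣ D.res (Pos.map Sq.inclUL)), L.essImage X

/-- A square is cartesian if it lies in the essential image of the right Kan extension functor from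
the square without its initial object. -/
def IsCartesian (X : D.Val (Pos.{w} Sq)) : Prop :=
  ∃ (R : D.Val (Pos.{w} {x : Sq // x ≠ (0, 0)}) ⥤ D.Val (Pos.{w} Sq))
    (_ : D.res (Pos.map Sq.inclLR) ⊣ R), R.essImage X

/-- Squares which are both cocartesian and cartesian. -/
def IsBicartesian (X : D.Val (Pos.{w} Sq)) : Prop := D.IsCocartesian X ∧ D.IsCartesian X

/-- A stable derivator: a derivator with a zero object such that cocartesian and cartesian squares
agree. -/
structure IsStableDerivator : Prop extends D.IsDerivator where
  pointed : HasZeroObject (D.Val Pt.{w})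
  stable (X : D.Val (Pos.{w} Sq)) : D.IsCocartesian X ↔ D.IsCartesian X

/-- Exact morphisms: they preserve zero objects and bicartesian squares. -/
structure IsExact {D E : Prederivator.{w, v, u}} (F : D ⟶ E) : Prop where
  isZero (X : D.Val Pt.{w}) : IsZero X → IsZero ((F.app _).toFunctor.obj X)
  isBicartesian (X : D.Val (Pos.{w} Sq)) :
    D.IsBicartesian X → E.IsBicartesian ((F.app _).toFunctor.obj X)

variable {D}

lemma IsCocartesian.of_iso {X Y : D.Val (Pos.{w} Sq)} (h : D.IsCocartesian X) (e : X ≅ Y) :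
    D.IsCocartesian Y := by
  obtain ⟨L, adj, h⟩ := h
  exact ⟨L, adj, L.essImage.prop_of_iso e h⟩

lemma IsBicartesian.of_iso {X Y : D.Val (Pos.{w} Sq)} (h : D.IsBicartesian X) (e : X ≅ Y) :
    D.IsBicartesian Y := by
  obtain ⟨h, R, adj, h'⟩ := h
  exact ⟨h.of_iso e, R, adj, R.essImage.prop_of_iso e h'⟩

variable (D)

def resObjIso {P A B : Type w} [Category.{w} P] [Category.{w} A] [Category.{w} B]
    {f : P ⥤ A} {g : A ⥤ B} {h : P ⥤ B} (e : f ⋙ g = h) (X : D.Val B) :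
    (D.res h).obj X ≅ (D.res f).obj ((D.res g).obj X) :=
  (eqToIso (by rw [e])) ≪≫ (D.resComp f g).app X

def resNatIso {D E : Prederivator.{w, v, u}} (F : D ⟶ E) {A B : Type w} [Category.{w} A]
    [Category.{w} B] (f : A ⥤ B) (X : D.Val B) :
    (F.app (op (Cat.of A))).toFunctor.obj ((D.res f).obj X) ≅
      (E.res f).obj ((F.app (op (Cat.of B))).toFunctor.obj X) :=
  (Cat.Hom.toNatIso (F.naturality f.toCatHom.op)).app X

end Prederivator

/-! ### Reinforced chains of cubes -/

/-- The objects `(n + ε₁, n + ε₂, n + ε₃)` with `εᵢ ∈ {0, 1}`, an infinite chain of cubes. -/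
def InCubes (p : ℤ × ℤ × ℤ) : Prop :=
  ∃ (n : ℤ) (e₁ e₂ e₃ : Fin 2), p = (n + (e₁ : ℕ), n + (e₂ : ℕ), n + (e₃ : ℕ))

/-- The additional objects, which reinforce the links between adjacent cubes. -/
def InLinks (p : ℤ × ℤ × ℤ) : Prop :=
  ∃ n : ℤ, p = (n, n + 2, n + 1) ∨ p = (n + 2, n + 1, n) ∨ p = (n + 1, n, n + 2)

/-- The reinforced chain of cubes `C`, a full subposet of `ℤ³`. -/
abbrev Chain : Type := {p : ℤ × ℤ × ℤ // InCubes p ∨ InLinks p}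

/-- The two-dimensional faces of the cubes `[(n, n, n), (n + 1, n + 1, n + 1)]`. -/
def IsFace (k : Sq →o Chain) : Prop :=
  ∃ (n : ℤ) (e : Fin 2),
    (∀ x y : Fin 2, (k (x, y)).1 = (n + (x : ℕ), n + (y : ℕ), n + (e : ℕ))) ∨
    (∀ x y : Fin 2, (k (x, y)).1 = (n + (e : ℕ), n + (x : ℕ), n + (y : ℕ))) ∨
    (∀ x y : Fin 2, (k (x, y)).1 = (n + (y : ℕ), n + (e : ℕ), n + (x : ℕ)))

/-- The three reinforcing squares at the vertex `(n + 1, n + 1, n + 1)` shared by two adjacent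
cubes; each of them has exactly one vertex outside of the cubes. -/
def IsReinforcing (k : Sq →o Chain) : Prop :=
  ∃ n : ℤ,
    (∀ x y : Fin 2, (k (x, y)).1 = (n + (x : ℕ), n + 1 + (y : ℕ), n + 1)) ∨
    (∀ x y : Fin 2, (k (x, y)).1 = (n + 1, n + (x : ℕ), n + 1 + (y : ℕ))) ∨
    (∀ x y : Fin 2, (k (x, y)).1 = (n + 1 + (y : ℕ), n + 1, n + (x : ℕ)))

/-- The small squares of `C`. -/
def IsSmallSquare (k : Sq →o Chain) : Prop := IsFace k ∨ IsReinforcing k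

/-- The shift `(n₁, n₂, n₃) ↦ (n₁ + 1, n₂ + 1, n₃ + 1)`. -/
def Chain.sh : Chain →o Chain where
  toFun p := ⟨(p.1.1 + 1, p.1.2.1 + 1, p.1.2.2 + 1), by
    rcases p.2 with ⟨n, a, b, c, h⟩ | ⟨n, h⟩
    · refine .inl ⟨n + 1, a, b, c, ?_⟩
      rw [h]; ext <;> dsimp <;> ring
    · refine .inr ⟨n + 1, ?_⟩
      rcases h with h | h | h <;> rw [h] <;> simp <;> omega⟩
  monotone' p q h := ⟨by simpa using h.1, by simpa using h.2.1, by simpa using h.2.2⟩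

/-- The rotation `(n₁, n₂, n₃) ↦ (n₃, n₁, n₂)`. -/
def Chain.rot : Chain →o Chain where
  toFun p := ⟨(p.1.2.2, p.1.1, p.1.2.1), by
    rcases p.2 with ⟨n, a, b, c, h⟩ | ⟨n, h⟩
    · exact .inl ⟨n, c, a, b, by rw [h]⟩
    · refine .inr ⟨n, ?_⟩
      rcases h with h | h | h <;> rw [h] <;> simp⟩
  monotone' p q h := ⟨h.2.2, h.1, h.2.1⟩

lemma Chain.sh_val (p : Chain) : (Chain.sh p).1 = (p.1.1 + 1, p.1.2.1 + 1, p.1.2.2 + 1) := rfl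

lemma Chain.rot_val (p : Chain) : (Chain.rot p).1 = (p.1.2.2, p.1.1, p.1.2.1) := rfl

lemma inCubes_sh (p : Chain) : InCubes (Chain.sh p).1 ↔ InCubes p.1 := by
  rw [Chain.sh_val]
  constructor
  · rintro ⟨n, a, b, c, h⟩
    refine ⟨n - 1, a, b, c, ?_⟩
    simp only [Prod.mk.injEq] at h
    ext <;> dsimp <;> omega
  · rintro ⟨n, a, b, c, h⟩
    refine ⟨n + 1, a, b, c, ?_⟩
    rw [h]; simp only [Prod.mk.injEq]; omega

lemma inCubes_rot (p : Chain) : InCubes (Chain.rot p).1 ↔ InCubes p.1 := by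
  rw [Chain.rot_val]
  constructor
  · rintro ⟨n, a, b, c, h⟩
    refine ⟨n, b, c, a, ?_⟩
    simp only [Prod.mk.injEq] at h
    ext <;> dsimp <;> omega
  · rintro ⟨n, a, b, c, h⟩
    exact ⟨n, c, a, b, by rw [h]⟩

lemma IsSmallSquare.sh {k : Sq →o Chain} (h : IsSmallSquare k) :
    IsSmallSquare (Chain.sh.comp k) := by
  rcases h with ⟨n, e, h⟩ | ⟨n, h⟩
  · refine .inl ⟨n + 1, e, ?_⟩
    rcases h with h | h | h
    · refine .inl fun x y => ?_
      change (Chain.sh (k (x, y))).1 = _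
      rw [Chain.sh_val, h]; exact Prod.ext (by ring) (Prod.ext (by ring) (by ring))
    · refine .inr (.inl fun x y => ?_)
      change (Chain.sh (k (x, y))).1 = _
      rw [Chain.sh_val, h]; exact Prod.ext (by ring) (Prod.ext (by ring) (by ring))
    · refine .inr (.inr fun x y => ?_)
      change (Chain.sh (k (x, y))).1 = _
      rw [Chain.sh_val, h]; exact Prod.ext (by ring) (Prod.ext (by ring) (by ring))
  · refine .inr ⟨n + 1, ?_⟩
    rcases h with h | h | h
    · refine .inl fun x y => ?_
      change (Chain.sh (k (x, y))).1 = _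
      rw [Chain.sh_val, h]; exact Prod.ext (by ring) (Prod.ext (by ring) (by ring))
    · refine .inr (.inl fun x y => ?_)
      change (Chain.sh (k (x, y))).1 = _
      rw [Chain.sh_val, h]; exact Prod.ext (by ring) (Prod.ext (by ring) (by ring))
    · refine .inr (.inr fun x y => ?_)
      change (Chain.sh (k (x, y))).1 = _
      rw [Chain.sh_val, h]; exact Prod.ext (by ring) (Prod.ext (by ring) (by ring))

lemma IsSmallSquare.rot {k : Sq →o Chain} (h : IsSmallSquare k) :
    IsSmallSquare (Chain.rot.comp k) := by
  have H (x) : (Chain.rot.comp k x).1 = ((k x).1.2.2, (k x).1.1, (k x).1.2.1) := rfl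
  rcases h with ⟨n, e, h⟩ | ⟨n, h⟩
  · refine .inl ⟨n, e, ?_⟩
    rcases h with h | h | h
    · exact .inr (.inl fun x y => by rw [H, h])
    · exact .inr (.inr fun x y => by rw [H, h])
    · exact .inl fun x y => by rw [H, h]
  · refine .inr ⟨n, ?_⟩
    rcases h with h | h | h
    · exact .inr (.inl fun x y => by rw [H, h])
    · exact .inr (.inr fun x y => by rw [H, h])
    · exact .inl fun x y => by rw [H, h]

/-- The trivalent source `[1]³_{≤ 1}`: the vertices of the cube with at most one coordinate `1`. -/
abbrev Source : Type := {p : Fin 2 × Fin 2 × Fin 2 // (p.1 : ℕ) + p.2.1 + p.2.2 ≤ 1}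

/-- The embedding of the trivalent source into the chain of cubes. -/
def Source.incl : Source →o Chain where
  toFun p := ⟨((p.1.1 : ℕ), (p.1.2.1 : ℕ), (p.1.2.2 : ℕ)),
    .inl ⟨0, p.1.1, p.1.2.1, p.1.2.2, by simp⟩⟩
  monotone' p q h := ⟨Int.ofNat_le.2 h.1, Int.ofNat_le.2 h.2.1, Int.ofNat_le.2 h.2.2⟩

namespace Prederivator

variable (D E : Prederivator.{w, v, u})

lemma prod'_const_comp {J J' A A' : Type w} [Category.{w} J] [Category.{w} J'] [Category.{w} A]
    [Category.{w} A'] (k : J ⥤ J') (a : A) (f : A ⥤ A') :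
    k.prod' ((Functor.const J).obj a) ⋙ (𝟭 J').prod f =
      k.prod' ((Functor.const J).obj (f.obj a)) :=
  Functor.hext (fun _ => rfl) fun _ _ _ => heq_of_eq (Prod.ext rfl (f.map_id a))

lemma fromPUnit_comp {A B : Type w} [Category.{w} A] [Category.{w} B] (a : A) (f : A ⥤ B) :
    Functor.fromPUnit.{w} a ⋙ f = Functor.fromPUnit.{w} (f.obj a) :=
  Functor.hext (fun _ => rfl) fun _ _ _ => heq_of_eq (f.map_id a)

/-- The condition defining `D^{C,ex}`, checked at every object `a` of `A`: all small squares are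
bicartesian and all objects outside of `C₀` are zero. -/
noncomputable def cexProp : (D.shift (Pos.{w} Chain)).ObjectProperty where
  prop A Y :=
    (∀ k : Sq →o Chain, IsSmallSquare k → ∀ a : A.unop, D.IsBicartesian
      ((D.res (B := Pos.{w} Chain × A.unop) ((Pos.map k).prod' ((Functor.const _).obj a))).obj Y)) ∧
    ∀ p : Chain, ¬ InCubes p.1 → ∀ a : A.unop,
      IsZero (D.ev (A := Pos.{w} Chain × A.unop) Y (Pos.of p, a))

instance : D.cexProp.IsClosedUnderMapObj where
  map_obj hY f :=
    ⟨fun k hk a => (hY.1 k hk (f.unop.toFunctor.obj a)).of_iso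
      (D.resObjIso (f := (Pos.map k).prod' ((Functor.const _).obj a))
        (g := (𝟭 _).prod f.unop.toFunctor) (prod'_const_comp _ _ _) _),
    fun p hp a => (hY.2 p hp (f.unop.toFunctor.obj a)).of_iso
      (D.resObjIso (f := Functor.fromPUnit (Pos.of p, a))
        (g := (𝟭 _).prod f.unop.toFunctor) (fromPUnit_comp _ _) _).symm⟩

/-- The prederivator `D^{C,ex}`. -/
noncomputable abbrev cex : Prederivator.{w, v, u} := D.cexProp.fullsubcategory

variable {D E}

lemma cexProp_shiftMap {F : D ⟶ E} (hF : IsExact F) (A : Cat.{w, w}ᵒᵖ)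
    (Y : (D.shift (Pos.{w} Chain)).obj A) (hY : D.cexProp.prop A Y) :
    E.cexProp.prop A (((shiftMap F (Pos.{w} Chain)).app A).toFunctor.obj Y) :=
  ⟨fun k hk a => (hF.isBicartesian _ (hY.1 k hk a)).of_iso
      (resNatIso F (B := Pos.{w} Chain × A.unop) ((Pos.map k).prod' ((Functor.const _).obj a)) Y),
    fun p hp a => (hF.isZero _ (hY.2 p hp a)).of_iso
      (resNatIso F (B := Pos.{w} Chain × A.unop) (Functor.fromPUnit (Pos.of p, a)) Y).symm⟩

/-- The morphism `F^{C,ex} : D^{C,ex} ⟶ E^{C,ex}` induced by an exact morphism `F : D ⟶ E`. -/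
noncomputable def cexMap (F : D ⟶ E) (hF : IsExact F) : D.cex ⟶ E.cex :=
  fullsubMap (shiftMap F (Pos.{w} Chain)) D.cexProp E.cexProp (cexProp_shiftMap hF)

/-- The monotone maps `φ : C → C` which preserve small squares and the complement of `C₀`. -/
structure Symm (φ : Chain →o Chain) : Prop where
  square (k : Sq →o Chain) : IsSmallSquare k → IsSmallSquare (φ.comp k)
  inCubes (p : Chain) : InCubes (φ p).1 ↔ InCubes p.1

lemma cexProp_restr {φ : Chain →o Chain} (hφ : Symm φ) (A : Cat.{w, w}ᵒᵖ)
    (Y : (D.shift (Pos.{w} Chain)).obj A) (hY : D.cexProp.prop A Y) :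
    D.cexProp.prop A (((D.restr (Pos.map.{w} φ)).app A).toFunctor.obj Y) :=
  ⟨fun k hk a => (hY.1 _ (hφ.square k hk) a).of_iso
      (D.resObjIso (f := (Pos.map k).prod' ((Functor.const _).obj a))
        (g := (Pos.map φ).prod (𝟭 A.unop)) rfl _),
    fun p hp a => (hY.2 (φ p) (mt (hφ.inCubes p).1 hp) a).of_iso
      (D.resObjIso (f := Functor.fromPUnit (Pos.of p, a))
        (g := (Pos.map φ).prod (𝟭 A.unop)) (fromPUnit_comp _ _) _).symm⟩

variable (D) in
/-- The restriction `φ^* : D^{C,ex} ⟶ D^{C,ex}`. -/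
noncomputable def cexRes (φ : Chain →o Chain) (hφ : Symm φ) : D.cex ⟶ D.cex :=
  fullsubMap (D.restr (Pos.map.{w} φ)) D.cexProp D.cexProp (cexProp_restr hφ)

/-- The canonical isomorphism `φ^* ≫ F^{C,ex} ≅ F^{C,ex} ≫ φ^*`. -/
noncomputable def cexResCell (φ : Chain →o Chain) (hφ : Symm φ) (F : D ⟶ E) (hF : IsExact F) :
    D.cexRes φ hφ ≫ cexMap F hF ≅ cexMap F hF ≫ E.cexRes φ hφ :=
  fullsubIso (commSq (prodOpMap (Pos.map.{w} φ)) F) _ _ _ _ _ _ _ _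

lemma symm_sh : Symm Chain.sh := ⟨fun _ => IsSmallSquare.sh, inCubes_sh⟩

lemma symm_rot : Symm Chain.rot := ⟨fun _ => IsSmallSquare.rot, inCubes_rot⟩

variable (D) in
/-- The morphism `sh^*`. -/
noncomputable abbrev shiftRes : D.cex ⟶ D.cex := D.cexRes Chain.sh symm_sh

variable (D) in
/-- The morphism `r^*`. -/
noncomputable abbrev rotRes : D.cex ⟶ D.cex := D.cexRes Chain.rot symm_rot

variable (D) in
/-- The Serre endomorphism `S = r^* ∘ sh^*`. -/
noncomputable abbrev serre : D.cex ⟶ D.cex := D.shiftRes ≫ D.rotRes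

/-! ### Suspension -/

variable (E) in
/-- The cocartesian squares of `E` with zero objects in the corners `(1, 0)` and `(0, 1)`, as a
condition on the objects of `E^□(A)` which is checked at every object `a` of `A`. -/
noncomputable def suspProp : (E.shift (Pos.{w} Sq)).ObjectProperty where
  prop A Y := ∀ a : A.unop,
    E.IsCocartesian ((E.res (B := Pos.{w} Sq × A.unop)
      ((𝟭 _).prod' ((Functor.const _).obj a))).obj Y) ∧
    IsZero (E.ev (A := Pos.{w} Sq × A.unop) Y (Pos.of (1, 0), a)) ∧
    IsZero (E.ev (A := Pos.{w} Sq × A.unop) Y (Pos.of (0, 1), a))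

variable (E) in
/-- A functorial choice of suspension squares: a morphism `square : E ⟶ E^□` together with an
isomorphism of its value at the corner `(0, 0)` with the identity of `E`, such that the squares
are cocartesian and vanish at the corners `(1, 0)` and `(0, 1)`. -/
structure Suspension where
  square : E ⟶ E.shift (Pos.{w} Sq)
  prop (A : Cat.{w, w}ᵒᵖ) (X : E.obj A) : E.suspProp.prop A ((square.app A).toFunctor.obj X)
  base : square ≫ E.eval (Pos.of (0, 0)) ≅ 𝟙 E

/-- The suspension `Σ : E ⟶ E`, the value of the suspension squares at the corner `(1, 1)`. -/
noncomputable abbrev Suspension.susp (σ : Suspension E) : E ⟶ E :=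
  σ.square ≫ E.eval (Pos.of (1, 1))

/-! ### Pasting -/

/-- The horizontal pasting of two squares that commute up to isomorphism. -/
def pasteSq {X₀ X₁ X₂ Y₀ Y₁ Y₂ : Prederivator.{w, v, u}} {s : X₀ ⟶ X₁} {t : X₁ ⟶ X₂}
    {s' : Y₀ ⟶ Y₁} {t' : Y₁ ⟶ Y₂} {F₀ : X₀ ⟶ Y₀} {F₁ : X₁ ⟶ Y₁} {F₂ : X₂ ⟶ Y₂}
    (a : s ≫ F₁ ≅ F₀ ≫ s') (b : t ≫ F₂ ≅ F₁ ≫ t') : (s ≫ t) ≫ F₂ ≅ F₀ ≫ s' ≫ t' :=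
  α_ _ _ _ ≪≫ whiskerLeftIso s b ≪≫ (α_ _ _ _).symm ≪≫ whiskerRightIso a t' ≪≫ α_ _ _ _

/-- The canonical isomorphism expressing that `F` commutes with evaluation at `b`. -/
def evalCell {B : Type w} [Category.{w} B] (b : B) (F : D ⟶ E) :
    D.eval b ≫ F ≅ shiftMap F B ≫ E.eval b :=
  commSqId (prodOpSect b) F

/-- The canonical isomorphism expressing that `F^{C,ex}` commutes with the Serre endomorphism. -/
noncomputable def serreCell (F : D ⟶ E) (hF : IsExact F) :
    D.serre ≫ cexMap F hF ≅ cexMap F hF ≫ E.serre :=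
  pasteSq (cexResCell _ _ F hF) (cexResCell _ _ F hF)

/-- A comparison of the suspension squares of `D` and `E` along `F : D ⟶ E`, compatible with the
identifications of their corners `(0, 0)`. -/
structure Comparison (F : D ⟶ E) (σ : Suspension D) (τ : Suspension E) where
  cell : σ.square ≫ shiftMap F (Pos.{w} Sq) ≅ F ≫ τ.square
  base : (pasteSq cell (evalCell (Pos.of (0, 0)) F)).hom ≫ F ◁ τ.base.hom =
    σ.base.hom ▷ F ≫ (λ_ F).hom ≫ (ρ_ F).inv

/-- The isomorphism `Σ ≫ F ≅ F ≫ Σ` given by a comparison of suspension squares. -/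
noncomputable def Comparison.suspCell {F : D ⟶ E} {σ : Suspension D} {τ : Suspension E}
    (κ : Comparison F σ τ) : σ.susp ≫ F ≅ F ≫ τ.susp :=
  pasteSq κ.cell (evalCell (Pos.of (1, 1)) F)

end Prederivator

/-! Everything rests on a family of cubes inside `C`. For `p = (p₁, p₂, p₃)` in `C` there is a cube
`Chain.cubeAt p` from `p` to `p + (3, 3, 3)` whose other six vertices are links: `(p₃+2, p₃+1, p₃)`,
`(p₁, p₁+2, p₁+1)`, `(p₂+1, p₂, p₂+2)` next to `p`, and `(p₁+3, p₁+2, p₁+1)`, `(p₂+1, p₂+3, p₂+2)`,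
`(p₃+2, p₃+1, p₃+3)` next to the final vertex. An exact diagram vanishes at links. If the
restriction to this cube is a left Kan extension from the cube without its final vertex, then its
value at `p + (3, 3, 3)` is the double suspension of its value at `p`. The cubes are monotone in
`p`, so they form a morphism `cubes` from `D^{C,ex}` to its shift by the cube, with initial vertex
the identity and final vertex `(sh^*)³`.

Iterating a choice of suspension squares gives a second such morphism, `Suspension.iter`, with
initial vertex the identity and final vertex `Σ²`. Both take values in diagrams that vanish away
from two vertices `b` and `t` and are left Kan extended to `t` (`starProp`). On these diagrams
evaluation at `b` is fully faithful (`starProp_bijective`), so there is exactly one isomorphism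
`cubes ≅ iter` compatible with the initial vertices. Its value at `(1, 1, 1)` is `ψ`. Since the
rotation commutes with the shift and has order three, `S³` and `(sh^*)³` are restrictions along the
same functor, and this gives `θ`. The uniqueness also yields compatibility with exact morphisms: the
two isomorphisms to be compared agree at the initial vertex (`compat_cubesIso`).

That the cubes are cocartesian has to be tested at the four objects of the trivalent source only
(`IsStableDerivator.cex_isLKE_iff`). At `(1, 0, 0)`, and also at `(1, 1, 0)`, it follows by pasting
small squares along staircases; rotation gives the other two unit vectors; and `(0, 0, 0)` follows
from `(1, 0, 0)`, `(0, 1, 0)` and `(1, 1, 0)` by stability (`IsEx.isLKE_cubeAt`).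

For the first part, an exact diagram is recovered from its restriction to the source by four Kan
extensions along full inclusions: right by zero to the nonnegative links, left by cocartesian
squares to all nonnegative objects, left by zero to the remaining links, right by cartesian squares
to all of `C` (`isEx_iff`). Hence `D^{C,ex}` is levelwise equivalent to the shift of `D` by the
source, inherits stability, and has suspension squares because evaluation of these squares at the
corner `(0, 0)` is an equivalence.

The tools are a pointwise calculus of Kan extensions (`LeftExact`, `IsLKE`, `LKEAt`) and a calculus
of isomorphisms compatible with given squares of morphisms (`Compat`). -/

namespace Prederivator
variable (D : Prederivator.{w, v, u})
-- Restriction functors, pasting of squares, universal morphisms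
section
variable {A B C E : Type w} [Category.{w} A] [Category.{w} B] [Category.{w} C] [Category.{w} E]

@[simp] lemma resMap_id (f : A ⥤ B) : D.resMap (𝟙 f) = 𝟙 (D.res f) :=
  congrArg Cat.Hom₂.toNatTrans (D.map₂_id f.toCatHom.op)

lemma resMap_comp {f g h : A ⥤ B} (α : f ⟶ g) (β : g ⟶ h) :
    D.resMap (α ≫ β) = D.resMap α ≫ D.resMap β :=
  congrArg Cat.Hom₂.toNatTrans (D.map₂_comp (op2 α.toCatHom₂) (op2 β.toCatHom₂))

lemma resMap_whiskerLeft (f : A ⥤ B) {g h : B ⥤ C} (β : g ⟶ h) (X : D.Val C) :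
    (D.resMap (Functor.whiskerLeft f β)).app X ≫ (D.resComp f h).hom.app X =
      (D.resComp f g).hom.app X ≫ (D.res f).map ((D.resMap β).app X) := by
  have := congrArg (fun t => t.toNatTrans.app X)
    (D.map₂_whisker_right (op2 β.toCatHom₂) f.toCatHom.op)
  have h2 : (D.resMap (Functor.whiskerLeft f β)).app X = (D.resComp f g).hom.app X ≫ (D.res f).map ((D.resMap β).app X) ≫ (D.resComp f h).inv.app X := this
  rw [h2]
  simp

lemma resMap_whiskerRight {f g : A ⥤ B} (α : f ⟶ g) (h : B ⥤ C) (X : D.Val C) :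
    (D.resMap (Functor.whiskerRight α h)).app X ≫ (D.resComp g h).hom.app X =
      (D.resComp f h).hom.app X ≫ (D.resMap α).app ((D.res h).obj X) := by
  have h2 : (D.resMap (Functor.whiskerRight α h)).app X = (D.resComp f h).hom.app X ≫ (D.resMap α).app ((D.res h).obj X) ≫ (D.resComp g h).inv.app X := congrArg (fun t => t.toNatTrans.app X)
    (D.map₂_whisker_left h.toCatHom.op (op2 α.toCatHom₂))
  rw [h2]
  simp

lemma resComp_assoc (f : A ⥤ B) (g : B ⥤ C) (h : C ⥤ E) (X : D.Val E) :
    (D.resComp f (g ⋙ h)).hom.app X ≫ (D.res f).map ((D.resComp g h).hom.app X) =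
      (D.resComp (f ⋙ g) h).hom.app X ≫ (D.resComp f g).hom.app ((D.res h).obj X) := by
  have h2 := congrArg (fun t => t.toNatTrans.app X)
    (D.mapComp_assoc_left_hom h.toCatHom.op g.toCatHom.op f.toCatHom.op)
  -- Composition of functors is strictly associative, so the associators in the coherence law act as
  -- identities.
  have h3 : (D.resComp f (g ⋙ h)).hom.app X ≫ (D.res f).map ((D.resComp g h).hom.app X) = (D.resMap (𝟙 (f ⋙ g ⋙ h))).app X ≫ (D.resComp (f ⋙ g) h).hom.app X ≫ (D.resComp f g).hom.app ((D.res h).obj X) ≫ 𝟙 _ := h2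
  rw [h3]
  simp

/-- The isomorphism `(𝟭 A)^* ≅ 𝟭`. -/
def resId (A : Type w) [Category.{w} A] : D.res (𝟭 A) ≅ 𝟭 (D.Val A) :=
  Cat.Hom.toNatIso (D.mapId (op (Cat.of A)))

lemma resComp_id_left (f : A ⥤ B) (X : D.Val B) :
    (D.resComp (𝟭 A) f).hom.app X = (D.resId A).inv.app ((D.res f).obj X) := by
  have h2 := congrArg (fun t => t.toNatTrans.app X)
    (D.map₂_right_unitor f.toCatHom.op)
  have h3 : (D.resMap (𝟙 f)).app X = (D.resComp (𝟭 A) f).hom.app X ≫ (D.resId A).hom.app ((D.res f).obj X) ≫ 𝟙 _ := h2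
  rw [← cancel_mono ((D.resId A).hom.app ((D.res f).obj X))]
  simpa using h3.symm

lemma resComp_id_right (f : A ⥤ B) (X : D.Val B) :
    (D.resComp f (𝟭 B)).hom.app X = (D.res f).map ((D.resId B).inv.app X) := by
  have h2 := congrArg (fun t => t.toNatTrans.app X)
    (D.map₂_left_unitor f.toCatHom.op)
  have h3 : (D.resMap (𝟙 f)).app X = (D.resComp f (𝟭 B)).hom.app X ≫ (D.res f).map ((D.resId B).hom.app X) ≫ 𝟙 _ := h2
  rw [← cancel_mono ((D.res f).map ((D.resId B).hom.app X)), ← Functor.map_comp]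
  simpa using h3.symm

end
end Prederivator

namespace Prederivator
variable (D : Prederivator.{w, v, u})
section
variable {P A Q B P' Q' : Type w} [Category.{w} P] [Category.{w} A] [Category.{w} Q]
  [Category.{w} B] [Category.{w} P'] [Category.{w} Q']

lemma resComp_assoc_inv {E : Type w} [Category.{w} E] (f : A ⥤ B) (g : B ⥤ Q) (h : Q ⥤ E)
    (X : D.Val E) :
    (D.resComp (f ⋙ g) h).hom.app X ≫ (D.resComp f g).hom.app ((D.res h).obj X) ≫
      (D.res f).map ((D.resComp g h).inv.app X) = (D.resComp f (g ⋙ h)).hom.app X := by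
  rw [← reassoc_of% D.resComp_assoc f g h X, ← Functor.map_comp, Iso.hom_inv_id_app]
  exact (congrArg _ ((D.res f).map_id _)).trans (Category.comp_id _)

/-! ### Squares of categories -/

section
variable {p : P ⥤ A} {u : A ⥤ B} {q : P ⥤ Q} {b : Q ⥤ B}

/-- The morphism `p^* u^* X ⟶ q^* b^* X` induced by `α : p ⋙ u ⟶ q ⋙ b`. -/
def bc (α : p ⋙ u ⟶ q ⋙ b) (X : D.Val B) :
    (D.res p).obj ((D.res u).obj X) ⟶ (D.res q).obj ((D.res b).obj X) :=
  (D.resComp p u).inv.app X ≫ (D.resMap α).app X ≫ (D.resComp q b).hom.app X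

lemma bc_naturality (α : p ⋙ u ⟶ q ⋙ b) {X Y : D.Val B} (f : X ⟶ Y) :
    (D.res p).map ((D.res u).map f) ≫ D.bc α Y = D.bc α X ≫ (D.res q).map ((D.res b).map f) := by
  have h1 := (D.resComp p u).inv.naturality f
  have h2 := (D.resMap α).naturality f
  have h3 := (D.resComp q b).hom.naturality f
  dsimp only [Functor.comp_map] at h1 h3
  simp only [bc, Category.assoc]
  rw [reassoc_of% h1, reassoc_of% h2, h3]

/-- The morphism `p^* W ⟶ q^* b^* V` induced by `c : W ⟶ u^* V` and `α : p ⋙ u ⟶ q ⋙ b`. -/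
def bcl (α : p ⋙ u ⟶ q ⋙ b) {W : D.Val A} {V : D.Val B} (c : W ⟶ (D.res u).obj V) :
    (D.res p).obj W ⟶ (D.res q).obj ((D.res b).obj V) :=
  (D.res p).map c ≫ D.bc α V

/-- The morphism `p^* u^* V ⟶ q^* W` induced by `c : b^* V ⟶ W` and `α : p ⋙ u ⟶ q ⋙ b`. -/
def bcr (α : p ⋙ u ⟶ q ⋙ b) {W : D.Val Q} {V : D.Val B} (c : (D.res b).obj V ⟶ W) :
    (D.res p).obj ((D.res u).obj V) ⟶ (D.res q).obj W :=
  D.bc α V ≫ (D.res q).map c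

lemma bcl_comp (α : p ⋙ u ⟶ q ⋙ b) {W : D.Val A} {V V' : D.Val B} (c : W ⟶ (D.res u).obj V)
    (g : V ⟶ V') :
    D.bcl α (c ≫ (D.res u).map g) = D.bcl α c ≫ (D.res q).map ((D.res b).map g) := by
  simp only [bcl, Functor.map_comp, Category.assoc, bc_naturality]

lemma bcr_comp (α : p ⋙ u ⟶ q ⋙ b) {W : D.Val Q} {V V' : D.Val B} (c : (D.res b).obj V ⟶ W)
    (g : V' ⟶ V) :
    D.bcr α ((D.res b).map g ≫ c) = (D.res p).map ((D.res u).map g) ≫ D.bcr α c := by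
  simp only [bcr, Functor.map_comp, reassoc_of% bc_naturality]

/-- Pasting squares of categories composes the induced morphisms. The pasted transformation `γ` is a
separate variable, so that any transformation equal to the whiskered composite, such as an identity,
may be used for it. -/
lemma bc_paste (α : p ⋙ u ⟶ q ⋙ b) {p' : P' ⥤ P} {q' : P' ⥤ Q'} {b' : Q' ⥤ Q}
    (β : p' ⋙ q ⟶ q' ⋙ b') (γ : (p' ⋙ p) ⋙ u ⟶ q' ⋙ b' ⋙ b)
    (h : γ = Functor.whiskerLeft p' α ≫ Functor.whiskerRight β b) (X : D.Val B) :
    (D.resComp p' p).hom.app ((D.res u).obj X) ≫ (D.res p').map (D.bc α X) ≫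
        D.bc β ((D.res b).obj X) =
      D.bc γ X ≫ (D.res q').map ((D.resComp b' b).hom.app X) := by
  have e1 := D.resComp_assoc_inv p' p u X
  have e2 := D.resMap_whiskerLeft p' α X
  have e3 := D.resComp_assoc p' q b X
  have e4 := D.resMap_whiskerRight β b X
  have e5 := D.resComp_assoc q' b' b X
  rw [← cancel_epi ((D.resComp (p' ⋙ p) u).hom.app X)]
  simp only [bc, Functor.map_comp, Category.assoc, Iso.hom_inv_id_app_assoc, e5]
  rw [reassoc_of% e1, h, resMap_comp]
  simp only [NatTrans.comp_app, Category.assoc]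
  rw [← reassoc_of% e2, reassoc_of% e3]
  simp only [Iso.hom_inv_id_app_assoc]
  rw [← reassoc_of% e4]

lemma bc_paste' (α : p ⋙ u ⟶ q ⋙ b) {p' : P' ⥤ Q'} {q' : P' ⥤ P} {u' : Q' ⥤ A}
    (β : p' ⋙ u' ⟶ q' ⋙ p) (γ : p' ⋙ u' ⋙ u ⟶ (q' ⋙ q) ⋙ b)
    (h : γ = Functor.whiskerRight β u ≫ Functor.whiskerLeft q' α) (X : D.Val B) :
    D.bc γ X ≫ (D.resComp q' q).hom.app ((D.res b).obj X) =
      (D.res p').map ((D.resComp u' u).hom.app X) ≫ D.bc β ((D.res u).obj X) ≫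
        (D.res q').map (D.bc α X) := by
  have e1 := D.resComp_assoc p' u' u X
  have e2 := D.resMap_whiskerRight β u X
  have e3 := D.resComp_assoc_inv q' p u X
  have e4 := D.resMap_whiskerLeft q' α X
  have e5 := D.resComp_assoc q' q b X
  rw [← cancel_epi ((D.resComp p' (u' ⋙ u)).hom.app X)]
  simp only [bc, Functor.map_comp, Category.assoc, Iso.hom_inv_id_app_assoc]
  rw [reassoc_of% e1, Iso.hom_inv_id_app_assoc, ← reassoc_of% e2, reassoc_of% e3, h, resMap_comp,
    ← reassoc_of% e4, e5]
  simp only [NatTrans.comp_app, Category.assoc]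

lemma bc_precomp (α : p ⋙ u ⟶ q ⋙ b) (r : P' ⥤ P) (X : D.Val B) :
    (D.resComp r p).hom.app ((D.res u).obj X) ≫ (D.res r).map (D.bc α X) =
      D.bc (p := r ⋙ p) (q := r ⋙ q) (Functor.whiskerLeft r α) X ≫
        (D.resComp r q).hom.app ((D.res b).obj X) := by
  have e1 := D.resComp_assoc_inv r p u X
  have e2 := D.resMap_whiskerLeft r α X
  have e3 := D.resComp_assoc r q b X
  rw [← cancel_epi ((D.resComp (r ⋙ p) u).hom.app X)]
  simp only [bc, Functor.map_comp, Category.assoc, Iso.hom_inv_id_app_assoc]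
  rw [reassoc_of% e1, ← reassoc_of% e2, e3]

lemma bc_comp_right (α : p ⋙ u ⟶ q ⋙ b) {b' : Q ⥤ B} (e : b ⟶ b') (X : D.Val B) :
    D.bc (α ≫ Functor.whiskerLeft q e) X = D.bc α X ≫ (D.res q).map ((D.resMap e).app X) := by
  have e1 := D.resMap_whiskerLeft q e X
  simp only [bc, resMap_comp, NatTrans.comp_app, Category.assoc, e1]

lemma bc_comp_left (α : p ⋙ u ⟶ q ⋙ b) {u' : A ⥤ B} (e : u' ⟶ u) (X : D.Val B) :
    D.bc (Functor.whiskerLeft p e ≫ α) X = (D.res p).map ((D.resMap e).app X) ≫ D.bc α X := by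
  have e1 := D.resMap_whiskerLeft p e X
  rw [← cancel_epi ((D.resComp p u').hom.app X)]
  simp only [bc, resMap_comp, NatTrans.comp_app, Category.assoc, Iso.hom_inv_id_app_assoc]
  rw [← reassoc_of% e1, Iso.hom_inv_id_app_assoc]

end

/-! ### Universal morphisms -/

section
variable {D}

/-- The morphism `c : W ⟶ q^* V` exhibits `V` as a left Kan extension of `W` along `q`. -/
def IsUniv (q : P ⥤ Q) {W : D.Val P} {V : D.Val Q} (c : W ⟶ (D.res q).obj V) : Prop :=
  ∀ Z, Function.Bijective fun g : V ⟶ Z => c ≫ (D.res q).map g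

/-- The morphism `c : q^* V ⟶ W` exhibits `V` as a right Kan extension of `W` along `q`. -/
def IsCouniv (q : P ⥤ Q) {W : D.Val P} {V : D.Val Q} (c : (D.res q).obj V ⟶ W) : Prop :=
  ∀ Z, Function.Bijective fun g : Z ⟶ V => (D.res q).map g ≫ c

variable {q : P ⥤ Q} {W W' : D.Val P} {V V' : D.Val Q}

lemma isUniv_iso_comp (i : W' ⟶ W) [IsIso i] (c : W ⟶ (D.res q).obj V) :
    IsUniv q (i ≫ c) ↔ IsUniv q c := by
  refine forall_congr' fun Z => ?_
  rw [← Function.Bijective.of_comp_iff' ((asIso i).homFromEquiv (Z := (D.res q).obj Z)).symm.bijective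
    (fun g : V ⟶ Z => c ≫ (D.res q).map g)]
  refine iff_of_eq (congrArg _ (funext fun g => ?_))
  simp [Iso.homFromEquiv]

lemma isCouniv_comp_iso (i : W ⟶ W') [IsIso i] (c : (D.res q).obj V ⟶ W) :
    IsCouniv q (c ≫ i) ↔ IsCouniv q c := by
  refine forall_congr' fun Z => ?_
  rw [← Function.Bijective.of_comp_iff' ((asIso i).homToEquiv (Z := (D.res q).obj Z)).bijective
    (fun g : Z ⟶ V => (D.res q).map g ≫ c)]
  refine iff_of_eq (congrArg _ (funext fun g => ?_))
  simp [Iso.homToEquiv]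

lemma isUniv_comp_map (c : W ⟶ (D.res q).obj V) (e : V ⟶ V') [IsIso e] :
    IsUniv q (c ≫ (D.res q).map e) ↔ IsUniv q c := by
  refine forall_congr' fun Z => ?_
  rw [← Function.Bijective.of_comp_iff (fun g : V ⟶ Z => c ≫ (D.res q).map g)
    ((asIso e).homFromEquiv (Z := Z)).symm.bijective]
  refine iff_of_eq (congrArg _ (funext fun g => ?_))
  simp [Iso.homFromEquiv]

lemma isCouniv_map_comp (c : (D.res q).obj V ⟶ W) (e : V' ⟶ V) [IsIso e] :
    IsCouniv q ((D.res q).map e ≫ c) ↔ IsCouniv q c := by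
  refine forall_congr' fun Z => ?_
  rw [← Function.Bijective.of_comp_iff (fun g : Z ⟶ V => (D.res q).map g ≫ c)
    ((asIso e).homToEquiv (Z := Z)).bijective]
  refine iff_of_eq (congrArg _ (funext fun g => ?_))
  simp [Iso.homToEquiv]

/-- Two objects corepresenting the same functor are isomorphic by a unique isomorphism under `W`. -/
lemma IsUniv.isIso {c : W ⟶ (D.res q).obj V} (h : IsUniv q c) {g : V ⟶ V'}
    (h' : IsUniv q (c ≫ (D.res q).map g)) : IsIso g := by
  obtain ⟨i, hi⟩ := (h' V).2 c
  dsimp only at hi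
  rw [Category.assoc, ← Functor.map_comp] at hi
  have h1 : g ≫ i = 𝟙 V := (h V).1 (by simpa using hi)
  refine ⟨i, h1, (h' V').1 ?_⟩
  dsimp only
  rw [Category.assoc, ← Functor.map_comp, reassoc_of% h1]
  simp

lemma IsCouniv.isIso {c : (D.res q).obj V ⟶ W} (h : IsCouniv q c) {g : V' ⟶ V}
    (h' : IsCouniv q ((D.res q).map g ≫ c)) : IsIso g := by
  obtain ⟨i, hi⟩ := (h' V).2 c
  dsimp only at hi
  rw [← Functor.map_comp_assoc] at hi
  have h1 : i ≫ g = 𝟙 V := (h V).1 (by simpa using hi)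
  refine ⟨i, (h' V').1 ?_, h1⟩
  dsimp only
  rw [← Functor.map_comp_assoc, Category.assoc, h1]
  simp

/-- The unit of an adjunction is universal, so a morphism out of `L W` is invertible exactly if its
transpose is universal. This turns (Der4), a statement about mates, into one about universal
morphisms, without chosen adjoints. -/
lemma isUniv_homEquiv {L : D.Val P ⥤ D.Val Q} (adj : L ⊣ D.res q) (g : L.obj W ⟶ V) :
    IsUniv q (adj.unit.app W ≫ (D.res q).map g) ↔ IsIso g := by
  have h : IsUniv q (adj.unit.app W) := fun Z => 
    (congrArg Function.Bijective (funext fun g => adj.homEquiv_unit W Z g)).mp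
      (adj.homEquiv W Z).bijective
  exact ⟨fun h' => h.isIso h', fun _ => (isUniv_comp_map _ g).2 h⟩

lemma isCouniv_homEquiv {R : D.Val P ⥤ D.Val Q} (adj : D.res q ⊣ R) (g : V ⟶ R.obj W) :
    IsCouniv q ((D.res q).map g ≫ adj.counit.app W) ↔ IsIso g := by
  have h : IsCouniv q (adj.counit.app W) := fun Z => 
    (congrArg Function.Bijective (funext fun g => adj.homEquiv_counit Z W g)).mp
      (adj.homEquiv Z W).symm.bijective
  exact ⟨fun h' => h.isIso h', fun _ => (isCouniv_map_comp _ g).2 h⟩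

lemma isUniv_unit {L : D.Val P ⥤ D.Val Q} (adj : L ⊣ D.res q) (W : D.Val P) :
    IsUniv q (adj.unit.app W) := by
  simpa using (isUniv_homEquiv adj (𝟙 (L.obj W))).2 inferInstance

lemma isCouniv_counit {R : D.Val P ⥤ D.Val Q} (adj : D.res q ⊣ R) (W : D.Val P) :
    IsCouniv q (adj.counit.app W) := by
  simpa using (isCouniv_homEquiv adj (𝟙 (R.obj W))).2 inferInstance

lemma IsUniv.exists_iso {c : W ⟶ (D.res q).obj V} (h : IsUniv q c)
    {c' : W ⟶ (D.res q).obj V'} (h' : IsUniv q c') : ∃ e : V ≅ V', c ≫ (D.res q).map e.hom = c' := by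
  obtain ⟨g, hg⟩ := (h V').2 c'
  have : IsIso g := h.isIso (by dsimp only at hg; rwa [hg])
  exact ⟨asIso g, hg⟩

lemma IsCouniv.exists_iso {c : (D.res q).obj V ⟶ W} (h : IsCouniv q c)
    {c' : (D.res q).obj V' ⟶ W} (h' : IsCouniv q c') :
    ∃ e : V' ≅ V, (D.res q).map e.hom ≫ c = c' := by
  obtain ⟨g, hg⟩ := (h V').2 c'
  have : IsIso g := h.isIso (by dsimp only at hg; rwa [hg])
  exact ⟨asIso g, hg⟩

end

/-- The adjunction `r^* ⊣ l^*` induced by an adjunction `l ⊣ r`. -/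
def resAdj {l : A ⥤ B} {r : B ⥤ A} (adj : l ⊣ r) : D.res r ⊣ D.res l :=
  Adjunction.mkOfUnitCounit
    -- Restriction reverses functors but not transformations: the unit and counit keep their roles
    -- while the two functors are exchanged.
    { unit := (D.resId A).inv ≫ D.resMap adj.unit ≫ (D.resComp l r).hom
      counit := (D.resComp r l).inv ≫ D.resMap adj.counit ≫ (D.resId B).hom
      left_triangle := by
        ext X
        have e1 := D.resMap_whiskerLeft r adj.unit X
        have e2 := D.resComp_assoc r l r X
        have e3 := D.resMap_whiskerRight adj.counit r X
        have e4 : D.resMap (Functor.whiskerLeft r adj.unit) ≫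
          D.resMap (Functor.whiskerRight adj.counit r) = 𝟙 _ := by
          refine (D.resMap_comp _ _).symm.trans ((congrArg D.resMap ?_).trans (D.resMap_id r))
          ext Y
          simp
        have e5 := congrArg (fun t => t.app X) e4
        dsimp at e5 ⊢
        simp only [Functor.map_comp, ← D.resComp_id_right, Category.assoc, Category.id_comp]
        rw [← reassoc_of% e1]
        erw [reassoc_of% e2]
        rw [Iso.hom_inv_id_app_assoc]
        erw [← reassoc_of% e3, reassoc_of% e5]
        rw [D.resComp_id_left]
        simp
      right_triangle := by
        ext X
        have e1 := D.resMap_whiskerRight adj.unit l X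
        have e3 := D.resMap_whiskerLeft l adj.counit X
        have e4 : D.resMap (Functor.whiskerRight adj.unit l) ≫
          D.resMap (Functor.whiskerLeft l adj.counit) = 𝟙 _ := by
          refine (D.resMap_comp _ _).symm.trans ((congrArg D.resMap ?_).trans (D.resMap_id l))
          ext Y
          simp
        have e5 := congrArg (fun t => t.app X) e4
        dsimp at e5 ⊢
        simp only [Functor.map_comp, Category.assoc, Category.id_comp]
        rw [resComp_id_left] at e1
        rw [resComp_id_right] at e3
        rw [← reassoc_of% e1, reassoc_of% resComp_assoc_inv, ← reassoc_of% e3, reassoc_of% e5,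
          ← Functor.map_comp, Iso.inv_hom_id_app]
        exact (D.res l).map_id X }

end
end Prederivator

/-! ### Final functors and exact squares -/

namespace Prederivator
variable {D : Prederivator.{w, v, u}}
section
variable {P A Q B P' Q' : Type w} [Category.{w} P] [Category.{w} A] [Category.{w} Q]
  [Category.{w} B] [Category.{w} P'] [Category.{w} Q']

/-! ### Finality -/

instance resMap_isIso {f g : A ⥤ B} (α : f ⟶ g) [IsIso α] : IsIso (D.resMap α) :=
  ⟨D.resMap (inv α), by rw [← resMap_comp, IsIso.hom_inv_id, resMap_id],
    by rw [← resMap_comp, IsIso.inv_hom_id, resMap_id]⟩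

/-- Morphisms `r^* M ⟶ r^* N` are morphisms `M ⟶ l^* r^* N` by `resAdj`, and the unit at `N`
identifies the target with `N`. -/
lemma res_map_bijective_of_isIso_unit {l : A ⥤ B} {r : B ⥤ A} (adj : l ⊣ r) (M N : D.Val A)
    [IsIso ((D.resMap adj.unit).app N)] :
    Function.Bijective fun g : M ⟶ N => (D.res r).map g := by
  have h : IsIso ((D.resAdj adj).unit.app N) := by
    change IsIso ((D.resId A).inv.app N ≫ (D.resMap adj.unit).app N ≫ (D.resComp l r).hom.app N)
    infer_instance
  rw [← Function.Bijective.of_comp_iff' ((D.resAdj adj).homEquiv M ((D.res r).obj N)).bijective]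
  refine (congrArg Function.Bijective (funext fun g => ?_)).mp
    ((asIso ((D.resAdj adj).unit.app N)).homToEquiv (Z := M)).bijective
  exact ((D.resAdj adj).unit.naturality g).trans ((D.resAdj adj).homEquiv_unit _ _ _).symm

lemma res_map_bijective_of_isIso_counit {l : A ⥤ B} {r : B ⥤ A} (adj : l ⊣ r) (M N : D.Val B)
    [IsIso ((D.resMap adj.counit).app M)] :
    Function.Bijective fun g : M ⟶ N => (D.res l).map g := by
  have h : IsIso ((D.resAdj adj).counit.app M) := by
    change IsIso ((D.resComp r l).inv.app M ≫ (D.resMap adj.counit).app M ≫ (D.resId B).hom.app M)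
    infer_instance
  rw [← Function.Bijective.of_comp_iff'
    ((D.resAdj adj).homEquiv ((D.res l).obj M) N).symm.bijective]
  refine (congrArg Function.Bijective (funext fun g => ?_)).mp
    ((asIso ((D.resAdj adj).counit.app M)).homFromEquiv (Z := N)).symm.bijective
  exact ((D.resAdj adj).counit.naturality g).symm.trans ((D.resAdj adj).homEquiv_counit _ _ _).symm

/-- Up to the composition isomorphisms, `α^*` at `q^* Z` is the restriction along `α` whiskered with
`q`; the transformation `α` itself may fail to be invertible. -/
lemma isIso_resMap_app_res {f g : P ⥤ A} (α : f ⟶ g) (q : A ⥤ B)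
    [IsIso (Functor.whiskerRight α q)] (Z : D.Val B) :
    IsIso ((D.resMap α).app ((D.res q).obj Z)) := by
  have e := D.resMap_whiskerRight α q Z
  have : (D.resMap α).app ((D.res q).obj Z) = (D.resComp f q).inv.app Z ≫
      (D.resMap (Functor.whiskerRight α q)).app Z ≫ (D.resComp g q).hom.app Z := by
    rw [e, Iso.inv_hom_id_app_assoc]
  rw [this]
  infer_instance

/-- Right adjoints are final. Morphisms into `q^* Z` are detected by `r^*`, since the unit becomes
invertible after applying `q`. -/
lemma isUniv_precomp {q : A ⥤ Q} (r : B ⥤ A) {l : A ⥤ B} (adj : l ⊣ r)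
    [IsIso (Functor.whiskerRight adj.unit q)] {W : D.Val A} {V : D.Val Q}
    (c : W ⟶ (D.res q).obj V) :
    IsUniv (r ⋙ q) ((D.res r).map c ≫ (D.resComp r q).inv.app V) ↔ IsUniv q c := by
  refine forall_congr' fun Z => ?_
  have := isIso_resMap_app_res (D := D) adj.unit q Z
  rw [← Function.Bijective.of_comp_iff' (res_map_bijective_of_isIso_unit adj W ((D.res q).obj Z)),
    ← Function.Bijective.of_comp_iff'
      ((((D.resComp r q).symm.app Z)).homToEquiv (Z := (D.res r).obj W)).bijective]
  refine iff_of_eq (congrArg _ (funext fun g => ?_))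
  have e := (D.resComp r q).inv.naturality g
  dsimp at e
  simp [Iso.homToEquiv, e]

lemma isCouniv_precomp {q : B ⥤ Q} {r : B ⥤ A} (l : A ⥤ B) (adj : l ⊣ r)
    [IsIso (Functor.whiskerRight adj.counit q)] {W : D.Val B} {V : D.Val Q}
    (c : (D.res q).obj V ⟶ W) :
    IsCouniv (l ⋙ q) ((D.resComp l q).hom.app V ≫ (D.res l).map c) ↔ IsCouniv q c := by
  refine forall_congr' fun Z => ?_
  have := isIso_resMap_app_res (D := D) adj.counit q Z
  rw [← Function.Bijective.of_comp_iff' (res_map_bijective_of_isIso_counit adj ((D.res q).obj Z) W),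
    ← Function.Bijective.of_comp_iff'
      ((((D.resComp l q).symm.app Z)).homFromEquiv (Z := (D.res l).obj W)).bijective]
  refine iff_of_eq (congrArg _ (funext fun g => ?_))
  simp [Iso.homFromEquiv]

/-! ### Exact squares -/

/-- A combinatorial condition on a square which ensures that it is compatible with left Kan
extensions. -/
def LeftExact {p : P ⥤ A} {u : A ⥤ B} {q : P ⥤ Q} {b : Q ⥤ B} (α : p ⋙ u ⟶ q ⋙ b) : Prop :=
  ∀ (y : Q) (a : A) (f : u.obj a ⟶ b.obj y), ∃ (k : P) (g : q.obj k ⟶ y) (h : a ⟶ p.obj k),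
    u.map h ≫ α.app k ≫ b.map g = f ∧
      ∀ (k' : P) (g' : q.obj k' ⟶ y) (h' : a ⟶ p.obj k'), u.map h' ≫ α.app k' ≫ b.map g' = f →
        ∃! m : k ⟶ k', h ≫ p.map m = h' ∧ q.map m ≫ g' = g

/-- A combinatorial condition on a square which ensures that it is compatible with right Kan
extensions. -/
def RightExact {p : P ⥤ A} {u : A ⥤ B} {q : P ⥤ Q} {b : Q ⥤ B} (α : p ⋙ u ⟶ q ⋙ b) : Prop :=
  ∀ (x : A) (y : Q) (f : u.obj x ⟶ b.obj y), ∃ (k : P) (g : x ⟶ p.obj k) (h : q.obj k ⟶ y),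
    u.map g ≫ α.app k ≫ b.map h = f ∧
      ∀ (k' : P) (g' : x ⟶ p.obj k') (h' : q.obj k' ⟶ y), u.map g' ≫ α.app k' ≫ b.map h' = f →
        ∃! m : k' ⟶ k, g' ≫ p.map m = g ∧ q.map m ≫ h = h'

/-- The functor between the comma categories at `y` and `b y` of a square. -/
def commaL {p : P ⥤ A} {u : A ⥤ B} {q : P ⥤ Q} {b : Q ⥤ B} (α : p ⋙ u ⟶ q ⋙ b) (y : Q) :
    Comma q (Functor.fromPUnit.{w} y) ⥤ Comma u (Functor.fromPUnit.{w} (b.obj y)) where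
  obj X := { left := p.obj X.left, right := X.right, hom := α.app X.left ≫ b.map X.hom }
  map f :=
    { left := p.map f.left
      right := f.right
      w := by
        have h1 := α.naturality f.left
        have h2 := f.w
        dsimp at h1 h2 ⊢
        rw [reassoc_of% h1, ← b.map_comp, h2]
        simp }

/-- The functor between the comma categories at `x` and `u x` of a square. -/
def commaR {p : P ⥤ A} {u : A ⥤ B} {q : P ⥤ Q} {b : Q ⥤ B} (α : p ⋙ u ⟶ q ⋙ b) (x : A) :
    Comma (Functor.fromPUnit.{w} x) p ⥤ Comma (Functor.fromPUnit.{w} (u.obj x)) b where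
  obj X := { left := X.left, right := q.obj X.right, hom := u.map X.hom ≫ α.app X.right }
  map f :=
    { left := f.left
      right := q.map f.right
      w := by
        have h1 := α.naturality f.right
        have h2 := f.w
        dsimp at h1 h2 ⊢
        rw [Category.assoc, ← h1, ← u.map_comp_assoc, ← h2]
        simp }

/-- `LeftExact` asks that, for each `f : u a ⟶ b y`, the category of factorisations of `f` through
`α` has an initial object. These are the initial objects of the structured arrow categories of
`commaL α y`, which provide a left adjoint. -/
lemma LeftExact.isRightAdjoint {p : P ⥤ A} {u : A ⥤ B} {q : P ⥤ Q} {b : Q ⥤ B}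
    {α : p ⋙ u ⟶ q ⋙ b} (h : LeftExact α) (y : Q) : (commaL α y).IsRightAdjoint := by
  have : ∀ M, HasInitial (StructuredArrow M (commaL α y)) := fun M => by
    obtain ⟨k, g, i, h1, h2⟩ := h y M.left M.hom
    let X : Comma q (Functor.fromPUnit.{w} y) := { left := k, right := M.right, hom := g }
    let e : M ⟶ (commaL α y).obj X :=
      { left := i
        right := 𝟙 _
        w := by
          exact h1.trans (Category.comp_id _).symm }
    refine (?_ : IsInitial (StructuredArrow.mk e)).hasInitial
    have key (T : StructuredArrow M (commaL α y)) := h2 T.right.left T.right.hom T.hom.left (by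
      exact T.hom.w.trans (Category.comp_id _))
    choose m hm hu using fun T => (key T)
    refine IsInitial.ofUniqueHom
      (fun T => StructuredArrow.homMk { left := m T, right := ⟨⟨Subsingleton.elim _ _⟩⟩, w := ?_ }
        (CommaMorphism.ext (hm T).1 (Subsingleton.elim _ _))) ?_
    · exact (hm T).2.trans (Category.comp_id _).symm
    · intro T f
      refine StructuredArrow.hom_ext _ _ (CommaMorphism.ext ?_ (Subsingleton.elim _ _))
      refine hu T _ ⟨?_, ?_⟩
      · exact congrArg CommaMorphism.left (StructuredArrow.w f)
      · exact f.right.w.trans (Category.comp_id _)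
  exact isRightAdjointOfStructuredArrowInitials _

lemma RightExact.isLeftAdjoint {p : P ⥤ A} {u : A ⥤ B} {q : P ⥤ Q} {b : Q ⥤ B}
    {α : p ⋙ u ⟶ q ⋙ b} (h : RightExact α) (x : A) : (commaR α x).IsLeftAdjoint := by
  have : ∀ M, HasTerminal (CostructuredArrow (commaR α x) M) := fun M => by
    obtain ⟨k, g, i, h1, h2⟩ := h x M.right M.hom
    let X : Comma (Functor.fromPUnit.{w} x) p := { left := M.left, right := k, hom := g }
    let e : (commaR α x).obj X ⟶ M :=
      { left := 𝟙 _
        right := i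
        w := by
          exact (Category.id_comp _).trans (h1.symm.trans (Category.assoc _ _ _).symm) }
    refine (?_ : IsTerminal (CostructuredArrow.mk e)).hasTerminal
    have key (T : CostructuredArrow (commaR α x) M) := h2 T.left.right T.left.hom T.hom.right (by
      exact (Category.assoc _ _ _).symm.trans (T.hom.w.symm.trans (Category.id_comp _)))
    choose m hm hu using fun T => (key T)
    refine IsTerminal.ofUniqueHom
      (fun T => CostructuredArrow.homMk { left := ⟨⟨Subsingleton.elim _ _⟩⟩, right := m T, w := ?_ }
        (CommaMorphism.ext (Subsingleton.elim _ _) (hm T).2)) ?_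
    · exact (Category.id_comp _).trans (hm T).1.symm
    · intro T f
      refine CostructuredArrow.hom_ext _ _ (CommaMorphism.ext (Subsingleton.elim _ _) ?_)
      refine hu T _ ⟨?_, ?_⟩
      · exact f.left.w.symm.trans (Category.id_comp _)
      · exact congrArg CommaMorphism.right (CostructuredArrow.w f)
  exact isLeftAdjoint_of_costructuredArrowTerminals _

/-- The isomorphism between `y ⋙ b` and `b y`. -/
def fromPUnitComp (y : Q) (b : Q ⥤ B) :
    Functor.fromPUnit.{w} y ⋙ b ≅ Functor.fromPUnit.{w} (b.obj y) :=
  Discrete.natIso fun _ => Iso.refl _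

/-- The pointwise formula at `y` for the pasted morphism is the formula at `b y` restricted along
the final functor `commaL α y`, so the two are universal together. -/
lemma LeftExact.isUniv_iff {p : P ⥤ A} {u : A ⥤ B} {q : P ⥤ Q} {b : Q ⥤ B}
    {α : p ⋙ u ⟶ q ⋙ b} (h : LeftExact α) (y : Q) {W : D.Val A} {V : D.Val B}
    (c : W ⟶ (D.res u).obj V) :
    IsUniv _ (D.bcl (Comma.natTrans q (Functor.fromPUnit.{w} y)) (D.bcl α c)) ↔
      IsUniv _ (D.bcl (Comma.natTrans u (Functor.fromPUnit.{w} (b.obj y))) c) := by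
  have := h.isRightAdjoint y
  have adj := Adjunction.ofIsRightAdjoint (commaL α y)
  -- The projection goes to the terminal category, where every morphism is invertible.
  have : IsIso (Functor.whiskerRight adj.unit
      (Comma.snd u (Functor.fromPUnit.{w} (b.obj y)))) := by
    have : ∀ X, IsIso ((Functor.whiskerRight adj.unit
      (Comma.snd u (Functor.fromPUnit.{w} (b.obj y)))).app X) := fun X => ⟨⟨⟨Subsingleton.elim _ _⟩⟩, Subsingleton.elim _ _, Subsingleton.elim _ _⟩
    exact NatIso.isIso_of_isIso_app _
  rw [← isUniv_precomp (commaL α y) adj]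
  let γ : (Comma.fst q (Functor.fromPUnit.{w} y) ⋙ p) ⋙ u ⟶
      Comma.snd q (Functor.fromPUnit.{w} y) ⋙ Functor.fromPUnit.{w} y ⋙ b :=
    Functor.whiskerLeft (Comma.fst q (Functor.fromPUnit.{w} y)) α ≫
      Functor.whiskerRight (Comma.natTrans q (Functor.fromPUnit.{w} y)) b
  have e1 := D.bc_paste α (Comma.natTrans q (Functor.fromPUnit.{w} y)) γ rfl V
  have e2 := D.bc_precomp (Comma.natTrans u (Functor.fromPUnit.{w} (b.obj y))) (commaL α y) V
  have e3 := D.bc_comp_right γ (fromPUnitComp y b).hom V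
  let δ : (Comma.fst q (Functor.fromPUnit.{w} y) ⋙ p) ⋙ u ⟶
      Comma.snd q (Functor.fromPUnit.{w} y) ⋙ Functor.fromPUnit.{w} (b.obj y) :=
    Functor.whiskerLeft (commaL α y) (Comma.natTrans u (Functor.fromPUnit.{w} (b.obj y)))
  have e4 : γ ≫ Functor.whiskerLeft _ (fromPUnitComp y b).hom =
      δ := by
    ext X
    simp only [γ, fromPUnitComp]
    exact Category.comp_id _
  have e5 := (D.resComp (Comma.fst q (Functor.fromPUnit.{w} y)) p).hom.naturality c
  have e6 := (D.resComp (commaL α y) (Comma.fst u (Functor.fromPUnit.{w} (b.obj y)))).hom.naturality c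
  rw [e4] at e3
  dsimp only [Functor.comp_map] at e5 e6
  -- `k1` and `k2` bring both morphisms, up to canonical isomorphisms on either side, to the same
  -- form: the restriction of `c` followed by the morphism induced by `δ`.
  have k1 : (D.resComp (Comma.fst q (Functor.fromPUnit.{w} y)) p).hom.app W ≫
      D.bcl (Comma.natTrans q (Functor.fromPUnit.{w} y)) (D.bcl α c) ≫
        (D.res (Comma.snd q (Functor.fromPUnit.{w} y))).map
          ((D.resComp (Functor.fromPUnit.{w} y) b).inv.app V ≫
            (D.resMap (fromPUnitComp y b).hom).app V) =
      (D.res (Comma.fst q (Functor.fromPUnit.{w} y) ⋙ p)).map c ≫ D.bc δ V := by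
    rw [e3]
    simp only [bcl, Functor.map_comp, Category.assoc]
    rw [← reassoc_of% e5, reassoc_of% e1, ← Functor.map_comp_assoc, Iso.hom_inv_id_app]
    exact congrArg _ (congrArg _ ((congrArg (· ≫ _) (CategoryTheory.Functor.map_id _ _)).trans (Category.id_comp _)))
  have k2 : (D.resComp (commaL α y) (Comma.fst u (Functor.fromPUnit.{w} (b.obj y)))).hom.app W ≫
      ((D.res (commaL α y)).map (D.bcl (Comma.natTrans u (Functor.fromPUnit.{w} (b.obj y))) c) ≫
        (D.resComp (commaL α y) (Comma.snd u (Functor.fromPUnit.{w} (b.obj y)))).inv.app _) =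
      (D.res (Comma.fst q (Functor.fromPUnit.{w} y) ⋙ p)).map c ≫ D.bc δ V := by
    simp only [bcl, Functor.map_comp, Category.assoc]
    rw [← reassoc_of% e6, reassoc_of% e2, Iso.hom_inv_id_app]
    exact congrArg _ (Category.comp_id _)
  rw [← isUniv_comp_map _ ((D.resComp (Functor.fromPUnit.{w} y) b).inv.app V ≫
            (D.resMap (fromPUnitComp y b).hom).app V), ← isUniv_iso_comp ((D.resComp (Comma.fst q (Functor.fromPUnit.{w} y)) p).hom.app W), k1,
    ← isUniv_iso_comp ((D.resComp (commaL α y) (Comma.fst u (Functor.fromPUnit.{w} (b.obj y)))).hom.app W), k2]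
  rfl

lemma RightExact.isCouniv_iff {p : P ⥤ A} {u : A ⥤ B} {q : P ⥤ Q} {b : Q ⥤ B}
    {α : p ⋙ u ⟶ q ⋙ b} (h : RightExact α) (x : A) {W : D.Val Q} {V : D.Val B}
    (c : (D.res b).obj V ⟶ W) :
    IsCouniv _ (D.bcr (Comma.natTrans (Functor.fromPUnit.{w} x) p) (D.bcr α c)) ↔
      IsCouniv _ (D.bcr (Comma.natTrans (Functor.fromPUnit.{w} (u.obj x)) b) c) := by
  have := h.isLeftAdjoint x
  have adj := Adjunction.ofIsLeftAdjoint (commaR α x)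
  have : IsIso (Functor.whiskerRight adj.counit
      (Comma.fst (Functor.fromPUnit.{w} (u.obj x)) b)) := by
    have : ∀ X, IsIso ((Functor.whiskerRight adj.counit
      (Comma.fst (Functor.fromPUnit.{w} (u.obj x)) b)).app X) := fun X =>
        ⟨⟨⟨Subsingleton.elim _ _⟩⟩, Subsingleton.elim _ _, Subsingleton.elim _ _⟩
    exact NatIso.isIso_of_isIso_app _
  rw [← isCouniv_precomp (commaR α x) adj]
  let γ : Comma.fst (Functor.fromPUnit.{w} x) p ⋙ Functor.fromPUnit.{w} x ⋙ u ⟶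
      (Comma.snd (Functor.fromPUnit.{w} x) p ⋙ q) ⋙ b :=
    Functor.whiskerRight (Comma.natTrans (Functor.fromPUnit.{w} x) p) u ≫
      Functor.whiskerLeft (Comma.snd (Functor.fromPUnit.{w} x) p) α
  let δ : Comma.fst (Functor.fromPUnit.{w} x) p ⋙ Functor.fromPUnit.{w} (u.obj x) ⟶
      (Comma.snd (Functor.fromPUnit.{w} x) p ⋙ q) ⋙ b :=
    Functor.whiskerLeft (commaR α x) (Comma.natTrans (Functor.fromPUnit.{w} (u.obj x)) b)
  have e1 := D.bc_paste' α (Comma.natTrans (Functor.fromPUnit.{w} x) p) γ rfl V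
  have e2 := D.bc_precomp (Comma.natTrans (Functor.fromPUnit.{w} (u.obj x)) b) (commaR α x) V
  have e3 := D.bc_comp_left γ (fromPUnitComp x u).inv V
  have e4 : Functor.whiskerLeft _ (fromPUnitComp x u).inv ≫ γ = δ := by
    ext X
    simp only [γ, fromPUnitComp]
    exact Category.id_comp _
  have e5 := (D.resComp (Comma.snd (Functor.fromPUnit.{w} x) p) q).inv.naturality c
  have e6 := (D.resComp (commaR α x)
    (Comma.snd (Functor.fromPUnit.{w} (u.obj x)) b)).inv.naturality c
  rw [e4] at e3
  dsimp only [Functor.comp_map] at e5 e6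
  have k1 : (D.res (Comma.fst (Functor.fromPUnit.{w} x) p)).map
        ((D.resMap (fromPUnitComp x u).inv).app V ≫
          (D.resComp (Functor.fromPUnit.{w} x) u).hom.app V) ≫
      D.bcr (Comma.natTrans (Functor.fromPUnit.{w} x) p) (D.bcr α c) ≫
      (D.resComp (Comma.snd (Functor.fromPUnit.{w} x) p) q).inv.app W =
      D.bc δ V ≫ (D.res (Comma.snd (Functor.fromPUnit.{w} x) p ⋙ q)).map c := by
    rw [e3]
    simp only [bcr, Functor.map_comp, Category.assoc]
    rw [e5, ← reassoc_of% e1, Iso.hom_inv_id_app_assoc]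
  have k2 : ((D.resComp (commaR α x) (Comma.fst (Functor.fromPUnit.{w} (u.obj x)) b)).hom.app _ ≫
      (D.res (commaR α x)).map
        (D.bcr (Comma.natTrans (Functor.fromPUnit.{w} (u.obj x)) b) c)) ≫
        (D.resComp (commaR α x) (Comma.snd (Functor.fromPUnit.{w} (u.obj x)) b)).inv.app _ =
      D.bc δ V ≫ (D.res (Comma.snd (Functor.fromPUnit.{w} x) p ⋙ q)).map c := by
    simp only [bcr, Functor.map_comp, Category.assoc]
    rw [e6, reassoc_of% e2, Iso.hom_inv_id_app_assoc]
    rfl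
  rw [← isCouniv_map_comp _ ((D.resMap (fromPUnitComp x u).inv).app V ≫
          (D.resComp (Functor.fromPUnit.{w} x) u).hom.app V),
    ← isCouniv_comp_iso ((D.resComp (Comma.snd (Functor.fromPUnit.{w} x) p) q).inv.app W),
    Category.assoc, k1, ← isCouniv_comp_iso ((D.resComp (commaR α x)
      (Comma.snd (Functor.fromPUnit.{w} (u.obj x)) b)).inv.app W), k2]
  rfl

end
end Prederivator

/-! ### Pointwise criteria for Kan extensions -/

namespace Prederivator
variable {D : Prederivator.{w, v, u}}
section
variable {P A Q B P' Q' : Type w} [Category.{w} P] [Category.{w} A] [Category.{w} Q]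
  [Category.{w} B] [Category.{w} P'] [Category.{w} Q']

/-! ### Pointwise Kan extensions -/

/-- The morphism `c : W ⟶ u^* V` exhibits `V_t` as a left Kan extension at `t`. -/
def UnivAt (u : A ⥤ B) {W : D.Val A} {V : D.Val B} (c : W ⟶ (D.res u).obj V) (t : B) : Prop :=
  IsUniv _ (D.bcl (Comma.natTrans u (Functor.fromPUnit.{w} t)) c)

/-- The morphism `c : u^* V ⟶ W` exhibits `V_t` as a right Kan extension at `t`. -/
def CounivAt (u : A ⥤ B) {W : D.Val A} {V : D.Val B} (c : (D.res u).obj V ⟶ W) (t : B) : Prop :=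
  IsCouniv _ (D.bcr (Comma.natTrans (Functor.fromPUnit.{w} t) u) c)

lemma LeftExact.univAt_iff {p : P ⥤ A} {u : A ⥤ B} {q : P ⥤ Q} {b : Q ⥤ B}
    {α : p ⋙ u ⟶ q ⋙ b} (h : LeftExact α) (y : Q) {W : D.Val A} {V : D.Val B}
    (c : W ⟶ (D.res u).obj V) : UnivAt q (D.bcl α c) y ↔ UnivAt u c (b.obj y) :=
  h.isUniv_iff y c

lemma RightExact.counivAt_iff {p : P ⥤ A} {u : A ⥤ B} {q : P ⥤ Q} {b : Q ⥤ B}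
    {α : p ⋙ u ⟶ q ⋙ b} (h : RightExact α) (x : A) {W : D.Val Q} {V : D.Val B}
    (c : (D.res b).obj V ⟶ W) : CounivAt p (D.bcr α c) x ↔ CounivAt b c (u.obj x) :=
  h.isCouniv_iff x c

/-- The axioms (Der2), (Der3) and (Der4) in terms of universal morphisms. -/
structure IsDerivator' (D : Prederivator.{w, v, u}) : Prop where
  der2 {A : Type w} [Category.{w} A] {X Y : D.Val A} (f : X ⟶ Y) :
    (∀ a : A, IsIso ((D.res (Functor.fromPUnit.{w} a)).map f)) → IsIso f
  exists_isUniv {A B : Type w} [Category.{w} A] [Category.{w} B] (u : A ⥤ B) (W : D.Val A) :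
    ∃ (V : D.Val B) (c : W ⟶ (D.res u).obj V), IsUniv u c
  exists_isCouniv {A B : Type w} [Category.{w} A] [Category.{w} B] (u : A ⥤ B) (W : D.Val A) :
    ∃ (V : D.Val B) (c : (D.res u).obj V ⟶ W), IsCouniv u c
  univAt {A B : Type w} [Category.{w} A] [Category.{w} B] {u : A ⥤ B} {W : D.Val A} {V : D.Val B}
    {c : W ⟶ (D.res u).obj V} : IsUniv u c → ∀ t, UnivAt u c t
  counivAt {A B : Type w} [Category.{w} A] [Category.{w} B] {u : A ⥤ B} {W : D.Val A} {V : D.Val B}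
    {c : (D.res u).obj V ⟶ W} : IsCouniv u c → ∀ t, CounivAt u c t

lemma isRightAdjoint_of_exists (u : A ⥤ B)
    (h : ∀ W : D.Val A, ∃ (V : D.Val B) (c : W ⟶ (D.res u).obj V), IsUniv u c) :
    (D.res u).IsRightAdjoint := by
  choose V c hc using h
  refine ⟨_, ⟨Adjunction.adjunctionOfEquivLeft (G := D.res u) (F_obj := V)
    (fun W Z => Equiv.ofBijective _ (hc W Z)) ?_⟩⟩
  intro W Z Z' g h
  simp

lemma isLeftAdjoint_of_exists (u : A ⥤ B)
    (h : ∀ W : D.Val A, ∃ (V : D.Val B) (c : (D.res u).obj V ⟶ W), IsCouniv u c) :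
    (D.res u).IsLeftAdjoint := by
  choose V c hc using h
  refine ⟨_, ⟨Adjunction.adjunctionOfEquivRight (F := D.res u) (G_obj := V)
    (fun Z W => (Equiv.ofBijective _ (hc W Z)).symm) ?_⟩⟩
  intro Z Z' W f g
  apply (Equiv.ofBijective _ (hc W Z)).injective
  simp only [Equiv.apply_symm_apply]
  have : (Equiv.ofBijective _ (hc W Z')) ((Equiv.ofBijective _ (hc W Z')).symm g) = g :=
    Equiv.apply_symm_apply _ _
  simp only [Equiv.ofBijective_apply] at this ⊢
  rw [Functor.map_comp, Category.assoc, this]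

/-- By `unit_mateEquiv_symm`, the mate in (Der4) is the morphism whose transpose is the unit pasted
with the comma square; its invertibility therefore says that the pasted morphism is universal. Any
other universal morphism differs from the unit by an isomorphism. -/
lemma IsDerivator.toIsDerivator' (hD : D.IsDerivator) : D.IsDerivator' where
  der2 := hD.der2
  exists_isUniv u W := by
    have := hD.der3_left u
    exact ⟨_, _, isUniv_unit (Adjunction.ofIsRightAdjoint (D.res u)) W⟩
  exists_isCouniv u W := by
    have := hD.der3_right u
    exact ⟨_, _, isCouniv_counit (Adjunction.ofIsLeftAdjoint (D.res u)) W⟩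
  univAt {A B} _ _ u W V c hc t := by
    have := hD.der3_left u
    have := hD.der3_left (Comma.snd u (Functor.fromPUnit.{w} t))
    let adj := Adjunction.ofIsRightAdjoint (D.res u)
    let adj' := Adjunction.ofIsRightAdjoint (D.res (Comma.snd u (Functor.fromPUnit.{w} t)))
    have h := hD.der4_left u t adj adj'
    have e := unit_mateEquiv_symm adj adj'
      (D.resSquare (Comma.natTrans u (Functor.fromPUnit.{w} t))) W
    have h2 : IsIso (((mateEquiv adj adj').symm
      (D.resSquare (Comma.natTrans u (Functor.fromPUnit.{w} t)))).app ((𝟭 (D.Val A)).obj W)) :=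
      inferInstanceAs (IsIso ((TwoSquare.natTrans _).app W))
    obtain ⟨i, rfl⟩ := (isUniv_unit adj W).exists_iso hc
    have h1 : UnivAt u (adj.unit.app W) t :=
      (congrArg (IsUniv _) e).mpr ((isUniv_comp_map _ _).2 (isUniv_unit adj' _))
    rw [UnivAt, bcl_comp]
    exact (isUniv_comp_map _ _).2 h1
  counivAt {A B} _ _ u W V c hc t := by
    have := hD.der3_right u
    have := hD.der3_right (Comma.fst (Functor.fromPUnit.{w} t) u)
    let adj := Adjunction.ofIsLeftAdjoint (D.res u)
    let adj' := Adjunction.ofIsLeftAdjoint (D.res (Comma.fst (Functor.fromPUnit.{w} t) u))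
    have h := hD.der4_right u t adj adj'
    have e := mateEquiv_counit adj adj'
      (D.resSquare (Comma.natTrans (Functor.fromPUnit.{w} t) u)) W
    have h2 : IsIso ((mateEquiv adj adj'
      (D.resSquare (Comma.natTrans (Functor.fromPUnit.{w} t) u))).app W) :=
      inferInstanceAs (IsIso ((TwoSquare.natTrans _).app W))
    obtain ⟨i, rfl⟩ := (isCouniv_counit adj W).exists_iso hc
    have h1 : CounivAt u (adj.counit.app W) t :=
      (congrArg (IsCouniv _) e).mp ((isCouniv_map_comp _ _).2 (isCouniv_counit adj' _))
    rw [CounivAt, bcr_comp]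
    exact (isCouniv_map_comp _ _).2 h1

lemma IsDerivator'.isDerivator (hD : D.IsDerivator')
    (der1 : ∀ {I : Type w} (A : I → Type w) [∀ i, Category.{w} (A i)],
      (Functor.pi' fun i => D.res (Sigma.incl (C := A) i)).IsEquivalence) : D.IsDerivator where
  der1 := der1
  der2 := hD.der2
  der3_left u := isRightAdjoint_of_exists u (hD.exists_isUniv u)
  der3_right u := isLeftAdjoint_of_exists u (hD.exists_isCouniv u)
  der4_left u t _ adj _ adj' := by
    have : ∀ W, IsIso (((mateEquiv adj adj').symm
        (D.resSquare (Comma.natTrans u (Functor.fromPUnit.{w} t)))).natTrans.app W) := fun W => by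
      have e := unit_mateEquiv_symm adj adj'
        (D.resSquare (Comma.natTrans u (Functor.fromPUnit.{w} t))) W
      exact (isUniv_homEquiv adj' _).1
        ((congrArg (IsUniv _) e).mp (hD.univAt (isUniv_unit adj W) t))
    exact NatIso.isIso_of_isIso_app _
  der4_right u t _ adj _ adj' := by
    have : ∀ W, IsIso ((mateEquiv adj adj'
        (D.resSquare (Comma.natTrans (Functor.fromPUnit.{w} t) u))).natTrans.app W) := fun W => by
      have e := mateEquiv_counit adj adj'
        (D.resSquare (Comma.natTrans (Functor.fromPUnit.{w} t) u)) W
      exact (isCouniv_homEquiv adj' _).1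
        ((congrArg (IsCouniv _) e).mpr (hD.counivAt (isCouniv_counit adj W) t))
    exact NatIso.isIso_of_isIso_app _

namespace IsDerivator'

variable (hD : D.IsDerivator')
include hD

/-- A morphism satisfying the pointwise formulas is compared with a genuine Kan extension; the
comparison is invertible at each `t` by uniqueness of universal morphisms, hence invertible by
(Der2). -/
lemma isUniv_iff {u : A ⥤ B} {W : D.Val A} {V : D.Val B} (c : W ⟶ (D.res u).obj V) :
    IsUniv u c ↔ ∀ t, UnivAt u c t := by
  refine ⟨hD.univAt, fun h => ?_⟩
  obtain ⟨V₀, c₀, h₀⟩ := hD.exists_isUniv u W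
  obtain ⟨g, rfl⟩ := (h₀ V).2 c
  have : IsIso g := hD.der2 g fun t => by
    have h1 := h t
    rw [UnivAt, bcl_comp] at h1
    exact (hD.univAt h₀ t).isIso h1
  exact (isUniv_comp_map _ _).2 h₀

lemma isCouniv_iff {u : A ⥤ B} {W : D.Val A} {V : D.Val B} (c : (D.res u).obj V ⟶ W) :
    IsCouniv u c ↔ ∀ t, CounivAt u c t := by
  refine ⟨hD.counivAt, fun h => ?_⟩
  obtain ⟨V₀, c₀, h₀⟩ := hD.exists_isCouniv u W
  obtain ⟨g, rfl⟩ := (h₀ V).2 c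
  have : IsIso g := hD.der2 g fun t => by
    have h1 := h t
    rw [CounivAt, bcr_comp] at h1
    exact (hD.counivAt h₀ t).isIso h1
  exact (isCouniv_map_comp _ _).2 h₀

/-- Base change: the restriction along `b` of a left Kan extension along `u` is a left Kan extension
along `q`. -/
lemma isUniv_bcl {p : P ⥤ A} {u : A ⥤ B} {q : P ⥤ Q} {b : Q ⥤ B}
    {α : p ⋙ u ⟶ q ⋙ b} (h : LeftExact α) {W : D.Val A} {V : D.Val B}
    {c : W ⟶ (D.res u).obj V} (hc : IsUniv u c) : IsUniv q (D.bcl α c) :=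
  (hD.isUniv_iff _).2 fun y => (h.univAt_iff y c).2 (hD.univAt hc _)

lemma isCouniv_bcr {p : P ⥤ A} {u : A ⥤ B} {q : P ⥤ Q} {b : Q ⥤ B}
    {α : p ⋙ u ⟶ q ⋙ b} (h : RightExact α) {W : D.Val Q} {V : D.Val B}
    {c : (D.res b).obj V ⟶ W} (hc : IsCouniv b c) : IsCouniv p (D.bcr α c) :=
  (hD.isCouniv_iff _).2 fun y => (h.counivAt_iff y c).2 (hD.counivAt hc _)

end IsDerivator'

/-! ### Products with a fixed category -/

/-- Allows Kan extensions with a parameter in `B` to be tested at each `b`. In the initial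
factorisation of `(f₁, f₂)` the morphism `h` carries `f₁` and the morphism `g` carries `f₂`. -/
lemma leftExact_prod_left (u : P ⥤ Q) (b : B) :
    LeftExact (p := Prod.sectR b P) (u := (𝟭 B).prod u) (q := u) (b := Prod.sectR b Q) (𝟙 _) := by
  rintro y ⟨b', a⟩ ⟨f₁, f₂⟩
  change b' ⟶ b at f₁
  change u.obj a ⟶ y at f₂
  refine ⟨a, f₂, (f₁, 𝟙 a), Prod.ext (show f₁ ≫ 𝟙 b ≫ 𝟙 b = f₁ by simp)
    (show u.map (𝟙 a) ≫ 𝟙 (u.obj a) ≫ f₂ = f₂ by simp), ?_⟩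
  rintro k' g' ⟨h₁, h₂⟩ h
  change b' ⟶ b at h₁
  change a ⟶ k' at h₂
  have h1 : h₁ ≫ 𝟙 b ≫ 𝟙 b = f₁ := congrArg Prod.fst h
  have h2 : u.map h₂ ≫ 𝟙 (u.obj k') ≫ g' = f₂ := congrArg Prod.snd h
  refine ⟨h₂, ⟨Prod.ext (show f₁ ≫ 𝟙 b = h₁ by simp [← h1]) (Category.id_comp h₂), by simpa using h2⟩,
    fun m hm => ?_⟩
  exact (Category.id_comp m).symm.trans (congrArg Prod.snd hm.1)

lemma rightExact_prod_left (u : P ⥤ Q) (b : B) :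
    RightExact (p := u) (u := Prod.sectR b Q) (q := Prod.sectR b P) (b := (𝟭 B).prod u) (𝟙 _) := by
  rintro y ⟨b', a⟩ ⟨f₁, f₂⟩
  change b ⟶ b' at f₁
  change y ⟶ u.obj a at f₂
  refine ⟨a, f₂, (f₁, 𝟙 a), Prod.ext (show 𝟙 b ≫ 𝟙 b ≫ f₁ = f₁ by simp)
    (show f₂ ≫ 𝟙 (u.obj a) ≫ u.map (𝟙 a) = f₂ by simp), ?_⟩
  rintro k' g' ⟨h₁, h₂⟩ h
  change b ⟶ b' at h₁
  change k' ⟶ a at h₂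
  have h1 : 𝟙 b ≫ 𝟙 b ≫ h₁ = f₁ := congrArg Prod.fst h
  have h2 : g' ≫ 𝟙 (u.obj k') ≫ u.map h₂ = f₂ := congrArg Prod.snd h
  refine ⟨h₂, ⟨by simpa using h2, Prod.ext (show 𝟙 b ≫ f₁ = h₁ by simp [← h1])
    (Category.comp_id h₂)⟩, fun m hm => ?_⟩
  exact (Category.comp_id m).symm.trans (congrArg Prod.snd hm.2)

/-- The inclusion `J ⥤ J × A` at the object `a` of `A`. -/
abbrev slice (J : Type w) [Category.{w} J] (a : A) : J ⥤ J × A :=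
  (𝟭 J).prod' ((Functor.const J).obj a)

lemma leftExact_prod_right (u : P ⥤ Q) (a : A) :
    LeftExact (p := slice P a) (u := u.prod (𝟭 A)) (q := u) (b := slice Q a) (𝟙 _) := by
  rintro y ⟨j, b⟩ ⟨f₁, f₂⟩
  change u.obj j ⟶ y at f₁
  change b ⟶ a at f₂
  refine ⟨j, f₁, (𝟙 j, f₂), Prod.ext (show u.map (𝟙 j) ≫ 𝟙 (u.obj j) ≫ f₁ = f₁ by simp)
    (show f₂ ≫ 𝟙 a ≫ 𝟙 a = f₂ by simp), ?_⟩
  rintro k' g' ⟨h₁, h₂⟩ h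
  change j ⟶ k' at h₁
  change b ⟶ a at h₂
  have h1 : u.map h₁ ≫ 𝟙 (u.obj k') ≫ g' = f₁ := congrArg Prod.fst h
  have h2 : h₂ ≫ 𝟙 a ≫ 𝟙 a = f₂ := congrArg Prod.snd h
  refine ⟨h₁, ⟨Prod.ext (Category.id_comp h₁) (show f₂ ≫ 𝟙 a = h₂ by simp [← h2]),
    by simpa using h1⟩, fun m hm => ?_⟩
  exact (Category.id_comp m).symm.trans (congrArg Prod.fst hm.1)

lemma rightExact_prod_right (u : P ⥤ Q) (a : A) :
    RightExact (p := u) (u := slice Q a) (q := slice P a) (b := u.prod (𝟭 A)) (𝟙 _) := by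
  rintro y ⟨j, b⟩ ⟨f₁, f₂⟩
  change y ⟶ u.obj j at f₁
  change a ⟶ b at f₂
  refine ⟨j, f₁, (𝟙 j, f₂), Prod.ext (show f₁ ≫ 𝟙 (u.obj j) ≫ u.map (𝟙 j) = f₁ by simp)
    (show 𝟙 a ≫ 𝟙 a ≫ f₂ = f₂ by simp), ?_⟩
  rintro k' g' ⟨h₁, h₂⟩ h
  change k' ⟶ j at h₁
  change a ⟶ b at h₂
  have h1 : g' ≫ 𝟙 (u.obj k') ≫ u.map h₁ = f₁ := congrArg Prod.fst h
  have h2 : 𝟙 a ≫ 𝟙 a ≫ h₂ = f₂ := congrArg Prod.snd h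
  refine ⟨h₁, ⟨by simpa using h1, Prod.ext (Category.comp_id h₁)
    (show 𝟙 a ≫ f₂ = h₂ by simp [← h2])⟩, fun m hm => ?_⟩
  exact (Category.comp_id m).symm.trans (congrArg Prod.fst hm.2)

end
end Prederivator

namespace Prederivator
variable {D : Prederivator.{w, v, u}}
section
variable {P A Q B P' Q' : Type w} [Category.{w} P] [Category.{w} A] [Category.{w} Q]
  [Category.{w} B] [Category.{w} P'] [Category.{w} Q']

/-! ### Objects which are Kan extensions of their restrictions -/

lemma _root_.CategoryTheory.Functor.bijective_map_iff {C C' : Type*} [Category* C] [Category* C']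
    {F G : C ⥤ C'} (e : F ≅ G) (X Y : C) :
    (Function.Bijective fun g : X ⟶ Y => F.map g) ↔ Function.Bijective fun g : X ⟶ Y => G.map g := by
  rw [← Function.Bijective.of_comp_iff' ((e.app X).homCongr (e.app Y)).bijective]
  refine iff_of_eq (congrArg _ (funext fun g => ?_))
  simp [Iso.homCongr]

/-- The object `X` is the left Kan extension of its restriction along `u`. -/
def IsLKE (u : A ⥤ B) (X : D.Val B) : Prop :=
  ∀ Z, Function.Bijective fun g : X ⟶ Z => (D.res u).map g

/-- The object `X` is the right Kan extension of its restriction along `u`. -/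
def IsRKE (u : A ⥤ B) (X : D.Val B) : Prop :=
  ∀ Z, Function.Bijective fun g : Z ⟶ X => (D.res u).map g

lemma isUniv_iff_isLKE {u : A ⥤ B} {W : D.Val A} {V : D.Val B} (c : W ⟶ (D.res u).obj V)
    [IsIso c] : IsUniv u c ↔ IsLKE u V := by
  have h := isUniv_iso_comp (q := u) c (𝟙 ((D.res u).obj V))
  rw [Category.comp_id] at h
  rw [h]
  refine forall_congr' fun Z => iff_of_eq (congrArg _ (funext fun g => Category.id_comp _))

lemma isCouniv_iff_isRKE {u : A ⥤ B} {W : D.Val A} {V : D.Val B} (c : (D.res u).obj V ⟶ W)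
    [IsIso c] : IsCouniv u c ↔ IsRKE u V := by
  have h := isCouniv_comp_iso (q := u) c (𝟙 ((D.res u).obj V))
  rw [← isCouniv_comp_iso (q := u) c (𝟙 ((D.res u).obj V)), Category.id_comp] at h
  rw [← Category.id_comp c, isCouniv_comp_iso]
  refine forall_congr' fun Z => iff_of_eq (congrArg _ (funext fun g => Category.comp_id _))

lemma IsLKE.of_iso {u : A ⥤ B} {X Y : D.Val B} (h : IsLKE u X) (e : X ≅ Y) : IsLKE u Y :=
  (isUniv_iff_isLKE _).1 ((isUniv_comp_map (𝟙 _) e.hom).2 ((isUniv_iff_isLKE (𝟙 _)).2 h))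

lemma IsRKE.of_iso {u : A ⥤ B} {X Y : D.Val B} (h : IsRKE u X) (e : X ≅ Y) : IsRKE u Y :=
  (isCouniv_iff_isRKE _).1 ((isCouniv_map_comp (𝟙 _) e.inv).2 ((isCouniv_iff_isRKE (𝟙 _)).2 h))

/-- Restriction along `u ⋙ f` is restriction along `f` followed by restriction along `u`, and the
second step is already bijective on morphisms out of `f^* X`. -/
lemma isLKE_comp_iff {u : A ⥤ B} {f : B ⥤ Q} {X : D.Val Q} (h : IsLKE u ((D.res f).obj X)) :
    IsLKE (u ⋙ f) X ↔ IsLKE f X := by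
  refine forall_congr' fun Z => ?_
  rw [Functor.bijective_map_iff (D.resComp u f)]
  exact Function.Bijective.of_comp_iff' (h ((D.res f).obj Z)) _

lemma isRKE_comp_iff {u : A ⥤ B} {f : B ⥤ Q} {X : D.Val Q} (h : IsRKE u ((D.res f).obj X)) :
    IsRKE (u ⋙ f) X ↔ IsRKE f X := by
  refine forall_congr' fun Z => ?_
  rw [Functor.bijective_map_iff (D.resComp u f)]
  exact Function.Bijective.of_comp_iff' (h ((D.res f).obj Z)) _

lemma isIso_of_isLKE {u : A ⥤ B} {X Y : D.Val B} (hX : IsLKE u X) (hY : IsLKE u Y) (f : X ⟶ Y)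
    [IsIso ((D.res u).map f)] : IsIso f := by
  obtain ⟨g, hg⟩ := (hY X).2 (inv ((D.res u).map f))
  refine ⟨g, (hX X).1 ?_, (hY Y).1 ?_⟩
  · dsimp only at hg ⊢
    rw [Functor.map_comp, hg, IsIso.hom_inv_id]
    exact ((D.res u).map_id X).symm
  · dsimp only at hg ⊢
    rw [Functor.map_comp, hg, IsIso.inv_hom_id]
    exact ((D.res u).map_id Y).symm

lemma isIso_of_isRKE {u : A ⥤ B} {X Y : D.Val B} (hX : IsRKE u X) (hY : IsRKE u Y) (f : X ⟶ Y)
    [IsIso ((D.res u).map f)] : IsIso f := by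
  obtain ⟨g, hg⟩ := (hX Y).2 (inv ((D.res u).map f))
  refine ⟨g, (hX X).1 ?_, (hY Y).1 ?_⟩
  · dsimp only at hg ⊢
    rw [Functor.map_comp, hg, IsIso.hom_inv_id]
    exact ((D.res u).map_id X).symm
  · dsimp only at hg ⊢
    rw [Functor.map_comp, hg, IsIso.inv_hom_id]
    exact ((D.res u).map_id Y).symm

/-- Since `(𝟭 A)^*` is only isomorphic to the identity functor, the universal morphism with which
`d` is compared is the structure isomorphism `resId`. -/
lemma isUniv_id_iff {W V : D.Val A} (d : W ⟶ (D.res (𝟭 A)).obj V) :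
    IsUniv (𝟭 A) d ↔ IsIso d := by
  have h0 : ∀ X : D.Val A, IsUniv (𝟭 A) ((D.resId A).inv.app X) := fun X Z => by
    rw [← Function.Bijective.of_comp_iff' ((((D.resId A).app Z)).homToEquiv (Z := X)).bijective]
    refine (congrArg Function.Bijective (funext fun g => ?_)).mp Function.bijective_id
    have e := (D.resId A).hom.naturality g
    dsimp at e
    simp [Iso.homToEquiv, e]
  constructor
  · intro h
    obtain ⟨e, he⟩ := (h0 W).exists_iso h
    rw [← he]
    infer_instance
  · intro h
    have e := isUniv_iso_comp (q := 𝟭 A) (d ≫ (D.resId A).hom.app V) ((D.resId A).inv.app V)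
    rw [Category.assoc, Iso.hom_inv_id_app] at e
    have e' : d ≫ 𝟙 ((D.res (𝟭 A)).obj V) = d := Category.comp_id d
    rw [e'] at e
    exact e.2 (h0 V)

lemma isCouniv_id_iff {W V : D.Val A} (d : (D.res (𝟭 A)).obj V ⟶ W) :
    IsCouniv (𝟭 A) d ↔ IsIso d := by
  have h0 : ∀ X : D.Val A, IsCouniv (𝟭 A) ((D.resId A).hom.app X) := fun X Z => by
    rw [← Function.Bijective.of_comp_iff'
      ((((D.resId A).app Z)).homFromEquiv (Z := X)).bijective]
    refine (congrArg Function.Bijective (funext fun g => ?_)).mp Function.bijective_id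
    simp [Iso.homFromEquiv]
  constructor
  · intro h
    obtain ⟨e, he⟩ := (h0 W).exists_iso h
    rw [← he]
    infer_instance
  · intro h
    have e := isCouniv_comp_iso (q := 𝟭 A) ((D.resId A).inv.app V ≫ d) ((D.resId A).hom.app V)
    rw [Iso.hom_inv_id_app_assoc] at e
    exact e.2 (h0 V)

/-! ### Pointwise conditions -/

/-- The value of `X` at `t` is given by the left Kan extension along `u`. -/
def LKEAt (u : A ⥤ B) (X : D.Val B) (t : B) : Prop := UnivAt u (𝟙 ((D.res u).obj X)) t

/-- The value of `X` at `t` is given by the right Kan extension along `u`. -/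
def RKEAt (u : A ⥤ B) (X : D.Val B) (t : B) : Prop := CounivAt u (𝟙 ((D.res u).obj X)) t

lemma univAt_iff_lkeAt {u : A ⥤ B} {W : D.Val A} {V : D.Val B} (c : W ⟶ (D.res u).obj V)
    [IsIso c] (t : B) : UnivAt u c t ↔ LKEAt u V t := by
  rw [LKEAt, UnivAt, UnivAt, ← isUniv_iso_comp ((D.res _).map c)]
  refine iff_of_eq (congrArg _ ?_)
  rw [bcl, bcl, ← Functor.map_comp_assoc, Category.comp_id]

lemma counivAt_iff_rkeAt {u : A ⥤ B} {W : D.Val A} {V : D.Val B} (c : (D.res u).obj V ⟶ W)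
    [IsIso c] (t : B) : CounivAt u c t ↔ RKEAt u V t := by
  rw [RKEAt, CounivAt, CounivAt, ← isCouniv_comp_iso ((D.res _).map c)]
  refine iff_of_eq (congrArg _ ?_)
  rw [bcr, bcr, Category.assoc, ← Functor.map_comp, Category.id_comp]

variable (D) in
lemma bc_isIso {p : P ⥤ A} {u : A ⥤ B} {q : P ⥤ Q} {b : Q ⥤ B} (α : p ⋙ u ⟶ q ⋙ b)
    (_ : IsIso α) (X : D.Val B) : IsIso (D.bc α X) := by
  unfold bc
  infer_instance

/-- For an invertible square the induced morphism is invertible, so the base change criterion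
becomes a property of the object `b^* X` alone. -/
lemma LeftExact.lkeAt_iff {p : P ⥤ A} {u : A ⥤ B} {q : P ⥤ Q} {b : Q ⥤ B}
    {α : p ⋙ u ⟶ q ⋙ b} (h : LeftExact α) (hα : IsIso α) (y : Q) (X : D.Val B) :
    LKEAt q ((D.res b).obj X) y ↔ LKEAt u X (b.obj y) := by
  have e : D.bcl α (𝟙 ((D.res u).obj X)) = D.bc α X :=
    (congrArg (· ≫ D.bc α X) ((D.res p).map_id _)).trans (Category.id_comp _)
  have := D.bc_isIso α hα X
  rw [LKEAt, LKEAt, ← h.univAt_iff, e]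
  exact (univAt_iff_lkeAt _ _).symm

lemma RightExact.rkeAt_iff {p : P ⥤ A} {u : A ⥤ B} {q : P ⥤ Q} {b : Q ⥤ B}
    {α : p ⋙ u ⟶ q ⋙ b} (h : RightExact α) (hα : IsIso α) (y : A) (X : D.Val B) :
    RKEAt p ((D.res u).obj X) y ↔ RKEAt b X (u.obj y) := by
  have e : D.bcr α (𝟙 ((D.res b).obj X)) = D.bc α X :=
    (congrArg (D.bc α X ≫ ·) ((D.res q).map_id _)).trans (Category.comp_id _)
  have := D.bc_isIso α hα X
  rw [RKEAt, RKEAt, ← h.counivAt_iff, e]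
  exact (counivAt_iff_rkeAt _ _).symm

/-- Full faithfulness of `u` is exactness of the square with two identities. Through this square,
Kan extensions along `u` restrict back to the given diagram (`isIso_of_isUniv`), and the condition
at objects in the image of `u` is void (`lkeAt_obj`). -/
lemma leftExact_of_full (u : A ⥤ B) [u.Full] [u.Faithful] :
    LeftExact (p := 𝟭 A) (u := u) (q := 𝟭 A) (b := u) (𝟙 _) := by
  intro y a f
  refine ⟨a, u.preimage f, 𝟙 a, by simp, fun k' g' h' h => ⟨h', ⟨by simp, ?_⟩, fun m hm => ?_⟩⟩
  · apply u.map_injective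
    simpa using h
  · simpa using hm.1

lemma rightExact_of_full (u : A ⥤ B) [u.Full] [u.Faithful] :
    RightExact (p := 𝟭 A) (u := u) (q := 𝟭 A) (b := u) (𝟙 _) := by
  intro y a f
  refine ⟨a, u.preimage f, 𝟙 a, by simp, fun k' g' h' h => ⟨h', ⟨?_, by simp⟩, fun m hm => ?_⟩⟩
  · apply u.map_injective
    simpa using h
  · simpa using hm.2

lemma leftExact_factor (u' : A ⥤ Q) (f : Q ⥤ B) [f.Full] [f.Faithful] :
    LeftExact (p := 𝟭 A) (u := u' ⋙ f) (q := u') (b := f) (𝟙 _) := by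
  intro y a g
  refine ⟨a, f.preimage g, 𝟙 a, by simp, fun k' g' h' h => ⟨h', ⟨by simp, ?_⟩, fun m hm => ?_⟩⟩
  · apply f.map_injective
    simpa using h
  · simpa using hm.1

lemma rightExact_factor (u' : A ⥤ Q) (f : Q ⥤ B) [f.Full] [f.Faithful] :
    RightExact (p := u') (u := f) (q := 𝟭 A) (b := u' ⋙ f) (𝟙 _) := by
  intro y a g
  refine ⟨a, f.preimage g, 𝟙 a, by simp, fun k' g' h' h => ⟨h', ⟨?_, by simp⟩, fun m hm => ?_⟩⟩
  · apply f.map_injective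
    simpa using h
  · simpa using hm.2

namespace IsDerivator'
variable (hD : D.IsDerivator')
include hD

lemma isLKE_iff {u : A ⥤ B} {X : D.Val B} : IsLKE u X ↔ ∀ t, LKEAt u X t :=
  (isUniv_iff_isLKE (𝟙 _)).symm.trans (hD.isUniv_iff _)

lemma isRKE_iff {u : A ⥤ B} {X : D.Val B} : IsRKE u X ↔ ∀ t, RKEAt u X t :=
  (isCouniv_iff_isRKE (𝟙 _)).symm.trans (hD.isCouniv_iff _)

lemma isLKE_res {p : P ⥤ A} {u : A ⥤ B} {q : P ⥤ Q} {b : Q ⥤ B}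
    {α : p ⋙ u ⟶ q ⋙ b} (h : LeftExact α) (hα : IsIso α) {X : D.Val B} (hX : IsLKE u X) :
    IsLKE q ((D.res b).obj X) :=
  hD.isLKE_iff.2 fun y => (h.lkeAt_iff hα y X).2 (hD.isLKE_iff.1 hX _)

lemma isRKE_res {p : P ⥤ A} {u : A ⥤ B} {q : P ⥤ Q} {b : Q ⥤ B}
    {α : p ⋙ u ⟶ q ⋙ b} (h : RightExact α) (hα : IsIso α) {X : D.Val B} (hX : IsRKE b X) :
    IsRKE p ((D.res u).obj X) :=
  hD.isRKE_iff.2 fun y => (h.rkeAt_iff hα y X).2 (hD.isRKE_iff.1 hX _)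

omit hD in
lemma isLKE_id (X : D.Val A) : IsLKE (𝟭 A) X :=
  (isUniv_iff_isLKE (𝟙 _)).1 ((isUniv_id_iff _).2 inferInstance)

omit hD in
lemma isRKE_id (X : D.Val A) : IsRKE (𝟭 A) X :=
  (isCouniv_iff_isRKE (𝟙 _)).1 ((isCouniv_id_iff _).2 inferInstance)

lemma lkeAt_obj (u : A ⥤ B) [u.Full] [u.Faithful] (X : D.Val B) (a : A) : LKEAt u X (u.obj a) :=
  ((leftExact_of_full u).lkeAt_iff (IsIso.id _) a X).1 (hD.isLKE_iff.1 (isLKE_id _) a)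

lemma rkeAt_obj (u : A ⥤ B) [u.Full] [u.Faithful] (X : D.Val B) (a : A) : RKEAt u X (u.obj a) :=
  ((rightExact_of_full u).rkeAt_iff (IsIso.id _) a X).1 (hD.isRKE_iff.1 (isRKE_id _) a)

/-- A full subcategory containing the image inherits the Kan extension. With `isLKE_of_comp`,
extensions can thus be broken at any intermediate full subcategory. -/
lemma isLKE_factor {u' : A ⥤ Q} {f : Q ⥤ B} [f.Full] [f.Faithful] {X : D.Val B}
    (h : IsLKE (u' ⋙ f) X) : IsLKE u' ((D.res f).obj X) :=
  hD.isLKE_res (leftExact_factor u' f) (IsIso.id _) h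

lemma isRKE_factor {u' : A ⥤ Q} {f : Q ⥤ B} [f.Full] [f.Faithful] {X : D.Val B}
    (h : IsRKE (u' ⋙ f) X) : IsRKE u' ((D.res f).obj X) :=
  hD.isRKE_res (rightExact_factor u' f) (IsIso.id _) h

lemma isLKE_of_comp {u' : A ⥤ Q} {f : Q ⥤ B} [f.Full] [f.Faithful] {X : D.Val B}
    (h : IsLKE (u' ⋙ f) X) : IsLKE f X :=
  (isLKE_comp_iff (hD.isLKE_factor h)).1 h

lemma isRKE_of_comp {u' : A ⥤ Q} {f : Q ⥤ B} [f.Full] [f.Faithful] {X : D.Val B}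
    (h : IsRKE (u' ⋙ f) X) : IsRKE f X :=
  (isRKE_comp_iff (hD.isRKE_factor h)).1 h

/-- Base change along the exact square of a fully faithful functor turns `c` into a left Kan
extension along an identity, which is an isomorphism by `isUniv_id_iff`. -/
lemma isIso_of_isUniv {u : A ⥤ B} [u.Full] [u.Faithful] {W : D.Val A} {V : D.Val B}
    {c : W ⟶ (D.res u).obj V} (hc : IsUniv u c) : IsIso c := by
  have h := (isUniv_id_iff _).1 (hD.isUniv_bcl (leftExact_of_full u) hc)
  have h0 := D.bc_isIso (p := 𝟭 A) (u := u) (q := 𝟭 A) (b := u) (𝟙 _) (IsIso.id _) V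
  have h' : IsIso ((D.res (𝟭 A)).map c) := @IsIso.of_isIso_comp_right _ _ _ _ _ _ _ h0 h
  exact (NatIso.isIso_map_iff (D.resId A) c).1 h'

lemma isIso_of_isCouniv {u : A ⥤ B} [u.Full] [u.Faithful] {W : D.Val A} {V : D.Val B}
    {c : (D.res u).obj V ⟶ W} (hc : IsCouniv u c) : IsIso c := by
  have h := (isCouniv_id_iff _).1 (hD.isCouniv_bcr (rightExact_of_full u) hc)
  have h0 := D.bc_isIso (p := 𝟭 A) (u := u) (q := 𝟭 A) (b := u) (𝟙 _) (IsIso.id _) V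
  have h' : IsIso ((D.res (𝟭 A)).map c) := @IsIso.of_isIso_comp_left _ _ _ _ _ _ _ h0 h
  exact (NatIso.isIso_map_iff (D.resId A) c).1 h'

lemma exists_isLKE (u : A ⥤ B) [u.Full] [u.Faithful] (W : D.Val A) :
    ∃ X : D.Val B, IsLKE u X ∧ Nonempty ((D.res u).obj X ≅ W) := by
  obtain ⟨V, c, hc⟩ := hD.exists_isUniv u W
  have := hD.isIso_of_isUniv hc
  exact ⟨V, (isUniv_iff_isLKE c).1 hc, ⟨(asIso c).symm⟩⟩

lemma exists_isRKE (u : A ⥤ B) [u.Full] [u.Faithful] (W : D.Val A) :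
    ∃ X : D.Val B, IsRKE u X ∧ Nonempty ((D.res u).obj X ≅ W) := by
  obtain ⟨V, c, hc⟩ := hD.exists_isCouniv u W
  have := hD.isIso_of_isCouniv hc
  exact ⟨V, (isCouniv_iff_isRKE c).1 hc, ⟨asIso c⟩⟩

lemma isLKE_prod_left {u : P ⥤ Q} {X : D.Val (B × Q)} :
    IsLKE ((𝟭 B).prod u) X ↔ ∀ b : B, IsLKE u ((D.res (Prod.sectR b Q)).obj X) :=
  ⟨fun h b => hD.isLKE_res (leftExact_prod_left u b) (IsIso.id _) h, fun h => hD.isLKE_iff.2 fun t =>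
    ((leftExact_prod_left u t.1).lkeAt_iff (IsIso.id _) t.2 X).1 (hD.isLKE_iff.1 (h t.1) t.2)⟩

lemma isRKE_prod_left {u : P ⥤ Q} {X : D.Val (B × Q)} :
    IsRKE ((𝟭 B).prod u) X ↔ ∀ b : B, IsRKE u ((D.res (Prod.sectR b Q)).obj X) :=
  ⟨fun h b => hD.isRKE_res (rightExact_prod_left u b) (IsIso.id _) h, fun h => hD.isRKE_iff.2 fun t =>
    ((rightExact_prod_left u t.1).rkeAt_iff (IsIso.id _) t.2 X).1 (hD.isRKE_iff.1 (h t.1) t.2)⟩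

lemma isLKE_prod_right {u : P ⥤ Q} {X : D.Val (Q × A)} :
    IsLKE (u.prod (𝟭 A)) X ↔ ∀ a : A, IsLKE u ((D.res (slice Q a)).obj X) :=
  ⟨fun h b => hD.isLKE_res (leftExact_prod_right u b) (IsIso.id _) h, fun h => hD.isLKE_iff.2 fun t =>
    ((leftExact_prod_right u t.2).lkeAt_iff (IsIso.id _) t.1 X).1 (hD.isLKE_iff.1 (h t.2) t.1)⟩

lemma isRKE_prod_right {u : P ⥤ Q} {X : D.Val (Q × A)} :
    IsRKE (u.prod (𝟭 A)) X ↔ ∀ a : A, IsRKE u ((D.res (slice Q a)).obj X) :=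
  ⟨fun h b => hD.isRKE_res (rightExact_prod_right u b) (IsIso.id _) h, fun h => hD.isRKE_iff.2 fun t =>
    ((rightExact_prod_right u t.2).rkeAt_iff (IsIso.id _) t.1 X).1 (hD.isRKE_iff.1 (h t.2) t.1)⟩

end IsDerivator'

/-! ### Cocartesian squares -/

instance _root_.Pos.hom_subsingleton {P : Type} [Preorder P] (x y : Pos.{w} P) :
    Subsingleton (x ⟶ y) := ⟨fun ⟨_⟩ ⟨_⟩ => congrArg ULift.up (Subsingleton.elim _ _)⟩

instance _root_.Pos.map_faithful {P Q : Type} [Preorder P] [Preorder Q] (f : P →o Q) :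
    (Pos.map.{w} f).Faithful := ⟨fun _ => Subsingleton.elim _ _⟩

lemma _root_.Pos.le_of_hom {P : Type} [Preorder P] {x y : Pos.{w} P} (f : x ⟶ y) :
    ULift.down x ≤ ULift.down y := f.down.le

/-- The morphism of `Pos P` given by an inequality. -/
def _root_.Pos.homOfLE {P : Type} [Preorder P] {x y : Pos.{w} P} (h : ULift.down x ≤ ULift.down y) : x ⟶ y :=
  ⟨CategoryTheory.homOfLE h⟩

lemma _root_.Pos.map_full {P Q : Type} [Preorder P] [Preorder Q] (f : P →o Q)
    (hf : ∀ x y, f x ≤ f y → x ≤ y) : (Pos.map.{w} f).Full :=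
  ⟨fun g => ⟨Pos.homOfLE (hf _ _ (Pos.le_of_hom g)), Subsingleton.elim _ _⟩⟩

instance _root_.Pos.map_subtype_full {P : Type} [Preorder P] (p : P → Prop) :
    (Pos.map.{w} (OrderHom.Subtype.val p)).Full := Pos.map_full _ fun _ _ h => h

instance _root_.Functor.prod_id_full (u : A ⥤ B) [u.Full] : (u.prod (𝟭 Q)).Full :=
  ⟨fun g => ⟨(u.preimage g.1, g.2), Prod.ext (u.map_preimage g.1) rfl⟩⟩

instance _root_.Functor.prod_id_faithful (u : A ⥤ B) [u.Faithful] : (u.prod (𝟭 Q)).Faithful :=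
  ⟨fun {_ _ f g} h => Prod.ext (u.map_injective (congrArg Prod.fst h))
    (by have := congrArg Prod.snd h; exact this)⟩

/-- The Kan extension functor along a full inclusion is fully faithful, so its essential image
consists of the objects that are extensions of their own restriction. -/
lemma IsDerivator'.isCocartesian_iff (hD : D.IsDerivator') (X : D.Val (Pos.{w} Sq)) :
    D.IsCocartesian X ↔ IsLKE (Pos.map Sq.inclUL) X := by
  constructor
  · rintro ⟨L, adj, W, ⟨e⟩⟩
    have h := isUniv_unit adj W
    have := hD.isIso_of_isUniv h
    exact ((isUniv_iff_isLKE _).1 h).of_iso e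
  · intro h
    have := isRightAdjoint_of_exists (D := D) (Pos.map Sq.inclUL) (hD.exists_isUniv _)
    refine ⟨_, Adjunction.ofIsRightAdjoint (D.res (Pos.map Sq.inclUL)),
      (D.res (Pos.map Sq.inclUL)).obj X, ?_⟩
    obtain ⟨e, -⟩ := (isUniv_unit (Adjunction.ofIsRightAdjoint (D.res (Pos.map Sq.inclUL)))
      ((D.res (Pos.map Sq.inclUL)).obj X)).exists_iso ((isUniv_iff_isLKE (𝟙 _)).2 h)
    exact ⟨e⟩

lemma IsDerivator'.isCartesian_iff (hD : D.IsDerivator') (X : D.Val (Pos.{w} Sq)) :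
    D.IsCartesian X ↔ IsRKE (Pos.map Sq.inclLR) X := by
  constructor
  · rintro ⟨L, adj, W, ⟨e⟩⟩
    have h := isCouniv_counit adj W
    have := hD.isIso_of_isCouniv h
    exact ((isCouniv_iff_isRKE _).1 h).of_iso e
  · intro h
    have := isLeftAdjoint_of_exists (D := D) (Pos.map Sq.inclLR) (hD.exists_isCouniv _)
    refine ⟨_, Adjunction.ofIsLeftAdjoint (D.res (Pos.map Sq.inclLR)),
      (D.res (Pos.map Sq.inclLR)).obj X, ?_⟩
    obtain ⟨e, -⟩ := (isCouniv_counit (Adjunction.ofIsLeftAdjoint (D.res (Pos.map Sq.inclLR)))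
      ((D.res (Pos.map Sq.inclLR)).obj X)).exists_iso ((isCouniv_iff_isRKE (𝟙 _)).2 h)
    exact ⟨e.symm⟩

end
end Prederivator

/-! ### Zero objects and Kan extensions between posets -/

namespace Prederivator
variable {D : Prederivator.{w, v, u}}
section
variable {P A Q B P' Q' : Type w} [Category.{w} P] [Category.{w} A] [Category.{w} Q]
  [Category.{w} B] [Category.{w} P'] [Category.{w} Q']

/-! ### Zero objects -/

lemma _root_.Function.bijective_iff_nonempty_unique {α β : Type*} (hβ : Nonempty (Unique β))
    (f : α → β) : Function.Bijective f ↔ Nonempty (Unique α) := by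
  obtain ⟨_⟩ := hβ
  exact ⟨fun h => ⟨(Equiv.ofBijective f h).unique⟩, fun ⟨_⟩ =>
    ⟨fun _ _ _ => Subsingleton.elim _ _, fun _ => ⟨default, Subsingleton.elim _ _⟩⟩⟩

/-- Between categories without objects any two functors are adjoint. -/
def adjOfIsEmpty [IsEmpty A] (l : A ⥤ B) (r : B ⥤ A) : l ⊣ r where
  unit := { app := fun a => isEmptyElim a, naturality := fun a => isEmptyElim a }
  counit := { app := fun b => isEmptyElim (r.obj b), naturality := fun b => isEmptyElim (r.obj b) }
  left_triangle_components a := (IsEmpty.false a).elim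
  right_triangle_components b := (IsEmpty.false (r.obj b)).elim

/-- (Der1) for the empty family makes the value at the empty sum equivalent to the terminal
category. An arbitrary empty `A` differs from that sum, whence the passage along the adjunction
between the two. -/
lemma IsDerivator.bijective_hom_of_isEmpty (hD : D.IsDerivator) [IsEmpty A] (M N : D.Val A) :
    Nonempty (Unique (M ⟶ N)) := by
  let F : PEmpty.{w + 1} → Type w := fun x => x.elim
  let _ : ∀ i, Category.{w} (F i) := fun i => i.elim
  have h := hD.der1 F
  let l : A ⥤ (Σ i, F i) :=
    { obj a := (IsEmpty.false a).elim
      map {a _} _ := (IsEmpty.false a).elim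
      map_id a := (IsEmpty.false a).elim
      map_comp {a _ _} _ _ := (IsEmpty.false a).elim }
  let r : (Σ i, F i) ⥤ A :=
    { obj a := a.1.elim
      map {a _} _ := a.1.elim
      map_id a := a.1.elim
      map_comp {a _ _} _ _ := a.1.elim }
  have hadj : IsIso (adjOfIsEmpty l r).unit := by
    have : ∀ a, IsIso ((adjOfIsEmpty l r).unit.app a) := fun a => isEmptyElim a
    exact NatIso.isIso_of_isIso_app _
  have h1 := res_map_bijective_of_isIso_unit (D := D) (adjOfIsEmpty l r) M N
  have h2 : Function.Bijective fun g : (D.res r).obj M ⟶ (D.res r).obj N =>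
      (Functor.pi' fun i => D.res (Sigma.incl (C := F) i)).map g :=
    ⟨fun _ _ e => Functor.map_injective _ e, fun g => Functor.map_surjective _ g⟩
  exact (Function.bijective_iff_nonempty_unique
    ⟨⟨fun i => i.elim⟩, fun _ => funext fun i => i.elim⟩ _).1 (h2.comp h1)

/-- A functor with adjoints on both sides preserves initial and terminal objects. -/
lemma isZero_res {u : A ⥤ B} (h1 : (D.res u).IsRightAdjoint) (h2 : (D.res u).IsLeftAdjoint)
    {X : D.Val B} (hX : IsZero X) : IsZero ((D.res u).obj X) where
  unique_to Y := by
    obtain ⟨h⟩ := hX.unique_to ((D.res u).rightAdjoint.obj Y)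
    exact ⟨((Adjunction.ofIsLeftAdjoint (D.res u)).homEquiv X Y).unique⟩
  unique_from Y := by
    obtain ⟨h⟩ := hX.unique_from ((D.res u).leftAdjoint.obj Y)
    exact ⟨((Adjunction.ofIsRightAdjoint (D.res u)).homEquiv Y X).symm.unique⟩

namespace IsDerivator
variable (hD : D.IsDerivator)
include hD

lemma isZero_res (u : A ⥤ B) {X : D.Val B} (hX : IsZero X) : IsZero ((D.res u).obj X) :=
  Prederivator.isZero_res (hD.der3_left u) (hD.der3_right u) hX

end IsDerivator

lemma IsStableDerivator.exists_isZero (hD : D.IsStableDerivator) (A : Type w) [Category.{w} A] :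
    ∃ X : D.Val A, IsZero X := by
  obtain ⟨Z, hZ⟩ := hD.pointed
  exact ⟨_, hD.isZero_res ((Functor.const A).obj ⟨⟨⟩⟩) hZ⟩

lemma IsZero.isIso' {C : Type*} [Category* C] {X Y : C} (hX : IsZero X) (hY : IsZero Y)
    (f : X ⟶ Y) : IsIso f :=
  ⟨hY.to_ X, hX.eq_of_src _ _, hY.eq_of_src _ _⟩

namespace IsStableDerivator
variable (hD : D.IsStableDerivator)
include hD

lemma isZero_iff {X : D.Val A} : IsZero X ↔ ∀ a, IsZero (D.ev X a) := by
  refine ⟨fun h a => hD.isZero_res _ h, fun h => ?_⟩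
  obtain ⟨Z, hZ⟩ := hD.exists_isZero A
  have : IsIso (hZ.from_ X) :=
    hD.der2 _ fun a => IsZero.isIso' (h a) (hD.isZero_res _ hZ) _
  exact hZ.of_iso (asIso (hZ.from_ X))

/-- In a category with a zero object every initial object is zero. -/
lemma isZero_of_unique_to {X : D.Val A} (h : ∀ Y, Nonempty (Unique (X ⟶ Y))) : IsZero X := by
  obtain ⟨Z, hZ⟩ := hD.exists_isZero A
  refine hZ.of_iso ⟨hZ.from_ X, hZ.to_ X, ?_, hZ.eq_of_src _ _⟩
  obtain ⟨h⟩ := h X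
  exact Subsingleton.elim _ _

lemma isZero_of_unique_from {X : D.Val A} (h : ∀ Y, Nonempty (Unique (Y ⟶ X))) : IsZero X := by
  obtain ⟨Z, hZ⟩ := hD.exists_isZero A
  refine hZ.of_iso ⟨hZ.from_ X, hZ.to_ X, ?_, hZ.eq_of_src _ _⟩
  obtain ⟨h⟩ := h X
  exact Subsingleton.elim _ _

/-- The comma category over `t` is empty, so the pointwise formula is an empty colimit and requires
`X_t` to be initial. Left Kan extension is therefore extension by zero at objects receiving no map
from the image. -/
lemma lkeAt_iff_isZero {u : A ⥤ B} {t : B} (ht : ∀ a, IsEmpty (u.obj a ⟶ t)) (X : D.Val B) :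
    LKEAt u X t ↔ IsZero (D.ev X t) := by
  have : IsEmpty (Comma u (Functor.fromPUnit.{w} t)) := ⟨fun x => (ht x.left).false x.hom⟩
  have h : LKEAt u X t ↔ ∀ Z, Nonempty (Unique (D.ev X t ⟶ Z)) := forall_congr' fun Z => by
    have hU := hD.bijective_hom_of_isEmpty ((D.res (Comma.fst u (Functor.fromPUnit.{w} t))).obj
      ((D.res u).obj X)) ((D.res (Comma.snd u (Functor.fromPUnit.{w} t))).obj Z)
    exact Function.bijective_iff_nonempty_unique hU _
  exact h.trans ⟨hD.isZero_of_unique_to, fun h => h.unique_to⟩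

lemma rkeAt_iff_isZero {u : A ⥤ B} {t : B} (ht : ∀ a, IsEmpty (t ⟶ u.obj a)) (X : D.Val B) :
    RKEAt u X t ↔ IsZero (D.ev X t) := by
  have : IsEmpty (Comma (Functor.fromPUnit.{w} t) u) := ⟨fun x => (ht x.right).false x.hom⟩
  have h : RKEAt u X t ↔ ∀ Z, Nonempty (Unique (Z ⟶ D.ev X t)) := forall_congr' fun Z => by
    have hU := hD.bijective_hom_of_isEmpty
      ((D.res (Comma.fst (Functor.fromPUnit.{w} t) u)).obj Z)
      ((D.res (Comma.snd (Functor.fromPUnit.{w} t) u)).obj ((D.res u).obj X))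
    exact Function.bijective_iff_nonempty_unique hU _
  exact h.trans ⟨hD.isZero_of_unique_from, fun h => h.unique_from⟩

end IsStableDerivator

/-! ### Kan extensions between posets -/

section
variable {P A Q B P' Q' : Type} [Preorder P] [Preorder A] [Preorder Q] [Preorder B]

/-- Between posets all equations and all uniqueness statements are automatic, and an initial
factorisation is a least `k`. -/
lemma leftExact_pos {p : P →o A} {u : A →o B} {q : P →o Q} {b : Q →o B}
    (α : Pos.map.{w} p ⋙ Pos.map u ⟶ Pos.map q ⋙ Pos.map b)
    (h : ∀ y a, u a ≤ b y → ∃ k, q k ≤ y ∧ a ≤ p k ∧ ∀ k', q k' ≤ y → a ≤ p k' → k ≤ k') :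
    LeftExact α := by
  intro y a f
  obtain ⟨k, h1, h2, h3⟩ := h (ULift.down y) (ULift.down a) (Pos.le_of_hom f)
  exact ⟨Pos.of k, Pos.homOfLE h1, Pos.homOfLE h2, Subsingleton.elim _ _,
    fun k' g' h' _ => ⟨Pos.homOfLE (h3 (ULift.down k') (Pos.le_of_hom g') (Pos.le_of_hom h')),
    ⟨Subsingleton.elim _ _, Subsingleton.elim _ _⟩, fun _ _ => Subsingleton.elim _ _⟩⟩

lemma rightExact_pos {p : P →o A} {u : A →o B} {q : P →o Q} {b : Q →o B}
    (α : Pos.map.{w} p ⋙ Pos.map u ⟶ Pos.map q ⋙ Pos.map b)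
    (h : ∀ a y, u a ≤ b y → ∃ k, a ≤ p k ∧ q k ≤ y ∧ ∀ k', a ≤ p k' → q k' ≤ y → k' ≤ k) :
    RightExact α := by
  intro a y f
  obtain ⟨k, h1, h2, h3⟩ := h (ULift.down a) (ULift.down y) (Pos.le_of_hom f)
  exact ⟨Pos.of k, Pos.homOfLE h1, Pos.homOfLE h2, Subsingleton.elim _ _,
    fun k' g' h' _ => ⟨Pos.homOfLE (h3 (ULift.down k') (Pos.le_of_hom g') (Pos.le_of_hom h')),
    ⟨Subsingleton.elim _ _, Subsingleton.elim _ _⟩, fun _ _ => Subsingleton.elim _ _⟩⟩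

/-- The isomorphism between functors given by two monotone maps. -/
def _root_.Pos.mapIso {f g : P →o A} (h : f = g) : Pos.map.{w} f ≅ Pos.map g :=
  NatIso.ofComponents (fun x => ⟨Pos.homOfLE (by subst h; exact le_rfl),
    Pos.homOfLE (by subst h; exact le_rfl), Subsingleton.elim _ _, Subsingleton.elim _ _⟩)
    fun _ => Subsingleton.elim _ _

/-- A commutative square of monotone maps. -/
def _root_.Pos.sqHom {p : P →o A} {u : A →o B} {q : P →o Q} {b : Q →o B}
    (h : u.comp p = b.comp q) : Pos.map.{w} p ⋙ Pos.map u ⟶ Pos.map q ⋙ Pos.map b :=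
  (Pos.mapIso h).hom

instance _root_.Pos.isIso_sqHom {p : P →o A} {u : A →o B} {q : P →o Q} {b : Q →o B}
    (h : u.comp p = b.comp q) : IsIso (Pos.sqHom.{w} h) :=
  inferInstanceAs (IsIso (Pos.mapIso h).hom)

end
end
end Prederivator

/-! ### Kan extensions on posets via cocartesian squares -/

namespace Prederivator
variable {D : Prederivator.{w, v, u}}

/-! ### Detection of Kan extensions by squares -/

lemma isIso_ev_map_iff {A B : Type w} [Category.{w} A] [Category.{w} B] (f : A ⥤ B) (a : A)
    {X Y : D.Val B} (g : X ⟶ Y) :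
    IsIso ((D.res (Functor.fromPUnit.{w} a)).map ((D.res f).map g)) ↔
      IsIso ((D.res (Functor.fromPUnit.{w} (f.obj a))).map g) := by
  have e : D.res (Functor.fromPUnit.{w} (f.obj a)) ≅ D.res f ⋙ D.res (Functor.fromPUnit.{w} a) :=
    asIso (D.resMap (fromPUnitComp a f).inv) ≪≫ D.resComp _ _
  exact (NatIso.isIso_map_iff e g).symm

/-- The value of `f^* X` at `a`. -/
noncomputable def evRes {A B : Type w} [Category.{w} A] [Category.{w} B] (f : A ⥤ B) (a : A) (X : D.Val B) :
    D.ev ((D.res f).obj X) a ≅ D.ev X (f.obj a) :=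
  ((asIso (D.resMap (fromPUnitComp a f).inv) ≪≫ D.resComp _ _).app X).symm

lemma _root_.Sq.cases (x : Sq) : x = (0, 0) ∨ x = (0, 1) ∨ x = (1, 0) ∨ x = (1, 1) := by
  revert x; decide

section
variable {B : Type} [Preorder B]

/-- For each `a` in `A` below some vertex, `h1` and `h2` provide a least vertex of the punctured
square above `a`. Thus the square formed by `k` and the two inclusions is exact, and the colimit
computing `X` at `k (1, 1)` from `A` is a pushout over the punctured square. -/
lemma IsDerivator'.isCocartesian_iff_lkeAt (hD : D.IsDerivator') {A : B → Prop} (k : Sq →o B)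
    (hA : ∀ x, x ≠ (1, 1) → A (k x))
    (h1 : ∀ a, A a → a ≤ k (1, 1) → a ≤ k (1, 0) ∨ a ≤ k (0, 1))
    (h2 : ∀ a, A a → a ≤ k (1, 0) → a ≤ k (0, 1) → a ≤ k (0, 0)) (X : D.Val (Pos.{w} B)) :
    D.IsCocartesian ((D.res (Pos.map k)).obj X) ↔
      LKEAt (Pos.map (OrderHom.Subtype.val A)) X (Pos.of (k (1, 1))) := by
  let p : {x : Sq // x ≠ (1, 1)} →o {b // A b} := ⟨fun x => ⟨k x.1, hA _ x.2⟩, fun x y h => k.2 h⟩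
  have h : LeftExact (Pos.sqHom.{w} (p := p) (u := OrderHom.Subtype.val A) (q := Sq.inclUL) (b := k)
      rfl) := leftExact_pos _ fun y a hya => by
    change a.1 ≤ k y at hya
    have c00 : (0, 0) ≠ ((1, 1) : Sq) := by decide
    have c10 : (1, 0) ≠ ((1, 1) : Sq) := by decide
    have c01 : (0, 1) ≠ ((1, 1) : Sq) := by decide
    -- The least vertex is `(0, 0)` if `a ≤ k (0, 0)`. Otherwise `h2` excludes that `a` lies below
    -- both arms, and the single arm above `a` is least.
    by_cases h00 : a.1 ≤ k (0, 0)
    · exact ⟨⟨(0, 0), c00⟩, ⟨bot_le, bot_le⟩, h00, fun k' _ _ => ⟨bot_le, bot_le⟩⟩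
    · have h3 : a.1 ≤ k (1, 0) ∨ a.1 ≤ k (0, 1) := by
        rcases Sq.cases y with rfl | rfl | rfl | rfl
        · exact absurd hya h00
        · exact .inr hya
        · exact .inl hya
        · exact h1 _ a.2 hya
      rcases h3 with h3 | h3
      · have h4 : ¬ a.1 ≤ k (0, 1) := fun h4 => h00 (h2 _ a.2 h3 h4)
        have key : ∀ x : Sq, a.1 ≤ k x → (1, 0) ≤ x := fun x hx => by
          rcases Sq.cases x with rfl | rfl | rfl | rfl
          · exact absurd hx h00
          · exact absurd hx h4
          · exact le_rfl
          · exact ⟨le_rfl, bot_le⟩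
        exact ⟨⟨(1, 0), c10⟩, key _ hya, h3, fun k' _ h => key _ h⟩
      · have h4 : ¬ a.1 ≤ k (1, 0) := fun h4 => h00 (h2 _ a.2 h4 h3)
        have key : ∀ x : Sq, a.1 ≤ k x → (0, 1) ≤ x := fun x hx => by
          rcases Sq.cases x with rfl | rfl | rfl | rfl
          · exact absurd hx h00
          · exact le_rfl
          · exact absurd hx h4
          · exact ⟨bot_le, le_rfl⟩
        exact ⟨⟨(0, 1), c01⟩, key _ hya, h3, fun k' _ h => key _ h⟩
  rw [hD.isCocartesian_iff, hD.isLKE_iff]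
  refine Iff.trans ⟨fun h => h (Pos.of (1, 1)), fun h t => ?_⟩
    (h.lkeAt_iff (Pos.isIso_sqHom _) (Pos.of (1, 1)) X)
  by_cases ht : ULift.down t = (1, 1)
  · obtain rfl : t = Pos.of (1, 1) := congrArg ULift.up ht
    exact h
  · exact hD.lkeAt_obj (Pos.map.{w} Sq.inclUL) _ (Pos.of ⟨ULift.down t, ht⟩)

lemma IsDerivator'.isCartesian_iff_rkeAt (hD : D.IsDerivator') {A : B → Prop} (k : Sq →o B)
    (hA : ∀ x, x ≠ (0, 0) → A (k x))
    (h1 : ∀ a, A a → k (0, 0) ≤ a → k (1, 0) ≤ a ∨ k (0, 1) ≤ a)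
    (h2 : ∀ a, A a → k (1, 0) ≤ a → k (0, 1) ≤ a → k (1, 1) ≤ a) (X : D.Val (Pos.{w} B)) :
    D.IsCartesian ((D.res (Pos.map k)).obj X) ↔
      RKEAt (Pos.map (OrderHom.Subtype.val A)) X (Pos.of (k (0, 0))) := by
  let p : {x : Sq // x ≠ (0, 0)} →o {b // A b} := ⟨fun x => ⟨k x.1, hA _ x.2⟩, fun x y h => k.2 h⟩
  have h : RightExact (Pos.sqHom.{w} (p := Sq.inclLR) (u := k) (q := p)
      (b := OrderHom.Subtype.val A) rfl) := rightExact_pos _ fun y a hya => by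
    change k y ≤ a.1 at hya
    have c00 : (1, 1) ≠ ((0, 0) : Sq) := by decide
    have c10 : (1, 0) ≠ ((0, 0) : Sq) := by decide
    have c01 : (0, 1) ≠ ((0, 0) : Sq) := by decide
    have le11 : ∀ x : Sq, x ≤ (1, 1) := by decide
    by_cases h00 : k (1, 1) ≤ a.1
    · exact ⟨⟨(1, 1), c00⟩, le11 _, h00, fun k' _ _ => le11 _⟩
    · have h3 : k (1, 0) ≤ a.1 ∨ k (0, 1) ≤ a.1 := by
        rcases Sq.cases y with rfl | rfl | rfl | rfl
        · exact h1 _ a.2 hya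
        · exact .inr hya
        · exact .inl hya
        · exact absurd hya h00
      rcases h3 with h3 | h3
      · have h4 : ¬ k (0, 1) ≤ a.1 := fun h4 => h00 (h2 _ a.2 h3 h4)
        have key : ∀ x : Sq, k x ≤ a.1 → x ≤ (1, 0) := fun x hx => by
          rcases Sq.cases x with rfl | rfl | rfl | rfl
          · exact ⟨bot_le, bot_le⟩
          · exact absurd hx h4
          · exact le_rfl
          · exact absurd hx h00
        exact ⟨⟨(1, 0), c10⟩, key _ hya, h3, fun k' _ h => key _ h⟩
      · have h4 : ¬ k (1, 0) ≤ a.1 := fun h4 => h00 (h2 _ a.2 h4 h3)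
        have key : ∀ x : Sq, k x ≤ a.1 → x ≤ (0, 1) := fun x hx => by
          rcases Sq.cases x with rfl | rfl | rfl | rfl
          · exact ⟨bot_le, bot_le⟩
          · exact le_rfl
          · exact absurd hx h4
          · exact absurd hx h00
        exact ⟨⟨(0, 1), c01⟩, key _ hya, h3, fun k' _ h => key _ h⟩
  rw [hD.isCartesian_iff, hD.isRKE_iff]
  refine Iff.trans ⟨fun h => h (Pos.of (0, 0)), fun h t => ?_⟩
    (h.rkeAt_iff (Pos.isIso_sqHom _) (Pos.of (0, 0)) X)
  by_cases ht : ULift.down t = (0, 0)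
  · obtain rfl : t = Pos.of (0, 0) := congrArg ULift.up ht
    exact h
  · exact hD.rkeAt_obj (Pos.map.{w} Sq.inclLR) _ (Pos.of ⟨ULift.down t, ht⟩)

variable {A : B → Prop}

/-- If `X` is a left Kan extension from `A`, then suitable squares are cocartesian. -/
lemma IsDerivator'.isCocartesian_of_isLKE (hD : D.IsDerivator') {X : D.Val (Pos.{w} B)}
    (hX : IsLKE (Pos.map (OrderHom.Subtype.val A)) X) (k : Sq →o B)
    (h1 : ∀ a, A a → a ≤ k (1, 1) → a ≤ k (1, 0) ∨ a ≤ k (0, 1))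
    (h2 : ∀ a, a ≤ k (1, 0) → a ≤ k (0, 1) → a ≤ k (0, 0)) :
    D.IsCocartesian ((D.res (Pos.map k)).obj X) := by
  -- `A` is enlarged to all objects satisfying `h1`. The larger set contains the punctured square
  -- even if `A` does not, and an extension from `A` is also one from the larger set.
  rw [hD.isCocartesian_iff_lkeAt (A := fun a => a ≤ k (1, 1) → a ≤ k (1, 0) ∨ a ≤ k (0, 1)) k ?_
    (fun _ h => h) fun a _ => h2 a]
  swap
  · intro x hx _
    rcases Sq.cases x with rfl | rfl | rfl | rfl
    · exact .inl (k.2 ⟨bot_le, le_rfl⟩)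
    · exact .inr le_rfl
    · exact .inl le_rfl
    · exact absurd rfl hx
  let i : {b // A b} →o {a // a ≤ k (1, 1) → a ≤ k (1, 0) ∨ a ≤ k (0, 1)} :=
    ⟨fun b => ⟨b.1, h1 _ b.2⟩, fun _ _ h => h⟩
  exact hD.isLKE_iff.1 (hD.isLKE_of_comp (u' := Pos.map.{w} i)
    (f := Pos.map (OrderHom.Subtype.val _)) hX) _

lemma IsDerivator'.isCartesian_of_isRKE (hD : D.IsDerivator') {X : D.Val (Pos.{w} B)}
    (hX : IsRKE (Pos.map (OrderHom.Subtype.val A)) X) (k : Sq →o B)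
    (h1 : ∀ a, A a → k (0, 0) ≤ a → k (1, 0) ≤ a ∨ k (0, 1) ≤ a)
    (h2 : ∀ a, k (1, 0) ≤ a → k (0, 1) ≤ a → k (1, 1) ≤ a) :
    D.IsCartesian ((D.res (Pos.map k)).obj X) := by
  rw [hD.isCartesian_iff_rkeAt (A := fun a => k (0, 0) ≤ a → k (1, 0) ≤ a ∨ k (0, 1) ≤ a) k ?_
    (fun _ h => h) fun a _ => h2 a]
  swap
  · intro x hx _
    rcases Sq.cases x with rfl | rfl | rfl | rfl
    · exact absurd rfl hx
    · exact .inr le_rfl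
    · exact .inl le_rfl
    · exact .inl (k.2 (by decide))
  let i : {b // A b} →o {a // k (0, 0) ≤ a → k (1, 0) ≤ a ∨ k (0, 1) ≤ a} :=
    ⟨fun b => ⟨b.1, h1 _ b.2⟩, fun _ _ h => h⟩
  exact hD.isRKE_iff.1 (hD.isRKE_of_comp (u' := Pos.map.{w} i)
    (f := Pos.map (OrderHom.Subtype.val _)) hX) _

/-- `X` is a left Kan extension from `A` if each object outside of `A` is the final vertex of a
suitable cocartesian square. -/
lemma IsDerivator'.isLKE_of_isCocartesian (hD : D.IsDerivator') (ρ : B → ℕ) {X : D.Val (Pos.{w} B)}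
    (h : ∀ t, ¬ A t → ∃ k : Sq →o B, k (1, 1) = t ∧ (∀ x, x ≠ (1, 1) → ρ (k x) < ρ t) ∧
      (∀ a, A a → a ≤ t → a ≤ k (1, 0) ∨ a ≤ k (0, 1)) ∧
      (∀ a, a ≤ k (1, 0) → a ≤ k (0, 1) → a ≤ k (0, 0)) ∧
      D.IsCocartesian ((D.res (Pos.map k)).obj X)) :
    IsLKE (Pos.map (OrderHom.Subtype.val A)) X := by
  obtain ⟨V, hV, ⟨φ⟩⟩ := hD.exists_isLKE (Pos.map.{w} (OrderHom.Subtype.val A)) ((D.res _).obj X)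
  obtain ⟨g, hg⟩ := (hV X).2 φ.hom
  -- `V` is the Kan extension of the restriction of `X`. The comparison `g` is invertible on `A`; at
  -- any other `t` the square ending there is cocartesian in both `V` and `X`, and `g` is invertible
  -- at its remaining vertices, which have smaller rank.
  suffices h : ∀ n t, ρ t = n → IsIso ((D.res (Functor.fromPUnit.{w} (Pos.of t))).map g) by
    have := hD.der2 g fun t => h _ _ rfl
    exact hV.of_iso (asIso g)
  intro n
  induction n using Nat.strong_induction_on with
  | _ n ih =>
    rintro t rfl
    by_cases ht : A t
    · have := isIso_ev_map_iff (Pos.map.{w} (OrderHom.Subtype.val A)) (Pos.of ⟨t, ht⟩) g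
      refine this.1 ?_
      dsimp only at hg
      rw [hg]
      infer_instance
    · obtain ⟨k, rfl, h1, h2, h3, h4⟩ := h t ht
      have h5 := hD.isCocartesian_of_isLKE hV k h2 h3
      rw [hD.isCocartesian_iff] at h4 h5
      have : IsIso ((D.res (Pos.map Sq.inclUL)).map ((D.res (Pos.map k)).map g)) :=
        hD.der2 _ fun x => (isIso_ev_map_iff _ _ _).2 ((isIso_ev_map_iff _ _ _).2
          (ih _ (h1 (ULift.down x).1 (ULift.down x).2) _ rfl))
      have := isIso_of_isLKE h5 h4 ((D.res (Pos.map k)).map g)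
      exact (isIso_ev_map_iff (Pos.map.{w} k) (Pos.of (1, 1)) g).1 inferInstance

lemma IsDerivator'.isRKE_of_isCartesian (hD : D.IsDerivator') (ρ : B → ℕ) {X : D.Val (Pos.{w} B)}
    (h : ∀ t, ¬ A t → ∃ k : Sq →o B, k (0, 0) = t ∧ (∀ x, x ≠ (0, 0) → ρ (k x) < ρ t) ∧
      (∀ a, A a → t ≤ a → k (1, 0) ≤ a ∨ k (0, 1) ≤ a) ∧
      (∀ a, k (1, 0) ≤ a → k (0, 1) ≤ a → k (1, 1) ≤ a) ∧
      D.IsCartesian ((D.res (Pos.map k)).obj X)) :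
    IsRKE (Pos.map (OrderHom.Subtype.val A)) X := by
  obtain ⟨V, hV, ⟨φ⟩⟩ := hD.exists_isRKE (Pos.map.{w} (OrderHom.Subtype.val A)) ((D.res _).obj X)
  obtain ⟨g, hg⟩ := (hV X).2 φ.inv
  suffices h : ∀ n t, ρ t = n → IsIso ((D.res (Functor.fromPUnit.{w} (Pos.of t))).map g) by
    have := hD.der2 g fun t => h _ _ rfl
    exact hV.of_iso (asIso g).symm
  intro n
  induction n using Nat.strong_induction_on with
  | _ n ih =>
    rintro t rfl
    by_cases ht : A t
    · have := isIso_ev_map_iff (Pos.map.{w} (OrderHom.Subtype.val A)) (Pos.of ⟨t, ht⟩) g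
      refine this.1 ?_
      dsimp only at hg
      rw [hg]
      infer_instance
    · obtain ⟨k, rfl, h1, h2, h3, h4⟩ := h t ht
      have h5 := hD.isCartesian_of_isRKE hV k h2 h3
      rw [hD.isCartesian_iff] at h4 h5
      have : IsIso ((D.res (Pos.map Sq.inclLR)).map ((D.res (Pos.map k)).map g)) :=
        hD.der2 _ fun x => (isIso_ev_map_iff _ _ _).2 ((isIso_ev_map_iff _ _ _).2
          (ih _ (h1 (ULift.down x).1 (ULift.down x).2) _ rfl))
      have := isIso_of_isRKE h4 h5 ((D.res (Pos.map k)).map g)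
      exact (isIso_ev_map_iff (Pos.map.{w} k) (Pos.of (0, 0)) g).1 inferInstance

end

/-! ### Extensions by zero -/

section
variable {A B : Type w} [Category.{w} A] [Category.{w} B]

lemma IsStableDerivator.isLKE_of_isZero (hD : D.IsStableDerivator) (u : A ⥤ B) [u.Full] [u.Faithful]
    {X : D.Val B} (h : ∀ t, (∃ a, u.obj a = t) ∨ (∀ a, IsEmpty (u.obj a ⟶ t)) ∧ IsZero (D.ev X t)) :
    IsLKE u X := by
  refine hD.toIsDerivator'.isLKE_iff.2 fun t => ?_
  obtain ⟨a, rfl⟩ | ⟨h1, h2⟩ := h t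
  · exact hD.toIsDerivator'.lkeAt_obj u X a
  · exact (hD.lkeAt_iff_isZero h1 X).2 h2

lemma IsStableDerivator.isRKE_of_isZero (hD : D.IsStableDerivator) (u : A ⥤ B) [u.Full] [u.Faithful]
    {X : D.Val B} (h : ∀ t, (∃ a, u.obj a = t) ∨ (∀ a, IsEmpty (t ⟶ u.obj a)) ∧ IsZero (D.ev X t)) :
    IsRKE u X := by
  refine hD.toIsDerivator'.isRKE_iff.2 fun t => ?_
  obtain ⟨a, rfl⟩ | ⟨h1, h2⟩ := h t
  · exact hD.toIsDerivator'.rkeAt_obj u X a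
  · exact (hD.rkeAt_iff_isZero h1 X).2 h2

lemma IsStableDerivator.isZero_of_isLKE (hD : D.IsStableDerivator) {u : A ⥤ B} {X : D.Val B}
    (h : IsLKE u X) {t : B} (ht : ∀ a, IsEmpty (u.obj a ⟶ t)) : IsZero (D.ev X t) :=
  (hD.lkeAt_iff_isZero ht X).1 (hD.toIsDerivator'.isLKE_iff.1 h t)

lemma IsStableDerivator.isZero_of_isRKE (hD : D.IsStableDerivator) {u : A ⥤ B} {X : D.Val B}
    (h : IsRKE u X) {t : B} (ht : ∀ a, IsEmpty (t ⟶ u.obj a)) : IsZero (D.ev X t) :=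
  (hD.rkeAt_iff_isZero ht X).1 (hD.toIsDerivator'.isRKE_iff.1 h t)

end
end Prederivator

/-! ### Stability under shifts and equivalences -/

namespace Prederivator
variable {D : Prederivator.{w, v, u}}
section
variable {P A Q B J : Type w} [Category.{w} P] [Category.{w} A] [Category.{w} Q]
  [Category.{w} B] [Category.{w} J]

/-! ### Shifted derivators -/

/-- The initial factorisation of `f : u a ⟶ t` is the object `(a, f)` of the comma category itself.
-/
lemma leftExact_comma (u : A ⥤ B) (t : B) :
    LeftExact (Comma.natTrans u (Functor.fromPUnit.{w} t)) := by
  intro y a f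
  refine ⟨{ left := a, right := y, hom := f }, 𝟙 _, 𝟙 _, ?_, fun k' g' h' h => ?_⟩
  · change u.map (𝟙 a) ≫ f ≫ 𝟙 t = f
    simp
  · refine ⟨{ left := h', right := ⟨⟨Subsingleton.elim _ _⟩⟩, w := ?_ },
      ⟨Category.id_comp _, Subsingleton.elim _ _⟩, fun m hm => CommaMorphism.ext ?_
        (Subsingleton.elim _ _)⟩
    · change u.map h' ≫ k'.hom = f ≫ 𝟙 t
      exact (congrArg (u.map h' ≫ ·) (Category.comp_id _).symm).trans
        (h.trans (Category.comp_id _).symm)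
    · exact (Category.id_comp _).symm.trans hm.1

lemma rightExact_comma (u : A ⥤ B) (t : B) :
    RightExact (Comma.natTrans (Functor.fromPUnit.{w} t) u) := by
  intro y a f
  refine ⟨{ left := y, right := a, hom := f }, 𝟙 _, 𝟙 _, ?_, fun k' g' h' h => ?_⟩
  · change 𝟙 t ≫ f ≫ u.map (𝟙 a) = f
    simp
  · refine ⟨{ left := ⟨⟨Subsingleton.elim _ _⟩⟩, right := h', w := ?_ },
      ⟨Subsingleton.elim _ _, Category.comp_id _⟩, fun m hm => CommaMorphism.ext
        (Subsingleton.elim _ _) ?_⟩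
    · change 𝟙 t ≫ f = k'.hom ≫ u.map h'
      exact (Category.id_comp _).trans (h.symm.trans (Category.id_comp _))
    · exact (Category.comp_id _).symm.trans hm.2

/-- The product of a square with a category. -/
def prodSq (J : Type w) [Category.{w} J] {p : P ⥤ A} {u : A ⥤ B} {q : P ⥤ Q} {b : Q ⥤ B}
    (α : p ⋙ u ⟶ q ⋙ b) :
    (𝟭 J).prod p ⋙ (𝟭 J).prod u ⟶ (𝟭 J).prod q ⋙ (𝟭 J).prod b :=
  NatTrans.prod (𝟙 (𝟭 J)) α

/-- Needed for (Der4) in a shift: the pointwise formula of `D^J` is indexed by `J` times a comma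
category of `u`, which is not a comma category of `𝟭 × u` but still gives an exact square. -/
lemma LeftExact.prod {p : P ⥤ A} {u : A ⥤ B} {q : P ⥤ Q} {b : Q ⥤ B}
    {α : p ⋙ u ⟶ q ⋙ b} (h : LeftExact α) : LeftExact (prodSq J α) := by
  rintro ⟨j, y⟩ ⟨j', a⟩ ⟨f₁, f₂⟩
  change j' ⟶ j at f₁
  obtain ⟨k, g, i, h1, h2⟩ := h y a f₂
  refine ⟨(j', k), (f₁, g), (𝟙 j', i), Prod.ext (show 𝟙 j' ≫ 𝟙 j' ≫ f₁ = f₁ by simp) h1, ?_⟩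
  rintro ⟨j'', k'⟩ ⟨g₁, g₂⟩ ⟨i₁, i₂⟩ e
  change j'' ⟶ j at g₁
  change j' ⟶ j'' at i₁
  have e1 : i₁ ≫ 𝟙 j'' ≫ g₁ = f₁ := congrArg Prod.fst e
  obtain ⟨m, ⟨m1, m2⟩, m3⟩ := h2 k' g₂ i₂ (congrArg Prod.snd e)
  refine ⟨(i₁, m), ⟨Prod.ext (Category.id_comp _) m1, Prod.ext (by simpa using e1) m2⟩, ?_⟩
  rintro ⟨n₁, n₂⟩ ⟨hn1, hn2⟩
  exact Prod.ext ((Category.id_comp _).symm.trans (congrArg Prod.fst hn1))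
    (m3 _ ⟨congrArg Prod.snd hn1, congrArg Prod.snd hn2⟩)

lemma RightExact.prod {p : P ⥤ A} {u : A ⥤ B} {q : P ⥤ Q} {b : Q ⥤ B}
    {α : p ⋙ u ⟶ q ⋙ b} (h : RightExact α) : RightExact (prodSq J α) := by
  rintro ⟨j', a⟩ ⟨j, y⟩ ⟨f₁, f₂⟩
  change j' ⟶ j at f₁
  obtain ⟨k, g, i, h1, h2⟩ := h a y f₂
  refine ⟨(j, k), (f₁, g), (𝟙 j, i), Prod.ext (show f₁ ≫ 𝟙 j ≫ 𝟙 j = f₁ by simp) h1, ?_⟩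
  rintro ⟨j'', k'⟩ ⟨g₁, g₂⟩ ⟨i₁, i₂⟩ e
  change j' ⟶ j'' at g₁
  change j'' ⟶ j at i₁
  have e1 : g₁ ≫ 𝟙 j'' ≫ i₁ = f₁ := congrArg Prod.fst e
  obtain ⟨m, ⟨m1, m2⟩, m3⟩ := h2 k' g₂ i₂ (congrArg Prod.snd e)
  refine ⟨(i₁, m), ⟨Prod.ext (by simpa using e1) m1, Prod.ext (Category.comp_id _) m2⟩, ?_⟩
  rintro ⟨n₁, n₂⟩ ⟨hn1, hn2⟩
  exact Prod.ext ((Category.comp_id _).symm.trans (congrArg Prod.fst hn2))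
    (m3 _ ⟨congrArg Prod.snd hn1, congrArg Prod.snd hn2⟩)

variable (D) in
-- The composition isomorphism of the shift contains a further factor coming from `prodOp`, which is
-- an identity.
lemma shift_resComp_hom (f : A ⥤ B) (g : B ⥤ Q) (X : D.Val (J × Q)) :
    ((D.shift J).resComp f g).hom.app X =
      (D.resComp ((𝟭 J).prod f) ((𝟭 J).prod g)).hom.app X := by
  have h : ((D.shift J).resComp f g).hom.app X =
    (D.resMap (𝟙 ((𝟭 J).prod f ⋙ (𝟭 J).prod g))).app X ≫
      (D.resComp ((𝟭 J).prod f) ((𝟭 J).prod g)).hom.app X := rfl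
  rw [h, resMap_id]
  exact Category.id_comp _

variable (D) in
lemma shift_resComp_inv (f : A ⥤ B) (g : B ⥤ Q) (X : D.Val (J × Q)) :
    ((D.shift J).resComp f g).inv.app X =
      (D.resComp ((𝟭 J).prod f) ((𝟭 J).prod g)).inv.app X := by
  have h : ((D.shift J).resComp f g).inv.app X =
      (D.resComp ((𝟭 J).prod f) ((𝟭 J).prod g)).inv.app X ≫
        (D.resMap (𝟙 ((𝟭 J).prod f ⋙ (𝟭 J).prod g))).app X := rfl
  rw [h, resMap_id]
  exact Category.comp_id _

variable (D) in
lemma shift_bc {p : P ⥤ A} {u : A ⥤ B} {q : P ⥤ Q} {b : Q ⥤ B}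
    (α : p ⋙ u ⟶ q ⋙ b) (X : D.Val (J × B)) :
    (D.shift J).bc α X = D.bc (prodSq J α) X := by
  have h1 := D.shift_resComp_inv (J := J) p u X
  have h2 := D.shift_resComp_hom (J := J) q b X
  unfold bc
  rw [h1, h2]
  rfl

variable (D) in
/-- The isomorphism `f^* ≅ g^*` given by an isomorphism `f ≅ g`. -/
def resIso {f g : A ⥤ B} (e : f ≅ g) : D.res f ≅ D.res g where
  hom := D.resMap e.hom
  inv := D.resMap e.inv
  hom_inv_id := by rw [← resMap_comp, e.hom_inv_id, resMap_id]
  inv_hom_id := by rw [← resMap_comp, e.inv_hom_id, resMap_id]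

variable (D) in
lemma res_isEquivalence (e : A ≌ B) : (D.res e.functor).IsEquivalence :=
  (CategoryTheory.Equivalence.mk (D.res e.functor) (D.res e.inverse)
    ((D.resId B).symm ≪≫ (asIso (D.resMap e.counitIso.inv)) ≪≫ D.resComp _ _)
    ((D.resComp _ _).symm ≪≫ (asIso (D.resMap e.unitIso.inv)) ≪≫ D.resId A)).isEquivalence_functor

lemma _root_.CategoryTheory.Functor.pi'_isEquivalence_of_iso {I : Type*} {C : Type*} [Category* C]
    {E : I → Type*} [∀ i, Category* (E i)] {F G : ∀ i, C ⥤ E i} (e : ∀ i, F i ≅ G i)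
    [(Functor.pi' F).IsEquivalence] : (Functor.pi' G).IsEquivalence :=
  Functor.isEquivalence_of_iso (NatIso.pi' fun i =>
    (show Functor.pi' F ⋙ Pi.eval E i ≅ Functor.pi' G ⋙ Pi.eval E i from e i))

/-- The equivalence between a sum of products and a product with a sum. -/
def sigmaProd {I : Type w} (J : Type w) [Category.{w} J] (F : I → Type w)
    [∀ i, Category.{w} (F i)] : (Σ i, J × F i) ⥤ J × (Σ i, F i) :=
  Sigma.desc fun i => (𝟭 J).prod (Sigma.incl i)

instance {I : Type w} (J : Type w) [Category.{w} J] (F : I → Type w)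
    [∀ i, Category.{w} (F i)] : (sigmaProd J F).IsEquivalence where
  faithful := ⟨by
    rintro ⟨i, j, x⟩ ⟨i', j', x'⟩ ⟨f⟩ ⟨g⟩ h
    have h1 : f.1 = g.1 := by have := congrArg Prod.fst h; exact this
    have h2 : Sigma.SigmaHom.mk f.2 = Sigma.SigmaHom.mk g.2 := by
      have := congrArg Prod.snd h; exact this
    have h3 : f.2 = g.2 := by injection h2
    exact congrArg _ (Prod.ext h1 h3)⟩
  full := ⟨by
    rintro ⟨i, j, x⟩ ⟨i', j', x'⟩ ⟨f₁, f₂⟩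
    change Sigma.SigmaHom ⟨i, x⟩ ⟨i', x'⟩ at f₂
    obtain ⟨f₂⟩ := f₂
    exact ⟨.mk (f₁, f₂), rfl⟩⟩
  essSurj := ⟨fun ⟨j, i, x⟩ => ⟨⟨i, j, x⟩, ⟨Iso.refl _⟩⟩⟩

lemma IsDerivator'.shift (hD : D.IsDerivator') (J : Type w) [Category.{w} J] :
    (D.shift J).IsDerivator' where
  der2 {A _ X Y} f h := hD.der2 (A := J × A) f fun ⟨j, a⟩ =>
    (isIso_ev_map_iff (D := D) ((𝟭 J).prod (Functor.fromPUnit.{w} a)) (j, ⟨⟨⟩⟩) f).1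
      (have : IsIso ((D.res ((𝟭 J).prod (Functor.fromPUnit.{w} a))).map f) := h a
       Functor.map_isIso (D.res (Functor.fromPUnit.{w} (j, (⟨⟨⟩⟩ : Pt.{w})))) _)
  exists_isUniv u W := hD.exists_isUniv ((𝟭 J).prod u) W
  exists_isCouniv u W := hD.exists_isCouniv ((𝟭 J).prod u) W
  univAt {A B _ _ u W V c} hc t := by
    have h := hD.isUniv_bcl (leftExact_comma u t).prod (u := (𝟭 J).prod u) hc
    exact (congrArg (fun t => IsUniv (D := D.shift J) _ (((D.shift J).res _).map c ≫ t))
      (D.shift_bc (J := J) (Comma.natTrans u (Functor.fromPUnit.{w} t)) V)).mpr h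
  counivAt {A B _ _ u W V c} hc t := by
    have h := hD.isCouniv_bcr (rightExact_comma u t).prod (b := (𝟭 J).prod u) hc
    exact (congrArg (fun t => IsCouniv (D := D.shift J) _ (t ≫ ((D.shift J).res _).map c))
      (D.shift_bc (J := J) (Comma.natTrans (Functor.fromPUnit.{w} t) u) V)).mpr h

/-- Kan extensions and their pointwise formulas are those of `D` with a parameter in `J`. For
(Der1), the product with `J` distributes over sums of categories. -/
lemma IsDerivator.shift (hD : D.IsDerivator) (J : Type w) [Category.{w} J] :
    (D.shift J).IsDerivator :=
  (hD.toIsDerivator'.shift J).isDerivator fun {I} F _ => by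
    have h1 := hD.der1 (fun i => J × F i)
    have h2 := D.res_isEquivalence (sigmaProd J F).asEquivalence
    have h3 : (D.res (sigmaProd J F) ⋙ Functor.pi'
      fun i => D.res (Sigma.incl (C := fun i => J × F i) i)).IsEquivalence :=
        inferInstanceAs ((D.res (sigmaProd J F).asEquivalence.functor ⋙ _).IsEquivalence)
    exact @Functor.pi'_isEquivalence_of_iso _ _ _ _ _
      (fun i => D.res (sigmaProd J F) ⋙ D.res (Sigma.incl (C := fun i => J × F i) i)) _
      (fun i => (D.resComp _ _).symm ≪≫ D.resIso (Sigma.inclDesc _ i)) h3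

lemma IsStableDerivator.isLKE_iff_isRKE (hD : D.IsStableDerivator) (X : D.Val (Pos.{w} Sq)) :
    IsLKE (Pos.map Sq.inclUL) X ↔ IsRKE (Pos.map Sq.inclLR) X := by
  rw [← hD.toIsDerivator'.isCocartesian_iff, ← hD.toIsDerivator'.isCartesian_iff, hD.stable]

/-- Cocartesian and cartesian squares of the shift are detected at each object of `J`, where they
agree by stability of `D`. -/
lemma IsStableDerivator.shift (hD : D.IsStableDerivator) (J : Type w) [Category.{w} J] :
    (D.shift J).IsStableDerivator where
  toIsDerivator := hD.toIsDerivator.shift J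
  pointed := (hD.exists_isZero (J × Pt.{w})).elim fun X h => ⟨⟨X, h⟩⟩
  stable X := by
    have h := hD.toIsDerivator'.shift J
    rw [h.isCocartesian_iff, h.isCartesian_iff]
    have h1 := hD.toIsDerivator'.isLKE_prod_left (B := J) (u := Pos.map.{w} Sq.inclUL) (X := X)
    have h2 := hD.toIsDerivator'.isRKE_prod_left (B := J) (u := Pos.map.{w} Sq.inclLR) (X := X)
    simp only [hD.isLKE_iff_isRKE] at h1
    exact h1.trans h2.symm

/-! ### Transport along morphisms -/

variable {E : Prederivator.{w, v, u}} (τ : D ⟶ E)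

/-- The functor `D(A) ⥤ E(A)` given by a morphism of prederivators. -/
abbrev valMap (A : Type w) [Category.{w} A] : D.Val A ⥤ E.Val A :=
  (τ.app (op (Cat.of A))).toFunctor

lemma resNatIso_naturality (f : A ⥤ B) {X Y : D.Val B} (g : X ⟶ Y) :
    (valMap τ A).map ((D.res f).map g) ≫ (resNatIso τ f Y).hom =
      (resNatIso τ f X).hom ≫ (E.res f).map ((valMap τ B).map g) :=
  (Cat.Hom.toNatIso (τ.naturality f.toCatHom.op)).hom.naturality g

lemma resNatIso_resMap {f g : A ⥤ B} (α : f ⟶ g) (X : D.Val B) :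
    (valMap τ A).map ((D.resMap α).app X) ≫ (resNatIso τ g X).hom =
      (resNatIso τ f X).hom ≫ (E.resMap α).app ((valMap τ B).obj X) :=
  congrArg (fun t => t.toNatTrans.app X) (τ.naturality_naturality (op2 α.toCatHom₂))

lemma resNatIso_resComp (f : A ⥤ B) (g : B ⥤ Q) (X : D.Val Q) :
    (valMap τ A).map ((D.resComp f g).hom.app X) ≫ (resNatIso τ f ((D.res g).obj X)).hom ≫
        (E.res f).map (resNatIso τ g X).hom =
      (resNatIso τ (f ⋙ g) X).hom ≫ (E.resComp f g).hom.app ((valMap τ Q).obj X) := by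
  have h : (resNatIso τ (f ⋙ g) X).hom ≫ (E.resComp f g).hom.app ((valMap τ Q).obj X) =
      (valMap τ A).map ((D.resComp f g).hom.app X) ≫ 𝟙 _ ≫
        (resNatIso τ f ((D.res g).obj X)).hom ≫ 𝟙 _ ≫
        (E.res f).map (resNatIso τ g X).hom ≫ 𝟙 _ :=
    congrArg (fun t => t.toNatTrans.app X) (τ.naturality_comp g.toCatHom.op f.toCatHom.op)
  rw [h]
  simp

/-- Pseudonaturality of `τ` for the composition isomorphisms and for 2-cells together gives
naturality for the morphism induced by a square. -/
lemma resNatIso_bc {p : P ⥤ A} {u : A ⥤ B} {q : P ⥤ Q} {b : Q ⥤ B}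
    (α : p ⋙ u ⟶ q ⋙ b) (X : D.Val B) :
    (valMap τ P).map (D.bc α X) ≫ (resNatIso τ q ((D.res b).obj X)).hom ≫
        (E.res q).map (resNatIso τ b X).hom =
      (resNatIso τ p ((D.res u).obj X)).hom ≫ (E.res p).map (resNatIso τ u X).hom ≫
        E.bc α ((valMap τ B).obj X) := by
  have h1 := resNatIso_resComp τ p u X
  have h2 := resNatIso_resMap τ α X
  have h3 := resNatIso_resComp τ q b X
  rw [← cancel_epi ((valMap τ P).map ((D.resComp p u).hom.app X)), reassoc_of% h1]
  simp only [bc, Functor.map_comp, Category.assoc, Iso.hom_inv_id_app_assoc]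
  rw [h3, reassoc_of% h2, ← Functor.map_comp_assoc, Iso.hom_inv_id_app]
  exact (congrArg (· ≫ _) ((valMap τ P).map_id _)).trans (Category.id_comp _)

/-- The image of `c : W ⟶ q^* V`. -/
def mapUniv {q : P ⥤ Q} {W : D.Val P} {V : D.Val Q} (c : W ⟶ (D.res q).obj V) :
    (valMap τ P).obj W ⟶ (E.res q).obj ((valMap τ Q).obj V) :=
  (valMap τ P).map c ≫ (resNatIso τ q V).hom

/-- The image of `c : q^* V ⟶ W`. -/
def mapCouniv {q : P ⥤ Q} {W : D.Val P} {V : D.Val Q} (c : (D.res q).obj V ⟶ W) :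
    (E.res q).obj ((valMap τ Q).obj V) ⟶ (valMap τ P).obj W :=
  (resNatIso τ q V).inv ≫ (valMap τ P).map c

lemma mapUniv_bcl {p : P ⥤ A} {u : A ⥤ B} {q : P ⥤ Q} {b : Q ⥤ B}
    (α : p ⋙ u ⟶ q ⋙ b) {W : D.Val A} {V : D.Val B} (c : W ⟶ (D.res u).obj V) :
    mapUniv τ (D.bcl α c) ≫ (E.res q).map (resNatIso τ b V).hom =
      (resNatIso τ p W).hom ≫ E.bcl α (mapUniv τ c) := by
  have h := resNatIso_bc τ α V
  simp only [mapUniv, bcl, Functor.map_comp, Category.assoc]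
  rw [h, reassoc_of% resNatIso_naturality]

lemma mapCouniv_bcr {p : P ⥤ A} {u : A ⥤ B} {q : P ⥤ Q} {b : Q ⥤ B}
    (α : p ⋙ u ⟶ q ⋙ b) {W : D.Val Q} {V : D.Val B} (c : (D.res b).obj V ⟶ W) :
    (E.res p).map (resNatIso τ u V).hom ≫ E.bcr α (mapCouniv τ c) =
      mapCouniv τ (D.bcr α c) ≫ (resNatIso τ q W).hom := by
  have h := resNatIso_bc τ α V
  simp only [mapCouniv, bcr, Functor.map_comp, Category.assoc]
  rw [← cancel_epi (resNatIso τ p ((D.res u).obj V)).hom, Iso.hom_inv_id_assoc,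
    ← reassoc_of% h, ← Functor.map_comp_assoc, Iso.hom_inv_id, resNatIso_naturality]
  exact congrArg _ (congrArg _ ((congrArg (· ≫ _) ((E.res q).map_id _)).trans
    (Category.id_comp _)))

section
variable [∀ A : Cat.{w, w}ᵒᵖ, (τ.app A).toFunctor.IsEquivalence]

/-- Bijectivity is first compared on targets in the image of `τ`, by full faithfulness; essential
surjectivity covers the remaining targets. -/
lemma isUniv_mapUniv_iff {q : P ⥤ Q} {W : D.Val P} {V : D.Val Q} (c : W ⟶ (D.res q).obj V) :
    IsUniv q (mapUniv τ c) ↔ IsUniv q c := by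
  have key (Z : D.Val Q) : (Function.Bijective fun g : V ⟶ Z => c ≫ (D.res q).map g) ↔
      Function.Bijective fun g : (valMap τ Q).obj V ⟶ (valMap τ Q).obj Z =>
        mapUniv τ c ≫ (E.res q).map g := by
    rw [← Function.Bijective.of_comp_iff _
      (Functor.FullyFaithful.ofFullyFaithful (valMap τ Q)).homEquiv.bijective,
      ← Function.Bijective.of_comp_iff'
      (Functor.FullyFaithful.ofFullyFaithful (valMap τ P)).homEquiv.bijective,
      ← Function.Bijective.of_comp_iff' ((resNatIso τ q Z).homToEquiv).bijective]
    refine iff_of_eq (congrArg _ (funext fun g => ?_))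
    simp [Iso.homToEquiv, mapUniv, Functor.FullyFaithful.homEquiv, resNatIso_naturality]
  refine ⟨fun h Z => (key Z).2 (h _), fun h Z => ?_⟩
  have h1 := (key ((valMap τ Q).objPreimage Z)).1 (h _)
  rw [← Function.Bijective.of_comp_iff' ((E.res q).mapIso
    ((valMap τ Q).objObjPreimageIso Z)).symm.homToEquiv.bijective,
    ← Function.Bijective.of_comp_iff _
    (((valMap τ Q).objObjPreimageIso Z).homToEquiv).bijective]
  refine (congrArg Function.Bijective (funext fun g => ?_)).mp h1
  simp [Iso.homToEquiv]

lemma isCouniv_mapCouniv_iff {q : P ⥤ Q} {W : D.Val P} {V : D.Val Q} (c : (D.res q).obj V ⟶ W) :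
    IsCouniv q (mapCouniv τ c) ↔ IsCouniv q c := by
  have key (Z : D.Val Q) : (Function.Bijective fun g : Z ⟶ V => (D.res q).map g ≫ c) ↔
      Function.Bijective fun g : (valMap τ Q).obj Z ⟶ (valMap τ Q).obj V =>
        (E.res q).map g ≫ mapCouniv τ c := by
    rw [← Function.Bijective.of_comp_iff _
      (Functor.FullyFaithful.ofFullyFaithful (valMap τ Q)).homEquiv.bijective,
      ← Function.Bijective.of_comp_iff'
      (Functor.FullyFaithful.ofFullyFaithful (valMap τ P)).homEquiv.bijective,
      ← Function.Bijective.of_comp_iff' ((resNatIso τ q Z).homFromEquiv).bijective]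
    refine iff_of_eq (congrArg _ (funext fun g => ?_))
    rw [Function.comp_apply, Function.comp_apply, Function.comp_apply]
    simp only [Iso.homFromEquiv, mapCouniv, Functor.FullyFaithful.homEquiv, Equiv.coe_fn_mk,
      Functor.map_comp]
    rw [← cancel_epi (resNatIso τ q Z).hom, ← reassoc_of% resNatIso_naturality]
    simp
  refine ⟨fun h Z => (key Z).2 (h _), fun h Z => ?_⟩
  have h1 := (key ((valMap τ Q).objPreimage Z)).1 (h _)
  rw [← Function.Bijective.of_comp_iff' ((E.res q).mapIso
    ((valMap τ Q).objObjPreimageIso Z)).symm.homFromEquiv.bijective,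
    ← Function.Bijective.of_comp_iff _
    (((valMap τ Q).objObjPreimageIso Z).homFromEquiv).bijective]
  refine (congrArg Function.Bijective (funext fun g => ?_)).mp h1
  simp [Iso.homFromEquiv]

lemma isLKE_valMap_iff {q : P ⥤ Q} (V : D.Val Q) : IsLKE q ((valMap τ Q).obj V) ↔ IsLKE q V := by
  rw [← isUniv_iff_isLKE (𝟙 ((D.res q).obj V)), ← isUniv_mapUniv_iff τ]
  have : IsIso (mapUniv τ (𝟙 ((D.res q).obj V))) := by unfold mapUniv; infer_instance
  rw [isUniv_iff_isLKE]

lemma isRKE_valMap_iff {q : P ⥤ Q} (V : D.Val Q) : IsRKE q ((valMap τ Q).obj V) ↔ IsRKE q V := by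
  rw [← isCouniv_iff_isRKE (𝟙 ((D.res q).obj V)), ← isCouniv_mapCouniv_iff τ]
  have : IsIso (mapCouniv τ (𝟙 ((D.res q).obj V))) := by unfold mapCouniv; infer_instance
  rw [isCouniv_iff_isRKE]

lemma isIso_res_map_valMap_iff (q : P ⥤ Q) {X Y : D.Val Q} (f : X ⟶ Y) :
    IsIso ((E.res q).map ((valMap τ Q).map f)) ↔ IsIso ((D.res q).map f) := by
  rw [← isIso_iff_of_reflects_iso _ (valMap τ P)]
  exact (NatIso.isIso_map_iff (Cat.Hom.toNatIso (τ.naturality q.toCatHom.op)) f).symm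

lemma IsDerivator'.of_equivalence (τ : D ⟶ E) [∀ A : Cat.{w, w}ᵒᵖ, (τ.app A).toFunctor.IsEquivalence]
    (hE : E.IsDerivator') : D.IsDerivator' where
  der2 {A _ X Y} f h := by
    rw [← isIso_iff_of_reflects_iso _ (valMap τ A)]
    exact hE.der2 _ fun a => (isIso_res_map_valMap_iff τ _ f).2 (h a)
  exists_isUniv {A B _ _} u W := by
    obtain ⟨V, c, hc⟩ := hE.exists_isUniv u ((valMap τ A).obj W)
    let e := (valMap τ B).objObjPreimageIso V
    refine ⟨(valMap τ B).objPreimage V, (valMap τ A).preimage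
      (c ≫ (E.res u).map e.inv ≫ (resNatIso τ u _).inv), (isUniv_mapUniv_iff τ _).1 ?_⟩
    rw [mapUniv, Functor.map_preimage]
    simp only [Category.assoc, Iso.inv_hom_id]
    rw [Category.comp_id]
    exact (isUniv_comp_map _ _).2 hc
  exists_isCouniv {A B _ _} u W := by
    obtain ⟨V, c, hc⟩ := hE.exists_isCouniv u ((valMap τ A).obj W)
    let e := (valMap τ B).objObjPreimageIso V
    refine ⟨(valMap τ B).objPreimage V, (valMap τ A).preimage
      ((resNatIso τ u _).hom ≫ (E.res u).map e.hom ≫ c), (isCouniv_mapCouniv_iff τ _).1 ?_⟩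
    rw [mapCouniv, Functor.map_preimage, Iso.inv_hom_id_assoc]
    exact (isCouniv_map_comp _ _).2 hc
  univAt {A B _ _ u W V c} hc t := by
    have h := hE.univAt ((isUniv_mapUniv_iff τ c).2 hc) t
    rw [UnivAt, ← isUniv_iso_comp (resNatIso τ _ W).hom, ← mapUniv_bcl, isUniv_comp_map,
      isUniv_mapUniv_iff] at h
    exact h
  counivAt {A B _ _ u W V c} hc t := by
    have h := hE.counivAt ((isCouniv_mapCouniv_iff τ c).2 hc) t
    rw [CounivAt, ← isCouniv_map_comp _ (resNatIso τ _ V).hom, mapCouniv_bcr, isCouniv_comp_iso,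
      isCouniv_mapCouniv_iff] at h
    exact h

/-- Kan extensions, their pointwise formulas and isomorphisms are all reflected by levelwise
equivalences. For (Der1), the comparison functor of `D` followed by a product of equivalences is
isomorphic to an equivalence followed by the comparison functor of `E`. -/
lemma IsDerivator.of_equivalence (τ : D ⟶ E) [∀ A : Cat.{w, w}ᵒᵖ, (τ.app A).toFunctor.IsEquivalence]
    (hE : E.IsDerivator) : D.IsDerivator :=
  (IsDerivator'.of_equivalence τ hE.toIsDerivator').isDerivator fun {I} F _ => by
    have h1 := hE.der1 F
    have h2 : (Functor.pi' fun i => D.res (Sigma.incl (C := F) i) ⋙ valMap τ (F i)).IsEquivalence :=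
      @Functor.pi'_isEquivalence_of_iso _ _ _ _ _
        (fun i => valMap τ (Σ i, F i) ⋙ E.res (Sigma.incl (C := F) i)) _
        (fun i => (Cat.Hom.toNatIso (τ.naturality (Sigma.incl (C := F) i).toCatHom.op)).symm)
        (inferInstanceAs ((valMap τ (Σ i, F i) ⋙ Functor.pi' fun i =>
          E.res (Sigma.incl (C := F) i)).IsEquivalence))
    have h3 : ((Functor.pi' fun i => D.res (Sigma.incl (C := F) i)) ⋙
      Functor.pi fun i => valMap τ (F i)).IsEquivalence := h2
    exact Functor.isEquivalence_of_comp_right _ (Functor.pi fun i => valMap τ (F i))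

lemma IsStableDerivator.of_equivalence (τ : D ⟶ E) [∀ A : Cat.{w, w}ᵒᵖ, (τ.app A).toFunctor.IsEquivalence]
    (hE : E.IsStableDerivator) : D.IsStableDerivator where
  toIsDerivator := IsDerivator.of_equivalence τ hE.toIsDerivator
  pointed := by
    obtain ⟨Z, hZ⟩ := hE.pointed
    refine ⟨⟨(valMap τ Pt.{w}).objPreimage Z, ?_⟩⟩
    have h := hZ.of_iso ((valMap τ Pt.{w}).objObjPreimageIso Z)
    exact ⟨fun Y => ⟨@Equiv.unique _ _ (h.unique_to _).some
      ((Functor.FullyFaithful.ofFullyFaithful (valMap τ Pt.{w})).homEquiv (Y := Y))⟩,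
      fun Y => ⟨@Equiv.unique _ _ (h.unique_from _).some
      ((Functor.FullyFaithful.ofFullyFaithful (valMap τ Pt.{w})).homEquiv (X := Y))⟩⟩
  stable X := by
    have h := IsDerivator'.of_equivalence τ hE.toIsDerivator'
    rw [h.isCocartesian_iff, h.isCartesian_iff, ← isLKE_valMap_iff τ, ← isRKE_valMap_iff τ,
      hE.isLKE_iff_isRKE]

end
end
end Prederivator

/-! ### Modifications, their lifting, and levelwise inverses -/

namespace CatTrans

/-! ### Transformations of pseudofunctors with values in categories -/

section
universe w₁ v₁ u₁ v₂ u₂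
variable {B : Type u₁} [Bicategory.{w₁, v₁} B] {F G H : B ⥤ᵖ Cat.{v₂, u₂}}

/-- The structure isomorphism of a transformation at an object. -/
def natApp (τ : F ⟶ G) {a b : B} (f : a ⟶ b) (M : F.obj a) :
    (τ.app b).toFunctor.obj ((F.map f).toFunctor.obj M) ≅
      (G.map f).toFunctor.obj ((τ.app a).toFunctor.obj M) :=
  (Cat.Hom.toNatIso (τ.naturality f)).app M

variable (τ : F ⟶ G)

lemma natApp_naturality {a b : B} (f : a ⟶ b) {M N : F.obj a} (g : M ⟶ N) :
    (τ.app b).toFunctor.map ((F.map f).toFunctor.map g) ≫ (natApp τ f N).hom =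
      (natApp τ f M).hom ≫ (G.map f).toFunctor.map ((τ.app a).toFunctor.map g) :=
  (Cat.Hom.toNatIso (τ.naturality f)).hom.naturality g

lemma natApp_naturality_assoc {a b : B} (f : a ⟶ b) {M N : F.obj a} (g : M ⟶ N) {Z : G.obj b}
    (h : (G.map f).toFunctor.obj ((τ.app a).toFunctor.obj N) ⟶ Z) :
    (τ.app b).toFunctor.map ((F.map f).toFunctor.map g) ≫ (natApp τ f N).hom ≫ h =
      (natApp τ f M).hom ≫ (G.map f).toFunctor.map ((τ.app a).toFunctor.map g) ≫ h := by
  rw [← Category.assoc, natApp_naturality, Category.assoc]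

lemma natApp_map₂ {a b : B} {f g : a ⟶ b} (η : f ⟶ g) (M : F.obj a) :
    (τ.app b).toFunctor.map ((F.map₂ η).toNatTrans.app M) ≫ (natApp τ g M).hom =
      (natApp τ f M).hom ≫ (G.map₂ η).toNatTrans.app ((τ.app a).toFunctor.obj M) :=
  congrArg (fun t => t.toNatTrans.app M) (τ.naturality_naturality η)

lemma natApp_id (a : B) (M : F.obj a) :
    (natApp τ (𝟙 a) M).hom ≫ (G.mapId a).hom.toNatTrans.app ((τ.app a).toFunctor.obj M) =
      (τ.app a).toFunctor.map ((F.mapId a).hom.toNatTrans.app M) := by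
  have h : (natApp τ (𝟙 a) M).hom ≫
      (G.mapId a).hom.toNatTrans.app ((τ.app a).toFunctor.obj M) =
      (τ.app a).toFunctor.map ((F.mapId a).hom.toNatTrans.app M) ≫ 𝟙 _ ≫ 𝟙 _ :=
    congrArg (fun t => t.toNatTrans.app M) (τ.naturality_id a)
  exact h.trans ((congrArg _ (Category.comp_id _)).trans (Category.comp_id _))

lemma natApp_comp {a b c : B} (f : a ⟶ b) (g : b ⟶ c) (M : F.obj a) :
    (natApp τ (f ≫ g) M).hom ≫ (G.mapComp f g).hom.toNatTrans.app ((τ.app a).toFunctor.obj M) =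
      (τ.app c).toFunctor.map ((F.mapComp f g).hom.toNatTrans.app M) ≫
        (natApp τ g ((F.map f).toFunctor.obj M)).hom ≫
          (G.map g).toFunctor.map (natApp τ f M).hom := by
  have h : (natApp τ (f ≫ g) M).hom ≫
      (G.mapComp f g).hom.toNatTrans.app ((τ.app a).toFunctor.obj M) =
      (τ.app c).toFunctor.map ((F.mapComp f g).hom.toNatTrans.app M) ≫ 𝟙 _ ≫
        (natApp τ g ((F.map f).toFunctor.obj M)).hom ≫ 𝟙 _ ≫
          (G.map g).toFunctor.map (natApp τ f M).hom ≫ 𝟙 _ :=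
    congrArg (fun t => t.toNatTrans.app M) (τ.naturality_comp f g)
  rw [h]
  simp

lemma natApp_comp_assoc {a b c : B} (f : a ⟶ b) (g : b ⟶ c) (M : F.obj a) {Z : G.obj c}
    (h : (G.map g).toFunctor.obj ((G.map f).toFunctor.obj ((τ.app a).toFunctor.obj M)) ⟶ Z) :
    (natApp τ (f ≫ g) M).hom ≫ (G.mapComp f g).hom.toNatTrans.app ((τ.app a).toFunctor.obj M) ≫ h =
      (τ.app c).toFunctor.map ((F.mapComp f g).hom.toNatTrans.app M) ≫
        (natApp τ g ((F.map f).toFunctor.obj M)).hom ≫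
          (G.map g).toFunctor.map (natApp τ f M).hom ≫ h :=
  ((Category.assoc _ _ _).symm.trans (congrArg (· ≫ h) (natApp_comp τ f g M))).trans
    ((Category.assoc _ _ _).trans (congrArg (_ ≫ ·) (Category.assoc _ _ _)))

/-- The components of a modification. -/
abbrev modApp {η θ : F ⟶ G} (φ : η ⟶ θ) {a : B} (M : F.obj a) :
    (η.app a).toFunctor.obj M ⟶ (θ.app a).toFunctor.obj M :=
  (φ.as.app a).toNatTrans.app M

lemma modApp_natApp {η θ : F ⟶ G} (φ : η ⟶ θ) {a b : B} (f : a ⟶ b) (M : F.obj a) :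
    modApp φ ((F.map f).toFunctor.obj M) ≫ (natApp θ f M).hom =
      (natApp η f M).hom ≫ (G.map f).toFunctor.map (modApp φ M) :=
  congrArg (fun t => t.toNatTrans.app M) (φ.as.naturality f)

lemma mod_ext {η θ : F ⟶ G} {φ ψ : η ⟶ θ}
    (h : ∀ (a : B) (M : F.obj a), modApp φ M = modApp ψ M) : φ = ψ :=
  Pseudofunctor.StrongTrans.homCategory.ext fun a =>
    Cat.Hom₂.ext (NatTrans.ext (funext fun M => h a M))

/-- Construct a modification from its components. -/
def mkMod {η θ : F ⟶ G}
    (φ : ∀ (a : B) (M : F.obj a), (η.app a).toFunctor.obj M ⟶ (θ.app a).toFunctor.obj M)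
    (h1 : ∀ (a : B) (M N : F.obj a) (g : M ⟶ N), (η.app a).toFunctor.map g ≫ φ a N =
      φ a M ≫ (θ.app a).toFunctor.map g)
    (h2 : ∀ (a b : B) (f : a ⟶ b) (M : F.obj a), φ b ((F.map f).toFunctor.obj M) ≫
      (natApp θ f M).hom = (natApp η f M).hom ≫ (G.map f).toFunctor.map (φ a M)) : η ⟶ θ where
  as :=
    { app a := NatTrans.toCatHom₂ { app := φ a, naturality := fun M N g => h1 a M N g }
      naturality {a b} f := Cat.Hom₂.ext (NatTrans.ext (funext fun M => h2 a b f M)) }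

/-- Construct an invertible modification from its components. -/
def mkModIso {η θ : F ⟶ G}
    (φ : ∀ (a : B) (M : F.obj a), (η.app a).toFunctor.obj M ≅ (θ.app a).toFunctor.obj M)
    (h1 : ∀ (a : B) (M N : F.obj a) (g : M ⟶ N), (η.app a).toFunctor.map g ≫ (φ a N).hom =
      (φ a M).hom ≫ (θ.app a).toFunctor.map g)
    (h2 : ∀ (a b : B) (f : a ⟶ b) (M : F.obj a), (φ b ((F.map f).toFunctor.obj M)).hom ≫
      (natApp θ f M).hom = (natApp η f M).hom ≫ (G.map f).toFunctor.map (φ a M).hom) : η ≅ θ :=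
  Pseudofunctor.StrongTrans.isoMk
    (fun a => Cat.Hom.isoMk (NatIso.ofComponents (φ a) fun {M N} g => h1 a M N g))
    (fun {a b} f => Cat.Hom₂.ext (NatTrans.ext (funext fun M => h2 a b f M)))

/-! ### Lifting modifications -/

section
variable {e : G ⟶ H} (P : G.ObjectProperty) [P.IsClosedUnderMapObj]
  (he : ∀ a (M N : G.obj a), P.prop a M → P.prop a N →
    Function.Bijective fun g : M ⟶ N => (e.app a).toFunctor.map g)
  {η θ : F ⟶ G} (hη : ∀ a M, P.prop a ((η.app a).toFunctor.obj M))
  (hθ : ∀ a M, P.prop a ((θ.app a).toFunctor.obj M))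
include he hη hθ

omit [P.IsClosedUnderMapObj] in
lemma whiskerRight_injective {φ ψ : η ⟶ θ} (h : φ ▷ e = ψ ▷ e) : φ = ψ :=
  mod_ext fun a M => (he a _ _ (hη a M) (hθ a M)).1 (congrArg (fun t => modApp t M) h)

/-- Each component of `ψ` has a unique lift because `e` is fully faithful between objects satisfying
`P`. Naturality of the lifts is an equation between such objects and holds after applying `e`. -/
lemma whiskerRight_surjective (ψ : η ≫ e ⟶ θ ≫ e) : ∃ φ : η ⟶ θ, φ ▷ e = ψ := by
  -- The components of `ψ` are named `p`, with the modification axiom written out including the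
  -- identities contributed by the associators.
  obtain ⟨p, hp, hn, hc⟩ : ∃ p : ∀ (a : B) (M : F.obj a),
      (e.app a).toFunctor.obj ((η.app a).toFunctor.obj M) ⟶
        (e.app a).toFunctor.obj ((θ.app a).toFunctor.obj M),
      (∀ a (M : F.obj a), p a M = modApp ψ M) ∧
      (∀ (a b : B) (f : a ⟶ b) (M : F.obj a), p b ((F.map f).toFunctor.obj M) ≫
        𝟙 _ ≫ (e.app b).toFunctor.map (natApp θ f M).hom ≫ 𝟙 _ ≫
          (natApp e f ((θ.app a).toFunctor.obj M)).hom ≫ 𝟙 _ =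
        (𝟙 _ ≫ (e.app b).toFunctor.map (natApp η f M).hom ≫ 𝟙 _ ≫
          (natApp e f ((η.app a).toFunctor.obj M)).hom ≫ 𝟙 _) ≫ (H.map f).toFunctor.map (p a M)) ∧
      ∀ (a : B) (M N : F.obj a) (g : M ⟶ N),
        (e.app a).toFunctor.map ((η.app a).toFunctor.map g) ≫ p a N =
          p a M ≫ (e.app a).toFunctor.map ((θ.app a).toFunctor.map g) :=
    ⟨fun a M => modApp ψ M, fun _ _ => rfl, fun a b f M => modApp_natApp ψ f M,
      fun a M N g => (ψ.as.app a).toNatTrans.naturality g⟩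
  choose φ hφ using fun a M => (he a _ _ (hη a M) (hθ a M)).2 (p a M)
  dsimp only at hφ
  refine ⟨mkMod φ (fun a M N g => (he a _ _ (hη a M) (hθ a N)).1 ?_)
    (fun a b f M => (he b _ _ (hη b _) (P.map_obj (hθ a M) f)).1 ?_),
    mod_ext fun a M => (hφ a M).trans (hp a M)⟩
  · dsimp only
    rw [Functor.map_comp, Functor.map_comp, hφ, hφ, hc]
  · dsimp only
    have h3 := natApp_naturality e f (φ a M)
    rw [hφ] at h3
    rw [Functor.map_comp, Functor.map_comp, hφ, ← cancel_mono (natApp e f _).hom, Category.assoc,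
      Category.assoc, h3]
    simpa using hn a b f M

/-- The source of all canonical isomorphisms below: an isomorphism is prescribed after a fully
faithful evaluation and lifted. By `whiskerRight_injective` the lift is unique. -/
lemma exists_iso_whiskerRight (ψ : η ≫ e ≅ θ ≫ e) : ∃ φ : η ≅ θ, φ.hom ▷ e = ψ.hom := by
  obtain ⟨φ, h1⟩ := whiskerRight_surjective P he hη hθ ψ.hom
  obtain ⟨φ', h2⟩ := whiskerRight_surjective P he hθ hη ψ.inv
  refine ⟨⟨φ, φ', whiskerRight_injective P he hη hη ?_, whiskerRight_injective P he hθ hθ ?_⟩, h1⟩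
  · rw [comp_whiskerRight, h1, h2, Iso.hom_inv_id, id_whiskerRight]
  · rw [comp_whiskerRight, h1, h2, Iso.inv_hom_id, id_whiskerRight]

end

/-! ### Levelwise equivalences -/

section
variable [∀ a, (τ.app a).toFunctor.IsEquivalence]

/-- The counit of a levelwise inverse. -/
noncomputable def invCounit {a : B} (Y : G.obj a) :
    (τ.app a).toFunctor.obj ((τ.app a).toFunctor.inv.obj Y) ≅ Y :=
  (τ.app a).toFunctor.asEquivalence.counitIso.app Y

lemma invCounit_naturality {a : B} {Y Z : G.obj a} (g : Y ⟶ Z) :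
    (τ.app a).toFunctor.map ((τ.app a).toFunctor.inv.map g) ≫ (invCounit τ Z).hom =
      (invCounit τ Y).hom ≫ g :=
  (τ.app a).toFunctor.asEquivalence.counitIso.hom.naturality g

/-- The structure isomorphisms of a levelwise inverse. -/
noncomputable def invNat {a b : B} (f : a ⟶ b) (Y : G.obj a) :
    (τ.app b).toFunctor.inv.obj ((G.map f).toFunctor.obj Y) ≅
      (F.map f).toFunctor.obj ((τ.app a).toFunctor.inv.obj Y) :=
  (τ.app b).toFunctor.preimageIso (invCounit τ _ ≪≫
    (G.map f).toFunctor.mapIso (invCounit τ Y).symm ≪≫ (natApp τ f _).symm)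

/-- This equation characterises `invNat`. Every coherence law of `levelInv` is proved by applying
`τ`, which is faithful, and reducing to it. -/
lemma map_invNat {a b : B} (f : a ⟶ b) (Y : G.obj a) :
    (τ.app b).toFunctor.map (invNat τ f Y).hom ≫ (natApp τ f _).hom ≫
      (G.map f).toFunctor.map (invCounit τ Y).hom = (invCounit τ _).hom := by
  simp [invNat, ← Functor.map_comp]

/-- A levelwise inverse of a transformation which is a levelwise equivalence. -/
noncomputable def levelInv : G ⟶ F where
  app a := (τ.app a).toFunctor.inv.toCatHom
  naturality {a b} f := Cat.Hom.isoMk (NatIso.ofComponents (fun Y => invNat τ f Y) fun {Y Z} g => by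
    change (τ.app b).toFunctor.inv.map ((G.map f).toFunctor.map g) ≫ (invNat τ f Z).hom =
      (invNat τ f Y).hom ≫ (F.map f).toFunctor.map ((τ.app a).toFunctor.inv.map g)
    apply (τ.app b).toFunctor.map_injective
    rw [← cancel_mono (natApp τ f _).hom,
      ← cancel_mono ((G.map f).toFunctor.map (invCounit τ Z).hom)]
    simp only [Functor.map_comp, Category.assoc, map_invNat, reassoc_of% natApp_naturality,
      invCounit_naturality]
    rw [← Functor.map_comp, invCounit_naturality, Functor.map_comp, reassoc_of% map_invNat])
  naturality_naturality {a b f g} α := Cat.Hom₂.ext (NatTrans.ext (funext fun Y => by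
    change (τ.app b).toFunctor.inv.map ((G.map₂ α).toNatTrans.app Y) ≫ (invNat τ g Y).hom =
      (invNat τ f Y).hom ≫ (F.map₂ α).toNatTrans.app ((τ.app a).toFunctor.inv.obj Y)
    apply (τ.app b).toFunctor.map_injective
    rw [← cancel_mono (natApp τ g _).hom,
      ← cancel_mono ((G.map g).toFunctor.map (invCounit τ Y).hom)]
    simp only [Functor.map_comp, Category.assoc, map_invNat, reassoc_of% natApp_map₂,
      invCounit_naturality]
    rw [← (G.map₂ α).toNatTrans.naturality, reassoc_of% map_invNat]))
  naturality_id a := Cat.Hom₂.ext (NatTrans.ext (funext fun Y => by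
    have : (invNat τ (𝟙 a) Y).hom ≫
        (F.mapId a).hom.toNatTrans.app ((τ.app a).toFunctor.inv.obj Y) =
      (τ.app a).toFunctor.inv.map ((G.mapId a).hom.toNatTrans.app Y) ≫ 𝟙 _ ≫ 𝟙 _ := by
      apply (τ.app a).toFunctor.map_injective
      rw [← cancel_mono (invCounit τ Y).hom]
      have h := (G.mapId a).hom.toNatTrans.naturality (invCounit τ Y).hom
      have h' : (G.map (𝟙 a)).toFunctor.map (invCounit τ Y).hom ≫
        (G.mapId a).hom.toNatTrans.app Y = (G.mapId a).hom.toNatTrans.app _ ≫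
          (invCounit τ Y).hom := h
      simp only [Functor.map_comp, Category.assoc, ← natApp_id]
      rw [← h', reassoc_of% map_invNat]
      have h2 := invCounit_naturality τ ((G.mapId a).hom.toNatTrans.app Y)
      refine h2.symm.trans ?_
      refine congrArg _ ?_
      exact ((congrArg₂ (· ≫ ·) ((τ.app a).toFunctor.map_id _) ((congrArg (· ≫ _)
        ((τ.app a).toFunctor.map_id _)).trans (Category.id_comp _))).trans (Category.id_comp _)).symm
    exact this))
  naturality_comp {a b c} f g := Cat.Hom₂.ext (NatTrans.ext (funext fun Y => by
    have : (invNat τ (f ≫ g) Y).hom ≫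
        (F.mapComp f g).hom.toNatTrans.app ((τ.app a).toFunctor.inv.obj Y) =
      (τ.app c).toFunctor.inv.map ((G.mapComp f g).hom.toNatTrans.app Y) ≫ 
        (invNat τ g ((G.map f).toFunctor.obj Y)).hom ≫ 
          (F.map g).toFunctor.map (invNat τ f Y).hom := by
      apply (τ.app c).toFunctor.map_injective
      rw [← cancel_mono (natApp τ g _).hom,
        ← cancel_mono ((G.map g).toFunctor.map (natApp τ f _).hom),
        ← cancel_mono ((G.map g).toFunctor.map ((G.map f).toFunctor.map (invCounit τ Y).hom))]
      have h := (G.mapComp f g).hom.toNatTrans.naturality (invCounit τ Y).hom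
      have h' : (G.map (f ≫ g)).toFunctor.map (invCounit τ Y).hom ≫
        (G.mapComp f g).hom.toNatTrans.app Y = (G.mapComp f g).hom.toNatTrans.app _ ≫
          (G.map g).toFunctor.map ((G.map f).toFunctor.map (invCounit τ Y).hom) := h
      simp only [Functor.map_comp, Category.assoc, ← natApp_comp_assoc, natApp_naturality_assoc]
      rw [← h', reassoc_of% map_invNat, ← Functor.map_comp, ← Functor.map_comp, map_invNat, map_invNat,
        invCounit_naturality]
    refine this.trans ?_
    change _ = (τ.app c).toFunctor.inv.map ((G.mapComp f g).hom.toNatTrans.app Y) ≫ 𝟙 _ ≫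
        (invNat τ g ((G.map f).toFunctor.obj Y)).hom ≫ 𝟙 _ ≫
          (F.map g).toFunctor.map (invNat τ f Y).hom ≫ 𝟙 _
    simp))

/-- The levelwise inverse is a right inverse. -/
noncomputable def levelInvCounit : levelInv τ ≫ τ ≅ 𝟙 G :=
  mkModIso (fun _ Y => invCounit τ Y) (fun a Y Z g => invCounit_naturality τ g) fun a b f Y => by
    change (invCounit τ _).hom ≫ 𝟙 _ ≫ 𝟙 _ = (𝟙 _ ≫ (τ.app b).toFunctor.map (invNat τ f Y).hom ≫
      𝟙 _ ≫ (natApp τ f _).hom ≫ 𝟙 _) ≫ (G.map f).toFunctor.map (invCounit τ Y).hom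
    simp [map_invNat]

/-- The property satisfied by all objects. -/
def topProp (F : B ⥤ᵖ Cat.{v₂, u₂}) : F.ObjectProperty where
  prop _ _ := True

instance : (topProp F).IsClosedUnderMapObj where
  map_obj _ _ := trivial

/-- The counit is at hand; the unit is lifted through `τ`, which is fully faithful on all objects.
The triangle identities are arranged by replacing the unit. -/
lemma exists_equivalence : ∃ e : F ≌ G, e.hom = τ := by
  obtain ⟨φ, -⟩ := exists_iso_whiskerRight (e := τ) (topProp F)
    (fun a M N _ _ => (Functor.FullyFaithful.ofFullyFaithful (τ.app a).toFunctor).homEquiv.bijective)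
    (η := 𝟙 F) (θ := τ ≫ levelInv τ) (fun _ _ => trivial) (fun _ _ => trivial)
    (λ_ τ ≪≫ (ρ_ τ).symm ≪≫ whiskerLeftIso τ (levelInvCounit τ).symm ≪≫ (α_ _ _ _).symm)
  exact ⟨Equivalence.mkOfAdjointifyCounit φ (levelInvCounit τ), rfl⟩

end
end
end CatTrans

/-! ### Combinatorics of the reinforced chain of cubes -/

namespace Chain

lemma inCubes_iff (a b c : ℤ) : InCubes (a, b, c) ↔
    a ≤ b + 1 ∧ b ≤ a + 1 ∧ b ≤ c + 1 ∧ c ≤ b + 1 ∧ a ≤ c + 1 ∧ c ≤ a + 1 := by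
  constructor
  · rintro ⟨n, x, y, z, h⟩
    simp only [Prod.mk.injEq] at h
    omega
  · intro h
    have key (n : ℤ) (ha : a = n ∨ a = n + 1) (hb : b = n ∨ b = n + 1) (hc : c = n ∨ c = n + 1) :
        InCubes (a, b, c) := by
      refine ⟨n, if a = n then 0 else 1, if b = n then 0 else 1, if c = n then 0 else 1, ?_⟩
      refine Prod.ext ?_ (Prod.ext ?_ ?_)
      · rcases ha with rfl | rfl <;> simp
      · rcases hb with rfl | rfl <;> simp
      · rcases hc with rfl | rfl <;> simp
    -- The integer `n` is the least of the three coordinates.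
    obtain ⟨n, h1, h2, h3⟩ : ∃ n, (a = n ∨ a = n + 1) ∧ (b = n ∨ b = n + 1) ∧
        (c = n ∨ c = n + 1) := by
      rcases le_total a b with h1 | h1 <;> rcases le_total b c with h2 | h2 <;>
        rcases le_total a c with h3 | h3
      all_goals first | exact ⟨a, by omega, by omega, by omega⟩ |
        exact ⟨b, by omega, by omega, by omega⟩ | exact ⟨c, by omega, by omega, by omega⟩
    exact key n h1 h2 h3

lemma inLinks_iff (a b c : ℤ) : InLinks (a, b, c) ↔
    (b = a + 2 ∧ c = a + 1) ∨ (a = c + 2 ∧ b = c + 1) ∨ (c = b + 2 ∧ a = b + 1) := by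
  constructor
  · rintro ⟨n, h⟩
    simp only [Prod.mk.injEq] at h
    omega
  · intro h
    rcases h with h | h | h
    · exact ⟨a, .inl (by rw [h.1, h.2])⟩
    · exact ⟨c, .inr (.inl (by rw [h.1, h.2]))⟩
    · exact ⟨b, .inr (.inr (by rw [h.1, h.2]))⟩

lemma mem_iff (p : Chain) :
    (p.1.1 ≤ p.1.2.1 + 1 ∧ p.1.2.1 ≤ p.1.1 + 1 ∧ p.1.2.1 ≤ p.1.2.2 + 1 ∧ p.1.2.2 ≤ p.1.2.1 + 1 ∧
      p.1.1 ≤ p.1.2.2 + 1 ∧ p.1.2.2 ≤ p.1.1 + 1) ∨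
    (p.1.2.1 = p.1.1 + 2 ∧ p.1.2.2 = p.1.1 + 1) ∨ (p.1.1 = p.1.2.2 + 2 ∧ p.1.2.1 = p.1.2.2 + 1) ∨
      (p.1.2.2 = p.1.2.1 + 2 ∧ p.1.1 = p.1.2.1 + 1) :=
  p.2.imp (inCubes_iff _ _ _).1 (inLinks_iff _ _ _).1

lemma le_iff (p q : Chain) :
    p ≤ q ↔ p.1.1 ≤ q.1.1 ∧ p.1.2.1 ≤ q.1.2.1 ∧ p.1.2.2 ≤ q.1.2.2 := Iff.rfl

/-- The condition on the initial vertex of a small square. -/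
def Corner (a b c : ℤ) : Prop := (a = b ∧ (c = a ∨ c = a + 1)) ∨ (b = a + 1 ∧ c = a + 1)

/-- The small squares parallel to the first two coordinate axes. -/
def sq {a b c : ℤ} (h : Corner a b c) : Sq →o Chain where
  toFun x := ⟨(a + (x.1 : ℕ), b + (x.2 : ℕ), c), by
    have h1 := x.1.2
    have h2 := x.2.2
    rw [inCubes_iff, inLinks_iff]
    unfold Corner at h
    omega⟩
  monotone' x y h := ⟨by have := h.1; dsimp; omega, by have := h.2; dsimp; omega, le_rfl⟩

lemma sq_val {a b c : ℤ} (h : Corner a b c) (x : Sq) :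
    (sq h x).1 = (a + (x.1 : ℕ), b + (x.2 : ℕ), c) := rfl

lemma isSmallSquare_sq {a b c : ℤ} (h : Corner a b c) : IsSmallSquare (sq h) := by
  rcases id h with ⟨rfl, rfl | rfl⟩ | ⟨rfl, rfl⟩
  · exact .inl ⟨c, 0, .inl fun x y => by rw [sq_val]; simp⟩
  · exact .inl ⟨a, 1, .inl fun x y => by rw [sq_val]; simp⟩
  · exact .inr ⟨a, .inl fun x y => by rw [sq_val]⟩

/-- Up to cyclic rotation, a small square is `[a, a + 1] × [b, b + 1] × {c}`. A face has `a = b`,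
with `c` equal to `a` or `a + 1`; a reinforcing square has `b = c = a + 1`. In all cases `b - a` is
`0` or `1` and `c ≥ a`. -/
lemma exists_corner {k : Sq →o Chain} (hk : IsSmallSquare k) : ∃ a b c, Corner a b c ∧
    ((∀ x y : Fin 2, (k (x, y)).1 = (a + (x : ℕ), b + (y : ℕ), c)) ∨
      (∀ x y : Fin 2, (k (x, y)).1 = (c, a + (x : ℕ), b + (y : ℕ))) ∨
      (∀ x y : Fin 2, (k (x, y)).1 = (b + (y : ℕ), c, a + (x : ℕ)))) := by
  rcases hk with ⟨n, e, h⟩ | ⟨n, h⟩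
  · exact ⟨n, n, n + (e : ℕ), .inl ⟨rfl, by omega⟩, h⟩
  · exact ⟨n, n + 1, n + 1, .inr ⟨rfl, rfl⟩, h⟩

/-- The three orientations of the squares parallel to coordinate planes. -/
lemma exists_square {a b c : ℤ} (h : Corner a b c) :
    (∃ k, IsSmallSquare k ∧ ∀ x y : Fin 2, (k (x, y)).1 = (a + (x : ℕ), b + (y : ℕ), c)) ∧
    (∃ k, IsSmallSquare k ∧ ∀ x y : Fin 2, (k (x, y)).1 = (c, a + (x : ℕ), b + (y : ℕ))) ∧
    ∃ k, IsSmallSquare k ∧ ∀ x y : Fin 2, (k (x, y)).1 = (b + (y : ℕ), c, a + (x : ℕ)) :=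
  ⟨⟨sq h, isSmallSquare_sq h, fun _ _ => rfl⟩, ⟨_, (isSmallSquare_sq h).rot, fun _ _ => rfl⟩,
    ⟨_, (isSmallSquare_sq h).rot.rot, fun _ _ => rfl⟩⟩

/-- The objects with nonnegative coordinates. -/
def Nonneg (p : Chain) : Prop := 0 ≤ p.1.1 ∧ 0 ≤ p.1.2.1 ∧ 0 ≤ p.1.2.2

/-- The sum of the coordinates. -/
def sum (p : Chain) : ℤ := p.1.1 + p.1.2.1 + p.1.2.2

/-- Inside a coordinate plane `k (0, 0)` is the componentwise meet of `k (1, 0)` and `k (0, 1)`.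
This is the second condition in the detection of cocartesian squares. -/
lemma square_meet {k : Sq →o Chain} (hk : IsSmallSquare k) (p : Chain) (h1 : p ≤ k (1, 0))
    (h2 : p ≤ k (0, 1)) : p ≤ k (0, 0) := by
  obtain ⟨a, b, c, -, h⟩ := exists_corner hk
  rw [le_iff] at h1 h2 ⊢
  rcases h with h | h | h <;>
  · simp only [h] at h1 h2 ⊢
    simp only [Fin.val_zero, Fin.val_one] at h1 h2 ⊢
    omega

lemma square_join {k : Sq →o Chain} (hk : IsSmallSquare k) (p : Chain) (h1 : k (1, 0) ≤ p)
    (h2 : k (0, 1) ≤ p) : k (1, 1) ≤ p := by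
  obtain ⟨a, b, c, -, h⟩ := exists_corner hk
  rw [le_iff] at h1 h2 ⊢
  rcases h with h | h | h <;>
  · simp only [h] at h1 h2 ⊢
    simp only [Fin.val_zero, Fin.val_one] at h1 h2 ⊢
    omega

/-- If `p` lies below neither arm, then its two coordinates in the plane of the square are those of
`k (1, 1)`. These are positive, so `p` has sum at least two; and they differ by `0` or `1` in cyclic
order, whereas the cyclic differences of a link are `2`, `-1`, `-1`. -/
lemma square_final {k : Sq →o Chain} (hk : IsSmallSquare k) (hk0 : Nonneg (k (0, 0))) (p : Chain)
    (hp : sum p ≤ 1 ∨ ¬ InCubes p.1) (h0 : Nonneg p) (h1 : p ≤ k (1, 1)) :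
    p ≤ k (1, 0) ∨ p ≤ k (0, 1) := by
  obtain ⟨a, b, c, hc, h⟩ := exists_corner hk
  have hm := mem_iff p
  rw [le_iff] at h1
  rw [le_iff, le_iff]
  unfold Nonneg at h0 hk0
  unfold sum at hp
  unfold Corner at hc
  replace hp := hp.imp_right (mt (inCubes_iff p.1.1 p.1.2.1 p.1.2.2).2)
  rcases h with h | h | h <;>
  · simp only [h] at h1 hk0 ⊢
    simp only [Fin.val_zero, Fin.val_one] at h1 hk0 ⊢
    omega

/-- If `p` lies above neither arm, its two coordinates in the plane are those of `k (0, 0)`. Their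
cyclic difference excludes links. If `p` is nonnegative, they are nonnegative and so is the constant
coordinate of the square, being at least the first of them, which contradicts `hk0`. -/
lemma square_initial {k : Sq →o Chain} (hk : IsSmallSquare k) (hk0 : ¬ Nonneg (k (0, 0)))
    (p : Chain) (hp : Nonneg p ∨ ¬ InCubes p.1) (h1 : k (0, 0) ≤ p) :
    k (1, 0) ≤ p ∨ k (0, 1) ≤ p := by
  obtain ⟨a, b, c, hc, h⟩ := exists_corner hk
  have hm := mem_iff p
  rw [le_iff] at h1
  rw [le_iff, le_iff]
  unfold Nonneg at hp hk0
  unfold Corner at hc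
  replace hp := hp.imp_right (mt (inCubes_iff p.1.1 p.1.2.1 p.1.2.2).2)
  rcases h with h | h | h <;>
  · simp only [h] at h1 hk0 ⊢
    simp only [Fin.val_zero, Fin.val_one] at h1 hk0 ⊢
    omega

lemma sum_lt {k : Sq →o Chain} (hk : IsSmallSquare k) :
    (∀ x, x ≠ (1, 1) → sum (k x) < sum (k (1, 1))) ∧
      ∀ x, x ≠ (0, 0) → sum (k (0, 0)) < sum (k x) := by
  obtain ⟨a, b, c, -, h⟩ := exists_corner hk
  unfold sum
  constructor
  · rintro ⟨x, y⟩ hx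
    have hx' : ¬ ((x : ℕ) = 1 ∧ (y : ℕ) = 1) :=
      fun h => hx (Prod.ext (Fin.ext h.1) (Fin.ext h.2))
    rcases h with h | h | h <;>
    · simp only [h]
      simp only [Fin.val_one]
      omega
  · rintro ⟨x, y⟩ hx
    have hx' : ¬ ((x : ℕ) = 0 ∧ (y : ℕ) = 0) :=
      fun h => hx (Prod.ext (Fin.ext h.1) (Fin.ext h.2))
    rcases h with h | h | h <;>
    · simp only [h]
      simp only [Fin.val_zero]
      omega

/-- A cyclically adjacent pair of coordinates of `t` is lowered by one. The case distinctions select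
a pair for which the result is a `Corner`; since the sum of `t` exceeds one, both lowered
coordinates stay nonnegative. -/
lemma exists_square_final (t : Chain) (h0 : Nonneg t) (h1 : InCubes t.1) (h2 : 1 < sum t) :
    ∃ k, IsSmallSquare k ∧ k (1, 1) = t ∧ Nonneg (k (0, 0)) := by
  replace h1 := (inCubes_iff t.1.1 t.1.2.1 t.1.2.2).1 h1
  unfold sum at h2
  unfold Nonneg at h0 ⊢
  by_cases e1 : t.1.1 = t.1.2.1 ∧ t.1.2.2 ≤ t.1.1 ∨ t.1.2.1 = t.1.1 + 1 ∧ t.1.2.2 = t.1.1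
  · obtain ⟨k, hk, h⟩ := (exists_square (a := t.1.1 - 1) (b := t.1.2.1 - 1) (c := t.1.2.2)
      (by unfold Corner; omega)).1
    refine ⟨k, hk, Subtype.ext ((h 1 1).trans ?_), ?_⟩
    · ext <;> simp
    · rw [h]; simp; omega
  by_cases e2 : t.1.2.1 = t.1.2.2 ∧ t.1.1 ≤ t.1.2.1 ∨ t.1.2.2 = t.1.2.1 + 1 ∧ t.1.1 = t.1.2.1
  · obtain ⟨k, hk, h⟩ := (exists_square (a := t.1.2.1 - 1) (b := t.1.2.2 - 1) (c := t.1.1)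
      (by unfold Corner; omega)).2.1
    refine ⟨k, hk, Subtype.ext ((h 1 1).trans ?_), ?_⟩
    · ext <;> simp
    · rw [h]; simp; omega
  · obtain ⟨k, hk, h⟩ := (exists_square (a := t.1.2.2 - 1) (b := t.1.1 - 1) (c := t.1.2.1)
      (by unfold Corner; omega)).2.2
    refine ⟨k, hk, Subtype.ext ((h 1 1).trans ?_), ?_⟩
    · ext <;> simp
    · rw [h]; simp; omega

lemma exists_square_initial (t : Chain) (h1 : InCubes t.1) :
    ∃ k, IsSmallSquare k ∧ k (0, 0) = t := by
  replace h1 := (inCubes_iff t.1.1 t.1.2.1 t.1.2.2).1 h1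
  by_cases e1 : Corner t.1.1 t.1.2.1 t.1.2.2
  · obtain ⟨k, hk, h⟩ := (exists_square e1).1
    exact ⟨k, hk, Subtype.ext ((h 0 0).trans (by ext <;> simp))⟩
  by_cases e2 : Corner t.1.2.1 t.1.2.2 t.1.1
  · obtain ⟨k, hk, h⟩ := (exists_square e2).2.1
    exact ⟨k, hk, Subtype.ext ((h 0 0).trans (by ext <;> simp))⟩
  · obtain ⟨k, hk, h⟩ := (exists_square (a := t.1.2.2) (b := t.1.1) (c := t.1.2.1)
      (by unfold Corner at *; omega)).2.2
    exact ⟨k, hk, Subtype.ext ((h 0 0).trans (by ext <;> simp))⟩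

/-- The nonnegative objects and the links. -/
abbrev C₃ : Type := {p : Chain // Nonneg p ∨ ¬ InCubes p.1}

/-- The nonnegative objects. -/
abbrev C₂ : Type := {p : C₃ // Nonneg p.1}

/-- The objects of the source and the nonnegative links. -/
abbrev C₁ : Type := {p : C₂ // sum p.1.1 ≤ 1 ∨ ¬ InCubes p.1.1.1}

lemma _root_.Source.sum_incl (p : Source) : sum (Source.incl p) ≤ 1 := by
  have h := p.2
  change ((p.1.1 : ℕ) : ℤ) + ((p.1.2.1 : ℕ) : ℤ) + ((p.1.2.2 : ℕ) : ℤ) ≤ 1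
  omega

lemma _root_.Source.nonneg_incl (p : Source) : Nonneg (Source.incl p) :=
  ⟨Int.natCast_nonneg _, Int.natCast_nonneg _, Int.natCast_nonneg _⟩

lemma _root_.Source.le_of_incl_le {p q : Source} (h : Source.incl p ≤ Source.incl q) : p ≤ q :=
  ⟨Int.ofNat_le.1 h.1, Int.ofNat_le.1 h.2.1, Int.ofNat_le.1 h.2.2⟩

lemma _root_.Source.exists_incl (t : Chain) (h0 : Nonneg t) (h2 : sum t ≤ 1) :
    ∃ p, Source.incl p = t := by
  unfold Nonneg at h0
  unfold sum at h2
  refine ⟨⟨(⟨t.1.1.toNat, by omega⟩, ⟨t.1.2.1.toNat, by omega⟩, ⟨t.1.2.2.toNat, by omega⟩),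
    by dsimp; omega⟩, Subtype.ext (Prod.ext ?_ (Prod.ext ?_ ?_))⟩
  · exact Int.toNat_of_nonneg h0.1
  · exact Int.toNat_of_nonneg h0.2.1
  · exact Int.toNat_of_nonneg h0.2.2

/-- The inclusion of the source. -/
noncomputable def source : Source →o C₁ :=
  ⟨fun p => ⟨⟨⟨Source.incl p, .inl (Source.nonneg_incl p)⟩, Source.nonneg_incl p⟩,
    .inl (Source.sum_incl p)⟩, fun _ _ h => Source.incl.2 h⟩

end Chain

/-! ### The equivalence with diagrams on the trivalent source -/

namespace Prederivator
variable {D : Prederivator.{w, v, u}}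

/-! ### The restriction to the source -/

open Chain in
/-- The inclusion of the nonnegative objects and the links. -/
noncomputable abbrev incl₃ : Pos.{w} C₃ ⥤ Pos.{w} Chain := Pos.map (OrderHom.Subtype.val _)

open Chain in
/-- The inclusion of the nonnegative objects. -/
noncomputable abbrev incl₂ : Pos.{w} C₂ ⥤ Pos.{w} C₃ := Pos.map (OrderHom.Subtype.val _)

open Chain in
/-- The inclusion of the source and the nonnegative links. -/
noncomputable abbrev incl₁ : Pos.{w} C₁ ⥤ Pos.{w} C₂ := Pos.map (OrderHom.Subtype.val _)

open Chain in
/-- The inclusion of the source. -/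
noncomputable abbrev incl₀ : Pos.{w} Source ⥤ Pos.{w} C₁ := Pos.map Chain.source

instance : (incl₀.{w}).Full := Pos.map_full _ fun _ _ h => Source.le_of_incl_le h

/-- All small squares are bicartesian, and the values at the links vanish. -/
def IsEx (Y : D.Val (Pos.{w} Chain)) : Prop :=
  (∀ k : Sq →o Chain, IsSmallSquare k → D.IsBicartesian ((D.res (Pos.map k)).obj Y)) ∧
    ∀ p : Chain, ¬ InCubes p.1 → IsZero (D.ev Y (Pos.of p))

/-- The inclusions `source ⊆ C₁ ⊆ C₂ ⊆ C₃ ⊆ C` add objects of one kind at a time. Nonnegative links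
map to no object of the source, and the other links receive no map from nonnegative objects, so
these two steps are extensions by zero. In the other two steps each new object is a final,
respectively initial, vertex of a small square, and the sum of coordinates serves as rank. -/
lemma isEx_iff (hD : D.IsStableDerivator) (Y : D.Val (Pos.{w} Chain)) : IsEx Y ↔
    IsRKE incl₃ Y ∧ IsLKE incl₂ ((D.res incl₃).obj Y) ∧
      IsLKE incl₁ ((D.res incl₂).obj ((D.res incl₃).obj Y)) ∧
        IsRKE incl₀ ((D.res incl₁).obj ((D.res incl₂).obj ((D.res incl₃).obj Y))) := by
  have hD' := hD.toIsDerivator'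
  constructor
  · intro h
    refine ⟨hD'.isRKE_of_isCartesian (fun t => (-Chain.sum t).toNat) fun t ht => ?_,
      hD.isLKE_of_isZero _ fun t => ?_,
      hD'.isLKE_of_isCocartesian (fun t => (Chain.sum t.1.1).toNat) fun t ht => ?_,
      hD.isRKE_of_isZero _ fun t => ?_⟩
    · rw [not_or, not_not] at ht
      obtain ⟨k, hk, rfl⟩ := Chain.exists_square_initial t ht.2
      refine ⟨k, rfl, fun x hx => ?_, Chain.square_initial hk ht.1, Chain.square_join hk,
        (h.1 k hk).2⟩
      have h1 := (Chain.sum_lt hk).2 x hx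
      -- One coordinate is negative and the others exceed it by at most one, so the sum is negative.
      -- Hence the truncation in the rank does not spoil the strict decrease.
      have h2 : Chain.sum (k (0, 0)) < 0 := by
        obtain ⟨h2, h3⟩ := ht
        generalize k (0, 0) = t at h2 h3 ⊢
        replace h3 := (Chain.inCubes_iff t.1.1 t.1.2.1 t.1.2.2).1 h3
        unfold Chain.Nonneg at h2
        unfold Chain.sum
        omega
      omega
    · obtain ⟨t⟩ := t
      by_cases ht : Chain.Nonneg t.1
      · exact .inl ⟨Pos.of ⟨t, ht⟩, rfl⟩
      -- Nonnegative objects are closed upwards, so none of them maps to a link with a negative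
      -- coordinate.
      · refine .inr ⟨fun a => ⟨fun f => ht ?_⟩,
          (h.2 t.1 (t.2.resolve_left ht)).of_iso (evRes incl₃ (Pos.of t) Y)⟩
        have h1 := Pos.le_of_hom f
        have h2 := (ULift.down a).2
        exact ⟨h2.1.trans h1.1, h2.2.1.trans h1.2.1, h2.2.2.trans h1.2.2⟩
    · rw [not_or, not_not, not_le] at ht
      obtain ⟨k, hk, h1, h2⟩ := Chain.exists_square_final t.1.1 t.2 ht.2 ht.1
      have h3 (x : Sq) : Chain.Nonneg (k x) := by
        have h3 : k (0, 0) ≤ k x := k.2 ⟨bot_le, bot_le⟩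
        exact ⟨h2.1.trans h3.1, h2.2.1.trans h3.2.1, h2.2.2.trans h3.2.2⟩
      let k' : Sq →o Chain.C₂ := ⟨fun x => ⟨⟨k x, .inl (h3 x)⟩, h3 x⟩, fun _ _ h => k.2 h⟩
      refine ⟨k', Subtype.ext (Subtype.ext h1), fun x hx => ?_, fun a ha hat => ?_,
        fun a => Chain.square_meet hk a.1.1, (h.1 k hk).1.of_iso
          (D.resObjIso (f := Pos.map k' ⋙ incl₂) (g := incl₃) rfl _ ≪≫ (D.resComp _ _).app _)⟩
      · have h4 := (Chain.sum_lt hk).1 x hx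
        rw [h1] at h4
        change (Chain.sum (k x)).toNat < _
        omega
      · refine Chain.square_final hk h2 a.1.1 ha a.2 ?_
        rw [h1]
        exact hat
    · obtain ⟨t⟩ := t
      by_cases ht : InCubes t.1.1.1.1
      · obtain ⟨p, hp⟩ := Source.exists_incl t.1.1.1 t.1.2 (t.2.resolve_right (not_not.2 ht))
        exact .inl ⟨Pos.of p, congrArg ULift.up (Subtype.ext (Subtype.ext (Subtype.ext hp)))⟩
      -- The coordinates of a link are three consecutive integers in some order; a nonnegative link
      -- has sum at least three and cannot lie below an object of the source.
      · refine .inr ⟨fun a => ⟨fun f => ?_⟩, (h.2 t.1.1.1 ht).of_iso (evRes _ _ _ ≪≫ evRes _ _ _ ≪≫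
          evRes _ _ _)⟩
        have h1 : t.1.1.1 ≤ Source.incl (ULift.down a) := Pos.le_of_hom f
        have h2 := Source.sum_incl (ULift.down a)
        have h3 : Chain.Nonneg t.1.1.1 := t.1.2
        have h4 := (Chain.mem_iff t.1.1.1).resolve_left (mt (Chain.inCubes_iff _ _ _).2 ht)
        rw [Chain.le_iff] at h1
        unfold Chain.sum at h2
        unfold Chain.Nonneg at h3
        omega
  · rintro ⟨h3, h2, h1, h0⟩
    constructor
    · intro k hk
      by_cases hk0 : Chain.Nonneg (k (0, 0))
      · have hx (x : Sq) : Chain.Nonneg (k x) := by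
          have h3 : k (0, 0) ≤ k x := k.2 ⟨bot_le, bot_le⟩
          exact ⟨hk0.1.trans h3.1, hk0.2.1.trans h3.2.1, hk0.2.2.trans h3.2.2⟩
        let k' : Sq →o Chain.C₂ := ⟨fun x => ⟨⟨k x, .inl (hx x)⟩, hx x⟩, fun _ _ h => k.2 h⟩
        have h := hD'.isCocartesian_of_isLKE h1 k'
          (fun a ha hat => Chain.square_final hk hk0 a.1.1 ha a.2 hat)
          (fun a => Chain.square_meet hk a.1.1)
        have h' : D.IsCocartesian ((D.res (Pos.map k)).obj Y) := h.of_iso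
          (D.resObjIso (f := Pos.map k' ⋙ incl₂) (g := incl₃) rfl _ ≪≫ (D.resComp _ _).app _).symm
        exact ⟨h', (hD.stable _).1 h'⟩
      · have h := hD'.isCartesian_of_isRKE h3 k (Chain.square_initial hk hk0) (Chain.square_join hk)
        exact ⟨(hD.stable _).2 h, h⟩
    · intro p hp
      by_cases hp0 : Chain.Nonneg p
      · have h := hD.isZero_of_isRKE h0 (t := Pos.of ⟨⟨⟨p, .inl hp0⟩, hp0⟩, .inr hp⟩) fun a => ⟨fun f => by
          have h1 : p ≤ Source.incl (ULift.down a) := Pos.le_of_hom f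
          have h2 := Source.sum_incl (ULift.down a)
          have h3 := hp0
          have h4 := (Chain.mem_iff p).resolve_left (mt (Chain.inCubes_iff _ _ _).2 hp)
          rw [Chain.le_iff] at h1
          unfold Chain.sum at h2
          unfold Chain.Nonneg at h3
          omega⟩
        exact h.of_iso (evRes incl₁ (Pos.of ⟨⟨⟨p, .inl hp0⟩, hp0⟩, .inr hp⟩) _ ≪≫
          evRes incl₂ (Pos.of ⟨⟨p, .inl hp0⟩, hp0⟩) _ ≪≫ evRes incl₃ (Pos.of ⟨p, .inl hp0⟩) _).symm
      · have h := hD.isZero_of_isLKE h2 (t := Pos.of ⟨p, .inr hp⟩) fun a => ⟨fun f => hp0 (by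
          have h1 := Pos.le_of_hom f
          have h2 := (ULift.down a).2
          exact ⟨h2.1.trans h1.1, h2.2.1.trans h1.2.1, h2.2.2.trans h1.2.2⟩)⟩
        exact h.of_iso (evRes incl₃ (Pos.of ⟨p, _⟩) Y).symm

variable {A : Type w} [Category.{w} A]

lemma slice_prod_iso {P Q : Type w} [Category.{w} P] [Category.{w} Q] (f : P ⥤ Q) (a : A)
    (X : D.Val (Q × A)) : Nonempty ((D.res (slice P a)).obj ((D.res (f.prod (𝟭 A))).obj X) ≅
      (D.res f).obj ((D.res (slice Q a)).obj X)) :=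
  ⟨((D.resComp (slice P a) (f.prod (𝟭 A))).app X).symm ≪≫ (D.resComp f (slice Q a)).app X⟩

lemma cexProp_iff (Y : D.Val (Pos.{w} Chain × A)) : D.cexProp.prop (op (Cat.of A)) Y ↔
    ∀ a : A, IsEx ((D.res (slice _ a)).obj Y) := by
  constructor
  · intro h a
    exact ⟨fun k hk => (h.1 k hk a).of_iso (D.resObjIso (f := Pos.map k) (g := slice _ a)
      (Functor.hext (fun _ => rfl) fun _ _ _ => HEq.rfl) _), fun p hp => (h.2 p hp a).of_iso
      (evRes (slice _ a) (Pos.of p) Y)⟩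
  · intro h
    exact ⟨fun k hk a => ((h a).1 k hk).of_iso (D.resObjIso (f := Pos.map k) (g := slice _ a)
      (Functor.hext (fun _ => rfl) fun _ _ _ => HEq.rfl) _).symm, fun p hp a => ((h a).2 p hp).of_iso
      (evRes (slice _ a) (Pos.of p) Y).symm⟩

lemma cexProp_iff' (hD : D.IsStableDerivator) (Y : D.Val (Pos.{w} Chain × A)) :
    D.cexProp.prop (op (Cat.of A)) Y ↔ IsRKE (incl₃.prod (𝟭 A)) Y ∧
      IsLKE (incl₂.prod (𝟭 A)) ((D.res (incl₃.prod (𝟭 A))).obj Y) ∧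
      IsLKE (incl₁.prod (𝟭 A)) ((D.res (incl₂.prod (𝟭 A))).obj ((D.res (incl₃.prod (𝟭 A))).obj Y)) ∧
      IsRKE (incl₀.prod (𝟭 A)) ((D.res (incl₁.prod (𝟭 A))).obj ((D.res (incl₂.prod (𝟭 A))).obj
        ((D.res (incl₃.prod (𝟭 A))).obj Y))) := by
  have hD' := hD.toIsDerivator'
  rw [cexProp_iff, hD'.isRKE_prod_right, hD'.isRKE_prod_right, hD'.isLKE_prod_right,
    hD'.isLKE_prod_right, ← forall_and, ← forall_and, ← forall_and]
  refine forall_congr' fun a => (isEx_iff hD _).trans (and_congr Iff.rfl ?_)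
  obtain ⟨e3⟩ := slice_prod_iso incl₃ a Y
  obtain ⟨e2⟩ := slice_prod_iso incl₂ a ((D.res (incl₃.prod (𝟭 A))).obj Y)
  obtain ⟨e1⟩ := slice_prod_iso incl₁ a
    ((D.res (incl₂.prod (𝟭 A))).obj ((D.res (incl₃.prod (𝟭 A))).obj Y))
  have e2' := e2 ≪≫ (D.res incl₂).mapIso e3
  have e1' := e1 ≪≫ (D.res incl₁).mapIso e2'
  exact and_congr ⟨fun h => h.of_iso e3.symm, fun h => h.of_iso e3⟩
    (and_congr ⟨fun h => h.of_iso e2'.symm, fun h => h.of_iso e2'⟩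
      ⟨fun h => h.of_iso e1'.symm, fun h => h.of_iso e1'⟩)

variable (D) in
/-- The restriction to the source. -/
noncomputable abbrev sourceRes : D.cex ⟶ D.shift (Pos.{w} Source) :=
  D.cexProp.ι ≫ D.restr (Pos.map.{w} Source.incl)

/-- Restriction factors into four steps, each bijective on morphisms `Y ⟶ Z`: for the two right Kan
extensions because of `Z`, for the two left ones because of `Y`. -/
lemma sourceRes_bijective (hD : D.IsStableDerivator) {Y Z : D.Val (Pos.{w} Chain × A)}
    (hY : D.cexProp.prop (op (Cat.of A)) Y) (hZ : D.cexProp.prop (op (Cat.of A)) Z) :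
    Function.Bijective fun g : Y ⟶ Z => (D.res ((Pos.map.{w} Source.incl).prod (𝟭 A))).map g := by
  obtain ⟨-, hY2, hY1, -⟩ := (cexProp_iff' hD Y).1 hY
  obtain ⟨hZ3, -, -, hZ0⟩ := (cexProp_iff' hD Z).1 hZ
  have h := (hZ0 _).comp ((hY1 _).comp ((hY2 _).comp (hZ3 Y)))
  refine (Functor.bijective_map_iff (D.resComp (incl₀.prod (𝟭 A) ⋙ incl₁.prod (𝟭 A) ⋙
    incl₂.prod (𝟭 A)) (incl₃.prod (𝟭 A)) ≪≫ Functor.isoWhiskerLeft _ (D.resComp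
      (incl₀.prod (𝟭 A) ⋙ incl₁.prod (𝟭 A)) (incl₂.prod (𝟭 A)) ≪≫ Functor.isoWhiskerLeft _
        (D.resComp (incl₀.prod (𝟭 A)) (incl₁.prod (𝟭 A))))) Y Z).2 ?_
  exact h

lemma sourceRes_essSurj (hD : D.IsStableDerivator) (W : D.Val (Pos.{w} Source × A)) :
    ∃ Y : D.Val (Pos.{w} Chain × A), D.cexProp.prop (op (Cat.of A)) Y ∧
      Nonempty ((D.res ((Pos.map.{w} Source.incl).prod (𝟭 A))).obj Y ≅ W) := by
  have hD' := hD.toIsDerivator'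
  obtain ⟨W1, h1, ⟨e1⟩⟩ := hD'.exists_isRKE (incl₀.{w}.prod (𝟭 A)) W
  obtain ⟨W2, h2, ⟨e2⟩⟩ := hD'.exists_isLKE (incl₁.{w}.prod (𝟭 A)) W1
  obtain ⟨W3, h3, ⟨e3⟩⟩ := hD'.exists_isLKE (incl₂.{w}.prod (𝟭 A)) W2
  obtain ⟨Y, h4, ⟨e4⟩⟩ := hD'.exists_isRKE (incl₃.{w}.prod (𝟭 A)) W3
  have e3' := (D.res (incl₂.prod (𝟭 A))).mapIso e4 ≪≫ e3
  have e2' := (D.res (incl₁.prod (𝟭 A))).mapIso e3' ≪≫ e2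
  have e1' := (D.res (incl₀.prod (𝟭 A))).mapIso e2' ≪≫ e1
  refine ⟨Y, (cexProp_iff' hD Y).2 ⟨h4, h3.of_iso e4.symm, h2.of_iso e3'.symm, h1.of_iso e2'.symm⟩,
    ⟨?_ ≪≫ e1'⟩⟩
  exact (D.resComp (incl₀.prod (𝟭 A) ⋙ incl₁.prod (𝟭 A) ⋙
    incl₂.prod (𝟭 A)) (incl₃.prod (𝟭 A)) ≪≫ Functor.isoWhiskerLeft _ (D.resComp
      (incl₀.prod (𝟭 A) ⋙ incl₁.prod (𝟭 A)) (incl₂.prod (𝟭 A)) ≪≫ Functor.isoWhiskerLeft _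
        (D.resComp (incl₀.prod (𝟭 A)) (incl₁.prod (𝟭 A))))).app Y

lemma sourceRes_isEquivalence (hD : D.IsStableDerivator) (A : Cat.{w, w}ᵒᵖ) :
    ((D.sourceRes).app A).toFunctor.IsEquivalence where
  faithful := ⟨fun {Y Z} f g h => ObjectProperty.hom_ext _
    ((sourceRes_bijective hD (A := A.unop) Y.property Z.property).1 h)⟩
  full := ⟨fun {Y Z} f => by
    obtain ⟨g, hg⟩ := (sourceRes_bijective hD (A := A.unop) Y.property Z.property).2 f
    exact ⟨ObjectProperty.homMk g, hg⟩⟩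
  essSurj := ⟨fun W => by
    obtain ⟨Y, hY, ⟨e⟩⟩ := sourceRes_essSurj hD (A := A.unop) W
    exact ⟨⟨Y, hY⟩, ⟨e⟩⟩⟩

/-- Stability is transported from the shift of `D` by the source, since restriction to the source is
an equivalence at every category. -/
lemma IsStableDerivator.cex (hD : D.IsStableDerivator) : D.cex.IsStableDerivator :=
  have := sourceRes_isEquivalence hD
  IsStableDerivator.of_equivalence D.sourceRes (hD.shift (Pos.{w} Source))

lemma exists_equivalence_source (hD : D.IsStableDerivator) :
    ∃ e : D.cex ≌ D.shift (Pos.{w} Source),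
      e.hom = D.cexProp.ι ≫ D.restr (Pos.map.{w} Source.incl) :=
  have := sourceRes_isEquivalence hD
  CatTrans.exists_equivalence D.sourceRes

end Prederivator

/-! ### Diagrams determined by one vertex, suspension squares, comparisons -/

namespace Prederivator
variable {D E : Prederivator.{w, v, u}}

/-! ### Diagrams which are determined by their initial value -/

instance sectR_full {J : Type} [Preorder J] (b : Pos.{w} J) (A : Type w) [Category.{w} A] :
    (Prod.sectR b A).Full := ⟨fun g => ⟨g.2, Prod.ext (Subsingleton.elim _ _) rfl⟩⟩

instance sectR_faithful {J : Type} [Preorder J] (b : Pos.{w} J) (A : Type w) [Category.{w} A] :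
    (Prod.sectR b A).Faithful := ⟨fun {_ _ f g} h => by have := congrArg Prod.snd h; exact this⟩

section
variable {J : Type} [PartialOrder J] (b t : J)

variable (E) in
/-- The diagrams which vanish at all objects different from `b` and `t` and which are left Kan
extensions from the complement of `t`. -/
def starProp : (E.shift (Pos.{w} J)).ObjectProperty where
  prop A Y := ∀ a : A.unop,
    IsLKE (Pos.map (OrderHom.Subtype.val fun j => j ≠ t))
      ((E.res (B := Pos.{w} J × A.unop) (slice _ a)).obj Y) ∧
    ∀ j, j ≠ b → j ≠ t → IsZero (E.ev (A := Pos.{w} J × A.unop) Y (Pos.of j, a))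

instance : (E.starProp b t).IsClosedUnderMapObj where
  map_obj hY f a := ⟨(hY (f.unop.toFunctor.obj a)).1.of_iso
      (E.resObjIso (f := slice (Pos.{w} J) a) (g := (𝟭 _).prod f.unop.toFunctor)
        (prod'_const_comp _ _ _) _),
    fun j h1 h2 => ((hY (f.unop.toFunctor.obj a)).2 j h1 h2).of_iso
      (evRes ((𝟭 (Pos.{w} J)).prod f.unop.toFunctor) (Pos.of j, a) _)⟩

lemma starProp_of_iso {A : Type w} [Category.{w} A] {Y Z : E.Val (Pos.{w} J × A)} (e : Y ≅ Z)
    (h : (E.starProp b t).prop (op (Cat.of A)) Y) : (E.starProp b t).prop (op (Cat.of A)) Z :=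
  fun a => ⟨(h a).1.of_iso ((E.res _).mapIso e), fun j h1 h2 => ((h a).2 j h1 h2).of_iso
    ((E.res _).mapIso e.symm)⟩

lemma suspProp_iff (hE : E.IsDerivator') {A : Type w} [Category.{w} A] (Y : E.Val (Pos.{w} Sq × A)) :
    E.suspProp.prop (op (Cat.of A)) Y ↔ (E.starProp (0, 0) (1, 1)).prop (op (Cat.of A)) Y := by
  refine forall_congr' fun a => and_congr (hE.isCocartesian_iff _) ?_
  constructor
  · rintro ⟨h1, h2⟩ j h3 h4
    rcases Sq.cases j with rfl | rfl | rfl | rfl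
    exacts [absurd rfl h3, h2, h1, absurd rfl h4]
  · exact fun h => ⟨h _ (by decide) (by decide), h _ (by decide) (by decide)⟩

variable (hE : E.IsStableDerivator) {b t : J} (hb : ∀ j, j ≤ b → j = b) (hbt : b ≠ t)
variable {A : Type w} [Category.{w} A]
include hE hb hbt

/-- Removing `t` loses nothing since `Y` is a left Kan extension from the complement. On this
complement `Z` is a right Kan extension from `b`: by minimality of `b` no other object maps to it,
and `Z` vanishes there. -/
lemma starProp_bijective {Y Z : E.Val (Pos.{w} J × A)}
    (hY : (E.starProp b t).prop (op (Cat.of A)) Y) (hZ : (E.starProp b t).prop (op (Cat.of A)) Z) :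
    Function.Bijective fun g : Y ⟶ Z => (E.res (Prod.sectR (Pos.of b) A)).map g := by
  let u := Pos.map.{w} (OrderHom.Subtype.val fun j => j ≠ t)
  let s := Prod.sectR (Pos.of.{w} (⟨b, hbt⟩ : {j // j ≠ t})) A
  have h1 : IsLKE (u.prod (𝟭 A)) Y := hE.toIsDerivator'.isLKE_prod_right.2 fun a => (hY a).1
  have h2 : IsRKE s ((E.res (u.prod (𝟭 A))).obj Z) := hE.isRKE_of_isZero _ fun x => by
    obtain ⟨⟨j⟩, a⟩ := x
    by_cases hj : j.1 = b
    · obtain ⟨j, hj'⟩ := j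
      dsimp only at hj
      subst hj
      exact .inl ⟨a, rfl⟩
    · exact .inr ⟨fun a' => ⟨fun f => hj (hb _ (Pos.le_of_hom f.1))⟩, ((hZ a).2 j.1 hj j.2).of_iso
        (evRes (u.prod (𝟭 A)) (Pos.of j, a) Z)⟩
  refine (Functor.bijective_map_iff (E.resComp s (u.prod (𝟭 A))) Y Z).2 ?_
  exact (h2 _).comp (h1 Z)

lemma starProp_essSurj (W : E.Val A) : ∃ Y, (E.starProp b t).prop (op (Cat.of A)) Y ∧
    Nonempty ((E.res (Prod.sectR (Pos.of b) A)).obj Y ≅ W) := by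
  let u := Pos.map.{w} (OrderHom.Subtype.val fun j => j ≠ t)
  let s := Prod.sectR (Pos.of.{w} (⟨b, hbt⟩ : {j // j ≠ t})) A
  obtain ⟨W1, h1, ⟨e1⟩⟩ := hE.toIsDerivator'.exists_isRKE s W
  obtain ⟨Y, h2, ⟨e2⟩⟩ := hE.toIsDerivator'.exists_isLKE (u.prod (𝟭 A)) W1
  refine ⟨Y, fun a => ⟨hE.toIsDerivator'.isLKE_prod_right.1 h2 a, fun j h3 h4 => ?_⟩,
    ⟨(E.resComp s (u.prod (𝟭 A))).app Y ≪≫ (E.res s).mapIso e2 ≪≫ e1⟩⟩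
  exact (hE.isZero_of_isRKE (h1.of_iso e2.symm) (t := (Pos.of ⟨j, h4⟩, a)) fun a' => ⟨fun f => h3
    (hb _ (Pos.le_of_hom f.1))⟩).of_iso (evRes (u.prod (𝟭 A)) (Pos.of ⟨j, h4⟩, a) Y).symm

end

/-! ### Existence of suspension squares -/

instance : E.suspProp.IsClosedUnderMapObj where
  map_obj hY f a := ⟨(hY (f.unop.toFunctor.obj a)).1.of_iso
      (E.resObjIso (f := slice (Pos.{w} Sq) a) (g := (𝟭 _).prod f.unop.toFunctor)
        (prod'_const_comp _ _ _) _),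
    (hY (f.unop.toFunctor.obj a)).2.1.of_iso
      (evRes ((𝟭 (Pos.{w} Sq)).prod f.unop.toFunctor) (Pos.of (1, 0), a) _),
    (hY (f.unop.toFunctor.obj a)).2.2.of_iso
      (evRes ((𝟭 (Pos.{w} Sq)).prod f.unop.toFunctor) (Pos.of (0, 1), a) _)⟩

lemma Sq.eq_of_le (j : Sq) (h : j ≤ (0, 0)) : j = (0, 0) := by
  revert j; decide

lemma suspProp_bijective (hE : E.IsStableDerivator) {A : Type w} [Category.{w} A]
    {Y Z : E.Val (Pos.{w} Sq × A)} (hY : E.suspProp.prop (op (Cat.of A)) Y)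
    (hZ : E.suspProp.prop (op (Cat.of A)) Z) :
    Function.Bijective fun g : Y ⟶ Z => (E.res (Prod.sectR (Pos.of (0, 0)) A)).map g :=
  starProp_bijective hE Sq.eq_of_le (by decide) ((suspProp_iff hE.toIsDerivator' _).1 hY)
    ((suspProp_iff hE.toIsDerivator' _).1 hZ)

/-- Evaluation at `(0, 0)` is a levelwise equivalence from suspension squares to `E`. A
pseudonatural inverse is a functorial choice, and its counit is the identification of the corner. -/
lemma IsStableDerivator.nonempty_suspension (hE : E.IsStableDerivator) : Nonempty (Suspension E) := by
  let τ : E.suspProp.fullsubcategory ⟶ E := E.suspProp.ι ≫ E.eval (Pos.of (0, 0))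
  have (A : Cat.{w, w}ᵒᵖ) : (τ.app A).toFunctor.IsEquivalence :=
    { faithful := ⟨fun {Y Z} f g h => ObjectProperty.hom_ext _
        ((suspProp_bijective hE (A := A.unop) Y.property Z.property).1 h)⟩
      full := ⟨fun {Y Z} f => by
        obtain ⟨g, hg⟩ := (suspProp_bijective hE (A := A.unop) Y.property Z.property).2 f
        exact ⟨ObjectProperty.homMk g, hg⟩⟩
      essSurj := ⟨fun W => by
        obtain ⟨Y, hY, ⟨e⟩⟩ := starProp_essSurj hE Sq.eq_of_le (t := (1, 1)) (by decide)
          (A := A.unop) W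
        exact ⟨⟨Y, (suspProp_iff hE.toIsDerivator' _).2 hY⟩, ⟨e⟩⟩⟩ }
  exact ⟨{
    square := CatTrans.levelInv τ ≫ E.suspProp.ι
    prop A X := (((CatTrans.levelInv τ).app A).toFunctor.obj X).property
    base := α_ _ _ _ ≪≫ CatTrans.levelInvCounit τ }⟩

/-! ### Existence of comparisons -/

/-- Both composites take values in suspension squares, on which evaluation at `(0, 0)` is fully
faithful. The isomorphism forced by the two identifications of the corner therefore lifts, and the
lift satisfies the required compatibility. -/
lemma exists_comparison (hE : E.IsStableDerivator) (F : D ⟶ E) (σ : Suspension D)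
    (τ : Suspension E)
    (hF : ∀ (A : Cat.{w, w}ᵒᵖ) (Y : (D.shift (Pos.{w} Sq)).obj A), D.suspProp.prop A Y →
      E.suspProp.prop A (((shiftMap F (Pos.{w} Sq)).app A).toFunctor.obj Y)) :
    Nonempty (Comparison F σ τ) := by
  obtain ⟨c, hc⟩ := CatTrans.exists_iso_whiskerRight (e := E.eval (Pos.of (0, 0))) E.suspProp
    (fun A M N hM hN => suspProp_bijective hE (A := A.unop) hM hN)
    (η := σ.square ≫ shiftMap F (Pos.{w} Sq)) (θ := F ≫ τ.square)
    (fun A X => hF A _ (σ.prop A X)) (fun A X => τ.prop A _)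
    (α_ _ _ _ ≪≫ whiskerLeftIso σ.square (evalCell (Pos.of (0, 0)) F).symm ≪≫ (α_ _ _ _).symm ≪≫
      whiskerRightIso σ.base F ≪≫ λ_ F ≪≫ (ρ_ F).symm ≪≫ whiskerLeftIso F τ.base.symm ≪≫
      (α_ _ _ _).symm)
  refine ⟨⟨c, ?_⟩⟩
  simp only [pasteSq, Iso.trans_hom, Iso.symm_hom, whiskerLeftIso_hom, whiskerRightIso_hom,
    Category.assoc] at hc ⊢
  rw [hc]
  simp

end Prederivator

namespace Prederivator

/-! ### Compatible pairs of isomorphisms -/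

section
variable {X₀ X₁ X₂ X₃ Y₀ Y₁ Y₂ Y₃ : Prederivator.{w, v, u}} {F₀ : X₀ ⟶ Y₀} {F₁ : X₁ ⟶ Y₁}
  {F₂ : X₂ ⟶ Y₂} {F₃ : X₃ ⟶ Y₃} {s s₁ s₂ : X₀ ⟶ X₁} {s' s₁' s₂' : Y₀ ⟶ Y₁} {t t₁ : X₁ ⟶ X₂}
  {t' t₁' : Y₁ ⟶ Y₂} {r : X₂ ⟶ X₃} {r' : Y₂ ⟶ Y₃}

/-- The isomorphisms `m` and `m'` are compatible with the squares `a` and `b`. -/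
def Compat (a : s ≫ F₁ ≅ F₀ ≫ s') (b : s₁ ≫ F₁ ≅ F₀ ≫ s₁') (m : s ≅ s₁) (m' : s' ≅ s₁') : Prop :=
  m.hom ▷ F₁ ≫ b.hom = a.hom ≫ F₀ ◁ m'.hom

/-- The identity square. -/
def idSq (F : X₀ ⟶ Y₀) : 𝟙 X₀ ≫ F ≅ F ≫ 𝟙 Y₀ := λ_ F ≪≫ (ρ_ F).symm

/-- Compatible pairs contain identities, are closed under composition, inversion and whiskering, and
contain associators and left unitors. The compatibility of `ψ` and `θ` is assembled from that of
their constituents by these rules. -/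
lemma Compat.refl (a : s ≫ F₁ ≅ F₀ ≫ s') : Compat a a (Iso.refl _) (Iso.refl _) := by
  simp [Compat]

lemma Compat.trans {a : s ≫ F₁ ≅ F₀ ≫ s'} {b : s₁ ≫ F₁ ≅ F₀ ≫ s₁'} {c : s₂ ≫ F₁ ≅ F₀ ≫ s₂'}
    {m : s ≅ s₁} {m' : s' ≅ s₁'} {n : s₁ ≅ s₂} {n' : s₁' ≅ s₂'} (h : Compat a b m m')
    (h' : Compat b c n n') : Compat a c (m ≪≫ n) (m' ≪≫ n') := by
  unfold Compat at *
  simp only [Iso.trans_hom, comp_whiskerRight, Bicategory.whiskerLeft_comp, Category.assoc]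
  rw [h', reassoc_of% h]

lemma Compat.symm {a : s ≫ F₁ ≅ F₀ ≫ s'} {b : s₁ ≫ F₁ ≅ F₀ ≫ s₁'} {m : s ≅ s₁} {m' : s' ≅ s₁'}
    (h : Compat a b m m') : Compat b a m.symm m'.symm := by
  unfold Compat at *
  have h' := m.inv ▷ F₁ ≫= h =≫ F₀ ◁ m'.inv
  simp only [Category.assoc, inv_hom_whiskerRight_assoc, whiskerLeft_hom_inv, Category.comp_id] at h'
  exact h'.symm

lemma Compat.whiskerLeft (a : s ≫ F₁ ≅ F₀ ≫ s') {b : t ≫ F₂ ≅ F₁ ≫ t'} {b₁ : t₁ ≫ F₂ ≅ F₁ ≫ t₁'}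
    {m : t ≅ t₁} {m' : t' ≅ t₁'} (h : Compat b b₁ m m') :
    Compat (pasteSq a b) (pasteSq a b₁) (whiskerLeftIso s m) (whiskerLeftIso s' m') := by
  unfold Compat at *
  have h' := congrArg (fun x => s ◁ x) h
  simp only [Bicategory.whiskerLeft_comp] at h'
  simp only [pasteSq, Iso.trans_hom, Iso.symm_hom, whiskerLeftIso_hom, whiskerRightIso_hom,
    Category.assoc, whisker_assoc, Iso.inv_hom_id_assoc]
  rw [reassoc_of% h', ← associator_naturality_right, ← whisker_exchange_assoc,
    associator_inv_naturality_right_assoc]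

lemma Compat.whiskerRight {a : s ≫ F₁ ≅ F₀ ≫ s'} {a₁ : s₁ ≫ F₁ ≅ F₀ ≫ s₁'}
    (b : t ≫ F₂ ≅ F₁ ≫ t') {m : s ≅ s₁} {m' : s' ≅ s₁'} (h : Compat a a₁ m m') :
    Compat (pasteSq a b) (pasteSq a₁ b) (whiskerRightIso m t) (whiskerRightIso m' t') := by
  unfold Compat at *
  have h' := congrArg (fun x => x ▷ t') h
  simp only [comp_whiskerRight] at h'
  simp only [pasteSq, Iso.trans_hom, Iso.symm_hom, whiskerLeftIso_hom, whiskerRightIso_hom,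
    Category.assoc]
  rw [associator_naturality_left_assoc, ← whisker_exchange_assoc,
    associator_inv_naturality_left_assoc, reassoc_of% h']
  simp

lemma compat_assoc (a : s ≫ F₁ ≅ F₀ ≫ s') (b : t ≫ F₂ ≅ F₁ ≫ t') (c : r ≫ F₃ ≅ F₂ ≫ r') :
    Compat (pasteSq (pasteSq a b) c) (pasteSq a (pasteSq b c)) (α_ _ _ _) (α_ _ _ _) := by
  unfold Compat
  simp [pasteSq]

lemma compat_leftUnitor (a : s ≫ F₁ ≅ F₀ ≫ s') :
    Compat (pasteSq (idSq F₀) a) a (λ_ s) (λ_ s') := by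
  unfold Compat
  simp [pasteSq, idSq]

end

end Prederivator

/-! ### Transformations into and out of iterated shifts -/

section
universe w₁ w₂ w₃ w₄ v₁ v₂ v₃ v₄ u₁ u₂ u₃ u₄
variable {B : Type u₁} [Bicategory.{w₁, v₁} B] {C : Type u₂} [Bicategory.{w₂, v₂} C]
  {E : Type u₃} [Bicategory.{w₃, v₃} E] {B' : Type u₄} [Bicategory.{w₄, v₄} B']

/-- The transformation with components `D (τ_a)`, with values in an iterated composition. -/
def postcompTransR {P : B ⥤ᵖ C} {R : B ⥤ᵖ B'} {Q : B' ⥤ᵖ C} (τ : P ⟶ R.comp Q) (D : C ⥤ᵖ E) :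
    P.comp D ⟶ R.comp (Q.comp D) where
  app a := D.map (τ.app a)
  naturality f := (D.mapComp _ _).symm ≪≫ D.map₂Iso (τ.naturality f) ≪≫ D.mapComp _ _
  naturality_naturality α := (postcompTrans τ D).naturality_naturality α
  naturality_id a := by
    refine Eq.trans ?_ ((postcompTrans τ D).naturality_id a)
    refine congrArg (fun x => _ ≫ D.map (τ.app a) ◁ x) ?_
    change D.map₂ (Q.map₂ (R.mapId a).hom) ≫ D.map₂ (Q.mapId _).hom ≫ (D.mapId _).hom =
      D.map₂ (Q.map₂ (R.mapId a).hom ≫ (Q.mapId _).hom) ≫ (D.mapId _).hom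
    rw [D.map₂_comp, Category.assoc]
  naturality_comp {a b c} f g := by
    refine Eq.trans ?_ ((postcompTrans τ D).naturality_comp f g)
    refine congrArg (fun x => _ ≫ D.map (τ.app a) ◁ x) ?_
    change D.map₂ (Q.map₂ (R.mapComp f g).hom) ≫ D.map₂ (Q.mapComp _ _).hom ≫ (D.mapComp _ _).hom =
      D.map₂ (Q.map₂ (R.mapComp f g).hom ≫ (Q.mapComp _ _).hom) ≫ (D.mapComp _ _).hom
    rw [D.map₂_comp, Category.assoc]

/-- The transformation with components `D (τ_a)`, on an iterated composition. -/
def postcompTransL {P : B ⥤ᵖ C} {R : B ⥤ᵖ B'} {Q : B' ⥤ᵖ C} (τ : R.comp Q ⟶ P) (D : C ⥤ᵖ E) :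
    R.comp (Q.comp D) ⟶ P.comp D where
  app a := D.map (τ.app a)
  naturality f := (D.mapComp _ _).symm ≪≫ D.map₂Iso (τ.naturality f) ≪≫ D.mapComp _ _
  naturality_naturality α := (postcompTrans τ D).naturality_naturality α
  naturality_id a := by
    refine ((postcompTrans τ D).naturality_id a).trans ?_
    refine congrArg (fun x => x ▷ D.map (τ.app a) ≫ _) ?_
    change D.map₂ (Q.map₂ (R.mapId a).hom ≫ (Q.mapId _).hom) ≫ (D.mapId _).hom =
      D.map₂ (Q.map₂ (R.mapId a).hom) ≫ D.map₂ (Q.mapId _).hom ≫ (D.mapId _).hom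
    rw [D.map₂_comp, Category.assoc]
  naturality_comp {a b c} f g := by
    refine ((postcompTrans τ D).naturality_comp f g).trans ?_
    refine congrArg (fun x => x ▷ D.map (τ.app c) ≫ _) ?_
    change D.map₂ (Q.map₂ (R.mapComp f g).hom ≫ (Q.mapComp _ _).hom) ≫ (D.mapComp _ _).hom =
      D.map₂ (Q.map₂ (R.mapComp f g).hom) ≫ D.map₂ (Q.mapComp _ _).hom ≫ (D.mapComp _ _).hom
    rw [D.map₂_comp, Category.assoc]

/-- The modification whose components are the structure isomorphisms of `F` at `τ_a`. -/
def commSqR {P : B ⥤ᵖ C} {R : B ⥤ᵖ B'} {Q : B' ⥤ᵖ C} (τ : P ⟶ R.comp Q) {D D' : C ⥤ᵖ E}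
    (F : D ⟶ D') : postcompTransR τ D ≫ precompTrans R (precompTrans Q F) ≅
      precompTrans P F ≫ postcompTransR τ D' :=
  Pseudofunctor.StrongTrans.isoMk (fun a => F.naturality (τ.app a)) fun f =>
    (commSq τ F).hom.as.naturality f

/-- The modification whose components are the structure isomorphisms of `F` at `τ_a`. -/
def commSqL {P : B ⥤ᵖ C} {R : B ⥤ᵖ B'} {Q : B' ⥤ᵖ C} (τ : R.comp Q ⟶ P) {D D' : C ⥤ᵖ E}
    (F : D ⟶ D') : postcompTransL τ D ≫ precompTrans P F ≅
      precompTrans R (precompTrans Q F) ≫ postcompTransL τ D' :=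
  Pseudofunctor.StrongTrans.isoMk (fun a => F.naturality (τ.app a)) fun f =>
    (commSq τ F).hom.as.naturality f

/-- The restriction of `F` to full subfunctors which `F` respects. -/
def fullsubMapR {R : B ⥤ᵖ B'} {D : B ⥤ᵖ Cat.{v₂, u₂}} {D' : B' ⥤ᵖ Cat.{v₂, u₂}} (F : D ⟶ R.comp D')
    (P : D.ObjectProperty) (P' : D'.ObjectProperty) [P.IsClosedUnderMapObj]
    [P'.IsClosedUnderMapObj]
    (h : ∀ a M, P.prop a M → P'.prop (R.obj a) ((F.app a).toFunctor.obj M)) :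
    P.fullsubcategory ⟶ R.comp P'.fullsubcategory where
  app a := ((P'.prop (R.obj a)).lift ((P.prop a).ι ⋙ (F.app a).toFunctor)
    (fun M => h a M.obj M.property)).toCatHom
  naturality {a b} f := Cat.Hom.isoMk (((P'.prop (R.obj b)).fullyFaithfulι.whiskeringRight _).preimageIso
    (Functor.isoWhiskerLeft (P.prop a).ι (Cat.Hom.toNatIso (F.naturality f))))
  naturality_naturality α := Cat.Hom₂.ext (NatTrans.ext (funext fun M =>
    ObjectProperty.hom_ext _
      (congrArg (fun t => t.toNatTrans.app M.obj) (F.naturality_naturality α))))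
  naturality_id a := Cat.Hom₂.ext (NatTrans.ext (funext fun M =>
    ObjectProperty.hom_ext _
      (congrArg (fun t => t.toNatTrans.app M.obj) (F.naturality_id a))))
  naturality_comp f g := Cat.Hom₂.ext (NatTrans.ext (funext fun M =>
    ObjectProperty.hom_ext _
      (congrArg (fun t => t.toNatTrans.app M.obj) (F.naturality_comp f g))))

/-- The restriction of an invertible modification to full subfunctors. -/
def fullsubIsoR {R : B ⥤ᵖ B'} {D D₂ : B ⥤ᵖ Cat.{v₂, u₂}} {D₁ D' : B' ⥤ᵖ Cat.{v₂, u₂}}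
    {F₁ : D ⟶ R.comp D₁} {G₁ : D₁ ⟶ D'} {F₂ : D ⟶ D₂}
    {G₂ : D₂ ⟶ R.comp D'} (e : F₁ ≫ precompTrans R G₁ ≅ F₂ ≫ G₂) (P : D.ObjectProperty)
    (P₁ : D₁.ObjectProperty)
    (P₂ : D₂.ObjectProperty) (P' : D'.ObjectProperty) [P.IsClosedUnderMapObj]
    [P₁.IsClosedUnderMapObj] [P₂.IsClosedUnderMapObj] [P'.IsClosedUnderMapObj] (hF₁) (hG₁) (hF₂)
    (hG₂) :
    fullsubMapR F₁ P P₁ hF₁ ≫ precompTrans R (fullsubMap G₁ P₁ P' hG₁) ≅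
      fullsubMap F₂ P P₂ hF₂ ≫ fullsubMapR G₂ P₂ P' hG₂ :=
  Pseudofunctor.StrongTrans.isoMk
    (fun a => Cat.Hom.isoMk (((P'.prop (R.obj a)).fullyFaithfulι.whiskeringRight _).preimageIso
      (Functor.isoWhiskerLeft (P.prop a).ι (Cat.Hom.toNatIso
        { hom := e.hom.as.app a
          inv := e.inv.as.app a
          hom_inv_id := congrArg (fun t => t.as.app a) e.hom_inv_id
          inv_hom_id := congrArg (fun t => t.as.app a) e.inv_hom_id }))))
    (fun f => Cat.Hom₂.ext (NatTrans.ext (funext fun M => ObjectProperty.hom_ext _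
      (congrArg (fun t => t.toNatTrans.app M.obj) (e.hom.as.naturality f)))))

end

section
variable {Q Q' I I' J A A' : Type w} [Category.{w} Q] [Category.{w} Q'] [Category.{w} J]
  [Category.{w} I] [Category.{w} I'] [Category.{w} A] [Category.{w} A']

/-- The functor `(p, x, a) ↦ (c (p, x), f a)`. -/
abbrev actFun (c : Q' × J ⥤ Q) (f : A' ⥤ A) : Q' × (J × A') ⥤ Q × A where
  obj x := (c.obj (x.1, x.2.1), f.obj x.2.2)
  map {x y} g := (c.map (X := (x.1, x.2.1)) (Y := (y.1, y.2.1)) (g.1, g.2.1), f.map g.2.2)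
  map_id _ := Prod.ext (c.map_id _) (f.map_id _)
  map_comp {x y z} g h := Prod.ext
    (c.map_comp (X := (x.1, x.2.1)) (Y := (y.1, y.2.1)) (Z := (z.1, z.2.1)) (g.1, g.2.1) (h.1, h.2.1))
    (f.map_comp _ _)

/-- The functor `(x, a) ↦ (c₂ x, c₁ x, f a)`. -/
abbrev diagFun (c₁ : J ⥤ I) (c₂ : J ⥤ I') (f : A' ⥤ A) : J × A' ⥤ I' × (I × A) where
  obj x := (c₂.obj x.1, c₁.obj x.1, f.obj x.2)
  map g := (c₂.map g.1, c₁.map g.1, f.map g.2)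
  map_id _ := Prod.ext (c₂.map_id _) (Prod.ext (c₁.map_id _) (f.map_id _))
  map_comp _ _ := Prod.ext (c₂.map_comp _ _) (Prod.ext (c₁.map_comp _ _) (f.map_comp _ _))

/-- The transformation with components `(p, x, a) ↦ (c (p, x), a)`. -/
def prodOpAct (c : Q' × J ⥤ Q) : prodOp Q ⟶ (prodOp J).comp (prodOp Q') where
  app A := (actFun c (𝟭 A.unop)).toCatHom.op
  naturality g := (Cat.Hom.isoMk (Iso.refl (actFun c g.unop.toFunctor))).op2
  naturality_naturality η := by
    refine congrArg op2 (Cat.Hom₂.ext (NatTrans.ext (funext fun X => Prod.ext ?_ ?_)))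
    · change 𝟙 (c.obj (X.1, X.2.1)) ≫ 𝟙 _ = 𝟙 _ ≫ c.map (𝟙 (X.1, X.2.1))
      exact (congrArg (fun t => 𝟙 _ ≫ t) (c.map_id _)).symm
    · change η.unop2.toNatTrans.app X.2.2 ≫ 𝟙 _ = 𝟙 _ ≫ η.unop2.toNatTrans.app X.2.2
      simp only [Category.comp_id, Category.id_comp]
  naturality_id A := by
    refine congrArg op2 (Cat.Hom₂.ext (NatTrans.ext (funext fun X => Prod.ext ?_ ?_)))
    · change 𝟙 (c.obj (X.1, X.2.1)) ≫ c.map (X := (X.1, X.2.1)) (Y := (X.1, X.2.1))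
        (𝟙 X.1 ≫ 𝟙 X.1, 𝟙 X.2.1 ≫ 𝟙 X.2.1) =
        𝟙 (c.obj (X.1, X.2.1)) ≫ 𝟙 (c.obj (X.1, X.2.1)) ≫ 𝟙 (c.obj (X.1, X.2.1))
      simp only [Category.comp_id]
      exact (Category.id_comp _).trans (c.map_id _)
    · change 𝟙 X.2.2 ≫ 𝟙 X.2.2 ≫ 𝟙 X.2.2 = 𝟙 _ ≫ 𝟙 _ ≫ 𝟙 X.2.2
      simp only [Category.comp_id]
  naturality_comp g h := by
    refine congrArg op2 (Cat.Hom₂.ext (NatTrans.ext (funext fun X => Prod.ext ?_ ?_)))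
    · change 𝟙 (c.obj (X.1, X.2.1)) ≫ c.map (X := (X.1, X.2.1)) (Y := (X.1, X.2.1))
        (𝟙 X.1 ≫ 𝟙 X.1, 𝟙 X.2.1 ≫ 𝟙 X.2.1) =
        𝟙 (c.obj (X.1, X.2.1)) ≫ 𝟙 _ ≫ 𝟙 _ ≫ 𝟙 _ ≫ 𝟙 _ ≫ 𝟙 _
      simp only [Category.comp_id]
      exact (Category.id_comp _).trans (c.map_id _)
    · change 𝟙 (g.unop.toFunctor.obj (h.unop.toFunctor.obj X.2.2)) ≫ 𝟙 _ ≫ 𝟙 _ = 𝟙 _ ≫ 𝟙 _ ≫ g.unop.toFunctor.map (𝟙 _) ≫ 𝟙 _ ≫ 𝟙 _ ≫ 𝟙 _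
      simp only [Category.comp_id, Category.id_comp]
      exact (g.unop.toFunctor.map_id _).symm

/-- The transformation with components `(x, a) ↦ (c₂ x, c₁ x, a)`. -/
def prodOpDiag (c₁ : J ⥤ I) (c₂ : J ⥤ I') : (prodOp I).comp (prodOp I') ⟶ prodOp J where
  app A := (diagFun c₁ c₂ (𝟭 A.unop)).toCatHom.op
  naturality g := (Cat.Hom.isoMk (Iso.refl (diagFun c₁ c₂ g.unop.toFunctor))).op2
  naturality_naturality η := by
    refine congrArg op2 (Cat.Hom₂.ext (NatTrans.ext (funext fun X => Prod.ext ?_ (Prod.ext ?_ ?_))))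
    · change 𝟙 (c₂.obj X.1) ≫ 𝟙 _ = 𝟙 _ ≫ c₂.map (𝟙 X.1)
      exact (congrArg (fun t => 𝟙 _ ≫ t) (c₂.map_id _)).symm
    · change 𝟙 (c₁.obj X.1) ≫ 𝟙 _ = 𝟙 _ ≫ c₁.map (𝟙 X.1)
      exact (congrArg (fun t => 𝟙 _ ≫ t) (c₁.map_id _)).symm
    · change η.unop2.toNatTrans.app X.2 ≫ 𝟙 _ = 𝟙 _ ≫ η.unop2.toNatTrans.app X.2
      simp only [Category.comp_id, Category.id_comp]
  naturality_id A := by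
    refine congrArg op2 (Cat.Hom₂.ext (NatTrans.ext (funext fun X => Prod.ext ?_ (Prod.ext ?_ ?_))))
    · change 𝟙 (c₂.obj X.1) ≫ c₂.map (𝟙 X.1) = (𝟙 (c₂.obj X.1) ≫ 𝟙 (c₂.obj X.1)) ≫ 𝟙 (c₂.obj X.1) ≫ 𝟙 (c₂.obj X.1)
      simp only [Category.comp_id]
      exact (Category.id_comp _).trans (c₂.map_id _)
    · change 𝟙 (c₁.obj X.1) ≫ c₁.map (𝟙 X.1) = (𝟙 (c₁.obj X.1) ≫ 𝟙 (c₁.obj X.1)) ≫ 𝟙 (c₁.obj X.1) ≫ 𝟙 (c₁.obj X.1)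
      simp only [Category.comp_id]
      exact (Category.id_comp _).trans (c₁.map_id _)
    · change 𝟙 X.2 ≫ 𝟙 X.2 = (𝟙 X.2 ≫ 𝟙 X.2) ≫ 𝟙 X.2 ≫ 𝟙 X.2
      simp only [Category.comp_id]
  naturality_comp g h := by
    refine congrArg op2 (Cat.Hom₂.ext (NatTrans.ext (funext fun X => Prod.ext ?_ (Prod.ext ?_ ?_))))
    · change 𝟙 (c₂.obj X.1) ≫ c₂.map (𝟙 X.1) =
        (𝟙 (c₂.obj X.1) ≫ 𝟙 (c₂.obj X.1)) ≫ 𝟙 _ ≫ 𝟙 _ ≫ 𝟙 _ ≫ 𝟙 _ ≫ 𝟙 _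
      simp only [Category.comp_id]
      exact (Category.id_comp _).trans (c₂.map_id _)
    · change 𝟙 (c₁.obj X.1) ≫ c₁.map (𝟙 X.1) =
        (𝟙 (c₁.obj X.1) ≫ 𝟙 (c₁.obj X.1)) ≫ 𝟙 _ ≫ 𝟙 _ ≫ 𝟙 _ ≫ 𝟙 _ ≫ 𝟙 _
      simp only [Category.comp_id]
      exact (Category.id_comp _).trans (c₁.map_id _)
    · change 𝟙 _ ≫ 𝟙 _ = (𝟙 _ ≫ 𝟙 _) ≫ 𝟙 _ ≫ g.unop.toFunctor.map (𝟙 _) ≫ 𝟙 _ ≫ 𝟙 _ ≫ 𝟙 _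
      simp only [Category.comp_id, Category.id_comp]
      exact (g.unop.toFunctor.map_id _).symm

end

namespace CatTrans

section
universe w₁ v₁ u₁ v₂ u₂
variable {B : Type u₁} [Bicategory.{w₁, v₁} B] {F G : B ⥤ᵖ Cat.{v₂, u₂}} {P : G.ObjectProperty}
  [P.IsClosedUnderMapObj]

/-- Construct an invertible modification between transformations to a full subfunctor. -/
def mkFullIso {η θ : F ⟶ P.fullsubcategory}
    (φ : ∀ (a : B) (M : F.obj a), ((η.app a).toFunctor.obj M).obj ≅ ((θ.app a).toFunctor.obj M).obj)
    (h1 : ∀ (a : B) (M N : F.obj a) (g : M ⟶ N), ((η.app a).toFunctor.map g).hom ≫ (φ a N).hom =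
      (φ a M).hom ≫ ((θ.app a).toFunctor.map g).hom)
    (h2 : ∀ (a b : B) (f : a ⟶ b) (M : F.obj a), (φ b ((F.map f).toFunctor.obj M)).hom ≫
      (natApp θ f M).hom.hom = (natApp η f M).hom.hom ≫ (G.map f).toFunctor.map (φ a M).hom) :
    η ≅ θ :=
  mkModIso (fun a M => (P.prop a).isoMk (φ a M)) (fun a M N g => ObjectProperty.hom_ext _ (h1 a M N g))
    (fun a b f M => ObjectProperty.hom_ext _ (h2 a b f M))

end
end CatTrans

/-! ### Restrictions and actions on exact diagrams -/

namespace Prederivator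
open CatTrans
variable {D E : Prederivator.{w, v, u}}

/-! ### Composition of restrictions -/

section
variable {P A B Q P' Q' : Type w} [Category.{w} P] [Category.{w} A] [Category.{w} B]
  [Category.{w} Q] [Category.{w} P'] [Category.{w} Q']

variable (D) in
-- The pasting law solved for the pasted square. It is the modification axiom for the isomorphism
-- between composed restrictions and the restriction along the composite.
lemma resComp_inv_bc {p : P ⥤ A} {u : A ⥤ B} {q : P ⥤ Q} {b : Q ⥤ B} (α : p ⋙ u ⟶ q ⋙ b)
    {p' : P' ⥤ P} {q' : P' ⥤ Q'} {b' : Q' ⥤ Q}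
    (β : p' ⋙ q ⟶ q' ⋙ b') (γ : (p' ⋙ p) ⋙ u ⟶ q' ⋙ b' ⋙ b)
    (h : γ = Functor.whiskerLeft p' α ≫ Functor.whiskerRight β b) (X : D.Val B) :
    (D.resComp p' p).inv.app ((D.res u).obj X) ≫ D.bc γ X =
      ((D.res p').map (D.bc α X) ≫ D.bc β ((D.res b).obj X)) ≫
        (D.res q').map ((D.resComp b' b).inv.app X) := by
  rw [← cancel_epi ((D.resComp p' p).hom.app ((D.res u).obj X)), Iso.hom_inv_id_app_assoc,
    ← Category.assoc, D.bc_paste α β γ h, Category.assoc, ← Functor.map_comp, Iso.hom_inv_id_app]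
  exact ((congrArg _ ((D.res q').map_id _)).trans (Category.comp_id _)).symm

lemma resComp_inv_naturality (p' : P' ⥤ P) (p : P ⥤ A) {X Y : D.Val A} (g : X ⟶ Y) :
    (D.res p').map ((D.res p).map g) ≫ (D.resComp p' p).inv.app Y =
      (D.resComp p' p).inv.app X ≫ (D.res (p' ⋙ p)).map g :=
  (D.resComp p' p).inv.naturality g

lemma resComp_inv_resNatIso (F : D ⟶ E) (p' : P' ⥤ P) (p : P ⥤ A) (X : D.Val A) :
    (valMap F P').map ((D.resComp p' p).inv.app X) ≫ (resNatIso F (p' ⋙ p) X).hom =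
      ((resNatIso F p' ((D.res p).obj X)).hom ≫ (E.res p').map (resNatIso F p X).hom) ≫
        (E.resComp p' p).inv.app ((valMap F A).obj X) := by
  have h := resNatIso_resComp F p' p X
  rw [← cancel_epi ((valMap F P').map ((D.resComp p' p).hom.app X)),
    ← Functor.map_comp_assoc, Iso.hom_inv_id_app]
  simp only [Category.assoc]
  rw [reassoc_of% h, Iso.hom_inv_id_app]
  exact ((congrArg (· ≫ _) ((valMap F P').map_id _)).trans (Category.id_comp _)).trans
    (Category.comp_id _).symm

variable (D) in
lemma resId_bc (p : P ⥤ A) (X : D.Val A) : (D.resId P).hom.app ((D.res p).obj X) =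
    D.bc (p := 𝟭 P) (u := p) (q := p) (b := 𝟭 A) (𝟙 p) X ≫ (D.res p).map ((D.resId A).hom.app X) := by
  have h : D.bc (p := 𝟭 P) (u := p) (q := p) (b := 𝟭 A) (𝟙 p) X = (D.resComp (𝟭 _) p).inv.app X ≫
    (D.resMap (𝟙 p)).app X ≫ (D.resComp p (𝟭 _)).hom.app X := rfl
  rw [h, D.resComp_id_right p X, resMap_id, ← cancel_epi ((D.resComp (𝟭 _) p).hom.app X)]
  simp only [Category.assoc, Iso.hom_inv_id_app_assoc, ← Functor.map_comp]
  rw [D.resComp_id_left p X, Iso.inv_hom_id_app, Iso.inv_hom_id_app]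
  exact ((Category.id_comp _).trans ((D.res p).map_id _)).symm

end

/-! ### Restrictions of exact diagrams -/

variable (D) in
/-- The restriction along `s` on exact diagrams. -/
noncomputable def cexResF (s : Pos.{w} Chain ⥤ Pos.{w} Chain)
    (hs : ∀ A Y, D.cexProp.prop A Y → D.cexProp.prop A (((D.restr s).app A).toFunctor.obj Y)) :
    D.cex ⟶ D.cex :=
  fullsubMap (D.restr s) D.cexProp D.cexProp hs

variable (D) in
/-- The functor `s` preserves exact diagrams by restriction. -/
def PreservesEx (s : Pos.{w} Chain ⥤ Pos.{w} Chain) : Prop :=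
  ∀ A Y, D.cexProp.prop A Y → D.cexProp.prop A (((D.restr s).app A).toFunctor.obj Y)

variable {s t : Pos.{w} Chain ⥤ Pos.{w} Chain}

/-- The canonical isomorphism expressing that `F` commutes with restriction along `s`. -/
noncomputable def cexResFCell (F : D ⟶ E) (hF : IsExact F) (hs : D.PreservesEx s)
    (hs' : E.PreservesEx s) : D.cexResF s hs ≫ cexMap F hF ≅ cexMap F hF ≫ E.cexResF s hs' :=
  fullsubIso (commSq (prodOpMap s) F) _ _ _ _ _ _ _ _

variable (D) in
/-- Restriction is compatible with composition. -/
noncomputable def cexResFComp (hs : D.PreservesEx s) (ht : D.PreservesEx t)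
    (hst : D.PreservesEx (t ⋙ s)) :
    D.cexResF s hs ≫ D.cexResF t ht ≅ D.cexResF (t ⋙ s) hst :=
  mkFullIso (fun A M => ((D.resComp (t.prod (𝟭 A.unop)) (s.prod (𝟭 A.unop))).app M.obj).symm)
    (fun A M N g => resComp_inv_naturality (t.prod (𝟭 A.unop)) (s.prod (𝟭 A.unop)) g.hom)
    (fun A B f M => by
      have h := D.resComp_inv_bc (p := s.prod (𝟭 B.unop)) (u := (𝟭 _).prod f.unop.toFunctor)
        (q := (𝟭 _).prod f.unop.toFunctor) (b := s.prod (𝟭 A.unop)) (𝟙 _)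
        (p' := t.prod (𝟭 B.unop)) (q' := (𝟭 _).prod f.unop.toFunctor) (b' := t.prod (𝟭 A.unop))
        (𝟙 _) (𝟙 _) (NatTrans.ext (funext fun x =>
          ((Category.id_comp _).trans ((s.prod (𝟭 A.unop)).map_id
            (t.obj x.1, f.unop.toFunctor.obj x.2))).symm)) M.obj
      refine h.trans (congrArg (· ≫ _) ?_)
      change _ = 𝟙 _ ≫ (D.res (t.prod (𝟭 B.unop))).map (D.bc (p := s.prod (𝟭 B.unop))
        (u := (𝟭 _).prod f.unop.toFunctor) (q := (𝟭 _).prod f.unop.toFunctor)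
        (b := s.prod (𝟭 A.unop)) (𝟙 _) M.obj) ≫ 𝟙 _ ≫ D.bc (p := t.prod (𝟭 B.unop))
        (u := (𝟭 _).prod f.unop.toFunctor) (q := (𝟭 _).prod f.unop.toFunctor)
        (b := t.prod (𝟭 A.unop)) (𝟙 _) _ ≫ 𝟙 _
      simp only [Category.id_comp, Category.comp_id])

variable (D) in
/-- Restriction along the identity. -/
noncomputable def cexResFId (hs : D.PreservesEx (𝟭 _)) : D.cexResF (𝟭 _) hs ≅ 𝟙 D.cex :=
  mkFullIso (fun A M => (D.resId (Pos.{w} Chain × A.unop)).app M.obj)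
    (fun A M N g => (D.resId (Pos.{w} Chain × A.unop)).hom.naturality g.hom)
    (fun A B f M => by
      let p : Pos.{w} Chain × B.unop ⥤ Pos.{w} Chain × A.unop := (𝟭 _).prod f.unop.toFunctor
      have h := D.resId_bc p M.obj
      change (D.resId _).hom.app ((D.res p).obj M.obj) ≫ 𝟙 _ ≫ 𝟙 _ = _
      rw [Category.comp_id, Category.comp_id]
      exact h)

/-- Restrictions along equal functors. -/
noncomputable def cexResFCongr (h : s = t) (hs : D.PreservesEx s) (ht : D.PreservesEx t) :
    D.cexResF s hs ≅ D.cexResF t ht :=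
  eqToIso (by subst h; rfl)

/-! ### Compatibility with exact morphisms -/

lemma modApp_pasteSq {X₀ X₁ X₂ Y₀ Y₁ Y₂ : Prederivator.{w, v, u}} {s : X₀ ⟶ X₁} {t : X₁ ⟶ X₂}
    {s' : Y₀ ⟶ Y₁} {t' : Y₁ ⟶ Y₂} {F₀ : X₀ ⟶ Y₀} {F₁ : X₁ ⟶ Y₁} {F₂ : X₂ ⟶ Y₂}
    (a : s ≫ F₁ ≅ F₀ ≫ s') (b : t ≫ F₂ ≅ F₁ ≫ t') {A : Cat.{w, w}ᵒᵖ} (M : X₀.obj A) :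
    modApp (pasteSq a b).hom M = modApp b.hom ((s.app A).toFunctor.obj M) ≫
      (t'.app A).toFunctor.map (modApp a.hom M) := by
  change 𝟙 _ ≫ modApp b.hom ((s.app A).toFunctor.obj M) ≫ 𝟙 _ ≫
      (t'.app A).toFunctor.map (modApp a.hom M) ≫ 𝟙 _ = _
  simp only [Category.id_comp]
  exact congrArg _ (Category.comp_id _)

lemma compat_of_modApp {X₀ X₁ Y₀ Y₁ : Prederivator.{w, v, u}} {F₀ : X₀ ⟶ Y₀} {F₁ : X₁ ⟶ Y₁}
    {s s₁ : X₀ ⟶ X₁} {s' s₁' : Y₀ ⟶ Y₁} {a : s ≫ F₁ ≅ F₀ ≫ s'} {b : s₁ ≫ F₁ ≅ F₀ ≫ s₁'}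
    {m : s ≅ s₁} {m' : s' ≅ s₁'} (h : ∀ (A : Cat.{w, w}ᵒᵖ) (M : X₀.obj A),
      (F₁.app A).toFunctor.map (modApp m.hom M) ≫ modApp b.hom M =
        modApp a.hom M ≫ modApp m'.hom ((F₀.app A).toFunctor.obj M)) : Compat a b m m' :=
  mod_ext h

section
variable (F : D ⟶ E) (hF : IsExact F)

/-- Componentwise this is the compatibility of the structure isomorphisms of `F` with composition of
functors. -/
lemma compat_cexResFComp (hs : D.PreservesEx s) (ht : D.PreservesEx t)
    (hst : D.PreservesEx (t ⋙ s)) (hs' : E.PreservesEx s) (ht' : E.PreservesEx t)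
    (hst' : E.PreservesEx (t ⋙ s)) :
    Compat (pasteSq (cexResFCell F hF hs hs') (cexResFCell F hF ht ht'))
      (cexResFCell F hF hst hst') (D.cexResFComp hs ht hst) (E.cexResFComp hs' ht' hst') :=
  compat_of_modApp fun A M => by
    rw [modApp_pasteSq]
    exact ObjectProperty.hom_ext _ (resComp_inv_resNatIso F (t.prod (𝟭 A.unop)) (s.prod (𝟭 A.unop))
      M.obj)

lemma compat_cexResFId (hs : D.PreservesEx (𝟭 _)) (hs' : E.PreservesEx (𝟭 _)) :
    Compat (cexResFCell F hF hs hs') (idSq (cexMap F hF)) (D.cexResFId hs) (E.cexResFId hs') :=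
  compat_of_modApp fun A M => by
    refine ObjectProperty.hom_ext _ ?_
    have h := natApp_id F (op (Cat.of (Pos.{w} Chain × A.unop))) M.obj
    change (F.app _).toFunctor.map ((D.mapId (op (Cat.of (Pos.{w} Chain × A.unop)))).hom.toNatTrans.app
      M.obj) ≫ 𝟙 _ ≫ 𝟙 _ = _
    rw [Category.comp_id, Category.comp_id]
    exact h.symm

lemma compat_cexResFCongr (h : s = t) (hs : D.PreservesEx s) (ht : D.PreservesEx t)
    (hs' : E.PreservesEx s) (ht' : E.PreservesEx t) :
    Compat (cexResFCell F hF hs hs') (cexResFCell F hF ht ht') (cexResFCongr h hs ht)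
      (cexResFCongr h hs' ht') := by
  subst h
  exact Compat.refl _

end

/-! ### Actions on exact diagrams -/

section
variable {J : Type w} [Category.{w} J] (c : Pos.{w} Chain × J ⥤ Pos.{w} Chain)

variable (D) in
/-- The action preserves exact diagrams. -/
def ActsEx : Prop := ∀ (A : Cat.{w, w}ᵒᵖ) (Y : (D.shift (Pos.{w} Chain)).obj A), D.cexProp.prop A Y →
  D.cexProp.prop ((prodOp J).obj A) (((postcompTransR (prodOpAct c) D).app A).toFunctor.obj Y)

variable (D) in
/-- The morphism `Y ↦ ((p, x) ↦ Y (c (p, x)))`. -/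
noncomputable def cexAct (hc : D.ActsEx c) : D.cex ⟶ D.cex.shift J :=
  fullsubMapR (R := prodOp J) (postcompTransR (prodOpAct c) D) D.cexProp D.cexProp hc

/-- The canonical isomorphism expressing that `F` commutes with the action. -/
noncomputable def cexActCell (F : D ⟶ E) (hF : IsExact F) (hc : D.ActsEx c) (hc' : E.ActsEx c) :
    D.cexAct c hc ≫ shiftMap (cexMap F hF) J ≅ cexMap F hF ≫ E.cexAct c hc' :=
  fullsubIsoR (R := prodOp J) (commSqR (prodOpAct c) F) _ _ _ _ _ _ _ _

/-- The structure isomorphism of an evaluation on an iterated shift contains three copies of the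
same identity cell; two of them are removed here. -/
lemma comp_ids {C : Type*} [Category* C] {X Y Z : C} (a : X ⟶ Y) (m : Y ⟶ Y) (hm : m = 𝟙 Y)
    (b : Y ⟶ Z) : (a ≫ m) ≫ m ≫ m ≫ b = a ≫ m ≫ b := by
  subst hm; simp

lemma comp_with_ids {C : Type*} [Category* C] {X Y Z : C} (a : X ⟶ Y) (b : Y ⟶ Z) :
    a ≫ b = 𝟙 _ ≫ a ≫ 𝟙 _ ≫ b ≫ 𝟙 _ := by simp

lemma natApp_cex_eval (x : J) {A B : Cat.{w, w}ᵒᵖ} (f : A ⟶ B) (N : (D.cex.shift J).obj A) :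
    (natApp (D.cex.eval x) f N).hom.hom =
      D.bc (p := (𝟭 (Pos.{w} Chain)).prod (Prod.sectR x B.unop))
        (u := (𝟭 _).prod ((𝟭 J).prod f.unop.toFunctor)) (q := (𝟭 _).prod f.unop.toFunctor)
        (b := (𝟭 (Pos.{w} Chain)).prod (Prod.sectR x A.unop)) (𝟙 _) N.obj := by
  let p := (𝟭 (Pos.{w} Chain)).prod (Prod.sectR x B.unop)
  let u := (𝟭 (Pos.{w} Chain)).prod ((𝟭 J).prod f.unop.toFunctor)
  let q := (𝟭 (Pos.{w} Chain)).prod f.unop.toFunctor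
  let b := (𝟭 (Pos.{w} Chain)).prod (Prod.sectR x A.unop)
  exact comp_ids ((D.resComp p u).inv.app N.obj) ((D.resMap (𝟙 (p ⋙ u))).app N.obj)
    (by rw [resMap_id]; rfl) ((D.resComp q b).hom.app N.obj)

variable (D) in
/-- The values of the action. -/
noncomputable def cexActEval (hc : D.ActsEx c) (x : J) (hx : D.PreservesEx (Prod.sectL _ x ⋙ c)) :
    D.cexAct c hc ≫ D.cex.eval x ≅ D.cexResF (Prod.sectL _ x ⋙ c) hx :=
  mkFullIso (fun A M => ((D.resComp ((𝟭 (Pos.{w} Chain)).prod (Prod.sectR x A.unop))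
      (actFun c (𝟭 A.unop))).app M.obj).symm)
    (fun A M N g => resComp_inv_naturality ((𝟭 (Pos.{w} Chain)).prod (Prod.sectR x A.unop))
      (actFun c (𝟭 A.unop)) g.hom)
    (fun A B f M => by
      have h := D.resComp_inv_bc (p := actFun c (𝟭 B.unop)) (u := (𝟭 _).prod f.unop.toFunctor)
        (q := (𝟭 _).prod ((𝟭 J).prod f.unop.toFunctor)) (b := actFun c (𝟭 A.unop)) (𝟙 _)
        (p' := (𝟭 (Pos.{w} Chain)).prod (Prod.sectR x B.unop)) (q' := (𝟭 _).prod f.unop.toFunctor)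
        (b' := (𝟭 (Pos.{w} Chain)).prod (Prod.sectR x A.unop))
        (𝟙 _) (𝟙 _) (NatTrans.ext (funext fun y =>
          ((Category.id_comp _).trans ((actFun c (𝟭 A.unop)).map_id
            (y.1, (x, f.unop.toFunctor.obj y.2)))).symm)) M.obj
      refine h.trans (congrArg (· ≫ _) ?_)
      change _ = 𝟙 _ ≫ (D.res ((𝟭 (Pos.{w} Chain)).prod (Prod.sectR x B.unop))).map
        (D.bc (p := actFun c (𝟭 B.unop)) (u := (𝟭 _).prod f.unop.toFunctor)
        (q := (𝟭 _).prod ((𝟭 J).prod f.unop.toFunctor)) (b := actFun c (𝟭 A.unop)) (𝟙 _) M.obj) ≫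
        𝟙 _ ≫ (natApp (D.cex.eval x) f (((D.cexAct c hc).app A).toFunctor.obj M)).hom.hom ≫ 𝟙 _
      rw [natApp_cex_eval]
      exact comp_with_ids _ _)

lemma compat_cexActEval (F : D ⟶ E) (hF : IsExact F) (hc : D.ActsEx c) (hc' : E.ActsEx c) (x : J)
    (hx : D.PreservesEx (Prod.sectL _ x ⋙ c)) (hx' : E.PreservesEx (Prod.sectL _ x ⋙ c)) :
    Compat (pasteSq (cexActCell c F hF hc hc') (evalCell x (cexMap F hF)))
      (cexResFCell F hF hx hx') (D.cexActEval c hc x hx) (E.cexActEval c hc' x hx') :=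
  compat_of_modApp fun A M => by
    rw [modApp_pasteSq]
    exact ObjectProperty.hom_ext _ (resComp_inv_resNatIso F
      ((𝟭 (Pos.{w} Chain)).prod (Prod.sectR x A.unop)) (actFun c (𝟭 A.unop)) M.obj)

end

end Prederivator

/-! ### Restrictions of iterated suspension squares -/

namespace Prederivator
open CatTrans
variable {D E : Prederivator.{w, v, u}}

/-! ### Iterated suspension squares -/

section
variable {X₀ X₁ Y₀ Y₁ : Prederivator.{w, v, u}} {s : X₀ ⟶ X₁} {s' : Y₀ ⟶ Y₁} {F₀ : X₀ ⟶ Y₀}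
  {F₁ : X₁ ⟶ Y₁} {J : Type w} [Category.{w} J]

/-- The shift of a square of morphisms of prederivators. -/
def shiftCell (a : s ≫ F₁ ≅ F₀ ≫ s') (J : Type w) [Category.{w} J] :
    shiftMap s J ≫ shiftMap F₁ J ≅ shiftMap F₀ J ≫ shiftMap s' J :=
  Pseudofunctor.StrongTrans.isoMk (fun A =>
    { hom := a.hom.as.app ((prodOp J).obj A)
      inv := a.inv.as.app ((prodOp J).obj A)
      hom_inv_id := congrArg (fun t => t.as.app ((prodOp J).obj A)) a.hom_inv_id
      inv_hom_id := congrArg (fun t => t.as.app ((prodOp J).obj A)) a.inv_hom_id })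
    (fun f => a.hom.as.naturality ((prodOp J).map f))

lemma natApp_comp_trans {X₀ X₁ X₂ : Prederivator.{w, v, u}} (s : X₀ ⟶ X₁) (t : X₁ ⟶ X₂)
    {A B : Cat.{w, w}ᵒᵖ} (f : A ⟶ B) (M : X₀.obj A) : (natApp (s ≫ t) f M).hom =
      (t.app B).toFunctor.map (natApp s f M).hom ≫ (natApp t f ((s.app A).toFunctor.obj M)).hom := by
  change 𝟙 _ ≫ (t.app B).toFunctor.map (natApp s f M).hom ≫ 𝟙 _ ≫
    (natApp t f ((s.app A).toFunctor.obj M)).hom ≫ 𝟙 _ = _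
  exact (comp_with_ids _ _).symm

/-- This is the modification axiom of `a` at the 1-cell given by the inclusion `A ⥤ J × A` at `i`.
-/
lemma compat_evalCell (a : s ≫ F₁ ≅ F₀ ≫ s') (i : J) :
    Compat (pasteSq (evalCell i F₀) a) (pasteSq (shiftCell a J) (evalCell i F₁)) (evalCell i s)
      (evalCell i s') :=
  compat_of_modApp fun A M => by
    rw [modApp_pasteSq, modApp_pasteSq]
    have h := modApp_natApp a.hom ((prodOpSect i).app A) M
    have e1 := natApp_comp_trans F₀ s' ((prodOpSect i).app A) M
    have e2 := natApp_comp_trans s F₁ ((prodOpSect i).app A) M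
    refine (Category.assoc _ _ _).symm.trans ((congrArg (· ≫ _) e2.symm).trans (h.symm.trans ?_))
    exact (congrArg (_ ≫ ·) e1).trans (Category.assoc _ _ _).symm

end

section
variable {I I' J : Type} [Preorder I] [Preorder I'] [Preorder J] (c₁ : J →o I) (c₂ : J →o I')

variable (E) in
/-- The restriction along `x ↦ (c₂ x, c₁ x)`. -/
def diagRes : (E.shift (Pos.{w} I')).shift (Pos.{w} I) ⟶ E.shift (Pos.{w} J) :=
  postcompTransL (prodOpDiag (Pos.map c₁) (Pos.map c₂)) E

/-- The canonical isomorphism expressing that `F` commutes with restriction along `(c₂, c₁)`. -/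
def diagResCell (F : D ⟶ E) : D.diagRes c₁ c₂ ≫ shiftMap F (Pos.{w} J) ≅
    shiftMap (shiftMap F (Pos.{w} I')) (Pos.{w} I) ≫ E.diagRes c₁ c₂ :=
  commSqL (prodOpDiag (Pos.map c₁) (Pos.map c₂)) F

lemma natApp_shift_eval {I I' : Type w} [Category.{w} I] [Category.{w} I'] (x : I)
    {A B : Cat.{w, w}ᵒᵖ} (f : A ⟶ B) (N : ((E.shift I').shift I).obj A) :
    (natApp ((E.shift I').eval x) f N).hom =
      E.bc (p := (𝟭 I').prod (Prod.sectR x B.unop))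
        (u := (𝟭 _).prod ((𝟭 I).prod f.unop.toFunctor)) (q := (𝟭 _).prod f.unop.toFunctor)
        (b := (𝟭 I').prod (Prod.sectR x A.unop)) (𝟙 _) N := by
  let p := (𝟭 I').prod (Prod.sectR x B.unop)
  let u := (𝟭 I').prod ((𝟭 I).prod f.unop.toFunctor)
  let q := (𝟭 I').prod f.unop.toFunctor
  let b := (𝟭 I').prod (Prod.sectR x A.unop)
  exact comp_ids ((E.resComp p u).inv.app N) ((E.resMap (𝟙 (p ⋙ u))).app N)
    (by rw [resMap_id]; rfl) ((E.resComp q b).hom.app N)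

lemma inv_hom_comp_of_comp_eq {C : Type*} [Category* C] {G H A₁ A₂ B₁ B₂ : C} (c₁ : G ≅ A₁)
    (c₂ : G ≅ A₂) (d₁ : H ≅ B₁) (d₂ : H ≅ B₂) {g : G ⟶ H} {n₁ : A₁ ⟶ B₁} {n₂ : A₂ ⟶ B₂}
    (h₁ : c₁.hom ≫ n₁ = g ≫ d₁.hom) (h₂ : c₂.hom ≫ n₂ = g ≫ d₂.hom) :
    (c₁.inv ≫ c₂.hom) ≫ n₂ = n₁ ≫ d₁.inv ≫ d₂.hom := by
  rw [Category.assoc, h₂, Iso.inv_comp_eq, reassoc_of% h₁, Iso.hom_inv_id_assoc]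

variable (E) in
/-- The values of the restriction along `x ↦ (c₂ x, c₁ x)`. -/
def diagResEval (x : J) : E.diagRes c₁ c₂ ≫ E.eval (Pos.of x) ≅
    (E.shift (Pos.{w} I')).eval (Pos.of (c₁ x)) ≫ E.eval (Pos.of (c₂ x)) :=
  mkModIso (fun A M => ((E.resComp (Prod.sectR (Pos.of x) A.unop)
      (diagFun (Pos.map c₁) (Pos.map c₂) (𝟭 A.unop))).app M).symm ≪≫
      (E.resComp (Prod.sectR (Pos.of (c₂ x)) A.unop)
        ((𝟭 _).prod (Prod.sectR (Pos.of (c₁ x)) A.unop))).app M)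
    (fun A M N g => by
      have h1 := resComp_inv_naturality (Prod.sectR (Pos.of x) A.unop)
        (diagFun (Pos.map c₁) (Pos.map c₂) (𝟭 A.unop)) g
      have h2 := (E.resComp (Prod.sectR (Pos.of (c₂ x)) A.unop)
        ((𝟭 _).prod (Prod.sectR (Pos.of (c₁ x)) A.unop))).hom.naturality g
      refine (Category.assoc _ _ _).symm.trans ((congrArg (· ≫ _) h1).trans ?_)
      refine (Category.assoc _ _ _).trans ((congrArg (_ ≫ ·) h2).trans ?_)
      exact (Category.assoc _ _ _).symm)
    (fun A B f M => by
      have h1 := E.bc_paste (p := diagFun (Pos.map.{w} c₁) (Pos.map.{w} c₂) (𝟭 B.unop))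
        (u := (𝟭 _).prod ((𝟭 _).prod f.unop.toFunctor))
        (q := (𝟭 _).prod f.unop.toFunctor) (b := diagFun (Pos.map c₁) (Pos.map c₂) (𝟭 A.unop)) (𝟙 _)
        (p' := Prod.sectR (Pos.of x) B.unop) (q' := f.unop.toFunctor)
        (b' := Prod.sectR (Pos.of x) A.unop)
        (𝟙 _) (𝟙 _) (NatTrans.ext (funext fun y =>
          ((Category.id_comp _).trans ((diagFun (Pos.map c₁) (Pos.map c₂) (𝟭 A.unop)).map_id
            (Pos.of x, f.unop.toFunctor.obj y))).symm)) M
      have h2 := E.bc_paste (p := (𝟭 (Pos.{w} I')).prod (Prod.sectR (Pos.of.{w} (c₁ x)) B.unop))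
        (u := (𝟭 _).prod ((𝟭 _).prod f.unop.toFunctor))
        (q := (𝟭 _).prod f.unop.toFunctor) (b := (𝟭 _).prod (Prod.sectR (Pos.of (c₁ x)) A.unop)) (𝟙 _)
        (p' := Prod.sectR (Pos.of (c₂ x)) B.unop) (q' := f.unop.toFunctor)
        (b' := Prod.sectR (Pos.of (c₂ x)) A.unop)
        (𝟙 _) (𝟙 _) (NatTrans.ext (funext fun y =>
          ((Category.id_comp _).trans (((𝟭 (Pos.{w} I')).prod
            (Prod.sectR (Pos.of.{w} (c₁ x)) A.unop)).map_id
            (Pos.of (c₂ x), f.unop.toFunctor.obj y))).symm)) M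
      have h := inv_hom_comp_of_comp_eq
        ((E.resComp (Prod.sectR (Pos.of x) B.unop)
          (diagFun (Pos.map c₁) (Pos.map c₂) (𝟭 B.unop))).app _)
        ((E.resComp (Prod.sectR (Pos.of (c₂ x)) B.unop)
          ((𝟭 _).prod (Prod.sectR (Pos.of (c₁ x)) B.unop))).app _)
        ((E.res f.unop.toFunctor).mapIso ((E.resComp (Prod.sectR (Pos.of x) A.unop)
          (diagFun (Pos.map c₁) (Pos.map c₂) (𝟭 A.unop))).app M))
        ((E.res f.unop.toFunctor).mapIso ((E.resComp (Prod.sectR (Pos.of (c₂ x)) A.unop)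
          ((𝟭 _).prod (Prod.sectR (Pos.of (c₁ x)) A.unop))).app M)) h1 h2
      have e1 := natApp_comp_trans (E.diagRes c₁ c₂) (E.eval (Pos.of x)) f M
      have e2 := natApp_comp_trans ((E.shift (Pos.{w} I')).eval (Pos.of (c₁ x)))
        (E.eval (Pos.of (c₂ x))) f M
      rw [natApp_shift_eval] at e2
      refine (congrArg (_ ≫ ·) e2).trans (h.trans ?_)
      refine (congrArg (_ ≫ ·) ((E.res f.unop.toFunctor).map_comp _ _).symm).trans ?_
      exact (congrArg (· ≫ _) e1).symm)

/-- The inclusion at `x` followed by the map to `I' × (I × A)` equals the inclusion at `c₂ x`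
followed by the one at `c₁ x`. Both sides are compared through the structure isomorphism of `F` at
this common composite. -/
lemma compat_diagResEval (F : D ⟶ E) (x : J) :
    Compat (pasteSq (diagResCell c₁ c₂ F) (evalCell (Pos.of x) F))
      (pasteSq (evalCell (Pos.of (c₁ x)) (shiftMap F (Pos.{w} I'))) (evalCell (Pos.of (c₂ x)) F))
      (D.diagResEval c₁ c₂ x) (E.diagResEval c₁ c₂ x) :=
  compat_of_modApp fun A M => by
    rw [modApp_pasteSq, modApp_pasteSq]
    have h1 := resNatIso_resComp F (Prod.sectR (Pos.of x) A.unop)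
      (diagFun (Pos.map.{w} c₁) (Pos.map.{w} c₂) (𝟭 A.unop)) M
    have h2 := resNatIso_resComp F (Prod.sectR (Pos.of (c₂ x)) A.unop)
      ((𝟭 (Pos.{w} I')).prod (Prod.sectR (Pos.of (c₁ x)) A.unop)) M
    have h := inv_hom_comp_of_comp_eq
      ((valMap F A.unop).mapIso ((D.resComp (Prod.sectR (Pos.of x) A.unop)
          (diagFun (Pos.map c₁) (Pos.map c₂) (𝟭 A.unop))).app M))
      ((valMap F A.unop).mapIso ((D.resComp (Prod.sectR (Pos.of (c₂ x)) A.unop)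
          ((𝟭 _).prod (Prod.sectR (Pos.of (c₁ x)) A.unop))).app M))
      ((E.resComp (Prod.sectR (Pos.of x) A.unop)
          (diagFun (Pos.map c₁) (Pos.map c₂) (𝟭 A.unop))).app _)
      ((E.resComp (Prod.sectR (Pos.of (c₂ x)) A.unop)
          ((𝟭 _).prod (Prod.sectR (Pos.of (c₁ x)) A.unop))).app _) h1 h2
    refine Eq.trans ?_ h
    exact congrArg (· ≫ _) ((valMap F A.unop).map_comp _ _)

end

end Prederivator

/-! ### Criteria for cocartesian squares and cubes -/

namespace Prederivator
variable {D : Prederivator.{w, v, u}}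

/-! ### Squares and cubes -/

section
variable {B : Type} [Preorder B]

/-- Squares which are degenerate in one direction are cocartesian. -/
lemma IsDerivator'.isCocartesian_of_le (hD : D.IsDerivator') (k : Sq →o B)
    (h : k (1, 1) ≤ k (0, 1)) (h' : k (1, 0) ≤ k (0, 0)) (X : D.Val (Pos.{w} B)) :
    D.IsCocartesian ((D.res (Pos.map k)).obj X) :=
  -- With all of `B` in the role of `A`, the hypotheses of the detection follow from degeneracy and
  -- the Kan condition at `k (1, 1)` is void.
  (hD.isCocartesian_iff_lkeAt (A := fun _ => True) k (fun _ _ => trivial)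
    (fun _ _ ha => .inr (ha.trans h)) (fun _ _ ha _ => ha.trans h') X).2
    (hD.lkeAt_obj (Pos.map.{w} (OrderHom.Subtype.val fun _ : B => True)) X (Pos.of ⟨k (1, 1), trivial⟩))

/-- The transposition of squares. -/
def _root_.Sq.swap : Sq →o Sq := ⟨Prod.swap, fun _ _ h => ⟨h.2, h.1⟩⟩

lemma IsDerivator'.isCocartesian_swap (hD : D.IsDerivator') {X : D.Val (Pos.{w} Sq)}
    (h : D.IsCocartesian X) : D.IsCocartesian ((D.res (Pos.map Sq.swap)).obj X) :=
  (hD.isCocartesian_iff_lkeAt (A := fun x : Sq => x ≠ (1, 1)) Sq.swap (by decide) (by decide)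
    (by decide) X).2 (hD.isLKE_iff.1 ((hD.isCocartesian_iff X).1 h) _)

lemma IsDerivator'.isCocartesian_of_swap (hD : D.IsDerivator') (k k' : Sq →o B)
    (hk : ∀ x y, k' (x, y) = k (y, x)) {X : D.Val (Pos.{w} B)}
    (h : D.IsCocartesian ((D.res (Pos.map k)).obj X)) :
    D.IsCocartesian ((D.res (Pos.map k')).obj X) := by
  obtain rfl : k' = k.comp Sq.swap := OrderHom.ext _ _ (funext fun x => hk x.1 x.2)
  exact (hD.isCocartesian_swap h).of_iso
    (D.resObjIso (f := Pos.map Sq.swap) (g := Pos.map k) rfl X).symm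

/-- The unit square of a grid with final vertex `(i + 1, j + 1)`. -/
def gridSq {m n : ℕ} (i : Fin m) (j : Fin n) : Sq →o Fin (m + 1) × Fin (n + 1) where
  toFun x := (⟨i + x.1, by omega⟩, ⟨j + x.2, by omega⟩)
  monotone' _ _ h := ⟨Nat.add_le_add_left h.1 _, Nat.add_le_add_left h.2 _⟩

/-- The outer square of a grid. -/
def gridOuter (m n : ℕ) : Sq →o Fin (m + 1) × Fin (n + 1) where
  toFun x := (⟨m * x.1, Nat.lt_succ_of_le ((Nat.mul_le_mul_left m (Nat.le_of_lt_succ x.1.2)).trans_eq (Nat.mul_one m))⟩,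
    ⟨n * x.2, Nat.lt_succ_of_le ((Nat.mul_le_mul_left n (Nat.le_of_lt_succ x.2.2)).trans_eq (Nat.mul_one n))⟩)
  monotone' _ _ h := ⟨Nat.mul_le_mul_left _ h.1, Nat.mul_le_mul_left _ h.2⟩

/-- If the unit squares of a grid are cocartesian, then so is its outer square. -/
lemma IsDerivator'.isCocartesian_grid (hD : D.IsDerivator') {m n : ℕ}
    {X : D.Val (Pos.{w} (Fin (m + 1) × Fin (n + 1)))}
    (h : ∀ i j, D.IsCocartesian ((D.res (Pos.map (gridSq i j))).obj X)) :
    D.IsCocartesian ((D.res (Pos.map (gridOuter m n))).obj X) := by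
  -- The grid is a left Kan extension from its two initial edges, by induction over unit squares,
  -- and the outer square is detected from these edges.
  refine hD.isCocartesian_of_isLKE (A := fun x => x.1 = 0 ∨ x.2 = 0)
    (hD.isLKE_of_isCocartesian (fun x => x.1 + x.2) ?_) _ ?_ ?_
  · rintro ⟨⟨i, hi⟩, ⟨j, hj⟩⟩ ht
    obtain ⟨h1, h2⟩ := not_or.1 ht
    obtain ⟨i, rfl⟩ := Nat.exists_eq_succ_of_ne_zero (fun h => h1 (Fin.ext h))
    obtain ⟨j, rfl⟩ := Nat.exists_eq_succ_of_ne_zero (fun h => h2 (Fin.ext h))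
    refine ⟨gridSq ⟨i, by omega⟩ ⟨j, by omega⟩, rfl, ?_, ?_, ?_, h _ _⟩
    · rintro x hx
      rcases Sq.cases x with rfl | rfl | rfl | rfl
      · change i + 0 + (j + 0) < i + 1 + (j + 1); omega
      · change i + 0 + (j + 1) < i + 1 + (j + 1); omega
      · change i + 1 + (j + 0) < i + 1 + (j + 1); omega
      · exact absurd rfl hx
    · rintro ⟨⟨a, ha⟩, ⟨b, hb⟩⟩ (h | h) hle
      · refine .inr ⟨?_, hle.2⟩
        change a ≤ i + 0
        have : a = 0 := congrArg Fin.val h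
        omega
      · refine .inl ⟨hle.1, ?_⟩
        change b ≤ j + 0
        have : b = 0 := congrArg Fin.val h
        omega
    · exact fun a h h' => ⟨h'.1, h.2⟩
  · rintro ⟨⟨a, ha⟩, ⟨b, hb⟩⟩ (h | h) hle
    · exact .inr ⟨h.le.trans (Fin.zero_le _), hle.2⟩
    · exact .inl ⟨hle.1, h.le.trans (Fin.zero_le _)⟩
  · exact fun a h h' => ⟨h'.1, h.2⟩

/-- The vertices of the cube. -/
abbrev _root_.Cube : Type := Fin 2 × Fin 2 × Fin 2

/-- The inclusion into the cube of the full subposet without the final object. -/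
abbrev _root_.Cube.incl : {x : Cube // x ≠ (1, 1, 1)} →o Cube := OrderHom.Subtype.val _

/-- The cube with two additional objects `(1, 1, z, 0)` below `(1, 1, z, 1)`. -/
abbrev _root_.CubeExt : Type := {h : Fin 2 × Fin 2 × Fin 2 × Fin 2 // h.2.2.2 ≤ h.1 ∧ h.2.2.2 ≤ h.2.1}

/-- The embedding of the cube. -/
def _root_.CubeExt.ofCube : Cube →o CubeExt where
  toFun x := ⟨(x.1, x.2.1, x.2.2, min x.1 x.2.1), min_le_left _ _, min_le_right _ _⟩
  monotone' _ _ h := ⟨h.1, h.2.1, h.2.2, min_le_min h.1 h.2.1⟩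

/-- The squares with final vertices `(1, 1, z, 0)`. -/
def _root_.CubeExt.sq (z : Fin 2) : Sq →o CubeExt where
  toFun x := ⟨(x.1, x.2, z, 0), Fin.zero_le _, Fin.zero_le _⟩
  monotone' _ _ h := ⟨h.1, h.2, le_rfl, le_rfl⟩

/-- The square with vertices `(1, 1, z, w)`. -/
def _root_.CubeExt.sq' : Sq →o CubeExt where
  toFun x := ⟨(1, 1, x.2, x.1), Fin.le_last _, Fin.le_last _⟩
  monotone' _ _ h := ⟨le_rfl, le_rfl, h.2, h.1⟩

/-- The added vertices are the pushouts of the spans in the two faces `z = 0` and `z = 1`. Every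
vertex missing from the punctured cube is the final vertex of one of the given squares, so `X` is an
extension of its restriction to the punctured cube, and this passes to the full subposet formed by
the cube. -/
lemma IsDerivator'.isLKE_cubeExt (hD : D.IsDerivator') {X : D.Val (Pos.{w} CubeExt)}
    (h : ∀ z, D.IsCocartesian ((D.res (Pos.map (CubeExt.sq z))).obj X))
    (h' : D.IsCocartesian ((D.res (Pos.map CubeExt.sq')).obj X)) :
    IsLKE (Pos.map Cube.incl) ((D.res (Pos.map CubeExt.ofCube)).obj X) := by
  have e : ∀ x y : Cube, CubeExt.ofCube x ≤ CubeExt.ofCube y → x ≤ y :=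
    fun x y h => ⟨h.1, h.2.1, h.2.2.1⟩
  have := Pos.map_full.{w} CubeExt.ofCube e
  have := Pos.map_full.{w} (CubeExt.ofCube.comp Cube.incl) fun x y h => e _ _ h
  let A : CubeExt → Prop := fun h => ∃ x : Cube, x ≠ (1, 1, 1) ∧ CubeExt.ofCube x = h
  have hA : IsLKE (Pos.map (OrderHom.Subtype.val A)) X := by
    refine hD.isLKE_of_isCocartesian (fun h => h.1.1 + h.1.2.1 + h.1.2.2.1 + h.1.2.2.2) ?_
    -- The vertex `(1, 1, 0, 1)` belongs to the punctured cube; only `(1, 1, 0, 0)`, `(1, 1, 1, 0)`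
    -- and `(1, 1, 1, 1)` are missing.
    have key : ∀ t : CubeExt, ¬ A t → t = CubeExt.sq 0 (1, 1) ∨ t = CubeExt.sq 1 (1, 1) ∨
        t = CubeExt.sq' (1, 1) := by
      decide
    rintro t hA
    rcases key _ hA with rfl | rfl | rfl
    · exact ⟨CubeExt.sq 0, rfl, by decide, by decide, by decide, h 0⟩
    · exact ⟨CubeExt.sq 1, rfl, by decide, by decide, by decide, h 1⟩
    · exact ⟨CubeExt.sq', rfl, by decide, by decide, by decide, h'⟩
  let g : {h // A h} →o {x : Cube // x ≠ (1, 1, 1)} :=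
    ⟨fun h => ⟨(h.1.1.1, h.1.1.2.1, h.1.1.2.2.1), by
      obtain ⟨x, hx, hx'⟩ := h.2
      rw [← hx']
      exact hx⟩, fun x y h => ⟨h.1, h.2.1, h.2.2.1⟩⟩
  have hg : (CubeExt.ofCube.comp Cube.incl).comp g = OrderHom.Subtype.val A := by
    refine OrderHom.ext _ _ (funext fun h => ?_)
    obtain ⟨_, x, hx, rfl⟩ := h
    rfl
  have h1 : IsLKE (Pos.map ((CubeExt.ofCube.comp Cube.incl).comp g)) X := hg ▸ hA
  have h2 := hD.isLKE_of_comp (u' := Pos.map.{w} g)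
    (f := Pos.map (CubeExt.ofCube.comp Cube.incl)) h1
  exact hD.isLKE_factor (u' := Pos.map.{w} Cube.incl) (f := Pos.map CubeExt.ofCube) h2

/-- A criterion for a cube to be a left Kan extension from the cube without its final object. -/
lemma IsDerivator'.isLKE_cube (hD : D.IsDerivator') (f : Cube →o B) (q : Fin 2 →o B)
    (hq₁ : ∀ z, f (1, 0, z) ≤ q z) (hq₂ : ∀ z, f (0, 1, z) ≤ q z) (hq₃ : ∀ z, q z ≤ f (1, 1, z))
    (k : Fin 2 → Sq →o B) (hk : ∀ z, k z (0, 0) = f (0, 0, z) ∧ k z (1, 0) = f (1, 0, z) ∧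
      k z (0, 1) = f (0, 1, z) ∧ k z (1, 1) = q z) (k' : Sq →o B)
    (hk' : k' (0, 0) = q 0 ∧ k' (1, 0) = f (1, 1, 0) ∧ k' (0, 1) = q 1 ∧ k' (1, 1) = f (1, 1, 1))
    {X : D.Val (Pos.{w} B)} (h : ∀ z, D.IsCocartesian ((D.res (Pos.map (k z))).obj X))
    (h' : D.IsCocartesian ((D.res (Pos.map k')).obj X)) :
    IsLKE (Pos.map Cube.incl) ((D.res (Pos.map f)).obj X) := by
  -- The two added vertices are sent to `q`, the remaining ones as prescribed by `f`; the criterion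
  -- is pulled back from the extended cube.
  let F : CubeExt →o B :=
    { toFun h := if h.1.1 = 1 ∧ h.1.2.1 = 1 ∧ h.1.2.2.2 = 0 then q h.1.2.2.1
        else f (h.1.1, h.1.2.1, h.1.2.2.1)
      monotone' := by
        rintro ⟨⟨a, b, c, d⟩, h1, h2⟩ ⟨⟨a', b', c', d'⟩, h1', h2'⟩ ⟨h3, h4, h5, h6⟩
        dsimp only at *
        have hc : f (a, b, c) ≤ f (a', b', c') := f.2 ⟨h3, h4, h5⟩
        have hc' : q c ≤ q c' := q.2 h5
        split_ifs with h7 h8 h8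
        · exact hc'
        · obtain ⟨rfl, rfl, rfl⟩ := h7
          exact (hq₃ c).trans hc
        · obtain ⟨rfl, rfl, rfl⟩ := h8
          by_cases ha : a = 0
          · subst ha
            exact (f.2 ⟨le_rfl, Fin.le_last b, h5⟩ : f (0, b, c) ≤ f (0, 1, c')).trans (hq₂ c')
          · have hb : b = 0 := by omega
            subst hb
            exact (f.2 ⟨Fin.le_last a, le_rfl, h5⟩ : f (a, 0, c) ≤ f (1, 0, c')).trans (hq₁ c')
        · exact hc }
  have e1 (z) : F.comp (CubeExt.sq z) = k z := by
    refine OrderHom.ext _ _ (funext fun x => ?_)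
    obtain ⟨h1, h2, h3, h4⟩ := hk z
    rcases Sq.cases x with rfl | rfl | rfl | rfl
    · exact h1.symm
    · exact h3.symm
    · exact h2.symm
    · exact h4.symm
  have e2 : F.comp CubeExt.sq' = k' := by
    refine OrderHom.ext _ _ (funext fun x => ?_)
    obtain ⟨h1, h2, h3, h4⟩ := hk'
    rcases Sq.cases x with rfl | rfl | rfl | rfl
    · exact h1.symm
    · exact h3.symm
    · exact h2.symm
    · exact h4.symm
  have e3 : F.comp CubeExt.ofCube = f := by
    refine OrderHom.ext _ _ (funext fun x => ?_)
    obtain ⟨x, y, z⟩ := x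
    refine if_neg ?_
    rintro ⟨h1, h2, h3⟩
    change min x y = 0 at h3
    change x = 1 at h1
    change y = 1 at h2
    subst h1 h2
    exact absurd h3 (by decide)
  have h1 := hD.isLKE_cubeExt (X := (D.res (Pos.map F)).obj X)
    (fun z => (e1 z ▸ h z : D.IsCocartesian ((D.res (Pos.map (F.comp (CubeExt.sq z)))).obj X)).of_iso
      (D.resObjIso (f := Pos.map (CubeExt.sq z)) (g := Pos.map F) rfl X))
    ((e2 ▸ h' : D.IsCocartesian ((D.res (Pos.map (F.comp CubeExt.sq'))).obj X)).of_iso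
      (D.resObjIso (f := Pos.map CubeExt.sq') (g := Pos.map F) rfl X))
  have h2 := h1.of_iso (D.resObjIso (f := Pos.map CubeExt.ofCube) (g := Pos.map F)
    (h := Pos.map (F.comp CubeExt.ofCube)) rfl X).symm
  exact e3 ▸ h2

end

instance _root_.Functor.id_prod_full {U A Q : Type w} [Category.{w} U] [Category.{w} A]
    [Category.{w} Q] (u : U ⥤ A) [u.Full] : ((𝟭 Q).prod u).Full where
  map_surjective f := ⟨(f.1, u.preimage f.2), Prod.ext rfl (u.map_preimage _)⟩

instance _root_.Functor.id_prod_faithful {U A Q : Type w} [Category.{w} U] [Category.{w} A]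
    [Category.{w} Q] (u : U ⥤ A) [u.Faithful] : ((𝟭 Q).prod u).Faithful where
  map_injective h := Prod.ext (congrArg (fun t => t.1) h) (u.map_injective (congrArg (fun t => t.2) h))

lemma slice_comp_prod {U A : Type w} [Category.{w} U] [Category.{w} A] (Q : Type w)
    [Category.{w} Q] (u : U ⥤ A) (a : U) :
    slice Q a ⋙ (𝟭 Q).prod u = slice Q (u.obj a) :=
  Functor.hext (fun _ => rfl) fun _ _ _ => heq_of_eq (Prod.ext rfl (u.map_id a))

/-- In a square of diagrams whose values are bicartesian, the initial diagram is a left Kan extension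
if the other ones are. -/
lemma IsStableDerivator.isLKE_of_isBicartesian (hD : D.IsStableDerivator) {U A : Type w}
    [Category.{w} U] [Category.{w} A] (u : U ⥤ A) [u.Full] [u.Faithful] {X : D.Val (Pos.{w} Sq × A)}
    (h : ∀ a, D.IsCocartesian ((D.res (slice _ a)).obj X))
    (h' : ∀ x : Sq, x ≠ (0, 0) → IsLKE u ((D.res (Prod.sectR (Pos.of x) A)).obj X)) :
    IsLKE u ((D.res (Prod.sectR (Pos.of (0, 0)) A)).obj X) := by
  have hD' := hD.toIsDerivator'
  -- `V` is the left Kan extension along `u` of the restriction of `X`, taken at all four corners at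
  -- once; the aim is that the comparison `g : V ⟶ X` is invertible.
  obtain ⟨V, hV, ⟨φ⟩⟩ := hD'.exists_isLKE ((𝟭 (Pos.{w} Sq)).prod u) ((D.res _).obj X)
  obtain ⟨g, hg⟩ := (hV X).2 φ.hom
  dsimp only at hg
  have hV' := hD'.isLKE_prod_left.1 hV
  have h1 : IsLKE ((Pos.map.{w} Sq.inclUL).prod (𝟭 U)) ((D.res ((𝟭 (Pos.{w} Sq)).prod u)).obj V) :=
    (hD'.isLKE_prod_right.2 fun a => ((hD'.isCocartesian_iff _).1 (h (u.obj a))).of_iso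
      (D.resObjIso (f := slice (Pos.{w} Sq) a) (g := (𝟭 (Pos.{w} Sq)).prod u)
        (h := slice _ (u.obj a)) (slice_comp_prod _ u a) X)).of_iso φ.symm
  -- Left Kan extensions in the two variables commute, so the squares of `V` remain cocartesian, and
  -- by stability they are cartesian.
  have h2 : IsLKE ((Pos.map.{w} Sq.inclUL).prod (𝟭 A)) V :=
    hD'.isLKE_of_comp (u' := (𝟭 _).prod u) (f := (Pos.map.{w} Sq.inclUL).prod (𝟭 A))
      ((isLKE_comp_iff h1).2 hV)
  have h3 (a : A) : IsRKE (Pos.map.{w} Sq.inclLR) ((D.res (slice _ a)).obj V) :=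
    (hD'.isCartesian_iff _).1 ((hD.stable _).1 ((hD'.isCocartesian_iff _).2
      (hD'.isLKE_prod_right.1 h2 a)))
  have h4 (a : A) (x : Sq) (hx : x ≠ (0, 0)) :
      IsIso ((D.res (Functor.fromPUnit.{w} (Pos.of x, a))).map g) := by
    have : IsIso ((D.res u).map ((D.res (Prod.sectR (Pos.of x) A)).map g)) :=
      hD'.der2 _ fun y => (isIso_ev_map_iff _ _ _).2 ((isIso_ev_map_iff _ _ _).2
        ((isIso_ev_map_iff ((𝟭 (Pos.{w} Sq)).prod u) (Pos.of x, y) g).1 (by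
          rw [hg]
          infer_instance)))
    have := isIso_of_isLKE (hV' (Pos.of x)) (h' x hx) ((D.res (Prod.sectR (Pos.of x) A)).map g)
    exact (isIso_ev_map_iff (Prod.sectR (Pos.of x) A) a g).1 inferInstance
  -- Both squares at `a` are cartesian and `g` is invertible at three corners, hence also at the
  -- initial one.
  have h5 (a : A) : IsIso ((D.res (slice (Pos.{w} Sq) a)).map g) := by
    have : IsIso ((D.res (Pos.map Sq.inclLR)).map ((D.res (slice (Pos.{w} Sq) a)).map g)) :=
      hD'.der2 _ fun x => (isIso_ev_map_iff _ _ _).2 ((isIso_ev_map_iff _ _ _).2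
        (h4 a (ULift.down x).1 (ULift.down x).2))
    exact isIso_of_isRKE (h3 a) ((hD'.isCartesian_iff _).1 ((hD.stable _).1 (h a))) _
  have h6 : IsIso g := hD'.der2 _ fun x => (isIso_ev_map_iff (slice (Pos.{w} Sq) x.2) x.1 g).1 (by
    have := h5 x.2
    infer_instance)
  exact (hV' _).of_iso ((D.res _).mapIso (asIso g))

end Prederivator

/-! ### The cubes relating an object and its triple shift -/

namespace Chain

/-- The coordinates of the vertices of the cubes. -/
def cubeCoord (a b c : Fin 2) (p q r : ℤ) : ℤ :=
  if a = 0 then (if c = 0 then p else q + 1) else (if b = 0 then r + 2 else p + 3)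

/-- A cube with initial vertex `p` and final vertex `p + (3, 3, 3)`, whose other vertices are
outside of the cubes of `C`. -/
noncomputable def cube : Chain × Cube →o Chain where
  toFun x := ⟨(cubeCoord x.2.1 x.2.2.1 x.2.2.2 x.1.1.1 x.1.1.2.1 x.1.1.2.2,
    cubeCoord x.2.2.1 x.2.2.2 x.2.1 x.1.1.2.1 x.1.1.2.2 x.1.1.1,
    cubeCoord x.2.2.2 x.2.1 x.2.2.1 x.1.1.2.2 x.1.1.1 x.1.1.2.1), by
      have h := mem_iff x.1
      rw [inCubes_iff, inLinks_iff]
      unfold cubeCoord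
      split_ifs <;> omega⟩
  monotone' := by
    rintro ⟨p, a, b, c⟩ ⟨p', a', b', c'⟩ ⟨h1, h2, h3, h4⟩
    dsimp only at h1 h2 h3 h4
    have h := mem_iff p
    -- These three cyclic inequalities hold on all of `C`, while the opposite ones fail at links.
    -- They are what monotonicity of the coordinates requires.
    have e1 : p.1.1 ≤ p.1.2.1 + 1 := by omega
    have e2 : p.1.2.1 ≤ p.1.2.2 + 1 := by omega
    have e3 : p.1.2.2 ≤ p.1.1 + 1 := by omega
    rw [le_iff] at h1
    have key {a b c a' b' c' : Fin 2} {p q r p' q' r' : ℤ} (h1 : a ≤ a') (h2 : b ≤ b')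
        (h3 : c ≤ c') (h4 : p ≤ p') (h5 : q ≤ q') (h6 : r ≤ r') (h7 : p ≤ q + 1)
        (h8 : q ≤ r + 1) (h9 : r ≤ p + 1) :
        cubeCoord a b c p q r ≤ cubeCoord a' b' c' p' q' r' := by
      unfold cubeCoord
      split_ifs <;> omega
    exact ⟨key h2 h3 h4 h1.1 h1.2.1 h1.2.2 e1 e2 e3,
      key h3 h4 h2 h1.2.1 h1.2.2 h1.1 e2 e3 e1,
      key h4 h2 h3 h1.2.2 h1.1 h1.2.1 e3 e1 e2⟩

/-- The cube with initial vertex `p`. -/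
noncomputable def cubeAt (p : Chain) : Cube →o Chain := ⟨fun x => cube (p, x), fun _ _ h => cube.2 ⟨le_rfl, h⟩⟩

/-- A vertex of the cubes. -/
noncomputable def vertex (x : Cube) : Chain →o Chain := ⟨fun p => cube (p, x), fun _ _ h => cube.2 ⟨h, le_rfl⟩⟩

lemma vertex_zero : vertex (0, 0, 0) = OrderHom.id := rfl

lemma vertex_one : vertex (1, 1, 1) = sh.comp (sh.comp sh) :=
  OrderHom.ext _ _ (funext fun p => Subtype.ext (Prod.ext (by
    change p.1.1 + 3 = p.1.1 + 1 + 1 + 1; ring) (Prod.ext (by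
      change p.1.2.1 + 3 = p.1.2.1 + 1 + 1 + 1; ring) (by
        change p.1.2.2 + 3 = p.1.2.2 + 1 + 1 + 1; ring))))

/-- Each of these vertices depends on a single coordinate of `p`: for instance `(1, 0, 0)` gives
`(p₃ + 2, p₃ + 1, p₃)` and `(1, 1, 0)` gives `(p₁ + 3, p₁ + 2, p₁ + 1)`. The first and third
coordinates, or a cyclic analogue, differ by two. -/
lemma not_inCubes_vertex (x : Cube) (h0 : x ≠ (0, 0, 0)) (h1 : x ≠ (1, 1, 1)) (p : Chain) :
    ¬ InCubes (vertex x p).1 := by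
  obtain ⟨a, b, c⟩ := x
  simp only [ne_eq, Prod.mk.injEq, not_and] at h0 h1
  change ¬ InCubes (cubeCoord _ _ _ _ _ _, cubeCoord _ _ _ _ _ _, cubeCoord _ _ _ _ _ _)
  rw [inCubes_iff]
  dsimp only
  unfold cubeCoord
  split_ifs <;> omega

/-- The rotation of the cube. -/
def _root_.Cube.rot : Cube →o Cube := ⟨fun x => (x.2.2, x.1, x.2.1), fun _ _ h => ⟨h.2.2, h.1, h.2.1⟩⟩

/-- An object of `C` with given coordinates. -/
def mk (a b c : ℤ) (h : (a ≤ b + 1 ∧ b ≤ a + 1 ∧ b ≤ c + 1 ∧ c ≤ b + 1 ∧ a ≤ c + 1 ∧ c ≤ a + 1) ∨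
    (b = a + 2 ∧ c = a + 1) ∨ (a = c + 2 ∧ b = c + 1) ∨ (c = b + 2 ∧ a = b + 1)) : Chain :=
  ⟨(a, b, c), h.imp (inCubes_iff a b c).2 (inLinks_iff a b c).2⟩

end Chain

namespace Prederivator
variable {D : Prederivator.{w, v, u}}

lemma Symm.comp {φ ψ : Chain →o Chain} (hφ : Symm φ) (hψ : Symm ψ) : Symm (φ.comp ψ) :=
  ⟨fun k hk => hφ.square _ (hψ.square k hk), fun p => (hφ.inCubes _).trans (hψ.inCubes p)⟩

lemma symm_id : Symm OrderHom.id := ⟨fun _ h => h, fun _ => Iff.rfl⟩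

lemma IsEx.symm {φ : Chain →o Chain} (hφ : Symm φ) {X : D.Val (Pos.{w} Chain)} (hX : IsEx X) :
    IsEx ((D.res (Pos.map φ)).obj X) :=
  ⟨fun k hk => (hX.1 _ (hφ.square k hk)).of_iso (D.resObjIso (f := Pos.map k) (g := Pos.map φ) rfl X),
    fun p hp => (hX.2 _ (mt (hφ.inCubes p).1 hp)).of_iso (evRes (Pos.map φ) (Pos.of p) X)⟩

lemma IsStableDerivator.isBicartesian_of_isZero (hD : D.IsStableDerivator) {X : D.Val (Pos.{w} Sq)}
    (hX : IsZero X) : D.IsBicartesian X := by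
  have h : D.IsCocartesian X := (hD.toIsDerivator'.isCocartesian_iff X).2 fun V =>
    (Function.bijective_iff_nonempty_unique ((hD.isZero_res _ hX).unique_to _) _).2 (hX.unique_to V)
  exact ⟨h, (hD.stable X).1 h⟩

/-- The extreme vertices give the identity and the triple shift. The other six give diagrams that
are zero everywhere, and zero squares are bicartesian. -/
lemma IsStableDerivator.isEx_vertex (hD : D.IsStableDerivator) (x : Cube) {X : D.Val (Pos.{w} Chain)}
    (hX : IsEx X) : IsEx ((D.res (Pos.map (Chain.vertex x))).obj X) := by
  by_cases h0 : x = (0, 0, 0)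
  · rw [h0, Chain.vertex_zero]
    exact hX.symm symm_id
  by_cases h1 : x = (1, 1, 1)
  · rw [h1, Chain.vertex_one]
    exact hX.symm (symm_sh.comp (symm_sh.comp symm_sh))
  have h (p) : IsZero (D.ev ((D.res (Pos.map (Chain.vertex x))).obj X) (Pos.of p)) :=
    (hX.2 _ (Chain.not_inCubes_vertex x h0 h1 p)).of_iso (evRes (Pos.map _) (Pos.of p) X)
  exact ⟨fun k _ => hD.isBicartesian_of_isZero (hD.isZero_iff.2 fun y =>
    (h (k (ULift.down y))).of_iso (evRes (Pos.map k) y _)), fun p _ => h p⟩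

section
variable (hD : D.IsStableDerivator) {X : D.Val (Pos.{w} Chain)}
include hD

lemma IsEx.isCocartesian_grid (hX : IsEx X) {m n : ℕ} (g : Fin (m + 1) × Fin (n + 1) →o Chain)
    (hg : ∀ i j, IsSmallSquare (g.comp (gridSq i j)) ∨
      IsSmallSquare ((g.comp (gridSq i j)).comp Sq.swap)) :
    D.IsCocartesian ((D.res (Pos.map (g.comp (gridOuter m n)))).obj X) := by
  have h := hD.toIsDerivator'.isCocartesian_grid (X := (D.res (Pos.map g)).obj X) fun i j => by
    have : D.IsCocartesian ((D.res (Pos.map (g.comp (gridSq i j)))).obj X) := by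
      obtain h | h := hg i j
      · exact (hX.1 _ h).1
      · exact hD.toIsDerivator'.isCocartesian_of_swap _ _ (fun _ _ => rfl) (hX.1 _ h).1
    exact this.of_iso (D.resObjIso (f := Pos.map (gridSq i j)) (g := Pos.map g) rfl X)
  exact h.of_iso (D.resObjIso (f := Pos.map (gridOuter m n)) (g := Pos.map g) rfl X).symm

/-- The squares with vertices `(1, 0, 0)`, `(2, 1, 0)`, `(1, 0, 2)` and `(2, 1, 2)` are cocartesian. -/
lemma IsEx.isCocartesian_of_two_by_two (hX : IsEx X) (k : Sq →o Chain)
    (hk : ∀ x, (k x).1 = (1 + ((x.1 : ℕ) : ℤ), ((x.1 : ℕ) : ℤ), 2 * ((x.2 : ℕ) : ℤ))) :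
    D.IsCocartesian ((D.res (Pos.map k)).obj X) := by
  -- The first two coordinates climb the staircase `(1, 0)`, `(1, 1)`, `(2, 1)` while the third runs
  -- from `0` to `2`. Two of the four unit squares are faces and two are reinforcing.
  let g : Fin (2 + 1) × Fin (2 + 1) →o Chain :=
    { toFun x := Chain.mk (1 + (x.1 : ℕ) / 2) (((x.1 : ℕ) + 1) / 2) (x.2 : ℕ) (by omega)
      monotone' x y h := by
        have h1 : (x.1 : ℕ) ≤ (y.1 : ℕ) := h.1
        have h2 : (x.2 : ℕ) ≤ (y.2 : ℕ) := h.2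
        refine ⟨?_, ?_, ?_⟩ <;> simp only [Chain.mk] <;> omega }
  obtain rfl : g.comp (gridOuter 2 2) = k :=
    OrderHom.ext _ _ (funext fun x => Subtype.ext ((hk x).symm ▸ by revert x; decide))
  refine hX.isCocartesian_grid hD g fun i j => ?_
  fin_cases i <;> fin_cases j
  · exact .inl (.inl ⟨0, 1, .inr (.inl (by decide))⟩)
  · exact .inl (.inr ⟨0, .inr (.inl (by decide))⟩)
  · exact .inr (.inr ⟨0, .inr (.inr (by decide))⟩)
  · exact .inr (.inl ⟨1, 0, .inr (.inr (by decide))⟩)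

/-- The squares with vertices `(1, 1, 0)`, `(1, 3, 2)`, `(2, 1, 0)` and `(2, 3, 2)` are cocartesian. -/
lemma IsEx.isCocartesian_of_four_by_one (hX : IsEx X) (k : Sq →o Chain)
    (hk : ∀ x, (k x).1 = (1 + ((x.2 : ℕ) : ℤ), 1 + 2 * ((x.1 : ℕ) : ℤ), 2 * ((x.1 : ℕ) : ℤ))) :
    D.IsCocartesian ((D.res (Pos.map k)).obj X) := by
  -- The last two coordinates climb the staircase `(1, 0)`, `(1, 1)`, `(2, 1)`, `(2, 2)`, `(3, 2)`
  -- while the first runs from `1` to `2`.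
  let g : Fin (4 + 1) × Fin (1 + 1) →o Chain :=
    { toFun x := Chain.mk (1 + (x.2 : ℕ)) (1 + (x.1 : ℕ) / 2) (((x.1 : ℕ) + 1) / 2) (by omega)
      monotone' x y h := by
        have h1 : (x.1 : ℕ) ≤ (y.1 : ℕ) := h.1
        have h2 : (x.2 : ℕ) ≤ (y.2 : ℕ) := h.2
        refine ⟨?_, ?_, ?_⟩ <;> simp only [Chain.mk] <;> omega }
  obtain rfl : g.comp (gridOuter 4 1) = k :=
    OrderHom.ext _ _ (funext fun x => Subtype.ext ((hk x).symm ▸ by revert x; decide))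
  refine hX.isCocartesian_grid hD g fun i j => ?_
  fin_cases i <;> fin_cases j
  · exact .inl (.inr ⟨0, .inr (.inr (by decide))⟩)
  · exact .inr (.inl ⟨1, 0, .inl (by decide)⟩)
  · exact .inl (.inl ⟨1, 1, .inr (.inr (by decide))⟩)
  · exact .inr (.inr ⟨1, .inl (by decide)⟩)

end

end Prederivator

/-! ### The cubes of an exact diagram are cocartesian -/

namespace Prederivator
variable {D : Prederivator.{w, v, u}}

/-! ### Suspension cubes of exact diagrams -/

lemma IsEx.of_iso {X Y : D.Val (Pos.{w} Chain)} (h : IsEx X) (e : X ≅ Y) : IsEx Y :=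
  ⟨fun k hk => (h.1 k hk).of_iso ((D.res _).mapIso e),
    fun p hp => (h.2 p hp).of_iso ((D.res _).mapIso e.symm)⟩

lemma IsDerivator'.isLKE_cube_rot (hD : D.IsDerivator') {X : D.Val (Pos.{w} Cube)}
    (hX : IsLKE (Pos.map Cube.incl) X) :
    IsLKE (Pos.map Cube.incl) ((D.res (Pos.map Cube.rot)).obj X) := by
  let r : {x : Cube // x ≠ (1, 1, 1)} →o {x : Cube // x ≠ (1, 1, 1)} :=
    ⟨fun x => ⟨Cube.rot x.1, by have h := x.2; generalize x.1 = y at h; revert y; decide⟩,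
      fun _ _ h => Cube.rot.2 h⟩
  refine hD.isLKE_res (p := Pos.map r) (b := Pos.map Cube.rot) (leftExact_pos
    (p := r) (u := Cube.incl) (q := Cube.incl) (b := Cube.rot) (Pos.sqHom rfl) ?_)
    (Pos.isIso_sqHom rfl) hX
  rintro y ⟨⟨a, b, c⟩, ha⟩ h
  refine ⟨⟨(b, c, a), fun h' => ha ?_⟩, ⟨h.2.1, h.2.2, h.1⟩, le_rfl,
    fun k' _ h' => ⟨h'.2.1, h'.2.2, h'.1⟩⟩
  simp only [Prod.mk.injEq] at h' ⊢
  tauto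

section
variable (hD : D.IsStableDerivator) {X : D.Val (Pos.{w} Chain)}
include hD

/-- The cubes are equivariant: the rotation of `C` maps the cube at `p` to the cube at its rotation,
up to rotating the coordinates of the cube. Two more rotations of the cube undo this, as rotation
has order three. -/
lemma IsEx.isLKE_cubeAt_of_rot (p : Chain) (h : IsLKE (Pos.map Cube.incl)
    ((D.res (Pos.map (Chain.cubeAt p))).obj ((D.res (Pos.map Chain.rot)).obj X))) :
    IsLKE (Pos.map Cube.incl) ((D.res (Pos.map (Chain.cubeAt (Chain.rot p)))).obj X) := by
  have hD' := hD.toIsDerivator'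
  let Y := (D.res (Pos.map (Chain.cubeAt (Chain.rot p)))).obj X
  have e : (D.res (Pos.map (Chain.cubeAt p))).obj ((D.res (Pos.map Chain.rot)).obj X) ≅
      (D.res (Pos.map Cube.rot)).obj Y :=
    (D.resObjIso (f := Pos.map (Chain.cubeAt p)) (g := Pos.map Chain.rot) rfl X).symm ≪≫
      D.resObjIso (f := Pos.map Cube.rot) (g := Pos.map (Chain.cubeAt (Chain.rot p)))
        (h := Pos.map (Chain.rot.comp (Chain.cubeAt p))) rfl X
  have h1 := hD'.isLKE_cube_rot (hD'.isLKE_cube_rot (h.of_iso e))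
  exact h1.of_iso ((D.res (Pos.map Cube.rot)).mapIso
    (D.resObjIso (f := Pos.map Cube.rot) (g := Pos.map Cube.rot) rfl Y).symm ≪≫
    (D.resObjIso (f := Pos.map Cube.rot) (g := Pos.map (Cube.rot.comp Cube.rot)) (h := 𝟭 _) rfl Y).symm
      ≪≫ (D.resId _).app Y)

lemma IsEx.isCocartesian_of_comp (hX : IsEx X) {φ : Chain →o Chain} (hφ : Symm φ)
    (k k' : Sq →o Chain) (hk : ∀ {Y : D.Val (Pos.{w} Chain)}, IsEx Y →
      D.IsCocartesian ((D.res (Pos.map k)).obj Y)) (hk' : ∀ x y, k' (x, y) = φ (k (y, x))) :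
    D.IsCocartesian ((D.res (Pos.map k')).obj X) :=
  hD.toIsDerivator'.isCocartesian_of_swap (φ.comp k) k' hk' ((hk (hX.symm hφ)).of_iso
    (D.resObjIso (f := Pos.map k) (g := Pos.map φ) rfl X).symm)

/-- The added vertices are `(2, 3, 2)` and `(2, 4, 3)`. The square to `(2, 3, 2)` is the transposed
four-by-one staircase, the one to `(2, 4, 3)` is degenerate, and the last square is a rotated and
shifted two-by-two staircase. -/
lemma IsEx.isLKE_cubeAt₁₁₀ (hX : IsEx X) :
    IsLKE (Pos.map Cube.incl) ((D.res (Pos.map (Chain.cubeAt (Chain.mk 1 1 0 (by decide))))).obj X) := by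
  let k₂ : Sq →o Chain := ⟨fun x => Chain.mk (1 + (x.1 : ℕ)) (x.1 : ℕ) (2 * (x.2 : ℕ)) (by
    revert x; decide), by decide⟩
  let k₄ : Sq →o Chain := ⟨fun x => Chain.mk (1 + (x.2 : ℕ)) (1 + 2 * (x.1 : ℕ)) (2 * (x.1 : ℕ)) (by
    revert x; decide), by decide⟩
  let k₀ : Sq →o Chain := ⟨fun x => Chain.mk (1 + (x.1 : ℕ)) (1 + 2 * (x.2 : ℕ)) (2 * (x.2 : ℕ)) (by
    revert x; decide), by decide⟩
  let k₁ : Sq →o Chain := ⟨fun x => Chain.mk 2 (1 + 3 * (x.2 : ℕ)) 3 (by revert x; decide), by decide⟩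
  let k' : Sq →o Chain := ⟨fun x => Chain.mk (2 + 2 * (x.1 : ℕ)) (3 + (x.2 : ℕ)) (2 + (x.2 : ℕ)) (by
    revert x; decide), by decide⟩
  let q : Fin 2 →o Chain := ⟨fun z => Chain.mk 2 (3 + (z : ℕ)) (2 + (z : ℕ)) (by revert z; decide),
    by decide⟩
  refine hD.toIsDerivator'.isLKE_cube _ q (by decide) (by decide) (by decide) ![k₀, k₁] (by decide)
    k' (by decide) ?_ ?_
  · rw [Fin.forall_fin_two]
    exact ⟨hX.isCocartesian_of_comp hD symm_id k₄ k₀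
      (fun hY => hY.isCocartesian_of_four_by_one hD _ fun _ => rfl) (by decide),
      hD.toIsDerivator'.isCocartesian_of_le k₁ (by decide) (by decide) X⟩
  · exact hX.isCocartesian_of_comp hD (symm_sh.comp (symm_sh.comp symm_rot)) k₂ k'
      (fun hY => hY.isCocartesian_of_two_by_two hD _ fun _ => rfl) (by decide)

/-- The same criterion with the two staircases exchanged. The cube is rotated beforehand, so that
the suitable pair of opposite faces is pushed out, and rotated back at the end. -/
lemma IsEx.isLKE_cubeAt₁₀₀ (hX : IsEx X) :
    IsLKE (Pos.map Cube.incl) ((D.res (Pos.map (Chain.cubeAt (Chain.mk 1 0 0 (by decide))))).obj X) := by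
  let k₂ : Sq →o Chain := ⟨fun x => Chain.mk (1 + (x.1 : ℕ)) (x.1 : ℕ) (2 * (x.2 : ℕ)) (by
    revert x; decide), by decide⟩
  let k₄ : Sq →o Chain := ⟨fun x => Chain.mk (1 + (x.2 : ℕ)) (1 + 2 * (x.1 : ℕ)) (2 * (x.1 : ℕ)) (by
    revert x; decide), by decide⟩
  let k₀ : Sq →o Chain := ⟨fun x => Chain.mk (1 + (x.2 : ℕ)) (x.2 : ℕ) (2 * (x.1 : ℕ)) (by
    revert x; decide), by decide⟩
  let k₁ : Sq →o Chain := ⟨fun x => Chain.mk (1 + 3 * (x.2 : ℕ)) 3 2 (by revert x; decide), by decide⟩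
  let k' : Sq →o Chain := ⟨fun x => Chain.mk (2 + 2 * (x.2 : ℕ)) (1 + 2 * (x.2 : ℕ)) (2 + (x.1 : ℕ)) (by
    revert x; decide), by decide⟩
  let q : Fin 2 →o Chain := ⟨fun z => Chain.mk (2 + 2 * (z : ℕ)) (1 + 2 * (z : ℕ)) 2 (by
    revert z; decide), by decide⟩
  have h := hD.toIsDerivator'.isLKE_cube (X := X)
    ((Chain.cubeAt (Chain.mk 1 0 0 (by decide))).comp (Cube.rot.comp Cube.rot)) q
    (by decide) (by decide) (by decide) ![k₀, k₁] (by decide) k' (by decide) (by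
      rw [Fin.forall_fin_two]
      exact ⟨hX.isCocartesian_of_comp hD symm_id k₂ k₀
        (fun hY => hY.isCocartesian_of_two_by_two hD _ fun _ => rfl) (by decide),
        hD.toIsDerivator'.isCocartesian_of_le k₁ (by decide) (by decide) X⟩)
    (hX.isCocartesian_of_comp hD (symm_sh.comp (symm_rot.comp symm_rot)) k₄ k'
      (fun hY => hY.isCocartesian_of_four_by_one hD _ fun _ => rfl) (by decide))
  exact (hD.toIsDerivator'.isLKE_cube_rot h).of_iso (D.resObjIso (f := Pos.map Cube.rot)
    (g := Pos.map ((Chain.cubeAt (Chain.mk 1 0 0 (by decide))).comp (Cube.rot.comp Cube.rot)))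
    (h := Pos.map (Chain.cubeAt _)) rfl X).symm

end

/-- The functor given by the cubes. -/
noncomputable def cubeFun : Pos.{w} Chain × Pos.{w} Cube ⥤ Pos.{w} Chain where
  obj x := Pos.of (Chain.cube (ULift.down x.1, ULift.down x.2))
  map f := Pos.homOfLE (Chain.cube.2 ⟨Pos.le_of_hom f.1, Pos.le_of_hom f.2⟩)
  map_id _ := Subsingleton.elim _ _
  map_comp _ _ := Subsingleton.elim _ _

/-- The cubes at `(0, 0, 0)`, `(1, 0, 0)`, `(0, 1, 0)` and `(1, 1, 0)` form a square of cubes that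
is bicartesian at each vertex of the cube. Three of them are Kan extensions, hence so is the first.
The cubes at the remaining unit vectors are rotations of the one at `(1, 0, 0)`. -/
lemma IsEx.isLKE_cubeAt (hD : D.IsStableDerivator) {X : D.Val (Pos.{w} Chain)} (hX : IsEx X)
    (s : Source) :
    IsLKE (Pos.map Cube.incl) ((D.res (Pos.map (Chain.cubeAt (Source.incl s)))).obj X) := by
  have h₁ : IsLKE (Pos.map Cube.incl)
      ((D.res (Pos.map (Chain.cubeAt (Chain.mk 0 1 0 (by decide))))).obj X) :=
    isLKE_cubeAt_of_rot hD (Chain.mk 1 0 0 (by decide)) ((hX.symm symm_rot).isLKE_cubeAt₁₀₀ hD)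
  have key : s = ⟨(0, 0, 0), by decide⟩ ∨ s = ⟨(1, 0, 0), by decide⟩ ∨ s = ⟨(0, 1, 0), by decide⟩ ∨
      s = ⟨(0, 0, 1), by decide⟩ := by
    revert s; decide
  rcases key with rfl | rfl | rfl | rfl
  · let f : Sq →o Chain := ⟨fun x => Chain.mk (x.1 : ℕ) (x.2 : ℕ) 0 (by revert x; decide), by decide⟩
    have hf : IsSmallSquare f := .inl ⟨0, 0, .inl (by decide)⟩
    let G : Pos.{w} Sq × Pos.{w} Cube ⥤ Pos.{w} Chain := (Pos.map f).prod (𝟭 _) ⋙ cubeFun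
    -- At a fixed vertex of the cube, this square of cubes is the face `f` evaluated on the exact
    -- diagram `Chain.vertex`.
    have h := hD.isLKE_of_isBicartesian (Pos.map.{w} Cube.incl) (X := (D.res G).obj X)
      (fun a => (((hD.isEx_vertex (ULift.down a) hX).1 f hf).1).of_iso
        ((D.resObjIso (f := Pos.map f) (g := Pos.map (Chain.vertex (ULift.down a))) rfl X).symm ≪≫
          D.resObjIso (f := slice _ a) (g := G) rfl X))
      fun x hx => by
        have e : (D.res (Pos.map (Chain.cubeAt (f x)))).obj X ≅
            (D.res (Prod.sectR (Pos.of x) (Pos.{w} Cube))).obj ((D.res G).obj X) :=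
          D.resObjIso (f := Prod.sectR (Pos.of x) (Pos.{w} Cube)) (g := G) rfl X
        refine IsLKE.of_iso ?_ e
        rcases Sq.cases x with rfl | rfl | rfl | rfl
        · exact absurd rfl hx
        · exact h₁
        · exact hX.isLKE_cubeAt₁₀₀ hD
        · exact hX.isLKE_cubeAt₁₁₀ hD
    exact h.of_iso (D.resObjIso (f := Prod.sectR (Pos.of (0, 0)) (Pos.{w} Cube)) (g := G)
      (h := Pos.map (Chain.cubeAt (f (0, 0)))) rfl X).symm
  · exact hX.isLKE_cubeAt₁₀₀ hD
  · exact h₁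
  · exact isLKE_cubeAt_of_rot hD (Chain.mk 0 1 0 (by decide))
      (isLKE_cubeAt_of_rot hD (Chain.mk 1 0 0 (by decide))
        (((hX.symm symm_rot).symm symm_rot).isLKE_cubeAt₁₀₀ hD))

lemma IsStableDerivator.actsEx_cubeFun (hD : D.IsStableDerivator) : D.ActsEx cubeFun.{w} := by
  intro A Y hY
  refine (cexProp_iff _).2 fun x => ?_
  exact (hD.isEx_vertex (ULift.down x.1) ((cexProp_iff (A := A.unop) Y).1 hY x.2)).of_iso
    ((D.resObjIso (f := Pos.map (Chain.vertex (ULift.down x.1))) (g := slice _ x.2)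
      (h := slice _ x ⋙ actFun cubeFun (𝟭 A.unop)) rfl Y).symm ≪≫
      D.resObjIso (f := slice _ x) (g := actFun cubeFun (𝟭 A.unop)) rfl Y)

end Prederivator

/-! ### Kan extensions and zero objects in exact diagrams -/

namespace Prederivator
variable {D E : Prederivator.{w, v, u}}

/-! ### Left Kan extensions and zero objects in the derivator of exact diagrams -/

/-- Kan extensions in exact diagrams are in general not those of `D` at every object of `C`. Through
the equivalence with the source they are tested at the four objects of the source only. -/
lemma IsStableDerivator.cex_isLKE_iff (hD : D.IsStableDerivator) {P Q : Type w} [Category.{w} P]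
    [Category.{w} Q] {q : P ⥤ Q} (Y : D.cex.Val Q) : IsLKE (D := D.cex) q Y ↔
      ∀ s : Source, IsLKE q ((D.res (Prod.sectR (Pos.of.{w} (Source.incl s)) Q)).obj Y.obj) := by
  have := sourceRes_isEquivalence hD
  have h : IsLKE (D := D.cex) q Y ↔ IsLKE ((𝟭 (Pos.{w} Source)).prod q)
      ((D.res ((Pos.map.{w} Source.incl).prod (𝟭 Q))).obj Y.obj) :=
    (isLKE_valMap_iff D.sourceRes Y).symm
  have e (s : Source) : (D.res (Prod.sectR (Pos.of.{w} (Source.incl s)) Q)).obj Y.obj ≅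
      (D.res (Prod.sectR (Pos.of.{w} s) Q)).obj
        ((D.res ((Pos.map.{w} Source.incl).prod (𝟭 Q))).obj Y.obj) :=
    D.resObjIso (f := Prod.sectR (Pos.of.{w} s) Q) (g := (Pos.map.{w} Source.incl).prod (𝟭 Q)) rfl _
  rw [h, hD.toIsDerivator'.isLKE_prod_left]
  exact ⟨fun h s => (h (Pos.of s)).of_iso (e s).symm, fun h s => (h (ULift.down s)).of_iso (e _)⟩

/-- The zero diagram is exact, so it is the zero object of the full subcategory as well. -/
lemma IsStableDerivator.isZero_cex_iff (hD : D.IsStableDerivator) {Q : Type w} [Category.{w} Q]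
    (Y : D.cex.Val Q) : IsZero Y ↔ IsZero Y.obj := by
  let ι := (D.cexProp.prop (op (Cat.of Q))).ι
  refine ⟨fun h => ?_, fun h => IsZero.of_full_of_faithful_of_isZero ι Y h⟩
  obtain ⟨Z, hZ⟩ := hD.exists_isZero (Pos.{w} Chain × Q)
  have hZ' : D.cexProp.prop (op (Cat.of Q)) Z :=
    ⟨fun _ _ _ => hD.isBicartesian_of_isZero (hD.isZero_res _ hZ), fun _ _ _ => hD.isZero_res _ hZ⟩
  have h1 : IsZero (⟨Z, hZ'⟩ : D.cex.Val Q) :=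
    IsZero.of_full_of_faithful_of_isZero ι ⟨Z, hZ'⟩ hZ
  exact hZ.of_iso (ι.mapIso (h.iso h1))

/-- The suspension cubes of exact diagrams. -/
lemma IsStableDerivator.starProp_cexAct (hD : D.IsStableDerivator) (A : Cat.{w, w}ᵒᵖ)
    (Y : D.cex.obj A) : (D.cex.starProp ((0, 0, 0) : Cube) (1, 1, 1)).prop A
      (((D.cexAct cubeFun hD.actsEx_cubeFun).app A).toFunctor.obj Y) := by
  intro a
  constructor
  · refine (hD.cex_isLKE_iff _).2 fun s => (((cexProp_iff (A := A.unop) Y.obj).1 Y.property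
      a).isLKE_cubeAt hD s).of_iso ?_
    exact (D.resObjIso (f := Pos.map (Chain.cubeAt (Source.incl s))) (g := slice _ a) rfl Y.obj).symm ≪≫
      D.resObjIso (f := Prod.sectR (Pos.of (Source.incl s)) (Pos.{w} Cube) ⋙ (𝟭 _).prod (slice _ a))
        (g := actFun cubeFun (𝟭 A.unop)) rfl Y.obj ≪≫ D.resObjIso rfl _
  · intro j h0 h1
    refine (hD.isZero_cex_iff _).2 (hD.isZero_iff.2 fun x => ?_)
    refine (Y.property.2 _ (Chain.not_inCubes_vertex j h0 h1 (ULift.down x.1)) a).of_iso ?_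
    exact evRes ((𝟭 (Pos.{w} Chain)).prod (Functor.fromPUnit (Pos.of j, a))) x _ ≪≫
      evRes (actFun cubeFun (𝟭 A.unop)) _ Y.obj

/-! ### Exact morphisms and suspension squares of exact diagrams -/

/-- The hypothesis on `F` concerns squares in `D`. A cocartesian square of exact diagrams is first
evaluated at the objects of the source, where it is bicartesian in `D`, and the images are
reassembled in the same way over `E`. -/
lemma suspProp_cexMap (hD : D.IsStableDerivator) (hE : E.IsStableDerivator) (F : D ⟶ E)
    (hF : IsExact F) (A : Cat.{w, w}ᵒᵖ) (Y : (D.cex.shift (Pos.{w} Sq)).obj A)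
    (hY : D.cex.suspProp.prop A Y) :
    E.cex.suspProp.prop A (((shiftMap (cexMap F hF) (Pos.{w} Sq)).app A).toFunctor.obj Y) := by
  have hz {Q : Type w} [Category.{w} Q] (Z : D.cex.Val Q) (h : IsZero Z) :
      IsZero ((valMap (cexMap F hF) Q).obj Z) := by
    refine (hE.isZero_cex_iff _).2 (hE.isZero_iff.2 fun x => ?_)
    exact (hF.isZero _ (hD.isZero_iff.1 ((hD.isZero_cex_iff _).1 h) x)).of_iso
      (resNatIso F (Functor.fromPUnit x) Z.obj).symm
  intro a
  refine ⟨?_, (hz _ (hY a).2.1).of_iso (resNatIso (cexMap F hF) _ Y).symm,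
    (hz _ (hY a).2.2).of_iso (resNatIso (cexMap F hF) _ Y).symm⟩
  refine ((hE.cex.toIsDerivator'.isCocartesian_iff _).2 ((hE.cex_isLKE_iff _).2 fun s => ?_)).of_iso
    (resNatIso (cexMap F hF) (slice (Pos.{w} Sq) a) Y)
  have h := (hD.toIsDerivator'.isCocartesian_iff _).2
    ((hD.cex_isLKE_iff _).1 ((hD.cex.toIsDerivator'.isCocartesian_iff _).1 (hY a).1) s)
  exact (hE.toIsDerivator'.isCocartesian_iff _).1 ((hF.isBicartesian _ ⟨h, (hD.stable _).1 h⟩).1.of_iso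
    (resNatIso F _ _))

end Prederivator

/-! ### Suspension cubes obtained by iterating suspension squares -/

namespace Prederivator
open CatTrans
variable {D E : Prederivator.{w, v, u}}

/-! ### Suspension cubes from suspension squares -/

/-- The coordinates in the inner suspension squares. -/
def _root_.Cube.inner : Cube →o Sq :=
  ⟨fun x => (max x.1 x.2.2, max x.2.1 x.2.2), fun _ _ h => ⟨max_le_max h.1 h.2.2, max_le_max h.2.1 h.2.2⟩⟩

/-- The coordinates in the outer suspension squares. -/
def _root_.Cube.outer : Cube →o Sq :=
  ⟨fun x => (min x.1 x.2.1, x.2.2), fun _ _ h => ⟨min_le_min h.1 h.2.1, h.2.2⟩⟩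

namespace Suspension
variable (σ : Suspension E)

/-- The suspension cubes obtained by iterating the suspension squares. -/
noncomputable def iter : E ⟶ E.shift (Pos.{w} Cube) :=
  σ.square ≫ shiftMap σ.square (Pos.{w} Sq) ≫ E.diagRes Cube.inner Cube.outer

/-- The vertices of the suspension cubes. -/
noncomputable def iterEval (x : Cube) : σ.iter ≫ E.eval (Pos.of x) ≅
    (σ.square ≫ E.eval (Pos.of (Cube.inner x))) ≫ σ.square ≫ E.eval (Pos.of (Cube.outer x)) :=
  α_ _ _ _ ≪≫ whiskerLeftIso σ.square (α_ _ _ _ ≪≫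
    whiskerLeftIso (shiftMap σ.square (Pos.{w} Sq)) (E.diagResEval Cube.inner Cube.outer x) ≪≫
    (α_ _ _ _).symm ≪≫
    whiskerRightIso (evalCell (Pos.of (Cube.inner x)) σ.square).symm (E.eval (Pos.of (Cube.outer x))) ≪≫
    α_ _ _ _) ≪≫ (α_ _ _ _).symm

/-- The initial vertex of the suspension cubes. -/
noncomputable def iterBase : σ.iter ≫ E.eval (Pos.of (0, 0, 0)) ≅ 𝟙 E :=
  σ.iterEval (0, 0, 0) ≪≫ whiskerRightIso σ.base (σ.square ≫ E.eval (Pos.of (0, 0))) ≪≫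
    λ_ _ ≪≫ σ.base

end Suspension

/-- The components of an invertible modification. -/
def _root_.CatTrans.modIso {X₀ X₁ : Prederivator.{w, v, u}} {s t : X₀ ⟶ X₁} (e : s ≅ t)
    {A : Cat.{w, w}ᵒᵖ} (M : X₀.obj A) : (s.app A).toFunctor.obj M ≅ (t.app A).toFunctor.obj M where
  hom := modApp e.hom M
  inv := modApp e.inv M
  hom_inv_id := congrArg (fun t => modApp t M) e.hom_inv_id
  inv_hom_id := congrArg (fun t => modApp t M) e.inv_hom_id

/-- With third coordinate `0` the cube is the suspension square of `M` with its final vertex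
replaced by a zero object receiving `Σ M`; with third coordinate `1` it is zero except for `Σ (Σ M)`
at the end. The pushouts of the two faces are `Σ M` and `0`, and the last square is the suspension
square of `Σ M`. -/
lemma Suspension.starProp_iter (hE : E.IsStableDerivator) (σ : Suspension E) (A : Cat.{w, w}ᵒᵖ)
    (M : E.obj A) : (E.starProp ((0, 0, 0) : Cube) (1, 1, 1)).prop A
      ((σ.iter.app A).toFunctor.obj M) := by
  have hE' := hE.toIsDerivator'
  intro a
  let N : E.Val (Pos.{w} Sq × A.unop) := (σ.square.app A).toFunctor.obj M
  let X : E.Val (Pos.{w} Sq × (Pos.{w} Sq × A.unop)) :=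
    (σ.square.app (op (Cat.of (Pos.{w} Sq × A.unop)))).toFunctor.obj N
  have hN := σ.prop A M a
  have hX := σ.prop (op (Cat.of (Pos.{w} Sq × A.unop))) N
  have e : (E.res (Prod.sectR (Pos.of (0, 0)) (Pos.{w} Sq × A.unop))).obj X ≅ N := modIso σ.base N
  let G : Pos.{w} (Sq × Sq) ⥤ Pos.{w} Sq × (Pos.{w} Sq × A.unop) :=
    (Pos.map OrderHom.fst).prod' ((Pos.map OrderHom.snd).prod' ((Functor.const _).obj a))
  let f : Cube →o Sq × Sq := Cube.outer.prod Cube.inner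
  have hz (j : Cube) : E.ev (A := Pos.{w} Cube × A.unop) ((σ.iter.app A).toFunctor.obj M) (Pos.of j, a) ≅
      E.ev X (Pos.of (Cube.outer j), (Pos.of (Cube.inner j), a)) := evRes _ _ X
  -- At the outer corner `(0, 0)` the identification `base` recovers the inner square `N`.
  have h00 (j : Sq) : E.ev X (Pos.of (0, 0), (Pos.of j, a)) ≅ E.ev N (Pos.of j, a) :=
    (evRes (Prod.sectR (Pos.of (0, 0)) (Pos.{w} Sq × A.unop)) (Pos.of j, a) X).symm ≪≫
      (E.res _).mapIso e
  constructor
  -- The added vertices `((0, z), (1, 1))` lie in the product of the outer and inner squares but not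
  -- in the image of the cube.
  · have h := hE'.isLKE_cube (X := (E.res G).obj X) f
      ⟨fun z => ((0, z), (1, 1)), by decide⟩ (by decide) (by decide) (by decide)
      ![⟨fun x => ((0, 0), x), by decide⟩, ⟨fun _ => ((0, 1), (1, 1)), by decide⟩] (by decide)
      ⟨fun x => (x, (1, 1)), by decide⟩ (by decide) (by
        rw [Fin.forall_fin_two]
        refine ⟨hN.1.of_iso ((E.res (slice (Pos.{w} Sq) a)).mapIso e.symm ≪≫ ?_),
          hE'.isCocartesian_of_le _ (by decide) (by decide) _⟩
        exact (E.resObjIso (f := slice (Pos.{w} Sq) a)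
          (g := Prod.sectR (Pos.of (0, 0)) (Pos.{w} Sq × A.unop)) rfl X).symm ≪≫
          E.resObjIso (f := Pos.map ⟨fun x : Sq => (((0, 0), x) : Sq × Sq), by decide⟩) (g := G) rfl X)
      ((hX (Pos.of (1, 1), a)).1.of_iso
        (E.resObjIso (f := Pos.map ⟨fun x : Sq => ((x, (1, 1)) : Sq × Sq), by decide⟩) (g := G) rfl X))
    exact h.of_iso ((E.resObjIso (f := Pos.map f) (g := G) rfl X).symm ≪≫
      E.resObjIso (f := slice _ a) (g := diagFun (Pos.map Cube.inner) (Pos.map Cube.outer) (𝟭 A.unop))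
        rfl X)
  · intro j h0 h1
    have key : ∀ j : Cube, j ≠ (0, 0, 0) → j ≠ (1, 1, 1) → Cube.outer j = (1, 0) ∨
        Cube.outer j = (0, 1) ∨ Cube.outer j = (0, 0) ∧
          (Cube.inner j = (1, 0) ∨ Cube.inner j = (0, 1)) := by decide
    refine IsZero.of_iso ?_ (hz j)
    rcases key j h0 h1 with h | h | ⟨h, h' | h'⟩
    · rw [h]
      exact (hX (Pos.of (Cube.inner j), a)).2.1
    · rw [h]
      exact (hX (Pos.of (Cube.inner j), a)).2.2
    · rw [h, h']
      exact hN.2.1.of_iso (h00 _)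
    · rw [h, h']
      exact hN.2.2.of_iso (h00 _)

namespace Comparison
variable {F : D ⟶ E} {σ : Suspension D} {τ : Suspension E} (κ : Comparison F σ τ)

/-- The comparison of suspension cubes induced by a comparison of suspension squares. -/
noncomputable def iterCell : σ.iter ≫ shiftMap F (Pos.{w} Cube) ≅ F ≫ τ.iter :=
  pasteSq κ.cell (pasteSq (shiftCell κ.cell (Pos.{w} Sq)) (diagResCell Cube.inner Cube.outer F))

/-- `iterEval` is composed of associators, of the evaluation of a diagonal restriction and of an
interchange of evaluation with the second suspension square. Each constituent is compatible with
`F`. -/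
lemma compat_iterEval (x : Cube) :
    Compat (pasteSq κ.iterCell (evalCell (Pos.of x) F))
      (pasteSq (pasteSq κ.cell (evalCell (Pos.of (Cube.inner x)) F))
        (pasteSq κ.cell (evalCell (Pos.of (Cube.outer x)) F)))
      (σ.iterEval x) (τ.iterEval x) :=
  (compat_assoc _ _ _).trans ((Compat.whiskerLeft _ ((compat_assoc _ _ _).trans
    ((Compat.whiskerLeft _ (compat_diagResEval _ _ F x)).trans ((compat_assoc _ _ _).symm.trans
      ((Compat.whiskerRight _ (compat_evalCell κ.cell (Pos.of (Cube.inner x))).symm).trans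
        (compat_assoc _ _ _)))))).trans (compat_assoc _ _ _).symm)

lemma compat_base : Compat (pasteSq κ.cell (evalCell (Pos.of (0, 0)) F)) (idSq F) σ.base τ.base :=
  κ.base.symm

lemma compat_iterBase :
    Compat (pasteSq κ.iterCell (evalCell (Pos.of (0, 0, 0)) F)) (idSq F) σ.iterBase τ.iterBase :=
  (κ.compat_iterEval (0, 0, 0)).trans ((Compat.whiskerRight _ κ.compat_base).trans
    ((compat_leftUnitor _).trans κ.compat_base))

end Comparison

end Prederivator

lemma Pos.functor_ext {A : Type w} [Category.{w} A] {P : Type} [Preorder P] {F G : A ⥤ Pos.{w} P}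
    (h : ∀ a, F.obj a = G.obj a) : F = G :=
  Functor.hext h fun a b _ => by
    have : Subsingleton (F.obj a ⟶ F.obj b) := inferInstance
    exact Subsingleton.helim (by rw [h a, h b]) _ _

/-! ### Construction and canonicity of the isomorphisms -/

namespace Prederivator
open CatTrans
variable {D E : Prederivator.{w, v, u}}

/-! ### The isomorphism between triple shift and double suspension -/

/-- Compatibility known only after evaluating by `t` becomes an equation whiskered with `t'`, to
which the injectivity of lifts applies. The contribution of the square `c` cancels. -/
lemma whiskerRight_eq_of_compat {X₀ X₁ X₂ Y₀ Y₁ Y₂ : Prederivator.{w, v, u}} {F₀ : X₀ ⟶ Y₀}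
    {F₁ : X₁ ⟶ Y₁} {F₂ : X₂ ⟶ Y₂} {s s₁ : X₀ ⟶ X₁} {s' s₁' : Y₀ ⟶ Y₁} {t : X₁ ⟶ X₂} {t' : Y₁ ⟶ Y₂}
    {a : s ≫ F₁ ≅ F₀ ≫ s'} {b : s₁ ≫ F₁ ≅ F₀ ≫ s₁'} {c : t ≫ F₂ ≅ F₁ ≫ t'} {m : s ≅ s₁}
    {m' : s' ≅ s₁'} (h : Compat (pasteSq a c) (pasteSq b c) (whiskerRightIso m t)
      (whiskerRightIso m' t')) : (m.hom ▷ F₁ ≫ b.hom) ▷ t' = (a.hom ≫ F₀ ◁ m'.hom) ▷ t' := by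
  unfold Compat at h
  simp only [pasteSq, Iso.trans_hom, Iso.symm_hom, whiskerLeftIso_hom, whiskerRightIso_hom,
    Category.assoc] at h
  rw [associator_naturality_left_assoc, ← whisker_exchange_assoc,
    associator_inv_naturality_left_assoc, Iso.cancel_iso_hom_left, cancel_epi, cancel_epi,
    ← associator_naturality_middle, ← comp_whiskerRight_assoc, ← comp_whiskerRight_assoc,
    cancel_mono] at h
  exact h

lemma preservesEx_map {φ : Chain →o Chain} (hφ : Symm φ) : D.PreservesEx (Pos.map.{w} φ) :=
  cexProp_restr hφ

lemma sectL_cubeFun_zero : Prod.sectL _ (Pos.of (0, 0, 0)) ⋙ cubeFun.{w} = 𝟭 _ :=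
  Pos.functor_ext fun _ => rfl

lemma sectL_cubeFun_one : Prod.sectL _ (Pos.of (1, 1, 1)) ⋙ cubeFun.{w} =
    (Pos.map Chain.sh ⋙ Pos.map Chain.sh) ⋙ Pos.map Chain.sh :=
  Pos.functor_ext fun p =>
    congrArg (fun f : Chain →o Chain => Pos.of.{w} (f (ULift.down p))) Chain.vertex_one

lemma preservesEx_comp {s t : Pos.{w} Chain ⥤ Pos.{w} Chain} {φ ψ : Chain →o Chain} (hφ : Symm φ)
    (hψ : Symm ψ) (hs : s = Pos.map φ) (ht : t = Pos.map ψ) : D.PreservesEx (t ⋙ s) := by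
  have h : t ⋙ s = Pos.map.{w} (φ.comp ψ) := by
    subst hs ht
    exact Pos.functor_ext fun _ => rfl
  rw [h]
  exact preservesEx_map (hφ.comp hψ)

variable (D) in
lemma preservesEx_shift : D.PreservesEx (Pos.map.{w} Chain.sh) := preservesEx_map symm_sh

variable (D) in
lemma preservesEx_shift₂ : D.PreservesEx (Pos.map.{w} Chain.sh ⋙ Pos.map Chain.sh) :=
  preservesEx_comp symm_sh symm_sh rfl rfl

variable (D) in
lemma preservesEx_shift₃ :
    D.PreservesEx ((Pos.map.{w} Chain.sh ⋙ Pos.map Chain.sh) ⋙ Pos.map Chain.sh) :=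
  preservesEx_comp symm_sh (symm_sh.comp symm_sh) rfl (Pos.functor_ext fun _ => rfl)

section
variable (hD : D.IsStableDerivator)

/-- The suspension cubes of exact diagrams. -/
noncomputable def cubes : D.cex ⟶ D.cex.shift (Pos.{w} Cube) := D.cexAct cubeFun hD.actsEx_cubeFun

/-- The initial vertex of the suspension cubes. -/
noncomputable def cubesBase : cubes hD ≫ D.cex.eval (Pos.of (0, 0, 0)) ≅ 𝟙 D.cex :=
  D.cexActEval cubeFun hD.actsEx_cubeFun (Pos.of (0, 0, 0))
    (sectL_cubeFun_zero ▸ preservesEx_map symm_id) ≪≫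
    cexResFCongr sectL_cubeFun_zero _ (preservesEx_map symm_id) ≪≫ D.cexResFId _

/-- The final vertex of the suspension cubes. -/
noncomputable def cubesFinal : cubes hD ≫ D.cex.eval (Pos.of (1, 1, 1)) ≅
    D.cexResF ((Pos.map Chain.sh ⋙ Pos.map Chain.sh) ⋙ Pos.map Chain.sh) D.preservesEx_shift₃ :=
  D.cexActEval cubeFun hD.actsEx_cubeFun (Pos.of (1, 1, 1))
    (sectL_cubeFun_one ▸ D.preservesEx_shift₃) ≪≫
    cexResFCongr sectL_cubeFun_one _ D.preservesEx_shift₃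

variable (hE : E.IsStableDerivator) (F : D ⟶ E) (hF : IsExact F)

/-- The canonical isomorphism expressing that `F` commutes with suspension cubes. -/
noncomputable def cubesCell : cubes hD ≫ shiftMap (cexMap F hF) (Pos.{w} Cube) ≅
    cexMap F hF ≫ cubes hE :=
  cexActCell cubeFun F hF hD.actsEx_cubeFun hE.actsEx_cubeFun

lemma compat_cubesBase :
    Compat (pasteSq (cubesCell hD hE F hF) (evalCell (Pos.of (0, 0, 0)) (cexMap F hF)))
      (idSq (cexMap F hF)) (cubesBase hD) (cubesBase hE) :=
  (compat_cexActEval cubeFun F hF _ _ _ _ _).trans ((compat_cexResFCongr F hF _ _ _ _ _).trans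
    (compat_cexResFId F hF _ _))

lemma compat_cubesFinal :
    Compat (pasteSq (cubesCell hD hE F hF) (evalCell (Pos.of (1, 1, 1)) (cexMap F hF)))
      (cexResFCell F hF D.preservesEx_shift₃ E.preservesEx_shift₃) (cubesFinal hD) (cubesFinal hE) :=
  (compat_cexActEval cubeFun F hF _ _ _ _ _).trans (compat_cexResFCongr F hF _ _ _ _ _)

/-- Both morphisms have values in diagrams determined by their vertex `(0, 0, 0)`, where both are
identified with the identity; the resulting isomorphism of initial vertices lifts. -/
lemma exists_cubesIso (σ : Suspension D.cex) : ∃ e : cubes hD ≅ σ.iter,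
    whiskerRightIso e (D.cex.eval (Pos.of (0, 0, 0))) = cubesBase hD ≪≫ σ.iterBase.symm := by
  obtain ⟨c, hc⟩ := exists_iso_whiskerRight (e := D.cex.eval (Pos.of (0, 0, 0)))
    (D.cex.starProp ((0, 0, 0) : Cube) (1, 1, 1))
    (fun A M N hM hN => starProp_bijective hD.cex (b := ((0, 0, 0) : Cube)) (by decide) (by decide)
      (A := A.unop) hM hN)
    (η := cubes hD) (θ := σ.iter) hD.starProp_cexAct (σ.starProp_iter hD.cex)
    (cubesBase hD ≪≫ σ.iterBase.symm)
  exact ⟨c, Iso.ext hc⟩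

/-- The isomorphism of suspension cubes which is compatible with the initial vertices. -/
noncomputable def cubesIso (σ : Suspension D.cex) : cubes hD ≅ σ.iter := (exists_cubesIso hD σ).choose

/-- At the initial vertex both composites are built from `cubesBase` and `iterBase`, which are
compatible with `F`. Since evaluation there is faithful on the target diagrams, the composites
agree, so the choice involved in `cubesIso` is immaterial. -/
lemma compat_cubesIso {σ : Suspension D.cex} {τ : Suspension E.cex}
    (κ : Comparison (cexMap F hF) σ τ) :
    Compat (cubesCell hD hE F hF) κ.iterCell (cubesIso hD σ) (cubesIso hE τ) := by
  have h : Compat (pasteSq (cubesCell hD hE F hF) (evalCell (Pos.of (0, 0, 0)) (cexMap F hF)))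
      (pasteSq κ.iterCell (evalCell (Pos.of (0, 0, 0)) (cexMap F hF)))
      (whiskerRightIso (cubesIso hD σ) _) (whiskerRightIso (cubesIso hE τ) _) := by
    rw [cubesIso, cubesIso, (exists_cubesIso hD σ).choose_spec, (exists_cubesIso hE τ).choose_spec]
    exact (compat_cubesBase hD hE F hF).trans κ.compat_iterBase.symm
  refine whiskerRight_injective (E.cex.starProp ((0, 0, 0) : Cube) (1, 1, 1)) ?_ ?_ ?_
    (whiskerRight_eq_of_compat h)
  · exact fun A M N hM hN => starProp_bijective hE.cex (b := ((0, 0, 0) : Cube)) (by decide)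
      (by decide) (A := A.unop) hM hN
  · exact fun A M => starProp_of_iso _ _ (modIso (cubesCell hD hE F hF) M).symm
      (hE.starProp_cexAct A _)
  · exact fun A M => τ.starProp_iter hE.cex A _

/-- The triple composition of restrictions. -/
noncomputable def cexResFTriple {s : Pos.{w} Chain ⥤ Pos.{w} Chain} (hs : D.PreservesEx s)
    (hs₂ : D.PreservesEx (s ⋙ s)) (hs₃ : D.PreservesEx ((s ⋙ s) ⋙ s)) :
    D.cexResF s hs ≫ D.cexResF s hs ≫ D.cexResF s hs ≅ D.cexResF ((s ⋙ s) ⋙ s) hs₃ :=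
  whiskerLeftIso _ (D.cexResFComp hs hs hs₂) ≪≫ D.cexResFComp hs hs₂ hs₃

variable (D) in
/-- The triple shift is a restriction. -/
noncomputable def shiftTriple : D.shiftRes ≫ D.shiftRes ≫ D.shiftRes ≅
    D.cexResF ((Pos.map Chain.sh ⋙ Pos.map Chain.sh) ⋙ Pos.map Chain.sh) D.preservesEx_shift₃ :=
  cexResFTriple D.preservesEx_shift D.preservesEx_shift₂
    D.preservesEx_shift₃

/-- The isomorphism `(sh^*)³ ≅ Σ²`. -/
noncomputable def shiftIso (σ : Suspension D.cex) :
    D.shiftRes ≫ D.shiftRes ≫ D.shiftRes ≅ σ.susp ≫ σ.susp :=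
  D.shiftTriple ≪≫ (cubesFinal hD).symm ≪≫ whiskerRightIso (cubesIso hD σ) _ ≪≫
    σ.iterEval (1, 1, 1)

/-- The restriction functor of the Serre endomorphism. -/
noncomputable abbrev serreFun : Pos.{w} Chain ⥤ Pos.{w} Chain := Pos.map (Chain.sh.comp Chain.rot)

/-- The rotation commutes with the shift and its third power is the identity. -/
lemma serreFun_triple : (serreFun.{w} ⋙ serreFun) ⋙ serreFun =
    (Pos.map Chain.sh ⋙ Pos.map Chain.sh) ⋙ Pos.map Chain.sh :=
  Pos.functor_ext fun _ => rfl

variable (D) in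
lemma preservesEx_serreFun : D.PreservesEx serreFun.{w} := preservesEx_map (symm_sh.comp symm_rot)

variable (D) in
lemma preservesEx_serreFun₂ : D.PreservesEx (serreFun.{w} ⋙ serreFun) :=
  preservesEx_comp (symm_sh.comp symm_rot) (symm_sh.comp symm_rot) rfl rfl

variable (D) in
lemma preservesEx_serreFun₃ : D.PreservesEx ((serreFun.{w} ⋙ serreFun) ⋙ serreFun) :=
  serreFun_triple ▸ D.preservesEx_shift₃

variable (D) in
/-- The Serre endomorphism is a restriction. -/
noncomputable def serreIso : D.serre ≅ D.cexResF serreFun D.preservesEx_serreFun :=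
  D.cexResFComp D.preservesEx_shift (preservesEx_map symm_rot) D.preservesEx_serreFun

variable (D) in
/-- The triple composition of the Serre endomorphism is a restriction. -/
noncomputable def serreTriple : D.serre ≫ D.serre ≫ D.serre ≅
    D.cexResF ((serreFun ⋙ serreFun) ⋙ serreFun) D.preservesEx_serreFun₃ :=
  whiskerRightIso D.serreIso _ ≪≫ whiskerLeftIso _ (whiskerRightIso D.serreIso _ ≪≫
    whiskerLeftIso _ D.serreIso) ≪≫
    cexResFTriple D.preservesEx_serreFun D.preservesEx_serreFun₂ D.preservesEx_serreFun₃

variable (D) in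
/-- The isomorphism `S³ ≅ (sh^*)³`. -/
noncomputable def serreShiftIso : D.serre ≫ D.serre ≫ D.serre ≅
    D.shiftRes ≫ D.shiftRes ≫ D.shiftRes :=
  D.serreTriple ≪≫ cexResFCongr serreFun_triple D.preservesEx_serreFun₃ D.preservesEx_shift₃ ≪≫
    D.shiftTriple.symm

lemma compat_cexResFTriple {s : Pos.{w} Chain ⥤ Pos.{w} Chain} (hs : D.PreservesEx s)
    (hs₂ : D.PreservesEx (s ⋙ s)) (hs₃ : D.PreservesEx ((s ⋙ s) ⋙ s)) (hs' : E.PreservesEx s)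
    (hs₂' : E.PreservesEx (s ⋙ s)) (hs₃' : E.PreservesEx ((s ⋙ s) ⋙ s)) :
    Compat (pasteSq (cexResFCell F hF hs hs') (pasteSq (cexResFCell F hF hs hs')
      (cexResFCell F hF hs hs'))) (cexResFCell F hF hs₃ hs₃') (cexResFTriple hs hs₂ hs₃)
      (cexResFTriple hs' hs₂' hs₃') :=
  (Compat.whiskerLeft _ (compat_cexResFComp F hF _ _ _ _ _ _)).trans
    (compat_cexResFComp F hF _ _ _ _ _ _)

lemma compat_shiftTriple :
    Compat (pasteSq (cexResCell _ symm_sh F hF) (pasteSq (cexResCell _ symm_sh F hF)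
      (cexResCell _ symm_sh F hF))) (cexResFCell F hF D.preservesEx_shift₃ E.preservesEx_shift₃)
      D.shiftTriple E.shiftTriple :=
  compat_cexResFTriple F hF D.preservesEx_shift D.preservesEx_shift₂
    D.preservesEx_shift₃ E.preservesEx_shift E.preservesEx_shift₂
    E.preservesEx_shift₃

/-- Each of the four factors of `shiftIso` is compatible; for the isomorphism of cubes this is
uniqueness, evaluated at the final vertex `(1, 1, 1)`. -/
lemma compat_shiftIso {σ : Suspension D.cex} {τ : Suspension E.cex}
    (κ : Comparison (cexMap F hF) σ τ) :
    Compat (pasteSq (cexResCell _ symm_sh F hF) (pasteSq (cexResCell _ symm_sh F hF)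
      (cexResCell _ symm_sh F hF))) (pasteSq κ.suspCell κ.suspCell) (shiftIso hD σ) (shiftIso hE τ) :=
  (compat_shiftTriple F hF).trans ((compat_cubesFinal hD hE F hF).symm.trans
    ((Compat.whiskerRight _ (compat_cubesIso hD hE F hF κ)).trans (κ.compat_iterEval (1, 1, 1))))

lemma compat_serreIso : Compat (serreCell F hF)
    (cexResFCell F hF D.preservesEx_serreFun E.preservesEx_serreFun) D.serreIso E.serreIso :=
  compat_cexResFComp F hF D.preservesEx_shift (preservesEx_map symm_rot)
    D.preservesEx_serreFun E.preservesEx_shift (preservesEx_map symm_rot)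
    E.preservesEx_serreFun

lemma compat_serreTriple :
    Compat (pasteSq (serreCell F hF) (pasteSq (serreCell F hF) (serreCell F hF)))
      (cexResFCell F hF D.preservesEx_serreFun₃ E.preservesEx_serreFun₃)
      D.serreTriple E.serreTriple :=
  (Compat.whiskerRight _ (compat_serreIso F hF)).trans ((Compat.whiskerLeft _
    ((Compat.whiskerRight _ (compat_serreIso F hF)).trans
      (Compat.whiskerLeft _ (compat_serreIso F hF)))).trans
    (compat_cexResFTriple F hF D.preservesEx_serreFun D.preservesEx_serreFun₂
      D.preservesEx_serreFun₃ E.preservesEx_serreFun E.preservesEx_serreFun₂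
      E.preservesEx_serreFun₃))

lemma compat_serreShiftIso :
    Compat (pasteSq (serreCell F hF) (pasteSq (serreCell F hF) (serreCell F hF)))
      (pasteSq (cexResCell _ symm_sh F hF) (pasteSq (cexResCell _ symm_sh F hF)
        (cexResCell _ symm_sh F hF))) D.serreShiftIso E.serreShiftIso :=
  (compat_serreTriple F hF).trans ((compat_cexResFCongr F hF serreFun_triple D.preservesEx_serreFun₃
    D.preservesEx_shift₃ E.preservesEx_serreFun₃ E.preservesEx_shift₃).trans
      (compat_shiftTriple F hF).symm)

end

end Prederivator

theorem mainTheorem8 :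
    (∀ D : Prederivator.{w, v, u}, D.IsStableDerivator →
      D.cex.IsStableDerivator ∧
      (∃ e : D.cex ≌ D.shift (Pos.{w} Source),
        e.hom = D.cexProp.ι ≫ D.restr (Pos.map.{w} Source.incl)) ∧
      Nonempty (Prederivator.Suspension D.cex)) ∧
    ∃ (ψ : ∀ D : Prederivator.{w, v, u}, D.IsStableDerivator →
        ∀ σ : Prederivator.Suspension D.cex,
          D.shiftRes ≫ D.shiftRes ≫ D.shiftRes ≅ σ.susp ≫ σ.susp)
      (θ : ∀ D : Prederivator.{w, v, u}, D.IsStableDerivator →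
        ∀ σ : Prederivator.Suspension D.cex,
          D.serre ≫ D.serre ≫ D.serre ≅ σ.susp ≫ σ.susp),
      ∀ (D E : Prederivator.{w, v, u}) (hD : D.IsStableDerivator) (hE : E.IsStableDerivator)
        (F : D ⟶ E) (hF : Prederivator.IsExact F)
        (σ : Prederivator.Suspension D.cex) (τ : Prederivator.Suspension E.cex),
        Nonempty (Prederivator.Comparison (Prederivator.cexMap F hF) σ τ) ∧
        ∀ κ : Prederivator.Comparison (Prederivator.cexMap F hF) σ τ,
          (ψ D hD σ).hom ▷ Prederivator.cexMap F hF ≫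
              (Prederivator.pasteSq κ.suspCell κ.suspCell).hom =
            (Prederivator.pasteSq (Prederivator.cexResCell _ Prederivator.symm_sh F hF)
              (Prederivator.pasteSq (Prederivator.cexResCell _ Prederivator.symm_sh F hF)
                (Prederivator.cexResCell _ Prederivator.symm_sh F hF))).hom ≫
              Prederivator.cexMap F hF ◁ (ψ E hE τ).hom ∧
          (θ D hD σ).hom ▷ Prederivator.cexMap F hF ≫
              (Prederivator.pasteSq κ.suspCell κ.suspCell).hom =
            (Prederivator.pasteSq (Prederivator.serreCell F hF)
              (Prederivator.pasteSq (Prederivator.serreCell F hF)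
                (Prederivator.serreCell F hF))).hom ≫
              Prederivator.cexMap F hF ◁ (θ E hE τ).hom := by
  -- `θ` is `ψ` precomposed with the identification of `S³` and `(sh^*)³`, so its compatibility
  -- follows from that of the two factors.
  refine ⟨fun D hD => ⟨hD.cex, Prederivator.exists_equivalence_source hD,
    hD.cex.nonempty_suspension⟩, fun D hD σ => Prederivator.shiftIso hD σ,
    fun D hD σ => D.serreShiftIso ≪≫ Prederivator.shiftIso hD σ, ?_⟩
  intro D E hD hE F hF σ τ
  exact ⟨Prederivator.exists_comparison hE.cex _ σ τ (Prederivator.suspProp_cexMap hD hE F hF),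
    fun κ => ⟨Prederivator.compat_shiftIso hD hE F hF κ,
      (Prederivator.compat_serreShiftIso F hF).trans (Prederivator.compat_shiftIso hD hE F hF κ)⟩⟩
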